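/- **Setting.** Let $\mathbb k$ be a field, $q\in\mathbb k\setminus\{0,1\}$, $n,\ell\ge 0$ integers, $Q_1,\dots,Q_\ell\in\mathbb k\setminus\{0\}$, $\kappa\in\mathbb R\setminus\{0\}$ and $\vartheta_1,\dots,\vartheta_\ell\in\mathbb R$. Let $R$ be a commutative ring with elements $\mathsf q$ and $\mathsf Q_1,\dots,\mathsf Q_\ell$. *The Hecke side.* The affine Hecke algebra is the $R$-algebra generated by $X_1^{\pm1},\dots,X_n^{\pm1},T_1,\dots,T_{n-1}$ with relations: the $X_i^{\pm1}$ commute and $X_iX_i^{-1}=1$; $T_r^2=(\mathsf q-1)T_r+\mathsf q$; $T_rX_rT_r=\mathsf qX_{r+1}$; $T_rT_{r+1}T_r=T_{r+1}T_rT_{r+1}$; $T_rX_s=X_sT_r$ for $s\ne r,r+1$; $T_rT_s=T_sT_r$ for $|r-s|>1$. The cyclotomic affine Hecke (Ariki–Koike) algebra $H_n(R;\mathsf q,\mathsf Q_\bullet)$ is its quotient by the two-sided ideal generated by $\prod_{i=1}^\ell(X_1-\mathsf Q_i)$ (for $n=0$ it is $R$). *The diagrammatic side.* A type WF Hecke diagram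 consists of $n$ curves (strands) in $\mathbb R\times[0,1]$, each projecting bijectively to the $y$-axis $[0,1]$; of a ghost of each strand, which is the strand translated by $\kappa$ to the right; and of vertical red lines at the points of the set $\{\vartheta_1,\dots,\vartheta_\ell\}$. Strands may carry squares and formal inverses of squares, away from crossings. No tangencies and no triple points of strands, ghosts and red lines are allowed, and no two of them (other than two ghosts of strands) meet at $y=0$ or $y=1$. Diagrams are taken up to isotopy through such diagrams. The product $ab$ is $a$ stacked on top of $b$ if the end points match, and $0$ otherwise. For an $n$-element set $B\subset\mathbb R$ in general position, $e_B$ is the diagram of vertical strands at the points of $B$. The affine algebra $\widetilde{WF}^\vartheta(\mathsf q,\mathsf Q_\bullet)$ is the $R$-span of the diagrams modulo the following local relations, in which $x_a$ denotes a square on the strand $a$, diagrams are read from bottom to top, and for a red line at $\alpha$ we put $p_\alpha(u)=\prod_{\vartheta_i=\alpha}(u-\mathsf Q_i)$. 1. Squares pass freely through crossings of their strand with ghosts and red lines. If $c$ is a crossing of a strand $a$ going from left to right with a strand $b$ going from right to left, then (square on $b$ above $c$) $-$ (square on $b$ below $c$) $=$ (square on $a$ below $c$) $-$ (square on $a$ above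 $c$) $=$ the two strands going straight up without crossing. 2. Bigons. Two strands crossing twice: $0$. A strand $a$ and the ghost of a strand $b$ crossing twice: the straight diagram times $x_a-\mathsf q x_b$. A strand $a$ and a red line at $\alpha$ crossing twice: the straight diagram times $p_\alpha(x_a)$. A ghost and a red line crossing twice: the straight diagram. 3. Triple points. Let three objects be in the order $a,b,c$ at the bottom and $c,b,a$ at the top, and let $D$ be (the diagram where $b$ passes to the left of the crossing of $a$ and $c$) minus (the diagram where $b$ passes to the right of it). If $b$ is a strand and $a,c$ are ghosts, then $D=-\mathsf q$ times the straight diagram; if $b$ is a ghost and $a,c$ are strands, then $D$ is the straight diagram; if $b$ is the red line at $\alpha$ and $a,c$ are strands, then $D$ is the straight diagram times $\dfrac{p_\alpha(x_a)-p_\alpha(x_c)}{x_a-x_c}$, expanded as a polynomial; in all other cases $D=0$. (In the straight diagram $a$ and $c$ do not cross.) A set $B$ is unsteady if it is a disjoint union $B=B'\sqcup B''$ with $B'\neq\emptyset$, $b'+|\kappa|<b''$ for all $b'\in B'$, $b''\in B''$, and $b'<\vartheta_i$ for all $b'\in B'$ and all $i$. The type WF Hecke algebra $WF^\vartheta(\mathsf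 q,\mathsf Q_\bullet)$ is the quotient of $\widetilde{WF}^\vartheta(\mathsf q,\mathsf Q_\bullet)$ by the two-sided ideal generated by all $e_B$ with $B$ unsteady. For a real number $s$ put $B_s=\{s,2s,\dots,ns\}$ and $\mathscr O=\{B_s\}$, and let $WF^\vartheta_{\mathscr O}(\mathsf q,\mathsf Q_\bullet)=e_{B_s}WF^\vartheta(\mathsf q,\mathsf Q_\bullet)e_{B_s}$ be the $R$-algebra (with unit $e_{B_s}$) spanned by the diagrams with top and bottom $B_s$. **Theorem.** Let $s>|\kappa|$ and $s>|\vartheta_i|+|\kappa|$ for all $i$. (a) Suppose that $\mathbb k$ has characteristic $0$. Let $R=\mathbb k[[h,z_1,\dots,z_\ell]]$, let $d(h)\in 1+h\mathbb k[[h]]$, and let $\mathsf q=q\,d(h)$ and $\mathsf Q_i=Q_ie^{-z_i}$. Then the $R$-algebra $WF^\vartheta_{\mathscr O}(\mathsf q,\mathsf Q_\bullet)$ is isomorphic to the deformed cyclotomic affine Hecke algebra $H_n(R;\mathsf q,\mathsf Q_\bullet)$. (b) (Undeformed version, $\mathbb k$ of arbitrary characteristic.) For $R=\mathbb k$, $\mathsf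 q=q$ and $\mathsf Q_i=Q_i$, the $\mathbb k$-algebra $WF^\vartheta_{\mathscr O}(q,Q_\bullet)$ is isomorphic to $H_n(\mathbb k;q,Q_\bullet)$. -/

import Mathlib

namespace WFHecke

open scoped Polynomial

noncomputable section

/-! ### Configurations, crossings and slices

A configuration of `n` strands on a horizontal line is a function `x : Fin n → ℝ`; the labelling of
the strands is only a device, it is forgotten by the relations `relabel` below, so that the objects
are `n`-element subsets of `ℝ`.  The strand `i` at `x i` has a ghost at `x i + κ`; there are
vertical red lines at the points `ϑ t`.  Several labels `t` may sit on the same red line, so a red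
line is named by its position. -/

/-- No two of the strands, ghosts and red lines meet on this horizontal line. (Two ghosts meet
exactly if their strands do.) -/
structure Generic {n ℓ : ℕ} (κ : ℝ) (ϑ : Fin ℓ → ℝ) (x : Fin n → ℝ) : Prop where
  strand_strand : Function.Injective x
  strand_ghost : ∀ i j, x i ≠ x j + κ
  strand_red : ∀ i t, x i ≠ ϑ t
  ghost_red : ∀ i t, x i + κ ≠ ϑ t

/-- The kinds of crossing that are recorded: of two strands (then their ghosts cross too, at the
same height), of the strand `i` with the ghost of the strand `j`, and of the strand `i` with the
red line at position `a`.  Ghosts pass freely through red lines (their bigons and all triple points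
that they form together are trivial), so these crossings are not recorded. -/
inductive Crossing (n : ℕ) : Type
  | strands (p : Sym2 (Fin n)) : Crossing n
  | ghost (i j : Fin n) : Crossing n
  | red (i : Fin n) (a : ℝ) : Crossing n

/-- The crossings of the straight-line diagram from `x` (bottom) to `y` (top). -/
inductive Crosses {n ℓ : ℕ} (κ : ℝ) (ϑ : Fin ℓ → ℝ) (x y : Fin n → ℝ) : Crossing n → Prop
  | strands {i j : Fin n} (h : x i < x j) (h' : y j < y i) : Crosses κ ϑ x y (.strands s(i, j))
  | ghost {i j : Fin n} (h : (x i - (x j + κ)) * (y i - (y j + κ)) < 0) :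
      Crosses κ ϑ x y (.ghost i j)
  | red {i : Fin n} {t : Fin ℓ} (h : (x i - ϑ t) * (y i - ϑ t) < 0) :
      Crosses κ ϑ x y (.red i (ϑ t))

/-- The set of crossings of the straight-line diagram from `x` to `y`. -/
def crossings {n ℓ : ℕ} (κ : ℝ) (ϑ : Fin ℓ → ℝ) (x y : Fin n → ℝ) : Set (Crossing n) :=
  {c | Crosses κ ϑ x y c}

/-- A slice: a straight-line diagram, the strand `i` running from `x i` at the bottom to `y i` at the
top, with at most one crossing.  Every diagram (`n` curves projecting homeomorphically to the
vertical axis, without tangencies and triple points of strands, ghosts and red lines, decorated with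
squares) is isotopic to a stack of slices and squares, and isotopies are generated by removing and
inserting crossing-free slices (`straighten`), by exchanging the heights of independent crossings
(`exchange`), and by moving squares (`square_slide`, `square_comm`, `square_add`). -/
structure IsSlice {n ℓ : ℕ} (κ : ℝ) (ϑ : Fin ℓ → ℝ) (x y : Fin n → ℝ) : Prop where
  bottom : Generic κ ϑ x
  top : Generic κ ϑ y
  at_most_one : (crossings κ ϑ x y).Subsingleton

theorem crossings_self {n ℓ : ℕ} (κ : ℝ) (ϑ : Fin ℓ → ℝ) (x : Fin n → ℝ) :
    crossings κ ϑ x x = ∅ := by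
  ext c
  simp only [crossings, Set.mem_ofPred_eq, Set.mem_empty_iff_false, iff_false]
  intro h
  cases h with
  | strands h h' => exact lt_asymm h h'
  | ghost h => exact absurd h (not_lt.mpr (mul_self_nonneg _))
  | red h => exact absurd h (not_lt.mpr (mul_self_nonneg _))

theorem Generic.isSlice {n ℓ : ℕ} {κ : ℝ} {ϑ : Fin ℓ → ℝ} {x : Fin n → ℝ}
    (h : Generic κ ϑ x) : IsSlice κ ϑ x x :=
  ⟨h, h, by rw [crossings_self]; exact Set.subsingleton_empty⟩

/-! ### Generators: slices, and vertical strands with a number of squares on one of them -/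

/-- The elementary diagrams: the slices, and the vertical diagram at `x` with `a` squares (formal
inverses of squares if `a < 0`) on the strand `i`. -/
inductive Gen {ℓ : ℕ} (κ : ℝ) (ϑ : Fin ℓ → ℝ) (n : ℕ) : Type
  | slice (x y : Fin n → ℝ) (h : IsSlice κ ϑ x y) : Gen κ ϑ n
  | square (x : Fin n → ℝ) (h : Generic κ ϑ x) (i : Fin n) (a : ℤ) : Gen κ ϑ n

/-- The slice from `x` to `y`, as an element of the free algebra. -/
def slice (R : Type*) [CommRing R] {n ℓ : ℕ} {κ : ℝ} {ϑ : Fin ℓ → ℝ} {x y : Fin n → ℝ}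
    (h : IsSlice κ ϑ x y) : FreeAlgebra R (Gen κ ϑ n) :=
  FreeAlgebra.ι R (Gen.slice x y h)

/-- Vertical strands at `x` with `a` squares on the strand `i`. -/
def square (R : Type*) [CommRing R] {n ℓ : ℕ} {κ : ℝ} {ϑ : Fin ℓ → ℝ} {x : Fin n → ℝ}
    (h : Generic κ ϑ x) (i : Fin n) (a : ℤ) : FreeAlgebra R (Gen κ ϑ n) :=
  FreeAlgebra.ι R (Gen.square x h i a)

/-- The idempotent `e_B`: vertical strands without squares. -/
def vertical (R : Type*) [CommRing R] {n ℓ : ℕ} {κ : ℝ} {ϑ : Fin ℓ → ℝ} {x : Fin n → ℝ}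
    (h : Generic κ ϑ x) : FreeAlgebra R (Gen κ ϑ n) :=
  slice R h.isSlice

open Classical in
/-- The polynomial `∏ (u - Q t)` over the labels `t` of the red line at position `a`. -/
def redPoly {R : Type*} [CommRing R] {ℓ : ℕ} (ϑ : Fin ℓ → ℝ) (Q : Fin ℓ → R) (a : ℝ) : R[X] :=
  ∏ t with ϑ t = a, (Polynomial.X - Polynomial.C (Q t))

/-- A polynomial in the square on the strand `i`, at the configuration `x`. -/
def polySquare {R : Type*} [CommRing R] {n ℓ : ℕ} {κ : ℝ} {ϑ : Fin ℓ → ℝ} {x : Fin n → ℝ}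
    (h : Generic κ ϑ x) (i : Fin n) (p : R[X]) : FreeAlgebra R (Gen κ ϑ n) :=
  ∑ m ∈ Finset.range (p.natDegree + 1), p.coeff m • square R h i m

/-- The divided difference `(p(u) - p(v)) / (u - v)`, that is, the sum of `p_m u^a v^b` over `m ≥ 1`
and `a + b = m - 1`, in the squares `u` on the strand `i` and `v` on the strand `k`. -/
def dividedDifference {R : Type*} [CommRing R] {n ℓ : ℕ} {κ : ℝ} {ϑ : Fin ℓ → ℝ} {x : Fin n → ℝ}
    (h : Generic κ ϑ x) (i k : Fin n) (p : R[X]) : FreeAlgebra R (Gen κ ϑ n) :=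
  ∑ m ∈ Finset.range p.natDegree, p.coeff (m + 1) •
    ∑ ab ∈ Finset.HasAntidiagonal.antidiagonal m, square R h i ab.1 * square R h k ab.2

/-- The sequences of three crossings at a triple point where an error term appears: a strand, a ghost
or a red line passes through a crossing of two ghosts, two strands, two strands respectively. -/
inductive Exceptional {n : ℕ} : Crossing n → Crossing n → Crossing n → Prop
  | strand (b i k : Fin n) : Exceptional (.ghost b i) (.strands s(i, k)) (.ghost b k)
  | ghost (b i k : Fin n) : Exceptional (.ghost i b) (.strands s(i, k)) (.ghost k b)
  | red (a : ℝ) (i k : Fin n) : Exceptional (.red i a) (.strands s(i, k)) (.red k a)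

/-! ### The relations

In a product `a * b` the diagram `a` is on top of `b`.  The relations are imposed between slices in
which nothing else happens; as they are closed under multiplication on both sides, they hold inside
any diagram. -/

/-- The defining relations of the affine algebra, with parameters `q` and `Q`. -/
inductive Rel {R : Type*} [CommRing R] {ℓ : ℕ} (κ : ℝ) (ϑ : Fin ℓ → ℝ) (q : R) (Q : Fin ℓ → R)
    (n : ℕ) : FreeAlgebra R (Gen κ ϑ n) → FreeAlgebra R (Gen κ ϑ n) → Prop
  -- the labels of the strands do not matter
  | relabel {x y : Fin n → ℝ} (σ : Equiv.Perm (Fin n)) (h : IsSlice κ ϑ x y)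
      (h' : IsSlice κ ϑ (x ∘ σ) (y ∘ σ)) : Rel κ ϑ q Q n (slice R h') (slice R h)
  | relabel_square {x : Fin n → ℝ} (σ : Equiv.Perm (Fin n)) (h : Generic κ ϑ x)
      (h' : Generic κ ϑ (x ∘ σ)) (i : Fin n) (a : ℤ) :
      Rel κ ϑ q Q n (square R h' i a) (square R h (σ i) a)
  -- diagrams whose end points do not match have product zero
  | mismatch {x y y' z : Fin n → ℝ} (h : IsSlice κ ϑ x y) (h' : IsSlice κ ϑ y' z)
      (hne : Set.range y ≠ Set.range y') : Rel κ ϑ q Q n (slice R h' * slice R h) 0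
  -- isotopy: two slices of which one has no crossing are a slice
  | straighten {x y z : Fin n → ℝ} (hxy : IsSlice κ ϑ x y) (hyz : IsSlice κ ϑ y z)
      (hxz : IsSlice κ ϑ x z) (hc : crossings κ ϑ x y = ∅ ∨ crossings κ ϑ y z = ∅) :
      Rel κ ϑ q Q n (slice R hyz * slice R hxy) (slice R hxz)
  -- isotopy: two independent crossings may exchange their heights
  | exchange {x y y' z : Fin n → ℝ} {c d : Crossing n} (hxy : IsSlice κ ϑ x y)
      (hyz : IsSlice κ ϑ y z) (hxy' : IsSlice κ ϑ x y') (hy'z : IsSlice κ ϑ y' z)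
      (h₁ : crossings κ ϑ x y = {c}) (h₂ : crossings κ ϑ y z = {d})
      (h₁' : crossings κ ϑ x y' = {d}) (h₂' : crossings κ ϑ y' z = {c}) :
      Rel κ ϑ q Q n (slice R hyz * slice R hxy) (slice R hy'z * slice R hxy')
  -- squares on one strand add up, with formal inverses
  | square_zero {x : Fin n → ℝ} (h : Generic κ ϑ x) (i : Fin n) :
      Rel κ ϑ q Q n (square R h i 0) (vertical R h)
  | square_add {x : Fin n → ℝ} (h : Generic κ ϑ x) (i : Fin n) (a b : ℤ) :
      Rel κ ϑ q Q n (square R h i a * square R h i b) (square R h i (a + b))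
  -- squares on different strands pass each other
  | square_comm {x : Fin n → ℝ} (h : Generic κ ϑ x) (i j : Fin n) (a b : ℤ) :
      Rel κ ϑ q Q n (square R h i a * square R h j b) (square R h j b * square R h i a)
  -- squares slide along a strand, except through crossings of this strand with another strand
  | square_slide {x y : Fin n → ℝ} (h : IsSlice κ ϑ x y) (i : Fin n) (a : ℤ)
      (hc : ∀ j, Crossing.strands s(i, j) ∉ crossings κ ϑ x y) :
      Rel κ ϑ q Q n (square R h.top i a * slice R h) (slice R h * square R h.bottom i a)
  -- squares and a crossing of strands, the strand `i` running to the right and `j` to the left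
  | square_cross_left {x y : Fin n → ℝ} {i j : Fin n} (h : IsSlice κ ϑ x y)
      (hc : crossings κ ϑ x y = {Crossing.strands s(i, j)}) (hij : x i < x j)
      (h' : IsSlice κ ϑ x (y ∘ Equiv.swap i j)) :
      Rel κ ϑ q Q n (square R h.top j 1 * slice R h - slice R h * square R h.bottom j 1)
        (slice R h')
  | square_cross_right {x y : Fin n → ℝ} {i j : Fin n} (h : IsSlice κ ϑ x y)
      (hc : crossings κ ϑ x y = {Crossing.strands s(i, j)}) (hij : x i < x j)
      (h' : IsSlice κ ϑ x (y ∘ Equiv.swap i j)) :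
      Rel κ ϑ q Q n (slice R h * square R h.bottom i 1 - square R h.top i 1 * slice R h)
        (slice R h')
  -- bigons
  | bigon_strands {x y z : Fin n → ℝ} {i j : Fin n} (hxy : IsSlice κ ϑ x y)
      (hyz : IsSlice κ ϑ y z) (h₁ : crossings κ ϑ x y = {Crossing.strands s(i, j)})
      (h₂ : crossings κ ϑ y z = {Crossing.strands s(i, j)}) :
      Rel κ ϑ q Q n (slice R hyz * slice R hxy) 0
  | bigon_ghost {x y z : Fin n → ℝ} {i j : Fin n} (hxy : IsSlice κ ϑ x y)
      (hyz : IsSlice κ ϑ y z) (hxz : IsSlice κ ϑ x z)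
      (h₁ : crossings κ ϑ x y = {Crossing.ghost i j})
      (h₂ : crossings κ ϑ y z = {Crossing.ghost i j}) :
      Rel κ ϑ q Q n (slice R hyz * slice R hxy)
        (slice R hxz * (square R hxz.bottom i 1 - q • square R hxz.bottom j 1))
  | bigon_red {x y z : Fin n → ℝ} {i : Fin n} {a : ℝ} (hxy : IsSlice κ ϑ x y)
      (hyz : IsSlice κ ϑ y z) (hxz : IsSlice κ ϑ x z)
      (h₁ : crossings κ ϑ x y = {Crossing.red i a})
      (h₂ : crossings κ ϑ y z = {Crossing.red i a}) :
      Rel κ ϑ q Q n (slice R hyz * slice R hxy)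
        (slice R hxz * polySquare hxz.bottom i (redPoly ϑ Q a))
  -- triple points: the two resolutions have the crossings `c, d, f` in opposite order
  | triple {x y₁ y₂ y₁' y₂' z : Fin n → ℝ} {c d f : Crossing n}
      (h₁ : IsSlice κ ϑ x y₁) (h₂ : IsSlice κ ϑ y₁ y₂) (h₃ : IsSlice κ ϑ y₂ z)
      (h₁' : IsSlice κ ϑ x y₁') (h₂' : IsSlice κ ϑ y₁' y₂') (h₃' : IsSlice κ ϑ y₂' z)
      (hc₁ : crossings κ ϑ x y₁ = {c}) (hc₂ : crossings κ ϑ y₁ y₂ = {d})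
      (hc₃ : crossings κ ϑ y₂ z = {f}) (hc₁' : crossings κ ϑ x y₁' = {f})
      (hc₂' : crossings κ ϑ y₁' y₂' = {d}) (hc₃' : crossings κ ϑ y₂' z = {c})
      (hcdf : ¬ Exceptional c d f) :
      Rel κ ϑ q Q n (slice R h₃ * slice R h₂ * slice R h₁)
        (slice R h₃' * slice R h₂' * slice R h₁')
  -- the strand `b` passes the crossing of the ghosts of `i` and `k` on the left, and on the right
  | triple_strand {x y₁ y₂ y₁' y₂' z : Fin n → ℝ} {b i k : Fin n}
      (h₁ : IsSlice κ ϑ x y₁) (h₂ : IsSlice κ ϑ y₁ y₂) (h₃ : IsSlice κ ϑ y₂ z)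
      (h₁' : IsSlice κ ϑ x y₁') (h₂' : IsSlice κ ϑ y₁' y₂') (h₃' : IsSlice κ ϑ y₂' z)
      (hc₁ : crossings κ ϑ x y₁ = {Crossing.ghost b i})
      (hc₂ : crossings κ ϑ y₁ y₂ = {Crossing.strands s(i, k)})
      (hc₃ : crossings κ ϑ y₂ z = {Crossing.ghost b k})
      (hc₁' : crossings κ ϑ x y₁' = {Crossing.ghost b k})
      (hc₂' : crossings κ ϑ y₁' y₂' = {Crossing.strands s(i, k)})
      (hc₃' : crossings κ ϑ y₂' z = {Crossing.ghost b i}) (hik : x i < x k)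
      (hs : IsSlice κ ϑ x (z ∘ Equiv.swap i k)) :
      Rel κ ϑ q Q n
        (slice R h₃ * slice R h₂ * slice R h₁ - slice R h₃' * slice R h₂' * slice R h₁')
        (-(q • slice R hs))
  -- the ghost of `b` passes the crossing of the strands `i` and `k` on the left, and on the right
  | triple_ghost {x y₁ y₂ y₁' y₂' z : Fin n → ℝ} {b i k : Fin n}
      (h₁ : IsSlice κ ϑ x y₁) (h₂ : IsSlice κ ϑ y₁ y₂) (h₃ : IsSlice κ ϑ y₂ z)
      (h₁' : IsSlice κ ϑ x y₁') (h₂' : IsSlice κ ϑ y₁' y₂') (h₃' : IsSlice κ ϑ y₂' z)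
      (hc₁ : crossings κ ϑ x y₁ = {Crossing.ghost i b})
      (hc₂ : crossings κ ϑ y₁ y₂ = {Crossing.strands s(i, k)})
      (hc₃ : crossings κ ϑ y₂ z = {Crossing.ghost k b})
      (hc₁' : crossings κ ϑ x y₁' = {Crossing.ghost k b})
      (hc₂' : crossings κ ϑ y₁' y₂' = {Crossing.strands s(i, k)})
      (hc₃' : crossings κ ϑ y₂' z = {Crossing.ghost i b}) (hik : x i < x k)
      (hs : IsSlice κ ϑ x (z ∘ Equiv.swap i k)) :
      Rel κ ϑ q Q n
        (slice R h₃ * slice R h₂ * slice R h₁ - slice R h₃' * slice R h₂' * slice R h₁')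
        (slice R hs)
  -- the red line at `a` is to the left, and to the right, of the crossing of `i` and `k`
  | triple_red {x y₁ y₂ y₁' y₂' z : Fin n → ℝ} {a : ℝ} {i k : Fin n}
      (h₁ : IsSlice κ ϑ x y₁) (h₂ : IsSlice κ ϑ y₁ y₂) (h₃ : IsSlice κ ϑ y₂ z)
      (h₁' : IsSlice κ ϑ x y₁') (h₂' : IsSlice κ ϑ y₁' y₂') (h₃' : IsSlice κ ϑ y₂' z)
      (hc₁ : crossings κ ϑ x y₁ = {Crossing.red i a})
      (hc₂ : crossings κ ϑ y₁ y₂ = {Crossing.strands s(i, k)})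
      (hc₃ : crossings κ ϑ y₂ z = {Crossing.red k a})
      (hc₁' : crossings κ ϑ x y₁' = {Crossing.red k a})
      (hc₂' : crossings κ ϑ y₁' y₂' = {Crossing.strands s(i, k)})
      (hc₃' : crossings κ ϑ y₂' z = {Crossing.red i a}) (hik : x i < x k)
      (hs : IsSlice κ ϑ x (z ∘ Equiv.swap i k)) :
      Rel κ ϑ q Q n
        (slice R h₃ * slice R h₂ * slice R h₁ - slice R h₃' * slice R h₂' * slice R h₁')
        (slice R hs * dividedDifference hs.bottom i k (redPoly ϑ Q a))

/-- The type WF affine Hecke algebra on `n` strands. (It is given a unit; this does not affect the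
algebras `e_B A e_B`.) -/
abbrev AffineWF {R : Type*} [CommRing R] {ℓ : ℕ} (κ : ℝ) (ϑ : Fin ℓ → ℝ) (q : R) (Q : Fin ℓ → R)
    (n : ℕ) : Type _ :=
  RingQuot (Rel κ ϑ q Q n)

/-- The idempotent `e_B` of the affine algebra. -/
def affineIdem {R : Type*} [CommRing R] {n ℓ : ℕ} {κ : ℝ} {ϑ : Fin ℓ → ℝ} (q : R) (Q : Fin ℓ → R)
    {x : Fin n → ℝ} (h : Generic κ ϑ x) : AffineWF κ ϑ q Q n :=
  RingQuot.mkAlgHom R (Rel κ ϑ q Q n) (vertical R h)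

/-- A configuration is unsteady if its strands can be divided into a non-empty left-hand group and a
right-hand group with a gap `> |κ|` between them, all red lines being to the right of the left-hand
group. -/
def IsUnsteady {n ℓ : ℕ} (κ : ℝ) (ϑ : Fin ℓ → ℝ) (x : Fin n → ℝ) : Prop :=
  ∃ S : Set (Fin n), S.Nonempty ∧ (∀ i ∈ S, ∀ j ∉ S, x i + |κ| < x j) ∧ ∀ i ∈ S, ∀ t, x i < ϑ t

/-- The unsteady idempotents are set to zero. -/
inductive SteadyRel {R : Type*} [CommRing R] {ℓ : ℕ} (κ : ℝ) (ϑ : Fin ℓ → ℝ) (q : R)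
    (Q : Fin ℓ → R) (n : ℕ) : AffineWF κ ϑ q Q n → AffineWF κ ϑ q Q n → Prop
  | unsteady {x : Fin n → ℝ} (h : Generic κ ϑ x) (hx : IsUnsteady κ ϑ x) :
      SteadyRel κ ϑ q Q n (affineIdem q Q h) 0

/-- The type WF Hecke algebra: the quotient by the two-sided ideal generated by the unsteady
idempotents. -/
abbrev WF {R : Type*} [CommRing R] {ℓ : ℕ} (κ : ℝ) (ϑ : Fin ℓ → ℝ) (q : R) (Q : Fin ℓ → R)
    (n : ℕ) : Type _ :=
  RingQuot (SteadyRel κ ϑ q Q n)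

/-- The idempotent `e_B` of the type WF Hecke algebra. -/
def wfIdem {R : Type*} [CommRing R] {n ℓ : ℕ} {κ : ℝ} {ϑ : Fin ℓ → ℝ} (q : R) (Q : Fin ℓ → R)
    {x : Fin n → ℝ} (h : Generic κ ϑ x) : WF κ ϑ q Q n :=
  RingQuot.mkAlgHom R (SteadyRel κ ϑ q Q n) (affineIdem q Q h)

theorem isIdempotentElem_wfIdem {R : Type*} [CommRing R] {n ℓ : ℕ} {κ : ℝ} {ϑ : Fin ℓ → ℝ} (q : R)
    (Q : Fin ℓ → R) {x : Fin n → ℝ} (h : Generic κ ϑ x) : IsIdempotentElem (wfIdem q Q h) := by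
  have h1 : affineIdem q Q h * affineIdem q Q h = affineIdem q Q h := by
    unfold affineIdem vertical
    rw [← map_mul]
    exact RingQuot.mkAlgHom_rel R
      (Rel.straighten h.isSlice h.isSlice h.isSlice (Or.inl (crossings_self κ ϑ x)))
  unfold IsIdempotentElem wfIdem
  rw [← map_mul, h1]

/-- The corner `e A e` of an `R`-algebra `A` at an idempotent `e` is an `R`-algebra with unit `e`. -/
instance cornerAlgebra {R A : Type*} [CommRing R] [Semiring A] [Algebra R A] {e : A}
    (he : IsIdempotentElem e) : Algebra R he.Corner where
  smul r a := ⟨r • a.1, by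
    obtain ⟨b, hb⟩ := a.2
    exact ⟨r • b, by rw [← hb]; simp⟩⟩
  algebraMap :=
    { toFun := fun r => ⟨r • e, ⟨r • e, by simp [he.eq]⟩⟩
      map_one' := Subtype.ext (one_smul R e)
      map_mul' := fun r s => Subtype.ext (by
        change (r * s) • e = (r • e) * (s • e)
        rw [smul_mul_smul_comm, he.eq])
      map_zero' := Subtype.ext (zero_smul R e)
      map_add' := fun r s => Subtype.ext (add_smul r s e) }
  commutes' r a := Subtype.ext (by
    have h := (Subsemigroup.mem_corner_iff he).mp a.2
    change (r • e) * a.1 = a.1 * (r • e)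
    rw [smul_mul_assoc, mul_smul_comm, h.1, h.2])
  smul_def' r a := Subtype.ext (by
    have h := (Subsemigroup.mem_corner_iff he).mp a.2
    change r • a.1 = (r • e) * a.1
    rw [smul_mul_assoc, h.1])

/-- The set `B_s = {s, 2s, …, ns}`. -/
def spaced (n : ℕ) (s : ℝ) : Fin n → ℝ := fun i => ((i : ℕ) + 1) * s

theorem generic_spaced {ℓ : ℕ} (n : ℕ) {κ s : ℝ} {ϑ : Fin ℓ → ℝ} (hκ : κ ≠ 0) (hs : |κ| < s)
    (hϑ : ∀ t, |ϑ t| + |κ| < s) : Generic κ ϑ (spaced n s) := by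
  have hs0 : 0 < s := lt_of_le_of_lt (abs_nonneg κ) hs
  have hge : ∀ i : Fin n, s ≤ spaced n s i := fun i => by
    have : (0 : ℝ) ≤ (i : ℕ) := Nat.cast_nonneg _
    unfold spaced
    nlinarith
  have hκ1 := neg_abs_le κ
  refine ⟨fun i j hij => ?_, fun i j hij => ?_, fun i t h => ?_, fun i t h => ?_⟩
  · have h := mul_right_cancel₀ hs0.ne' hij
    exact Fin.ext (by exact_mod_cast add_right_cancel h)
  · have h : ((((i : ℕ) : ℤ) - ((j : ℕ) : ℤ) : ℤ) : ℝ) * s = κ := by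
      unfold spaced at hij
      push_cast
      linarith
    rcases eq_or_ne (((i : ℕ) : ℤ) - ((j : ℕ) : ℤ)) 0 with h0 | h0
    · rw [h0] at h
      exact hκ (by simpa using h.symm)
    · have h1 : (1 : ℝ) ≤ |((((i : ℕ) : ℤ) - ((j : ℕ) : ℤ) : ℤ) : ℝ)| := by
        exact_mod_cast Int.one_le_abs h0
      have h2 : |κ| = |((((i : ℕ) : ℤ) - ((j : ℕ) : ℤ) : ℤ) : ℝ)| * s := by
        rw [← h, abs_mul, abs_of_pos hs0]
      nlinarith
  · have := hge i
    have := le_abs_self (ϑ t)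
    have := abs_nonneg κ
    have := hϑ t
    linarith
  · have := hge i
    have := le_abs_self (ϑ t)
    have := hϑ t
    linarith

/-- The algebra `WF_𝒪`, spanned by the diagrams with top and bottom `B_s`. -/
abbrev WFO {R : Type*} [CommRing R] {ℓ : ℕ} (n : ℕ) {κ s : ℝ} {ϑ : Fin ℓ → ℝ} (hκ : κ ≠ 0)
    (hs : |κ| < s) (hϑ : ∀ t, |ϑ t| + |κ| < s) (q : R) (Q : Fin ℓ → R) : Type _ :=
  (isIdempotentElem_wfIdem q Q (generic_spaced n hκ hs hϑ)).Corner

/-! ### The cyclotomic affine Hecke algebra -/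

/-- Generators `X_i^{±1}` and `T_r` of the affine Hecke algebra (indices start at `0`). -/
inductive HeckeGen (n : ℕ) : Type
  | X (i : Fin n) : HeckeGen n
  | Xinv (i : Fin n) : HeckeGen n
  | T (r : ℕ) (h : r + 1 < n) : HeckeGen n

namespace HeckeGen

/-- The generator `X_i` in the free algebra. -/
def x (R : Type*) [CommRing R] {n : ℕ} (i : Fin n) : FreeAlgebra R (HeckeGen n) :=
  FreeAlgebra.ι R (X i)

/-- The generator `X_i⁻¹` in the free algebra. -/
def xinv (R : Type*) [CommRing R] {n : ℕ} (i : Fin n) : FreeAlgebra R (HeckeGen n) :=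
  FreeAlgebra.ι R (Xinv i)

/-- The generator `T_r` in the free algebra. -/
def t (R : Type*) [CommRing R] {n : ℕ} (r : ℕ) (h : r + 1 < n) : FreeAlgebra R (HeckeGen n) :=
  FreeAlgebra.ι R (T r h)

end HeckeGen

open HeckeGen in
/-- The relations of the affine Hecke algebra with parameter `q`. -/
inductive HeckeRel {R : Type*} [CommRing R] (q : R) (n : ℕ) :
    FreeAlgebra R (HeckeGen n) → FreeAlgebra R (HeckeGen n) → Prop
  | x_comm (i j : Fin n) : HeckeRel q n (x R i * x R j) (x R j * x R i)
  | x_xinv (i : Fin n) : HeckeRel q n (x R i * xinv R i) 1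
  | xinv_x (i : Fin n) : HeckeRel q n (xinv R i * x R i) 1
  | quadratic (r : ℕ) (h : r + 1 < n) :
      HeckeRel q n (t R r h * t R r h) ((q - 1) • t R r h + algebraMap R _ q)
  | txt (r : ℕ) (h : r + 1 < n) :
      HeckeRel q n (t R r h * x R ⟨r, Nat.lt_of_succ_lt h⟩ * t R r h) (q • x R ⟨r + 1, h⟩)
  | braid (r : ℕ) (h : r + 1 < n) (h' : r + 1 + 1 < n) :
      HeckeRel q n (t R r h * t R (r + 1) h' * t R r h) (t R (r + 1) h' * t R r h * t R (r + 1) h')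
  | t_x (r : ℕ) (h : r + 1 < n) (j : Fin n) (h₁ : (j : ℕ) ≠ r) (h₂ : (j : ℕ) ≠ r + 1) :
      HeckeRel q n (t R r h * x R j) (x R j * t R r h)
  | t_t (r r' : ℕ) (h : r + 1 < n) (h' : r' + 1 < n) (h₁ : r' ≠ r + 1) (h₂ : r ≠ r' + 1) :
      HeckeRel q n (t R r h * t R r' h') (t R r' h' * t R r h)

/-- The affine Hecke algebra of rank `n` with parameter `q`. -/
abbrev AffineHecke {R : Type*} [CommRing R] (q : R) (n : ℕ) : Type _ :=
  RingQuot (HeckeRel q n)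

/-- The cyclotomic relation `∏ (X_1 - Q t) = 0`. -/
inductive CyclotomicRel {R : Type*} [CommRing R] {ℓ : ℕ} (q : R) (Q : Fin ℓ → R) (n : ℕ) :
    AffineHecke q n → AffineHecke q n → Prop
  | cyclotomic (h : 0 < n) :
      CyclotomicRel q Q n
        (Polynomial.aeval (RingQuot.mkAlgHom R (HeckeRel q n) (HeckeGen.x R ⟨0, h⟩))
          (∏ t, (Polynomial.X - Polynomial.C (Q t)))) 0

/-- The cyclotomic affine Hecke algebra (Ariki–Koike algebra) with parameters `q` and `Q`. -/
abbrev CyclotomicHecke {R : Type*} [CommRing R] {ℓ : ℕ} (q : R) (Q : Fin ℓ → R) (n : ℕ) : Type _ :=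
  RingQuot (CyclotomicRel q Q n)

/-! ### The base ring and the deformed parameters -/

/-- The power series ring `k[[h, z_1, …, z_ℓ]]`; the variable `h` is `none`, and `z_t` is `some t`. -/
abbrev Base (k : Type*) [Field k] (ℓ : ℕ) : Type _ := MvPowerSeries (Option (Fin ℓ)) k

/-- The deformed parameter `q d(h)`. -/
def qDeformed {k : Type*} [Field k] (ℓ : ℕ) (q : k) (d : PowerSeries k) : Base k ℓ :=
  q • PowerSeries.subst (MvPowerSeries.X none : Base k ℓ) d

/-- The deformed parameters `Q_t exp(-z_t)`. -/
def QDeformed {k : Type*} [Field k] [CharZero k] {ℓ : ℕ} (Q : Fin ℓ → k) (t : Fin ℓ) : Base k ℓ :=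
  Q t • PowerSeries.subst (-MvPowerSeries.X (some t) : Base k ℓ) (PowerSeries.exp k)

end

end WFHecke

namespace WFHecke

open scoped Polynomial

set_option linter.unusedSectionVars false

noncomputable section

section

open Topology

/-! ### Affine arrangements of hyperplanes -/

section Envelope

variable {ι : Type*} [DecidableEq ι]

/-! Both algebras are quotients of affine ones, and the affine versions are compared first. Let `e`
be the idempotent of `spaced n s` in `AffineWF`. When the ring is a domain and the parameter `q` is
a unit, the corner at `e` is the affine Hecke algebra: squares correspond to the `X_i`, and a
crossing of two neighbouring strands (with their ghosts), shifted by the scalar `q` or `-1`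
according to the sign of `κ`, corresponds to `T_r`.

The lower bound comes from a polynomial representation `rep` over the field of rational functions. A
crossing of strands acts as a divided difference. A strand that passes a ghost or a red line acts by
the factor of the bigon relation in one direction and by `1` in the other. Functions are indexed by
labellings of the strands instead of having their variables permuted, so the operators are linear
over the whole field, and the corner acts on a space of dimension `n!`. There `T_r` becomes a
Demazure–Lusztig operator.

The upper bound says that the corner is spanned over Laurent polynomials by `n!` elements.
Configurations are points off a hyperplane arrangement whose walls are the possible crossings, and a
diagram is a gallery. Two minimal galleries with the same ends are linked by moves around faces of
codimension two (`Arrangement.facet_induction`). Such a face lies on two walls (exchange of heights)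
or three walls (triple point), and each move is valid modulo diagrams with fewer crossings. Hence
`straighten_aux`: up to fewer crossings only the connection of the end points matters.

If `n!` elements span an algebra over Laurent polynomials, and the images of one joint eigenvector
span a space of dimension `n!`, then these images form a basis and the action on that vector is
faithful (`injective_of_heckeOp`). Applied to the corner, this reduces the Hecke relations to
identities of operators. Applied to the affine Hecke algebra, which also has `n!` spanning elements,
it gives injectivity of `heckeToCorner`. Surjectivity holds because reduced words of permutations
give minimal galleries.

For the quotients, pulling the first strand to the left of all red lines and pushing it back acts by
`∏ (X_1 - Q_t)`. By faithfulness it equals the cyclotomic element, which therefore factors through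
an unsteady configuration. Conversely, a minimal diagram from `spaced n s` to any unsteady
configuration can be routed through this particular one (`exists_gal_unsteady`). So the ideal of
unsteady idempotents cuts out of the corner exactly the ideal of the cyclotomic relation. Both parts
of the theorem are then instances of one isomorphism over a domain. -/

/-- On the upper envelope of finitely many affine functions on `[0, 1]`, a property that is
preserved at every break point is preserved from the left end to the right end. -/
theorem envelope_induction (S : Finset ι) (α β : ι → ℝ) {H K : ι} (hH : H ∈ S) (hK : K ∈ S)
    (αH : α H = 0) (αlt : ∀ c ∈ S, c ≠ H → α c < 0) (βK : β K = 0)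
    (βlt : ∀ c ∈ S, c ≠ K → β c < 0) (P : ι → Prop)
    (step : ∀ u : ℝ, 0 ≤ u → u ≤ 1 → ∀ A ∈ S, ∀ C ∈ S, A ≠ C →
      (∀ c ∈ S, (1 - u) * α c + u * β c ≤ (1 - u) * α A + u * β A) →
      (1 - u) * α C + u * β C = (1 - u) * α A + u * β A →
      (∀ c ∈ S, (1 - u) * α c + u * β c = (1 - u) * α A + u * β A →
        β A - α A ≤ β c - α c ∧ β c - α c ≤ β C - α C) → P A → P C)
    (hP : P H) : P K := by
  -- Strong induction on the number of functions steeper than the current one. The invariant is that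
  -- `A` is maximal at time `u` and steepest among the maximal ones, hence is the maximum just after
  -- `u`.
  have main : ∀ m : ℕ, ∀ u : ℝ, 0 ≤ u → u ≤ 1 → ∀ A ∈ S,
      (∀ c ∈ S, (1 - u) * α c + u * β c ≤ (1 - u) * α A + u * β A) →
      (∀ c ∈ S, (1 - u) * α c + u * β c = (1 - u) * α A + u * β A → β c - α c ≤ β A - α A) →
      P A → (S.filter fun c => β A - α A < β c - α c).card = m → P K := by
    intro m
    induction m using Nat.strong_induction_on with
    | _ m ih =>
      intro u hu0 hu1 A hA hmax hslope hPA hm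
      by_cases hAK : A = K
      · exact hAK ▸ hPA
      have hKA : β A < β K := by rw [βK]; exact βlt A hA hAK
      -- `A` is not below `K` at time `u` but strictly below it at time `1`.
      have hKs : β A - α A < β K - α K := by
        have := hmax K hK
        by_contra hcon
        have h1 : (1 - u) * (β K - α K) ≤ (1 - u) * (β A - α A) :=
          mul_le_mul_of_nonneg_left (not_lt.mp hcon) (by linarith)
        nlinarith
      set T := S.filter fun c => β A - α A < β c - α c with hT
      have hKT : K ∈ T := by simp [hT, hK, hKs]
      -- `v c` is the time at which a steeper function `c` catches up with `A`.
      set v : ι → ℝ := fun c => (α A - α c) / ((β c - α c) - (β A - α A)) with hv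
      have hvle : ∀ c ∈ T, ∀ w : ℝ,
          ((1 - w) * α c + w * β c ≤ (1 - w) * α A + w * β A ↔ w ≤ v c) := by
        intro c hc w
        have hp : 0 < (β c - α c) - (β A - α A) := by
          have := (Finset.mem_filter.mp hc).2; linarith
        rw [hv]
        simp only
        rw [le_div_iff₀ hp]
        constructor <;> intro h <;> nlinarith
      have hveq : ∀ c ∈ T, ∀ w : ℝ,
          ((1 - w) * α c + w * β c = (1 - w) * α A + w * β A ↔ w = v c) := by
        intro c hc w
        have hp : 0 < (β c - α c) - (β A - α A) := by
          have := (Finset.mem_filter.mp hc).2; linarith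
        rw [hv]
        simp only
        rw [eq_div_iff hp.ne']
        constructor <;> intro h <;> nlinarith
      obtain ⟨B, hBT, hBmin⟩ := Finset.exists_min_image T v ⟨K, hKT⟩
      -- The next break point is `v B`. Several functions may catch up there; the steepest of them
      -- takes over.
      obtain ⟨C, hC, hCmax⟩ := Finset.exists_max_image (T.filter fun c => v c = v B)
        (fun c => β c - α c) ⟨B, by simp [hBT]⟩
      have hCT : C ∈ T := (Finset.mem_filter.mp hC).1
      have hCv : v C = v B := (Finset.mem_filter.mp hC).2
      have hCS : C ∈ S := (Finset.mem_filter.mp hCT).1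
      have hCs : β A - α A < β C - α C := (Finset.mem_filter.mp hCT).2
      have huB : u < v B := by
        have hBS := (Finset.mem_filter.mp hBT).1
        refine lt_of_le_of_ne ((hvle B hBT u).mp (hmax B hBS)) fun h => ?_
        have := hslope B hBS ((hveq B hBT u).mpr h)
        exact absurd (Finset.mem_filter.mp hBT).2 (not_lt.mpr this)
      have hB1 : v B ≤ 1 := by
        refine (hBmin K hKT).trans (le_of_lt ?_)
        rw [← not_le]
        intro h
        have := (hvle K hKT 1).mpr h
        simp only [sub_self, zero_mul, one_mul, zero_add] at this
        linarith
      have hlow : ∀ c ∈ S, c ∉ T →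
          (1 - v B) * α c + v B * β c ≤ (1 - v B) * α A + v B * β A := by
        intro c hc hcT
        have h1 : β c - α c ≤ β A - α A := by
          by_contra h
          exact hcT (by simp [hT, hc, not_le.mp h])
        have h2 := hmax c hc
        nlinarith [mul_nonneg (sub_nonneg.mpr huB.le) (sub_nonneg.mpr h1)]
      have hmax' : ∀ c ∈ S, (1 - v B) * α c + v B * β c ≤ (1 - v B) * α A + v B * β A := by
        intro c hc
        by_cases hcT : c ∈ T
        · exact (hvle c hcT _).mpr (hBmin c hcT)
        · exact hlow c hc hcT
      have hties : ∀ c ∈ S, (1 - v B) * α c + v B * β c = (1 - v B) * α A + v B * β A →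
          β A - α A ≤ β c - α c ∧ β c - α c ≤ β C - α C := by
        intro c hc heq
        by_cases hcT : c ∈ T
        · have h1 := (Finset.mem_filter.mp hcT).2
          exact ⟨h1.le, hCmax c (by simp [hcT, ((hveq c hcT _).mp heq).symm])⟩
        · have h1 : β c - α c ≤ β A - α A := by
            by_contra h
            exact hcT (by simp [hT, hc, not_le.mp h])
          refine ⟨?_, h1.trans hCs.le⟩
          -- A function less steep than `A` that ties with it at the later time `v B` would have
          -- been larger at time `u`.
          have h2 := hmax c hc
          by_contra h3
          nlinarith [mul_pos (sub_pos.mpr huB) (sub_pos.mpr (not_le.mp h3))]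
      have hCeq : (1 - v B) * α C + v B * β C = (1 - v B) * α A + v B * β A :=
        (hveq C hCT _).mpr hCv.symm
      have hAC : A ≠ C := by rintro rfl; exact lt_irrefl _ hCs
      have hPC := step (v B) (by linarith) hB1 A hA C hCS hAC hmax' hCeq hties hPA
      refine ih _ ?_ (v B) (by linarith) hB1 C hCS (fun c hc => hCeq ▸ hmax' c hc)
        (fun c hc h => (hties c hc (h.trans hCeq)).2) hPC rfl
      rw [← hm]
      apply Finset.card_lt_card
      rw [Finset.ssubset_iff_of_subset]
      · exact ⟨C, hCT, by simp⟩
      · intro c hc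
        rw [Finset.mem_filter] at hc
        simp only [hT, Finset.mem_filter]
        exact ⟨hc.1, hCs.trans hc.2⟩
  -- At time `0` only `H` attains the maximum, so the condition on slopes is trivial.
  refine main _ 0 le_rfl zero_le_one H hH (fun c hc => ?_) (fun c hc h => ?_) hP rfl
  · by_cases h : c = H
    · rw [h]
    · simpa [αH] using (αlt c hc h).le
  · by_cases h' : c = H
    · rw [h']
    · have := αlt c hc h'
      simp [αH] at h
      exact absurd h this.ne

end Envelope

/-! ### Points off finitely many hyperplanes -/

section Density

variable {V : Type*} [NormedAddCommGroup V] [NormedSpace ℝ V]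

theorem isOpen_affine_ne (l : V →L[ℝ] ℝ) (b : ℝ) : IsOpen {x | l x + b ≠ 0} :=
  isOpen_ne_fun (by fun_prop) continuous_const

/-- On the segment from a zero of the functional towards `p`, the functional is a multiple of the
parameter by a nonzero number, so it is nonzero arbitrarily close to the zero. -/
theorem dense_affine_ne (l : V →L[ℝ] ℝ) (b : ℝ) {p : V} (hp : l p + b ≠ 0) :
    Dense {x | l x + b ≠ 0} := by
  intro x
  by_cases hx : l x + b = 0
  · have ht : Filter.Tendsto (fun ε : ℝ => x + ε • (p - x)) (𝓝[>] 0) (𝓝 x) := by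
      have : Continuous fun ε : ℝ => x + ε • (p - x) := by fun_prop
      have h := this.tendsto 0
      simp only [zero_smul, add_zero] at h
      exact h.mono_left nhdsWithin_le_nhds
    refine mem_closure_of_tendsto ht ?_
    filter_upwards [self_mem_nhdsWithin] with ε hε
    have : l (x + ε • (p - x)) + b = ε * (l p + b) := by
      simp only [map_add, map_smul, map_sub, smul_eq_mul]
      linear_combination (1 - ε) * hx
    simp only [this]
    exact mul_ne_zero (ne_of_gt hε) hp
  · exact subset_closure hx

theorem dense_biInter_affine_ne {J : Type*} (s : Finset J) (l : J → V →L[ℝ] ℝ) (b : J → ℝ)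
    (h : ∀ j ∈ s, ∃ p, l j p + b j ≠ 0) :
    IsOpen {x | ∀ j ∈ s, l j x + b j ≠ 0} ∧ Dense {x | ∀ j ∈ s, l j x + b j ≠ 0} := by
  classical
  induction s using Finset.induction_on with
  | empty => simp
  | insert a s ha ih =>
    obtain ⟨ho, hd⟩ := ih fun j hj => h j (Finset.mem_insert_of_mem hj)
    obtain ⟨p, hp⟩ := h a (Finset.mem_insert_self a s)
    have : {x | ∀ j ∈ insert a s, l j x + b j ≠ 0} =
        {x | l a x + b a ≠ 0} ∩ {x | ∀ j ∈ s, l j x + b j ≠ 0} := by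
      ext x; simp
    rw [this]
    exact ⟨(isOpen_affine_ne _ _).inter ho,
      (dense_affine_ne _ _ hp).inter_of_isOpen_left hd (isOpen_affine_ne _ _)⟩

/-- A point of a hyperplane can be moved inside it off finitely many affine functionals which vanish
at a given point outside the hyperplane. -/
theorem exists_mem_hyperplane {J : Type*} (s : Finset J) (l : J → V →L[ℝ] ℝ) (b : J → ℝ)
    (lH : V →L[ℝ] ℝ) (bH : ℝ) {x h₀ : V} (h0 : lH h₀ + bH = 0) (hx : lH x + bH ≠ 0)
    (hl : ∀ j ∈ s, l j x + b j = 0 ∧ ∃ p, l j p + b j ≠ 0) {U : Set V} (hU : IsOpen U)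
    (hU0 : h₀ ∈ U) : ∃ h ∈ U, lH h + bH = 0 ∧ ∀ j ∈ s, l j h + b j ≠ 0 := by
  -- Density is applied in the space `N` of directions of the hyperplane, to the functionals
  -- translated to `h₀`.
  let N := LinearMap.ker lH.toLinearMap
  have key : ∀ j ∈ s, ∃ v : N, (l j).comp N.subtypeL v + (l j h₀ + b j) ≠ 0 := by
    intro j hj
    obtain ⟨h1, p, hp⟩ := hl j hj
    by_contra! hcon
    apply hp
    -- With this `c` the vector `p - h₀ - c • (x - h₀)` is parallel to the hyperplane. A functional
    -- that vanishes on the hyperplane and at `x` therefore vanishes at `p`.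
    set c := (lH p + bH) / (lH x + bH) with hc
    have hvN : p - h₀ - c • (x - h₀) ∈ N := by
      have : c * (lH x + bH) = lH p + bH := by rw [hc]; field_simp
      simp only [N, LinearMap.mem_ker, ContinuousLinearMap.coe_coe, map_sub, map_smul, smul_eq_mul]
      linear_combination -this + (c - 1) * h0
    have h2 := hcon ⟨_, hvN⟩
    have h3 := hcon 0
    simp only [ContinuousLinearMap.comp_apply, Submodule.subtypeL_apply, map_sub, map_smul,
      smul_eq_mul, map_zero, zero_add] at h2 h3
    linear_combination h2 + c * h1 - c * h3
  obtain ⟨-, hd⟩ := dense_biInter_affine_ne s (fun j => (l j).comp N.subtypeL)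
    (fun j => l j h₀ + b j) key
  have hc : Continuous fun v : N => h₀ + (v : V) := by fun_prop
  obtain ⟨v, hvU, hv⟩ := hd.inter_open_nonempty _ (hU.preimage hc)
    ⟨0, by simpa using hU0⟩
  refine ⟨h₀ + v, hvU, ?_, fun j hj => ?_⟩
  · have : lH (v : V) = 0 := v.2
    rw [map_add, this, add_zero, h0]
  · have := hv j hj
    simp only [ContinuousLinearMap.comp_apply, Submodule.subtypeL_apply] at this
    rw [map_add]
    intro h
    exact this (by linarith)

end Density

end

/-! ### Arrangements, separating walls and facets -/

section

open Topology

/-- A finite arrangement of affine hyperplanes, with a dense set of generic points off all of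
them. In a pencil (hyperplanes through a point with pairwise linear dependencies of length three)
there are at most three hyperplanes. -/
structure Arrangement (ι V : Type*) [NormedAddCommGroup V] [NormedSpace ℝ V] where
  walls : Finset ι
  lin : ι → V →L[ℝ] ℝ
  const : ι → ℝ
  gen : Set V
  dense_gen : Dense gen
  gen_ne : ∀ x ∈ gen, ∀ c ∈ walls, lin c x + const c ≠ 0
  indep : ∀ A ∈ walls, ∀ B ∈ walls, A ≠ B → ∃ p, lin A p + const A = 0 ∧ lin B p + const B ≠ 0
  pencil : ∀ e : V, ∀ A ∈ walls, ∀ B ∈ walls, ∀ C ∈ walls, ∀ D ∈ walls, A ≠ B → C ≠ D →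
    lin A e + const A = 0 → lin B e + const B = 0 → lin C e + const C = 0 →
    lin D e + const D = 0 → ∀ a₁ a₂ a₃ b₁ b₂ b₃ : ℝ, a₁ ≠ 0 → a₂ ≠ 0 → a₃ ≠ 0 → b₁ ≠ 0 → b₂ ≠ 0 →
    b₃ ≠ 0 → (∀ v, a₁ * lin A v + a₂ * lin B v + a₃ * lin C v = 0) →
    (∀ v, b₁ * lin A v + b₂ * lin B v + b₃ * lin D v = 0) → False

namespace Arrangement

variable {ι V : Type*} [DecidableEq ι] [NormedAddCommGroup V] [NormedSpace ℝ V]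
  (𝒜 : Arrangement ι V)

/-- The affine functional of a wall. -/
def ev (c : ι) (x : V) : ℝ := 𝒜.lin c x + 𝒜.const c

/-- The walls that separate two points. -/
def sep (x y : V) : Finset ι := 𝒜.walls.filter fun c => 𝒜.ev c x * 𝒜.ev c y < 0

variable {𝒜}

theorem mem_sep {c : ι} {x y : V} :
    c ∈ 𝒜.sep x y ↔ c ∈ 𝒜.walls ∧ 𝒜.ev c x * 𝒜.ev c y < 0 := Finset.mem_filter

theorem ev_ne {x : V} (hx : x ∈ 𝒜.gen) {c : ι} (hc : c ∈ 𝒜.walls) : 𝒜.ev c x ≠ 0 :=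
  𝒜.gen_ne x hx c hc

theorem continuous_ev (c : ι) : Continuous (𝒜.ev c) := by unfold ev; fun_prop

theorem not_mem_sep_iff {c : ι} (hc : c ∈ 𝒜.walls) {x y : V} (hx : x ∈ 𝒜.gen) (hy : y ∈ 𝒜.gen) :
    c ∉ 𝒜.sep x y ↔ 0 < 𝒜.ev c x * 𝒜.ev c y := by
  rw [mem_sep, not_and, not_lt]
  have := mul_ne_zero (ev_ne hx hc) (ev_ne hy hc)
  exact ⟨fun h => lt_of_le_of_ne (h hc) this.symm, fun h _ => h.le⟩

theorem sep_comm (x y : V) : 𝒜.sep x y = 𝒜.sep y x := by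
  ext c; rw [mem_sep, mem_sep, mul_comm]

theorem sep_self (x : V) : 𝒜.sep x x = ∅ := by
  ext c
  simp only [mem_sep, Finset.notMem_empty, iff_false, not_and, not_lt]
  exact fun _ => mul_self_nonneg _

/-- The sign at `y` cancels, so a wall is counted by parity. All computations of separating sets
below rest on this rule. -/
theorem sep_symmDiff {x y z : V} (hx : x ∈ 𝒜.gen) (hy : y ∈ 𝒜.gen) (hz : z ∈ 𝒜.gen) :
    𝒜.sep x z = symmDiff (𝒜.sep x y) (𝒜.sep y z) := by
  ext c
  rw [Finset.mem_symmDiff]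
  by_cases hc : c ∈ 𝒜.walls
  · have h1 := ev_ne hx hc
    have h2 := ev_ne hy hc
    have h3 := ev_ne hz hc
    simp only [mem_sep, hc, true_and, not_lt]
    rcases h1.lt_or_gt with h1 | h1 <;> rcases h2.lt_or_gt with h2 | h2 <;>
      rcases h3.lt_or_gt with h3 | h3 <;>
      simp [mul_neg_iff, mul_nonneg_iff, h1, h2, h3, h1.le, h2.le, h3.le, h1.not_gt, h2.not_gt,
        h3.not_gt, h1.not_ge, h2.not_ge, h3.not_ge]
  · simp [mem_sep, hc]

/-- Open chambers meet the dense set of generic points. Hence points constructed by convex geometry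
only have to avoid the walls before being replaced by generic ones. -/
theorem exists_gen_of_ne (p : V) (hp : ∀ c ∈ 𝒜.walls, 𝒜.ev c p ≠ 0) {U : Set V} (hU : IsOpen U)
    (hpU : p ∈ U) : ∃ z ∈ 𝒜.gen, z ∈ U ∧ ∀ c ∈ 𝒜.walls, 0 < 𝒜.ev c z * 𝒜.ev c p := by
  have ho : IsOpen {z | ∀ c ∈ 𝒜.walls, 0 < 𝒜.ev c z * 𝒜.ev c p} := by
    have : {z | ∀ c ∈ 𝒜.walls, 0 < 𝒜.ev c z * 𝒜.ev c p} =
        ⋂ c ∈ 𝒜.walls, {z | 0 < 𝒜.ev c z * 𝒜.ev c p} := by ext; simp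
    rw [this]
    exact isOpen_biInter_finset fun c _ =>
      isOpen_lt continuous_const ((continuous_ev c).mul continuous_const)
  obtain ⟨z, hz, hzg⟩ := 𝒜.dense_gen.inter_open_nonempty _ (ho.inter hU)
    ⟨p, fun c hc => mul_self_pos.mpr (hp c hc), hpU⟩
  exact ⟨z, hzg, hz.2, hz.1⟩

/-- Two walls are met at the same moment by the segment from `x` to `y'` only if their ratios agree.
After moving `y` within its chamber, the separating walls are thus crossed one at a time. -/
theorem exists_gen_off (x y : V) (hx : x ∈ 𝒜.gen) (hy : y ∈ 𝒜.gen) :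
    ∃ y' : V, (∀ c ∈ 𝒜.walls, 0 < 𝒜.ev c y' * 𝒜.ev c y) ∧
      ∀ A ∈ 𝒜.walls, ∀ B ∈ 𝒜.walls, A ≠ B → 𝒜.ev A y' / 𝒜.ev A x ≠ 𝒜.ev B y' / 𝒜.ev B x := by
  obtain ⟨-, hd⟩ := dense_biInter_affine_ne
    ((𝒜.walls ×ˢ 𝒜.walls).filter fun j => j.1 ≠ j.2)
    (fun j => (𝒜.ev j.1 x)⁻¹ • 𝒜.lin j.1 - (𝒜.ev j.2 x)⁻¹ • 𝒜.lin j.2)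
    (fun j => (𝒜.ev j.1 x)⁻¹ * 𝒜.const j.1 - (𝒜.ev j.2 x)⁻¹ * 𝒜.const j.2) (by
      rintro ⟨A, B⟩ hj
      simp only [Finset.mem_filter, Finset.mem_product] at hj
      obtain ⟨p, hp1, hp2⟩ := 𝒜.indep A hj.1.1 B hj.1.2 hj.2
      refine ⟨p, ?_⟩
      have h2 := ev_ne hx hj.1.2
      simp only [sub_apply, smul_apply, smul_eq_mul]
      have : (𝒜.ev A x)⁻¹ * 𝒜.lin A p - (𝒜.ev B x)⁻¹ * 𝒜.lin B p +
          ((𝒜.ev A x)⁻¹ * 𝒜.const A - (𝒜.ev B x)⁻¹ * 𝒜.const B) =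
          -((𝒜.ev B x)⁻¹ * (𝒜.lin B p + 𝒜.const B)) := by
        linear_combination (𝒜.ev A x)⁻¹ * hp1
      rw [this]
      exact neg_ne_zero.mpr (mul_ne_zero (inv_ne_zero h2) hp2))
  have ho : IsOpen {z | ∀ c ∈ 𝒜.walls, 0 < 𝒜.ev c z * 𝒜.ev c y} := by
    have : {z | ∀ c ∈ 𝒜.walls, 0 < 𝒜.ev c z * 𝒜.ev c y} =
        ⋂ c ∈ 𝒜.walls, {z | 0 < 𝒜.ev c z * 𝒜.ev c y} := by ext; simp
    rw [this]
    exact isOpen_biInter_finset fun c _ =>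
      isOpen_lt continuous_const ((continuous_ev c).mul continuous_const)
  obtain ⟨z, hz, hz'⟩ := hd.inter_open_nonempty _ ho
    ⟨y, fun c hc => mul_self_pos.mpr (ev_ne hy hc)⟩
  refine ⟨z, hz, fun A hA B hB hAB heq => ?_⟩
  have := hz' (A, B) (by simp [hA, hB, hAB])
  apply this
  simp only [sub_apply, smul_apply, smul_eq_mul]
  rw [div_eq_inv_mul, div_eq_inv_mul] at heq
  simp only [ev] at heq ⊢
  linear_combination heq

/-- A chamber that is separated from a point has a facet separating it from this point. -/
theorem exists_facet {x y : V} (hx : x ∈ 𝒜.gen) (hy : y ∈ 𝒜.gen) (hs : (𝒜.sep x y).Nonempty) :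
    ∃ H ∈ 𝒜.sep x y, ∃ z ∈ 𝒜.gen, 𝒜.sep z y = {H} := by
  obtain ⟨y', hy', hne⟩ := exists_gen_off x y hx hy
  -- Up to a positive factor, the functional `c` takes the value `(w c + μ) * ev c x` at the point
  -- of the segment proportional to `y' + μ • x`. So the wall `c` is crossed at `μ = -w c`, and the
  -- first one met from `y'` has the largest `w` among the separating walls.
  set w : ι → ℝ := fun c => 𝒜.ev c y' / 𝒜.ev c x with hw
  have hev : ∀ c ∈ 𝒜.walls, 𝒜.ev c y' = w c * 𝒜.ev c x := fun c hc => by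
    rw [hw]; simp only; rw [div_mul_cancel₀ _ (ev_ne hx hc)]
  have hsw : ∀ c ∈ 𝒜.walls, (c ∈ 𝒜.sep x y ↔ w c < 0) := by
    intro c hc
    have h1 := hy' c hc
    have h2 := mul_self_pos.mpr (ev_ne hx hc)
    rw [hev c hc] at h1
    simp only [mem_sep, hc, true_and]
    have h3 : 0 < w c * (𝒜.ev c x * 𝒜.ev c y) := by linarith
    constructor
    · intro h; by_contra h'; nlinarith [mul_nonneg (not_lt.mp h') (neg_nonneg.mpr h.le)]
    · intro h; by_contra h'; nlinarith [mul_nonneg (not_lt.mp h') (neg_nonneg.mpr h.le)]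
  obtain ⟨H, hH, hmax⟩ := Finset.exists_max_image _ w hs
  have hHW := (mem_sep.mp hH).1
  have hH0 := (hsw H hHW).mp hH
  have hlt : ∀ c ∈ 𝒜.sep x y, c ≠ H → w c < w H := fun c hc hcH =>
    lt_of_le_of_ne (hmax c hc) (hne c (mem_sep.mp hc).1 H hHW hcH)
  -- The parameter is taken between the first and the second crossing, so that only `H` has been
  -- passed. If there is no second crossing, any larger value will do.
  obtain ⟨μ, hμ1, hμ2⟩ : ∃ μ : ℝ, -w H < μ ∧ ∀ c ∈ 𝒜.sep x y, c ≠ H → μ < -w c := by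
    by_cases hne' : ((𝒜.sep x y).erase H).Nonempty
    · obtain ⟨B, hB, hBmax⟩ := Finset.exists_max_image _ w hne'
      have hB' := Finset.mem_erase.mp hB
      have := hlt B hB'.2 hB'.1
      refine ⟨-(w H + w B) / 2, by linarith, fun c hc hcH => ?_⟩
      have := hBmax c (Finset.mem_erase.mpr ⟨hcH, hc⟩)
      linarith
    · refine ⟨-w H + 1, by linarith, fun c hc hcH => ?_⟩
      exact absurd ⟨c, Finset.mem_erase.mpr ⟨hcH, hc⟩⟩ hne'
  have hμ : 0 < μ := by linarith
  set p := (1 / (1 + μ)) • (y' + μ • x) with hp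
  have hpev : ∀ c ∈ 𝒜.walls, 𝒜.ev c p = (1 / (1 + μ)) * ((w c + μ) * 𝒜.ev c x) := by
    intro c hc
    have h1 := hev c hc
    have h2 : (1 : ℝ) / (1 + μ) * (1 + μ) = 1 := by field_simp
    simp only [ev] at h1 ⊢
    rw [hp]
    simp only [map_smul, map_add, smul_eq_mul]
    linear_combination (1 / (1 + μ)) * h1 - 𝒜.const c * h2
  have hwμ : ∀ c ∈ 𝒜.walls, (c ∈ 𝒜.sep x y ∧ c ≠ H → w c + μ < 0) ∧
      (¬ (c ∈ 𝒜.sep x y ∧ c ≠ H) → 0 < w c + μ) := by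
    refine fun c hc => ⟨fun h => by linarith [hμ2 c h.1 h.2], fun h => ?_⟩
    by_cases hcH : c = H
    · rw [hcH]; linarith
    · have : ¬ w c < 0 := fun h' => h ⟨(hsw c hc).mpr h', hcH⟩
      linarith
  have hp0 : ∀ c ∈ 𝒜.walls, 𝒜.ev c p ≠ 0 := by
    intro c hc
    rw [hpev c hc]
    refine mul_ne_zero (by positivity) (mul_ne_zero ?_ (ev_ne hx hc))
    by_cases h : c ∈ 𝒜.sep x y ∧ c ≠ H
    · exact ((hwμ c hc).1 h).ne
    · exact ((hwμ c hc).2 h).ne'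
  obtain ⟨z, hz, -, hzp⟩ := exists_gen_of_ne p hp0 isOpen_univ trivial
  refine ⟨H, hH, z, hz, ?_⟩
  have hxz : 𝒜.sep x z = (𝒜.sep x y).erase H := by
    ext c
    rw [Finset.mem_erase, mem_sep (y := z)]
    by_cases hc : c ∈ 𝒜.walls
    · have h1 := hzp c hc
      rw [hpev c hc] at h1
      have h2 : 0 < (w c + μ) * (𝒜.ev c x * 𝒜.ev c z) := by
        have h4 : (0 : ℝ) < 1 / (1 + μ) := by positivity
        by_contra h3
        nlinarith [mul_nonneg h4.le (neg_nonneg.mpr (not_lt.mp h3))]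
      have hne0 := ev_ne hz hc
      simp only [hc, true_and]
      constructor
      · intro h
        by_contra hcon
        have := (hwμ c hc).2 (fun h => hcon ⟨h.2, h.1⟩)
        nlinarith [mul_pos this (neg_pos.mpr h)]
      · intro h
        have := (hwμ c hc).1 ⟨h.2, h.1⟩
        by_contra h'
        nlinarith [mul_nonneg (neg_pos.mpr this).le (not_lt.mp h')]
    · simp [hc, mem_sep]
  rw [sep_symmDiff hz hx hy, sep_comm z x, hxz]
  ext c
  simp only [Finset.mem_symmDiff, Finset.mem_erase, Finset.mem_singleton]
  constructor
  · tauto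
  · rintro rfl; exact Or.inr ⟨hH, by tauto⟩

/-- The segment from `y` to `z` meets `H` at the parameter `ev H y / (ev H y - ev H z)`. Every other
functional has one sign at both ends, and keeps it there. -/
theorem exists_facet_point {y z : V} (hy : y ∈ 𝒜.gen) (hz : z ∈ 𝒜.gen) {H : ι}
    (h : 𝒜.sep z y = {H}) :
    ∃ h₀, 𝒜.ev H h₀ = 0 ∧ ∀ c ∈ 𝒜.walls, c ≠ H → 0 < 𝒜.ev c h₀ * 𝒜.ev c y := by
  have hH : H ∈ 𝒜.sep z y := by rw [h]; exact Finset.mem_singleton_self H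
  have hneg := (mem_sep.mp hH).2
  set a := 𝒜.ev H y with ha
  set b := 𝒜.ev H z with hb
  have ha0 : a ≠ 0 := by rintro h0; rw [h0] at hneg; simp at hneg
  have hs : 0 < a * (a - b) := by nlinarith [mul_self_pos.mpr ha0]
  have hd : a - b ≠ 0 := by rintro h0; rw [h0] at hs; simp at hs
  set t := a / (a - b) with ht
  have ht' : t * (a - b) = a := by rw [ht]; field_simp
  have ht0 : 0 < t := by
    have : 0 < t * ((a - b) * (a - b)) := by rw [← mul_assoc, ht']; exact hs
    exact pos_of_mul_pos_left this (mul_self_nonneg _)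
  have ht1 : t < 1 := by
    have h1 : (1 - t) * ((a - b) * (a - b)) = -b * (a - b) := by
      linear_combination (b - a) * ht'
    have hb0 : b ≠ 0 := by rintro h0; rw [h0] at hneg; simp at hneg
    have h2 : 0 < -b * (a - b) := by nlinarith [mul_self_pos.mpr hb0]
    have : 0 < 1 - t := pos_of_mul_pos_left (h1 ▸ h2) (mul_self_nonneg _)
    linarith
  have hev : ∀ c, 𝒜.ev c (y + t • (z - y)) = (1 - t) * 𝒜.ev c y + t * 𝒜.ev c z := by
    intro c; simp only [ev, map_add, map_smul, map_sub, smul_eq_mul]; ring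
  refine ⟨y + t • (z - y), ?_, fun c hc hcH => ?_⟩
  · rw [hev]; linear_combination -ht'
  · have hcs : c ∉ 𝒜.sep z y := by rw [h]; simpa using hcH
    have := (not_mem_sep_iff hc hz hy).mp hcs
    rw [hev]
    nlinarith [mul_pos ht0 this, mul_pos (sub_pos.mpr ht1) (mul_self_pos.mpr (ev_ne hy hc))]

end Arrangement

end

/-! ### Going round a face of codimension two -/

namespace Arrangement

variable {ι V : Type*} [DecidableEq ι] [NormedAddCommGroup V] [NormedSpace ℝ V]
  {𝒜 : Arrangement ι V}

/-- Generic points near a point `e`, in the direction `μ (x - e) + r t`. -/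
theorem exists_gen_near {x y e t : V} (hx : x ∈ 𝒜.gen) (hy : y ∈ 𝒜.gen) {M : Finset ι}
    (hM : M ⊆ 𝒜.sep x y) (he : ∀ c ∈ M, 𝒜.ev c e = 0)
    (hpos : ∀ c ∈ 𝒜.walls, c ∉ M → 0 < 𝒜.ev c e * 𝒜.ev c y) (σ : ι → ℝ)
    (hσ : ∀ c ∈ M, 𝒜.lin c t = σ c * 𝒜.ev c x) (r μ : ℝ) (hne : ∀ c ∈ M, r * σ c + μ ≠ 0) :
    ∃ z ∈ 𝒜.gen, 𝒜.sep z y = M.filter fun c => 0 < r * σ c + μ := by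
  have hcont : ∀ c, Continuous fun ε : ℝ => 𝒜.ev c (e + ε • (r • t + μ • (x - e))) := fun c =>
    (continuous_ev c).comp (by fun_prop)
  -- On a wall through `e` the functional is proportional to the step `ε`, and the sign of `r * σ c
  -- + μ` tells whether the new point is on the side of `x`. As these walls separate `x` from `y`, a
  -- positive sign means that the wall separates the new point from `y`.
  have hlin : ∀ c ∈ M, ∀ ε : ℝ,
      𝒜.ev c (e + ε • (r • t + μ • (x - e))) = ε * ((r * σ c + μ) * 𝒜.ev c x) := by
    intro c hc ε
    have h1 := he c hc
    have h2 := hσ c hc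
    simp only [ev] at h1 h2 ⊢
    simp only [map_add, map_smul, map_sub, smul_eq_mul]
    linear_combination (1 - ε * μ) * h1 + ε * r * h2
  -- Walls that avoid `e` keep the sign they have at `y` as long as `ε` is small.
  have hev : ∀ᶠ ε : ℝ in nhds 0, ∀ c ∈ 𝒜.walls \ M,
      0 < 𝒜.ev c (e + ε • (r • t + μ • (x - e))) * 𝒜.ev c y := by
    rw [Filter.eventually_all_finset]
    intro c hc
    rw [Finset.mem_sdiff] at hc
    refine ((hcont c).mul continuous_const).continuousAt.eventually_const_lt ?_
    simpa using hpos c hc.1 hc.2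
  obtain ⟨ε, hε, hε0⟩ := ((hev.filter_mono nhdsWithin_le_nhds).and
    (self_mem_nhdsWithin (s := Set.Ioi (0 : ℝ)))).exists
  have hε0' : (0 : ℝ) < ε := hε0
  obtain ⟨z, hz, -, hzp⟩ := exists_gen_of_ne (𝒜 := 𝒜) (e + ε • (r • t + μ • (x - e)))
    (fun c hc h0 => by
      by_cases hcM : c ∈ M
      · rw [hlin c hcM] at h0
        have := mul_ne_zero hε0'.ne' (mul_ne_zero (hne c hcM) (ev_ne hx hc))
        exact this h0
      · have := hε c (Finset.mem_sdiff.mpr ⟨hc, hcM⟩)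
        rw [h0] at this; simp at this) isOpen_univ trivial
  refine ⟨z, hz, ?_⟩
  ext c
  rw [Finset.mem_filter]
  by_cases hcM : c ∈ M
  · have hcs := hM hcM
    obtain ⟨hc, hxy⟩ := mem_sep.mp hcs
    have h1 := hzp c hc
    rw [hlin c hcM] at h1
    have h2 : 0 < (r * σ c + μ) * (𝒜.ev c z * 𝒜.ev c x) := by
      by_contra h3
      nlinarith [mul_nonneg hε0'.le (neg_nonneg.mpr (not_lt.mp h3))]
    have h3 := mul_self_pos.mpr (ev_ne hx hc)
    have h4 := mul_self_pos.mpr (ev_ne hy hc)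
    have hyz : 𝒜.ev c z * 𝒜.ev c y ≠ 0 := mul_ne_zero (ev_ne hz hc) (ev_ne hy hc)
    have h5 : (𝒜.ev c z * 𝒜.ev c x) * (𝒜.ev c z * 𝒜.ev c y) < 0 := by
      have := mul_self_pos.mpr (ev_ne hz hc); nlinarith
    simp only [mem_sep, hc, true_and, hcM]
    constructor
    · intro h
      have h6 : 0 < 𝒜.ev c z * 𝒜.ev c x := by
        by_contra h7; nlinarith [mul_nonneg (neg_nonneg.mpr (not_lt.mp h7)) (neg_nonneg.mpr h.le)]
      exact pos_of_mul_pos_left h2 h6.le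
    · intro h
      have h6 : 0 < 𝒜.ev c z * 𝒜.ev c x := pos_of_mul_pos_right h2 h.le
      by_contra h7
      nlinarith [mul_nonneg h6.le (not_lt.mp h7)]
  · simp only [hcM, false_and, iff_false]
    by_cases hc : c ∈ 𝒜.walls
    · rw [not_mem_sep_iff hc hz hy]
      have h1 := hzp c hc
      have h2 := hε c (Finset.mem_sdiff.mpr ⟨hc, hcM⟩)
      have := mul_pos h1 h2
      have h3 := mul_self_pos.mpr (fun h0 => by rw [h0] at h1; simp at h1 :
        𝒜.ev c (e + ε • (r • t + μ • (x - e))) ≠ 0)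
      by_contra h4
      nlinarith [mul_nonneg h3.le (neg_nonneg.mpr (not_lt.mp h4))]
    · simp [mem_sep, hc]

/-- The facets of the chamber of `y` that separate it from `x` are connected through faces of
codimension two, which lie on two or three walls. -/
theorem facet_induction {x y : V} (hx : x ∈ 𝒜.gen) (hy : y ∈ 𝒜.gen) (P : ι → Prop)
    (step2 : ∀ A C : ι, A ≠ C → A ∈ 𝒜.sep x y → C ∈ 𝒜.sep x y → ∀ y₀ ∈ 𝒜.gen, ∀ zA ∈ 𝒜.gen,
      ∀ zC ∈ 𝒜.gen, 𝒜.sep y₀ y = {A, C} → 𝒜.sep zA y = {C} → 𝒜.sep zC y = {A} → P A → P C)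
    (step3 : ∀ A B C : ι, A ≠ B → B ≠ C → A ≠ C → A ∈ 𝒜.sep x y → B ∈ 𝒜.sep x y →
      C ∈ 𝒜.sep x y → ∀ e : V, 𝒜.ev A e = 0 → 𝒜.ev B e = 0 → 𝒜.ev C e = 0 →
      (∀ c ∈ 𝒜.walls, c ≠ A → c ≠ B → c ≠ C → 0 < 𝒜.ev c e * 𝒜.ev c y) →
      ∀ y₀ ∈ 𝒜.gen, ∀ z₁ ∈ 𝒜.gen, ∀ z₂ ∈ 𝒜.gen, ∀ z₁' ∈ 𝒜.gen, ∀ z₂' ∈ 𝒜.gen,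
      𝒜.sep y₀ y = {A, B, C} → 𝒜.sep z₁ y = {B, C} → 𝒜.sep z₂ y = {C} → 𝒜.sep z₁' y = {A, B} →
      𝒜.sep z₂' y = {A} → P A → P C)
    {H K : ι} (hH : H ∈ 𝒜.sep x y) (hK : K ∈ 𝒜.sep x y) {zH zK : V} (hzH : zH ∈ 𝒜.gen)
    (hzK : zK ∈ 𝒜.gen) (sH : 𝒜.sep zH y = {H}) (sK : 𝒜.sep zK y = {K}) (hP : P H) : P K := by
  have hHW := (mem_sep.mp hH).1
  have hKW := (mem_sep.mp hK).1
  have hopen : ∀ H, IsOpen {z | ∀ c ∈ 𝒜.walls.erase H, 0 < 𝒜.ev c z * 𝒜.ev c y} := by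
    intro H
    have : {z | ∀ c ∈ 𝒜.walls.erase H, 0 < 𝒜.ev c z * 𝒜.ev c y} =
        ⋂ c ∈ 𝒜.walls.erase H, {z | 0 < 𝒜.ev c z * 𝒜.ev c y} := by ext; simp
    rw [this]
    exact isOpen_biInter_finset fun c _ =>
      isOpen_lt continuous_const ((continuous_ev c).mul continuous_const)
  -- a generic point of the facet on `K`
  obtain ⟨k, hk, hK0, hkne⟩ : ∃ k, (∀ c ∈ 𝒜.walls.erase K, 0 < 𝒜.ev c k * 𝒜.ev c y) ∧
      𝒜.ev K k = 0 ∧ ∀ A ∈ 𝒜.walls, ∀ B ∈ 𝒜.walls, A ≠ B →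
        𝒜.ev A k / 𝒜.ev A x ≠ 𝒜.ev B k / 𝒜.ev B x := by
    obtain ⟨k₀, h0, h1⟩ := exists_facet_point hy hzK sK
    obtain ⟨k, hk, hk0, hkne⟩ := exists_mem_hyperplane
      ((𝒜.walls ×ˢ 𝒜.walls).filter fun j => j.1 ≠ j.2)
      (fun j => (𝒜.ev j.1 x)⁻¹ • 𝒜.lin j.1 - (𝒜.ev j.2 x)⁻¹ • 𝒜.lin j.2)
      (fun j => (𝒜.ev j.1 x)⁻¹ * 𝒜.const j.1 - (𝒜.ev j.2 x)⁻¹ * 𝒜.const j.2)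
      (𝒜.lin K) (𝒜.const K) (x := x) h0 (ev_ne hx hKW) (by
        rintro ⟨A, B⟩ hj
        simp only [Finset.mem_filter, Finset.mem_product] at hj
        have hA := ev_ne hx hj.1.1
        have hB := ev_ne hx hj.1.2
        simp only [sub_apply, smul_apply, smul_eq_mul]
        refine ⟨?_, ?_⟩
        · have h1 := inv_mul_cancel₀ hA
          have h2 := inv_mul_cancel₀ hB
          have h3 : 𝒜.ev A x = 𝒜.lin A x + 𝒜.const A := rfl
          have h4 : 𝒜.ev B x = 𝒜.lin B x + 𝒜.const B := rfl
          linear_combination h1 - h2 - (𝒜.ev A x)⁻¹ * h3 + (𝒜.ev B x)⁻¹ * h4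
        · obtain ⟨p, hp1, hp2⟩ := 𝒜.indep A hj.1.1 B hj.1.2 hj.2
          refine ⟨p, ?_⟩
          have : (𝒜.ev A x)⁻¹ * 𝒜.lin A p - (𝒜.ev B x)⁻¹ * 𝒜.lin B p +
              ((𝒜.ev A x)⁻¹ * 𝒜.const A - (𝒜.ev B x)⁻¹ * 𝒜.const B) =
              -((𝒜.ev B x)⁻¹ * (𝒜.lin B p + 𝒜.const B)) := by
            linear_combination (𝒜.ev A x)⁻¹ * hp1
          rw [this]
          exact neg_ne_zero.mpr (mul_ne_zero (inv_ne_zero hB) hp2))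
      (hopen K) (show k₀ ∈ _ from fun c hc => h1 c (Finset.mem_of_mem_erase hc)
        (Finset.ne_of_mem_erase hc))
    refine ⟨k, hk, hk0, fun A hA B hB hAB heq => ?_⟩
    have := hkne (A, B) (by simp [hA, hB, hAB])
    apply this
    simp only [sub_apply, smul_apply, smul_eq_mul]
    rw [div_eq_inv_mul, div_eq_inv_mul] at heq
    simp only [ev] at heq ⊢
    linear_combination heq
  -- Dividing by the value at `x` normalises each functional to be `1` there. On the closure of the
  -- chamber of `y`, the separating walls then have nonpositive values.
  set β : ι → ℝ := fun c => 𝒜.ev c k / 𝒜.ev c x with hβ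
  -- a generic point of the facet on `H`
  obtain ⟨h, hh, hH0, hhne⟩ : ∃ h, (∀ c ∈ 𝒜.walls.erase H, 0 < 𝒜.ev c h * 𝒜.ev c y) ∧
      𝒜.ev H h = 0 ∧ ∀ A ∈ 𝒜.walls, ∀ B ∈ 𝒜.walls, ∀ C ∈ 𝒜.walls,
        (∃ p, (β B - β C) * (𝒜.ev A p / 𝒜.ev A x) + (β C - β A) * (𝒜.ev B p / 𝒜.ev B x) +
          (β A - β B) * (𝒜.ev C p / 𝒜.ev C x) ≠ 0) →
        (β B - β C) * (𝒜.ev A h / 𝒜.ev A x) + (β C - β A) * (𝒜.ev B h / 𝒜.ev B x) +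
          (β A - β B) * (𝒜.ev C h / 𝒜.ev C x) ≠ 0 := by
    classical
    obtain ⟨h₀, h0, h1⟩ := exists_facet_point hy hzH sH
    -- These combinations of three normalised functionals vanish at `x`, because the weights add up
    -- to `0`, and at `k`, by the choice of weights. Keeping `h` off those that are not identically
    -- zero ensures that three walls tied at a point of the segment from `h` to `k` are linearly
    -- dependent.
    have hform : ∀ A B C p, ((β B - β C) * (𝒜.ev A x)⁻¹) * 𝒜.lin A p +
        ((β C - β A) * (𝒜.ev B x)⁻¹) * 𝒜.lin B p + ((β A - β B) * (𝒜.ev C x)⁻¹) * 𝒜.lin C p +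
        (((β B - β C) * (𝒜.ev A x)⁻¹) * 𝒜.const A +
        ((β C - β A) * (𝒜.ev B x)⁻¹) * 𝒜.const B + ((β A - β B) * (𝒜.ev C x)⁻¹) * 𝒜.const C) =
        (β B - β C) * (𝒜.ev A p / 𝒜.ev A x) + (β C - β A) * (𝒜.ev B p / 𝒜.ev B x) +
          (β A - β B) * (𝒜.ev C p / 𝒜.ev C x) := by
      intro A B C p
      simp only [div_eq_inv_mul]
      simp only [ev]; ring
    obtain ⟨h, hh, hh0, hhne⟩ := exists_mem_hyperplane
      ((𝒜.walls ×ˢ 𝒜.walls ×ˢ 𝒜.walls).filter fun j =>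
        ∃ p, (β j.2.1 - β j.2.2) * (𝒜.ev j.1 p / 𝒜.ev j.1 x) +
          (β j.2.2 - β j.1) * (𝒜.ev j.2.1 p / 𝒜.ev j.2.1 x) +
          (β j.1 - β j.2.1) * (𝒜.ev j.2.2 p / 𝒜.ev j.2.2 x) ≠ 0)
      (fun j => ((β j.2.1 - β j.2.2) * (𝒜.ev j.1 x)⁻¹) • 𝒜.lin j.1 +
        ((β j.2.2 - β j.1) * (𝒜.ev j.2.1 x)⁻¹) • 𝒜.lin j.2.1 +
        ((β j.1 - β j.2.1) * (𝒜.ev j.2.2 x)⁻¹) • 𝒜.lin j.2.2)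
      (fun j => ((β j.2.1 - β j.2.2) * (𝒜.ev j.1 x)⁻¹) * 𝒜.const j.1 +
        ((β j.2.2 - β j.1) * (𝒜.ev j.2.1 x)⁻¹) * 𝒜.const j.2.1 +
        ((β j.1 - β j.2.1) * (𝒜.ev j.2.2 x)⁻¹) * 𝒜.const j.2.2)
      (𝒜.lin H) (𝒜.const H) (x := x) h0 (ev_ne hx hHW) (by
        rintro ⟨A, B, C⟩ hj
        simp only [Finset.mem_filter, Finset.mem_product] at hj
        obtain ⟨⟨hA, hB, hC⟩, p, hp⟩ := hj
        simp only [add_apply, smul_apply, smul_eq_mul]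
        refine ⟨?_, p, ?_⟩
        · rw [hform, div_self (ev_ne hx hA), div_self (ev_ne hx hB), div_self (ev_ne hx hC)]; ring
        · rw [hform]; exact hp)
      (hopen H) (show h₀ ∈ _ from fun c hc => h1 c (Finset.mem_of_mem_erase hc)
        (Finset.ne_of_mem_erase hc))
    refine ⟨h, hh, hh0, fun A hA B hB C hC hp => ?_⟩
    have := hhne (A, B, C) (by simpa [hA, hB, hC] using hp)
    simp only [add_apply, smul_apply, smul_eq_mul] at this
    rwa [hform] at this
  set α : ι → ℝ := fun c => 𝒜.ev c h / 𝒜.ev c x with hα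
  have hneg : ∀ p, ∀ c ∈ 𝒜.sep x y, 0 < 𝒜.ev c p * 𝒜.ev c y → 𝒜.ev c p / 𝒜.ev c x < 0 := by
    intro p c hc hp
    obtain ⟨hcW, hxy⟩ := mem_sep.mp hc
    rw [div_neg_iff]
    rcases (ev_ne hx hcW).lt_or_gt with h1 | h1
    · left; refine ⟨?_, h1⟩; by_contra h2; nlinarith [mul_nonneg_of_nonpos_of_nonpos (not_lt.mp h2) h1.le, mul_self_pos.mpr (ev_ne hy hcW), pos_of_mul_neg_right hxy h1.le]
    · right; refine ⟨?_, h1⟩; by_contra h2; nlinarith [neg_of_mul_neg_right hxy h1.le]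
  -- Seen from `x`, the segment from `h` to `k` is covered by facets of the chamber of `y`: the ray
  -- from a point of the segment to `x` first meets the wall whose normalised functional is largest.
  -- The upper envelope lists these facets, and its break points are the faces of codimension two
  -- between them.
  refine envelope_induction (𝒜.sep x y) α β hH hK (by simp [hα, hH0])
    (fun c hc hcH => hneg h c hc (hh c (Finset.mem_erase.mpr ⟨hcH, (mem_sep.mp hc).1⟩)))
    (by simp [hβ, hK0])
    (fun c hc hcK => hneg k c hc (hk c (Finset.mem_erase.mpr ⟨hcK, (mem_sep.mp hc).1⟩)))
    P ?_ hP
  intro u hu0 hu1 A hA C hC hAC hmax hCA hslope hPA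
  have hAW := (mem_sep.mp hA).1
  have hCW := (mem_sep.mp hC).1
  have hβinj : ∀ B ∈ 𝒜.walls, ∀ D ∈ 𝒜.walls, B ≠ D → β B ≠ β D := hkne
  set g : ι → ℝ := fun c => (1 - u) * α c + u * β c with hg
  have hgA : g A ≤ 0 := by
    have h1 : α A ≤ 0 := by
      by_cases hAH : A = H
      · rw [hAH]; simp [hα, hH0]
      · exact (hneg h A hA (hh A (Finset.mem_erase.mpr ⟨hAH, hAW⟩))).le
    have h2 : β A ≤ 0 := by
      by_cases hAK : A = K
      · rw [hAK]; simp [hβ, hK0]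
      · exact (hneg k A hA (hk A (Finset.mem_erase.mpr ⟨hAK, hAW⟩))).le
    simp only [hg]
    nlinarith
  -- With this `μ`, the point `e` is where the ray from the point of the segment at parameter `u`
  -- towards `x` first meets a separating wall. The walls through `e` are those tied with `A`.
  set μ := -g A with hμ
  have hμ0 : 0 ≤ μ := by linarith
  have hμ1 : (0 : ℝ) < 1 / (1 + μ) := by positivity
  set e := (1 / (1 + μ)) • ((1 - u) • h + u • k + μ • x) with he
  have hαc : ∀ c ∈ 𝒜.walls, 𝒜.ev c h = α c * 𝒜.ev c x := fun c hc => by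
    rw [hα]; simp only; rw [div_mul_cancel₀ _ (ev_ne hx hc)]
  have hβc : ∀ c ∈ 𝒜.walls, 𝒜.ev c k = β c * 𝒜.ev c x := fun c hc => by
    rw [hβ]; simp only; rw [div_mul_cancel₀ _ (ev_ne hx hc)]
  have heev : ∀ c, 𝒜.ev c e =
      (1 / (1 + μ)) * ((1 - u) * 𝒜.ev c h + u * 𝒜.ev c k + μ * 𝒜.ev c x) := by
    intro c
    have h2 : (1 : ℝ) / (1 + μ) * (1 + μ) = 1 := by field_simp
    rw [he]
    simp only [ev, map_smul, map_add, smul_eq_mul]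
    linear_combination -𝒜.const c * h2
  have heev' : ∀ c ∈ 𝒜.walls, 𝒜.ev c e = (1 / (1 + μ)) * ((g c - g A) * 𝒜.ev c x) := by
    intro c hc
    rw [heev, hαc c hc, hβc c hc]; simp only [hg, hμ]; ring
  set M := (𝒜.sep x y).filter fun c => g c = g A with hM
  have hMW : M ⊆ 𝒜.sep x y := Finset.filter_subset _ _
  have heM : ∀ c ∈ M, 𝒜.ev c e = 0 := by
    intro c hc
    obtain ⟨h1, h2⟩ := Finset.mem_filter.mp hc
    rw [heev' c (mem_sep.mp h1).1, h2]; simp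
  have hpos : ∀ c ∈ 𝒜.walls, c ∉ M → 0 < 𝒜.ev c e * 𝒜.ev c y := by
    intro c hc hcM
    by_cases hcs : c ∈ 𝒜.sep x y
    · have h1 : g c < g A := lt_of_le_of_ne (hmax c hcs) fun h => hcM (by simp [hM, hcs, h])
      have h2 := (mem_sep.mp hcs).2
      rw [heev' c hc]
      have h3 : 0 < (g c - g A) * (𝒜.ev c x * 𝒜.ev c y) :=
        mul_pos_of_neg_of_neg (by linarith) h2
      have := mul_pos hμ1 h3
      linarith
    · have hcH : c ≠ H := fun h => hcs (h ▸ hH)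
      have hcK : c ≠ K := fun h => hcs (h ▸ hK)
      have h1 := hh c (Finset.mem_erase.mpr ⟨hcH, hc⟩)
      have h2 := hk c (Finset.mem_erase.mpr ⟨hcK, hc⟩)
      have h3 := (not_mem_sep_iff hc hx hy).mp hcs
      rw [heev]
      have h4 : 0 < (1 - u) * (𝒜.ev c h * 𝒜.ev c y) + u * (𝒜.ev c k * 𝒜.ev c y) := by
        rcases hu0.eq_or_lt with h5 | h5
        · rw [← h5]; simpa using h1
        · nlinarith [mul_pos h5 h2, mul_nonneg (sub_nonneg.mpr hu1) h1.le]
      have := mul_pos hμ1 (add_pos_of_pos_of_nonneg h4 (mul_nonneg hμ0 h3.le))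
      linarith
  -- Moving `e` in the direction `k - h` changes the normalised functionals at these rates, and
  -- distinct rates allow points between consecutive walls to be chosen.
  set σ : ι → ℝ := fun c => β c - α c with hσ
  have hσl : ∀ c ∈ M, 𝒜.lin c (k - h) = σ c * 𝒜.ev c x := by
    intro c hc
    have hcW := (mem_sep.mp (hMW hc)).1
    have h1 := hαc c hcW
    have h2 := hβc c hcW
    simp only [ev] at h1 h2
    rw [map_sub, hσ]
    simp only [ev]
    linear_combination h2 - h1
  have hσne : ∀ B ∈ M, ∀ D ∈ M, B ≠ D → σ B ≠ σ D := by
    intro B hB D hD hBD heq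
    have hB' := (Finset.mem_filter.mp hB).2
    have hD' := (Finset.mem_filter.mp hD).2
    apply hβinj B (mem_sep.mp (hMW hB)).1 D (mem_sep.mp (hMW hD)).1 hBD
    simp only [hg] at hB' hD'
    simp only [hσ] at heq
    linear_combination hB' - hD' + (1 - u) * heq
  have hAM : A ∈ M := by simp [hM, hA]
  have hCM : C ∈ M := by simp only [hM, Finset.mem_filter]; exact ⟨hC, hCA⟩
  -- The combination vanishes at `k` and, by the tie, at the point with parameter `u`. Hence it
  -- vanishes at `h`, and so identically by the choice of `h`.
  have hdep : ∀ B ∈ M, ∀ v, (β B - β C) * (𝒜.lin A v / 𝒜.ev A x) +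
      (β C - β A) * (𝒜.lin B v / 𝒜.ev B x) + (β A - β B) * (𝒜.lin C v / 𝒜.ev C x) = 0 := by
    intro B hB v
    have hBW := (mem_sep.mp (hMW hB)).1
    have hgB : g B = g A := (Finset.mem_filter.mp hB).2
    have hgC : g C = g A := hCA
    have hall : ∀ p, (β B - β C) * (𝒜.ev A p / 𝒜.ev A x) + (β C - β A) * (𝒜.ev B p / 𝒜.ev B x) +
          (β A - β B) * (𝒜.ev C p / 𝒜.ev C x) = 0 := by
      by_contra! hcon
      have h1 : (β B - β C) * α A + (β C - β A) * α B + (β A - β B) * α C ≠ 0 :=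
        hhne A hAW B hBW C hCW hcon
      apply h1
      -- At `u = 1` the tie would equate two values of `β`, which are distinct by the choice of `k`.
      by_cases hu : u = 1
      · exfalso
        have h2 : β C = β A := by simpa [hg, hu] using hgC
        exact hβinj C hCW A hAW hAC.symm h2
      · have h3 : 1 - u ≠ 0 := fun h => hu (by linarith)
        apply mul_left_cancel₀ h3
        simp only [hg] at hgB hgC
        linear_combination (β C - β A) * hgB + (β A - β B) * hgC
    have h1 := hall v
    have h2 := hall 0
    simp only [ev, map_zero, zero_add] at h1 h2
    simp only [ev]
    linear_combination h1 - h2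
  have sample := fun r μ' => exists_gen_near hx hy hMW heM hpos σ hσl r μ'
  have hσAC : σ A < σ C := lt_of_le_of_ne (hslope C hC hCA).1 (hσne A hAM C hCM hAC)
  by_cases hB : ∃ B ∈ M, B ≠ A ∧ B ≠ C
  · obtain ⟨B, hBM, hBA, hBC⟩ := hB
    have hBs := hMW hBM
    have hBW := (mem_sep.mp hBs).1
    have hsl := hslope B hBs (Finset.mem_filter.mp hBM).2
    have hσAB : σ A < σ B := lt_of_le_of_ne hsl.1 (hσne A hAM B hBM hBA.symm)
    have hσBC : σ B < σ C := lt_of_le_of_ne hsl.2 (hσne B hBM C hCM hBC)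
    have hcoef : ∀ B ∈ 𝒜.walls, ∀ D ∈ 𝒜.walls, ∀ E ∈ 𝒜.walls, B ≠ D →
        (β B - β D) / 𝒜.ev E x ≠ 0 := fun B hB D hD E hE hBD =>
      div_ne_zero (sub_ne_zero.mpr (hβinj B hB D hD hBD)) (ev_ne hx hE)
    -- A fourth wall `D` would give a second dependency of length three with `A` and `C`, against
    -- `pencil`.
    have hMeq : M = {A, B, C} := by
      ext D
      simp only [Finset.mem_insert, Finset.mem_singleton]
      constructor
      · intro hD
        by_contra! hcon
        obtain ⟨hDA, hDB, hDC⟩ := hcon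
        have hDW := (mem_sep.mp (hMW hD)).1
        refine 𝒜.pencil e A hAW C hCW B hBW D hDW hAC hDB.symm (heM A hAM) (heM C hCM) (heM B hBM)
          (heM D hD) _ _ _ _ _ _ (hcoef B hBW C hCW A hAW hBC) (hcoef A hAW B hBW C hCW hBA.symm)
          (hcoef C hCW A hAW B hBW hAC.symm) (hcoef D hDW C hCW A hAW hDC)
          (hcoef A hAW D hDW C hCW hDA.symm) (hcoef C hCW A hAW D hDW hAC.symm) (fun v => ?_)
          (fun v => ?_)
        · linear_combination hdep B hBM v
        · linear_combination hdep D hD v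
      · rintro (rfl | rfl | rfl) <;> assumption
    rw [hMeq] at sample
    -- `y₀` is beyond all three walls as seen from `y`. The other points use the midpoints between
    -- consecutive rates as thresholds: `z₁, z₂` go round `e` crossing `A, B, C` in this order, and
    -- `z₁', z₂'` go round the other side in the opposite order.
    obtain ⟨y₀, hy₀, sy₀⟩ := sample 0 1 (by simp)
    obtain ⟨z₁, hz₁, sz₁⟩ := sample 1 (-(σ A + σ B) / 2) (by
      simp only [Finset.mem_insert, Finset.mem_singleton]
      rintro c (rfl | rfl | rfl) <;> intro h <;> linarith)
    obtain ⟨z₂, hz₂, sz₂⟩ := sample 1 (-(σ B + σ C) / 2) (by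
      simp only [Finset.mem_insert, Finset.mem_singleton]
      rintro c (rfl | rfl | rfl) <;> intro h <;> linarith)
    obtain ⟨z₁', hz₁', sz₁'⟩ := sample (-1) ((σ B + σ C) / 2) (by
      simp only [Finset.mem_insert, Finset.mem_singleton]
      rintro c (rfl | rfl | rfl) <;> intro h <;> linarith)
    obtain ⟨z₂', hz₂', sz₂'⟩ := sample (-1) ((σ A + σ B) / 2) (by
      simp only [Finset.mem_insert, Finset.mem_singleton]
      rintro c (rfl | rfl | rfl) <;> intro h <;> linarith)
    refine step3 A B C hBA.symm hBC hAC hA hBs hC e (heM A hAM) (heM B hBM) (heM C hCM)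
      (fun c hc h1 h2 h3 => hpos c hc (by rw [hMeq]; simp [h1, h2, h3])) y₀ hy₀ z₁ hz₁ z₂ hz₂ z₁' hz₁'
      z₂' hz₂' ?_ ?_ ?_ ?_ ?_ hPA
    · rw [sy₀]; simp
    · rw [sz₁]
      rw [Finset.filter_insert, Finset.filter_insert, Finset.filter_singleton, if_neg, if_pos, if_pos]
        <;> linarith
    · rw [sz₂]
      rw [Finset.filter_insert, Finset.filter_insert, Finset.filter_singleton, if_neg, if_neg, if_pos]
        <;> linarith
    · rw [sz₁']
      rw [Finset.filter_insert, Finset.filter_insert, Finset.filter_singleton, if_pos, if_pos, if_neg]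
      · rfl
      all_goals linarith
    · rw [sz₂']
      rw [Finset.filter_insert, Finset.filter_insert, Finset.filter_singleton, if_pos, if_neg, if_neg]
      · rfl
      all_goals linarith
  · push Not at hB
    have hMeq : M = {A, C} := by
      ext D
      simp only [Finset.mem_insert, Finset.mem_singleton]
      constructor
      · intro hD
        by_cases h : D = A
        · exact Or.inl h
        · exact Or.inr (hB D hD h)
      · rintro (rfl | rfl) <;> assumption
    rw [hMeq] at sample
    obtain ⟨y₀, hy₀, sy₀⟩ := sample 0 1 (by simp)
    obtain ⟨z₁, hz₁, sz₁⟩ := sample 1 (-(σ A + σ C) / 2) (by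
      simp only [Finset.mem_insert, Finset.mem_singleton]
      rintro c (rfl | rfl) <;> intro h <;> linarith)
    obtain ⟨z₂, hz₂, sz₂⟩ := sample (-1) ((σ A + σ C) / 2) (by
      simp only [Finset.mem_insert, Finset.mem_singleton]
      rintro c (rfl | rfl) <;> intro h <;> linarith)
    refine step2 A C hAC hA hC y₀ hy₀ z₁ hz₁ z₂ hz₂ ?_ ?_ ?_ hPA
    · rw [sy₀]; simp
    · rw [sz₁]
      rw [Finset.filter_insert, Finset.filter_singleton, if_neg, if_pos] <;> linarith
    · rw [sz₂]
      rw [Finset.filter_insert, Finset.filter_singleton, if_pos, if_neg]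
      · rfl
      all_goals linarith

end Arrangement

section

/-! ### The arrangement of the type WF Hecke algebra -/

open Classical in
instance (n : ℕ) : DecidableEq (Crossing n) := inferInstance

/-- The coordinate of the strand `i`. -/
def coord {n : ℕ} (i : Fin n) : (Fin n → ℝ) →L[ℝ] ℝ := ContinuousLinearMap.proj i

@[simp]
theorem coord_apply {n : ℕ} (i : Fin n) (x : Fin n → ℝ) : coord i x = x i := rfl

/-- The linear part of the functional that vanishes where a crossing happens. -/
def crossingLin {n : ℕ} : Crossing n → (Fin n → ℝ) →L[ℝ] ℝ
  | .strands p => coord p.inf - coord p.sup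
  | .ghost i j => coord i - coord j
  | .red i _ => coord i

/-- The constant part of the functional that vanishes where a crossing happens. -/
def crossingConst (κ : ℝ) {n : ℕ} : Crossing n → ℝ
  | .strands _ => 0
  | .ghost _ _ => -κ
  | .red _ a => -a

/-- The objects that take part in a crossing, a red line being `none`. -/
def Crossing.supp {n : ℕ} : Crossing n → Sym2 (Option (Fin n))
  | .strands p => p.map some
  | .ghost i j => s(some i, some j)
  | .red i _ => s(some i, none)

open Classical in
/-- All possible crossings. -/
def wallSet {ℓ : ℕ} (n : ℕ) (ϑ : Fin ℓ → ℝ) : Finset (Crossing n) :=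
  ((Finset.univ.filter fun p : Sym2 (Fin n) => ¬ p.IsDiag).image Crossing.strands) ∪
  ((Finset.univ.filter fun p : Fin n × Fin n => p.1 ≠ p.2).image fun p => Crossing.ghost p.1 p.2) ∪
  ((Finset.univ : Finset (Fin n × Fin ℓ)).image fun p => Crossing.red p.1 (ϑ p.2))

variable {n ℓ : ℕ} {κ : ℝ} {ϑ : Fin ℓ → ℝ}

theorem mem_wallSet {c : Crossing n} : c ∈ wallSet n ϑ ↔
    (∃ i j, i ≠ j ∧ c = .strands s(i, j)) ∨ (∃ i j, i ≠ j ∧ c = .ghost i j) ∨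
      ∃ i t, c = .red i (ϑ t) := by
  classical
  simp only [wallSet, Finset.mem_union, Finset.mem_image, Finset.mem_filter, Finset.mem_univ,
    true_and, Prod.exists, or_assoc]
  constructor
  · rintro (⟨p, hp, rfl⟩ | ⟨i, j, h, rfl⟩ | ⟨i, t, rfl⟩)
    · induction p with
      | _ i j => exact Or.inl ⟨i, j, hp, rfl⟩
    · exact Or.inr (Or.inl ⟨i, j, h, rfl⟩)
    · exact Or.inr (Or.inr ⟨i, t, rfl⟩)
  · rintro (⟨i, j, h, rfl⟩ | ⟨i, j, h, rfl⟩ | ⟨i, t, rfl⟩)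
    · exact Or.inl ⟨_, by simpa using h, rfl⟩
    · exact Or.inr (Or.inl ⟨i, j, h, rfl⟩)
    · exact Or.inr (Or.inr ⟨i, t, rfl⟩)

theorem crossingLin_strands (i j : Fin n) :
    crossingLin (.strands s(i, j)) = coord i - coord j ∨
    crossingLin (.strands s(i, j)) = -(coord i - coord j) := by
  rcases le_total i j with h | h
  · left; simp [crossingLin, Sym2.inf_mk, Sym2.sup_mk, h]
  · right; simp [crossingLin, Sym2.inf_mk, Sym2.sup_mk, h]

/-- A vector that moves one object only. -/
def testVector : Option (Fin n) → Fin n → ℝ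
  | some i => Pi.single i 1
  | none => fun _ => 1

/-- Shifting a single strand, or all strands together in place of a red line, changes the functional
exactly when the shifted object takes part in the crossing. Linear relations between functionals
thereby become statements about supports. -/
theorem crossingLin_testVector_ne {c : Crossing n} (hc : c ∈ wallSet n ϑ) (v : Option (Fin n)) :
    crossingLin c (testVector v) ≠ 0 ↔ v ∈ c.supp := by
  rcases mem_wallSet.mp hc with ⟨i, j, h, rfl⟩ | ⟨i, j, h, rfl⟩ | ⟨i, t, rfl⟩
  · have : crossingLin (.strands s(i, j)) (testVector v) ≠ 0 ↔
        testVector v i - testVector v j ≠ 0 := by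
      rcases crossingLin_strands i j with h | h <;> rw [h] <;>
        simp only [neg_apply, sub_apply, coord_apply, ne_eq, neg_eq_zero]
    rw [this]
    cases v with
    | none => simp [testVector, Crossing.supp]
    | some k =>
      simp only [testVector, Crossing.supp, Sym2.map_mk, Sym2.mem_iff, Option.some.injEq, Pi.single_apply]
      by_cases h1 : i = k <;> by_cases h2 : j = k <;> simp_all [eq_comm]
  · cases v with
    | none => simp [testVector, crossingLin, Crossing.supp]
    | some k =>
      simp only [testVector, Crossing.supp, crossingLin, sub_apply,
        coord_apply, Sym2.mem_iff, Option.some.injEq, Pi.single_apply]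
      by_cases h1 : i = k <;> by_cases h2 : j = k <;> simp_all [eq_comm]
  · cases v with
    | none => simp [testVector, crossingLin, Crossing.supp]
    | some k =>
      simp only [testVector, Crossing.supp, crossingLin,
        coord_apply, Sym2.mem_iff, Option.some.injEq, Pi.single_apply]
      by_cases h1 : i = k <;> simp_all [eq_comm]

theorem supp_not_isDiag {c : Crossing n} (hc : c ∈ wallSet n ϑ) : ¬ c.supp.IsDiag := by
  rcases mem_wallSet.mp hc with ⟨i, j, h, rfl⟩ | ⟨i, j, h, rfl⟩ | ⟨i, t, rfl⟩ <;>
    simp_all [Crossing.supp]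

theorem crossing_ev_strands (i j : Fin n) (x : Fin n → ℝ) :
    crossingLin (.strands s(i, j)) x + crossingConst κ (.strands s(i, j)) = x i - x j ∨
    crossingLin (.strands s(i, j)) x + crossingConst κ (.strands s(i, j)) = -(x i - x j) := by
  rcases crossingLin_strands i j with h | h <;> rw [h] <;> simp [crossingConst]

/-- At a given point two objects meet in at most one way: as `κ ≠ 0`, the strands `i` and `j` cannot
meet while one of them also meets the ghost of the other, nor can each meet the ghost of the other.
The position of a red line, which the support forgets, is recovered from the strand that meets it.
-/
theorem supp_injective_of_vanish (hκ : κ ≠ 0) {A B : Crossing n} (hA : A ∈ wallSet n ϑ)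
    (hB : B ∈ wallSet n ϑ) {e : Fin n → ℝ} (hAe : crossingLin A e + crossingConst κ A = 0)
    (hBe : crossingLin B e + crossingConst κ B = 0) (h : A.supp = B.supp) : A = B := by
  have hs : ∀ i j, crossingLin (.strands s(i, j)) e + crossingConst κ (.strands s(i, j)) = 0 →
      e i = e j := fun i j h0 => by
    rcases crossing_ev_strands (κ := κ) i j e with h1 | h1 <;> rw [h1] at h0 <;> linarith
  rcases mem_wallSet.mp hA with ⟨i, j, hij, rfl⟩ | ⟨i, j, hij, rfl⟩ | ⟨i, t, rfl⟩ <;>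
    rcases mem_wallSet.mp hB with ⟨i', j', hij', rfl⟩ | ⟨i', j', hij', rfl⟩ | ⟨i', t', rfl⟩ <;>
    simp only [Crossing.supp, Sym2.map_mk, Sym2.eq_iff, Option.some.injEq, reduceCtorEq, and_false,
      false_and, or_false, and_true] at h
  · rcases h with ⟨rfl, rfl⟩ | ⟨rfl, rfl⟩
    · rfl
    · rw [Sym2.eq_swap]
  · exfalso
    have := hs _ _ hAe
    simp only [crossingLin, crossingConst, sub_apply, coord_apply] at hBe
    rcases h with ⟨rfl, rfl⟩ | ⟨rfl, rfl⟩ <;> exact hκ (by linarith)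
  · exfalso
    have := hs _ _ hBe
    simp only [crossingLin, crossingConst, sub_apply, coord_apply] at hAe
    rcases h with ⟨rfl, rfl⟩ | ⟨rfl, rfl⟩ <;> exact hκ (by linarith)
  · rcases h with ⟨rfl, rfl⟩ | ⟨rfl, rfl⟩
    · rfl
    · exfalso
      simp only [crossingLin, crossingConst, sub_apply, coord_apply] at hAe hBe
      exact hκ (by linarith)
  · subst h
    simp only [crossingLin, crossingConst, coord_apply] at hAe hBe
    have : ϑ t = ϑ t' := by linarith
    rw [this]

theorem generic_iff (x : Fin n → ℝ) : Generic κ ϑ x ↔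
    (∀ i j, i ≠ j → x i - x j ≠ 0) ∧ (∀ i j, x i - x j - κ ≠ 0) ∧ (∀ i t, x i - ϑ t ≠ 0) ∧
      ∀ i t, x i + (κ - ϑ t) ≠ 0 := by
  constructor
  · intro h
    refine ⟨fun i j hij h0 => hij (h.strand_strand (by linarith)),
      fun i j h0 => h.strand_ghost i j (by linarith), fun i t h0 => h.strand_red i t (by linarith),
      fun i t h0 => h.ghost_red i t (by linarith)⟩
  · rintro ⟨h1, h2, h3, h4⟩
    refine ⟨fun i j hij => ?_, fun i j h0 => h2 i j (by linarith), fun i t h0 => h3 i t (by linarith),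
      fun i t h0 => h4 i t (by linarith)⟩
    by_contra hne
    exact h1 i j hne (by linarith)

/-- Genericity also forbids meetings of ghosts with red lines, which are not walls. For this reason
an arrangement carries a dense set of generic points instead of using the whole complement of its
walls. -/
theorem dense_generic (hκ : κ ≠ 0) : Dense {x : Fin n → ℝ | Generic κ ϑ x} := by
  obtain ⟨o1, d1⟩ := dense_biInter_affine_ne
    ((Finset.univ : Finset (Fin n × Fin n)).filter fun p => p.1 ≠ p.2)
    (fun p => coord p.1 - coord p.2)
    (fun _ => 0) (by
      rintro ⟨i, j⟩ h
      simp only [Finset.mem_filter, Finset.mem_univ, true_and] at h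
      exact ⟨Pi.single i 1, by simp [h.symm]⟩)
  obtain ⟨o2, d2⟩ := dense_biInter_affine_ne (Finset.univ : Finset (Fin n × Fin n))
    (fun p => coord p.1 - coord p.2)
    (fun _ => -κ) (fun p _ => ⟨0, by simpa using hκ⟩)
  obtain ⟨o3, d3⟩ := dense_biInter_affine_ne (Finset.univ : Finset (Fin n × Fin ℓ))
    (fun p => coord p.1)
    (fun p => -ϑ p.2) (fun p _ => ⟨fun _ => ϑ p.2 + 1, by simp⟩)
  obtain ⟨o4, d4⟩ := dense_biInter_affine_ne (Finset.univ : Finset (Fin n × Fin ℓ))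
    (fun p => coord p.1)
    (fun p => κ - ϑ p.2) (fun p _ => ⟨fun _ => ϑ p.2 - κ + 1, by simp only [coord_apply]; ring_nf; norm_num⟩)
  have := (d1.inter_of_isOpen_left (d2.inter_of_isOpen_left (d3.inter_of_isOpen_left d4 o3) o2) o1)
  refine this.mono ?_
  rintro x ⟨h1, h2, h3, h4⟩
  refine (generic_iff x).mpr ⟨fun i j hij => ?_, fun i j => ?_, fun i t => ?_, fun i t => ?_⟩
  · simpa using h1 (i, j) (by simp [hij])
  · exact h2 (i, j) (by simp)
  · exact h3 (i, t) (by simp)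
  · exact h4 (i, t) (by simp)

theorem Sym2.exists_mem_not_mem {α : Type*} {p r : Sym2 α} (hp : ¬ p.IsDiag) (h : p ≠ r) :
    ∃ a ∈ p, a ∉ r := by
  induction p with
  | _ a b =>
    by_contra! hcon
    exact h ((Sym2.mem_and_mem_iff hp).mp ⟨hcon a (by simp), hcon b (by simp)⟩).symm

theorem exists_vanish {A : Crossing n} (hA : A ∈ wallSet n ϑ) :
    ∃ p, crossingLin A p + crossingConst κ A = 0 := by
  rcases mem_wallSet.mp hA with ⟨i, j, h, rfl⟩ | ⟨i, j, h, rfl⟩ | ⟨i, t, rfl⟩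
  · exact ⟨0, by simp [crossingConst]⟩
  · exact ⟨Pi.single i κ, by simp [crossingConst, crossingLin, h]⟩
  · exact ⟨fun _ => ϑ t, by simp [crossingConst, crossingLin]⟩

/-- The arrangement of all crossings of `n` strands. -/
def arr (n : ℕ) {ℓ : ℕ} {κ : ℝ} (hκ : κ ≠ 0) (ϑ : Fin ℓ → ℝ) :
    Arrangement (Crossing n) (Fin n → ℝ) where
  walls := wallSet n ϑ
  lin := crossingLin
  const := crossingConst κ
  gen := {x | Generic κ ϑ x}
  dense_gen := dense_generic hκ
  gen_ne := by
    intro x hx c hc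
    obtain ⟨h1, h2, h3, -⟩ := (generic_iff x).mp hx
    rcases mem_wallSet.mp hc with ⟨i, j, h, rfl⟩ | ⟨i, j, h, rfl⟩ | ⟨i, t, rfl⟩
    · rcases crossing_ev_strands (κ := κ) i j x with h0 | h0 <;> rw [h0]
      · exact h1 i j h
      · exact neg_ne_zero.mpr (h1 i j h)
    · exact h2 i j
    · exact h3 i t
  indep := by
    intro A hA B hB hAB
    obtain ⟨p, hp⟩ := exists_vanish (κ := κ) hA
    -- If both functionals vanish at `p`, the supports differ, and shifting an object of `B` that
    -- does not occur in `A` moves `p` off `B` inside `A`.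
    by_cases hpB : crossingLin B p + crossingConst κ B = 0
    · have hs : B.supp ≠ A.supp := fun h => hAB (supp_injective_of_vanish hκ hA hB hp hpB h.symm)
      obtain ⟨v, hvB, hvA⟩ := Sym2.exists_mem_not_mem (supp_not_isDiag hB) hs
      have h1 := (crossingLin_testVector_ne hB v).mpr hvB
      have h2 := (not_iff_not.mpr (crossingLin_testVector_ne hA v)).mpr hvA
      rw [not_ne_iff] at h2
      refine ⟨p + testVector v, ?_, ?_⟩
      · rw [map_add, h2]; linarith
      · rw [map_add]
        intro h
        exact h1 (by linarith)
    · exact ⟨p, hp, hpB⟩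
  pencil := by
    intro e A hA B hB C hC D hD hAB hCD hAe hBe hCe hDe a₁ a₂ a₃ b₁ b₂ b₃ ha₁ ha₂ ha₃ hb₁ hb₂ hb₃ h h'
    have hs : A.supp ≠ B.supp := fun h0 => hAB (supp_injective_of_vanish hκ hA hB hAe hBe h0)
    obtain ⟨a, haA, haB⟩ := Sym2.exists_mem_not_mem (supp_not_isDiag hA) hs
    obtain ⟨b, hbB, hbA⟩ := Sym2.exists_mem_not_mem (supp_not_isDiag hB) hs.symm
    have hab : a ≠ b := fun h0 => hbA (h0 ▸ haA)
    -- An object in exactly one of `A` and `B` must also occur in the third wall of a dependency,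
    -- since no other term could cancel it. This fixes the support of the third wall, so `C` and `D`
    -- have the same support and both contain `e`.
    have key : ∀ E ∈ wallSet n ϑ, ∀ c₁ c₂ c₃ : ℝ, c₁ ≠ 0 → c₂ ≠ 0 → c₃ ≠ 0 →
        (∀ v, c₁ * crossingLin A v + c₂ * crossingLin B v + c₃ * crossingLin E v = 0) →
        E.supp = s(a, b) := by
      intro E hE c₁ c₂ c₃ hc₁ hc₂ hc₃ h0
      have h2 := (not_iff_not.mpr (crossingLin_testVector_ne hB a)).mpr haB
      have h3 := (not_iff_not.mpr (crossingLin_testVector_ne hA b)).mpr hbA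
      rw [not_ne_iff] at h2 h3
      refine (Sym2.mem_and_mem_iff hab).mp ⟨?_, ?_⟩
      · rw [← crossingLin_testVector_ne hE]
        intro h1
        have := h0 (testVector a)
        rw [h1, h2] at this
        exact mul_ne_zero hc₁ ((crossingLin_testVector_ne hA a).mpr haA) (by linarith)
      · rw [← crossingLin_testVector_ne hE]
        intro h1
        have := h0 (testVector b)
        rw [h1, h3] at this
        exact mul_ne_zero hc₂ ((crossingLin_testVector_ne hB b).mpr hbB) (by linarith)
    exact hCD (supp_injective_of_vanish hκ hC hD hCe hDe
      ((key C hC _ _ _ ha₁ ha₂ ha₃ h).trans (key D hD _ _ _ hb₁ hb₂ hb₃ h').symm))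

/-! ### Crossings of slices -/

theorem strands_mem_crossings {x y : Fin n → ℝ} {i j : Fin n} :
    Crossing.strands s(i, j) ∈ crossings κ ϑ x y ↔ (x i - x j) * (y i - y j) < 0 := by
  have key : ∀ p, Crosses κ ϑ x y (.strands p) → ∀ i j, p = s(i, j) → (x i - x j) * (y i - y j) < 0 := by
    intro p hp i j hij
    cases hp with
    | strands h h' =>
      rcases Sym2.eq_iff.mp hij with ⟨rfl, rfl⟩ | ⟨rfl, rfl⟩ <;> nlinarith
  constructor
  · exact fun h => key _ h i j rfl
  · intro h
    rcases mul_neg_iff.mp h with ⟨h1, h2⟩ | ⟨h1, h2⟩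
    · show Crosses κ ϑ x y _
      rw [Sym2.eq_swap]
      exact .strands (by linarith) (by linarith)
    · exact .strands (by linarith) (by linarith)

theorem ghost_mem_crossings {x y : Fin n → ℝ} {i j : Fin n} :
    Crossing.ghost i j ∈ crossings κ ϑ x y ↔ (x i - (x j + κ)) * (y i - (y j + κ)) < 0 :=
  ⟨fun h => by cases h; assumption, fun h => .ghost h⟩

theorem red_mem_crossings {x y : Fin n → ℝ} {i : Fin n} {a : ℝ} :
    Crossing.red i a ∈ crossings κ ϑ x y ↔ (∃ t, ϑ t = a) ∧ (x i - a) * (y i - a) < 0 :=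
  ⟨fun h => by cases h with | red h => exact ⟨⟨_, rfl⟩, h⟩, fun ⟨⟨t, ht⟩, h⟩ => ht ▸ .red (ht ▸ h)⟩

theorem ne_of_strands_mem {x y : Fin n → ℝ} {i j : Fin n}
    (h : Crossing.strands s(i, j) ∈ crossings κ ϑ x y) : i ≠ j := by
  rintro rfl
  have := strands_mem_crossings.mp h
  simp at this

theorem ne_of_ghost_mem {x y : Fin n → ℝ} {i j : Fin n}
    (h : Crossing.ghost i j ∈ crossings κ ϑ x y) : i ≠ j := by
  rintro rfl
  have := ghost_mem_crossings.mp h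
  nlinarith [mul_self_nonneg κ]

/-- The bridge between diagrams and geometry: a crossing occurs in the straight-line diagram from
`x` to `y` exactly when its functional changes sign. -/
theorem coe_sep (hκ : κ ≠ 0) (x y : Fin n → ℝ) :
    ((arr n hκ ϑ).sep x y : Set (Crossing n)) = crossings κ ϑ x y := by
  have hs : ∀ i j, (arr n hκ ϑ).ev (.strands s(i, j)) x * (arr n hκ ϑ).ev (.strands s(i, j)) y =
      (x i - x j) * (y i - y j) := by
    intro i j
    rcases le_total i j with h | h <;>
      simp [Arrangement.ev, arr, crossingLin, crossingConst, Sym2.inf_mk, Sym2.sup_mk, h]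
    ring
  ext c
  rw [Finset.mem_coe, Arrangement.mem_sep]
  show c ∈ wallSet n ϑ ∧ _ ↔ _
  cases c with
  | strands p =>
    induction p with
    | _ i j =>
      rw [strands_mem_crossings, hs, mem_wallSet]
      refine ⟨fun h => h.2, fun h => ⟨Or.inl ⟨i, j, ?_, rfl⟩, h⟩⟩
      rintro rfl
      simp at h
  | ghost i j =>
    have : ∀ x, (arr n hκ ϑ).ev (.ghost i j) x = x i - (x j + κ) := by
      intro x; simp [Arrangement.ev, arr, crossingLin, crossingConst]; ring
    rw [this, this]
    refine ⟨fun h => ghost_mem_crossings.mpr h.2, fun h => ⟨mem_wallSet.mpr (Or.inr (Or.inl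
      ⟨i, j, ne_of_ghost_mem h, rfl⟩)), ghost_mem_crossings.mp h⟩⟩
  | red i a =>
    have : ∀ x, (arr n hκ ϑ).ev (.red i a) x = x i - a := by
      intro x; simp [Arrangement.ev, arr, crossingLin, crossingConst]; ring
    rw [this, this, red_mem_crossings, mem_wallSet]
    constructor
    · rintro ⟨h1 | h1 | ⟨i', t, h1⟩, h2⟩
      · obtain ⟨_, _, _, h1⟩ := h1; cases h1
      · obtain ⟨_, _, _, h1⟩ := h1; cases h1
      · cases h1; exact ⟨⟨t, rfl⟩, h2⟩
    · rintro ⟨⟨t, rfl⟩, h2⟩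
      exact ⟨Or.inr (Or.inr ⟨i, t, rfl⟩), h2⟩

theorem crossings_comm (x y : Fin n → ℝ) : crossings κ ϑ x y = crossings κ ϑ y x := by
  ext c
  cases c with
  | strands p => induction p with | _ i j => rw [strands_mem_crossings, strands_mem_crossings, mul_comm]
  | ghost i j => rw [ghost_mem_crossings, ghost_mem_crossings, mul_comm]
  | red i a => rw [red_mem_crossings, red_mem_crossings, mul_comm]

/-- Relabelling of crossings. -/
def Crossing.map (σ : Equiv.Perm (Fin n)) : Crossing n → Crossing n
  | .strands p => .strands (p.map σ)
  | .ghost i j => .ghost (σ i) (σ j)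
  | .red i a => .red (σ i) a

theorem Crossing.map_injective (σ : Equiv.Perm (Fin n)) :
    Function.Injective (Crossing.map (n := n) σ) := by
  intro c d h
  cases c <;> cases d <;> simp only [Crossing.map, Crossing.strands.injEq, Crossing.ghost.injEq,
    Crossing.red.injEq, reduceCtorEq, EmbeddingLike.apply_eq_iff_eq] at h ⊢
  · exact Sym2.map.injective σ.injective h
  · exact h
  · exact h

theorem mem_crossings_comp {x y : Fin n → ℝ} (σ : Equiv.Perm (Fin n)) {c : Crossing n} :
    c ∈ crossings κ ϑ (x ∘ σ) (y ∘ σ) ↔ c.map σ ∈ crossings κ ϑ x y := by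
  cases c with
  | strands p =>
    induction p with | _ i j =>
    rw [strands_mem_crossings]
    simp only [Crossing.map, Sym2.map_mk, strands_mem_crossings, Function.comp_apply]
  | ghost i j => rw [ghost_mem_crossings]; simp only [Crossing.map, ghost_mem_crossings, Function.comp_apply]
  | red i a => rw [red_mem_crossings]; simp only [Crossing.map, red_mem_crossings, Function.comp_apply]

theorem Generic.comp {x : Fin n → ℝ} (h : Generic κ ϑ x) (σ : Equiv.Perm (Fin n)) :
    Generic κ ϑ (x ∘ σ) :=
  ⟨h.strand_strand.comp σ.injective, fun _ _ => h.strand_ghost _ _, fun _ t => h.strand_red _ t,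
    fun _ t => h.ghost_red _ t⟩

theorem IsSlice.comp {x y : Fin n → ℝ} (h : IsSlice κ ϑ x y) (σ : Equiv.Perm (Fin n)) :
    IsSlice κ ϑ (x ∘ σ) (y ∘ σ) :=
  ⟨h.bottom.comp σ, h.top.comp σ, fun _ hc _ hd => Crossing.map_injective σ
    (h.at_most_one ((mem_crossings_comp σ).mp hc) ((mem_crossings_comp σ).mp hd))⟩

theorem IsSlice.symm {x y : Fin n → ℝ} (h : IsSlice κ ϑ x y) : IsSlice κ ϑ y x :=
  ⟨h.top, h.bottom, crossings_comm (κ := κ) (ϑ := ϑ) x y ▸ h.at_most_one⟩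

theorem crossings_comp_eq_empty {x y : Fin n → ℝ} (σ : Equiv.Perm (Fin n))
    (h : crossings κ ϑ x y = ∅) : crossings κ ϑ (x ∘ σ) (y ∘ σ) = ∅ := by
  ext c; rw [mem_crossings_comp, h]; simp

theorem crossings_comp_eq_singleton {x y : Fin n → ℝ} (σ : Equiv.Perm (Fin n)) {c : Crossing n}
    (h : crossings κ ϑ x y = {c.map σ}) : crossings κ ϑ (x ∘ σ) (y ∘ σ) = {c} := by
  ext d
  rw [mem_crossings_comp, h, Set.mem_singleton_iff, Set.mem_singleton_iff,
    (Crossing.map_injective σ).eq_iff]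

end

section

/-! ### Elementary computations with diagrams -/

variable {R : Type*} [CommRing R] {n ℓ : ℕ} {κ : ℝ} {ϑ : Fin ℓ → ℝ} {q : R} {Q : Fin ℓ → R}

/-- A slice, as an element of the affine algebra. -/
def sl (q : R) (Q : Fin ℓ → R) {x y : Fin n → ℝ} (h : IsSlice κ ϑ x y) : AffineWF κ ϑ q Q n :=
  RingQuot.mkAlgHom R (Rel κ ϑ q Q n) (slice R h)

/-- Squares on a strand, as an element of the affine algebra. -/
def sq (q : R) (Q : Fin ℓ → R) {x : Fin n → ℝ} (h : Generic κ ϑ x) (i : Fin n) (a : ℤ) :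
    AffineWF κ ϑ q Q n :=
  RingQuot.mkAlgHom R (Rel κ ϑ q Q n) (square R h i a)

theorem affineIdem_eq_sl {x : Fin n → ℝ} (h : Generic κ ϑ x) :
    affineIdem q Q h = sl q Q h.isSlice := rfl

theorem sl_comp {x y : Fin n → ℝ} (σ : Equiv.Perm (Fin n)) (h : IsSlice κ ϑ x y) :
    sl q Q (h.comp σ) = sl q Q h :=
  RingQuot.mkAlgHom_rel R (Rel.relabel σ h _)

theorem sq_comp {x : Fin n → ℝ} (σ : Equiv.Perm (Fin n)) (h : Generic κ ϑ x) (i : Fin n) (a : ℤ) :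
    sq q Q (h.comp σ) i a = sq q Q h (σ i) a :=
  RingQuot.mkAlgHom_rel R (Rel.relabel_square σ h _ i a)

theorem sl_mul_sl_of_ne {x y y' z : Fin n → ℝ} (h : IsSlice κ ϑ x y) (h' : IsSlice κ ϑ y' z)
    (hne : Set.range y ≠ Set.range y') : sl q Q h' * sl q Q h = 0 := by
  have := RingQuot.mkAlgHom_rel R (Rel.mismatch (q := q) (Q := Q) h h' hne)
  rwa [map_mul, map_zero] at this

theorem sl_mul_sl {x y z : Fin n → ℝ} (hxy : IsSlice κ ϑ x y) (hyz : IsSlice κ ϑ y z)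
    (hxz : IsSlice κ ϑ x z) (hc : crossings κ ϑ x y = ∅ ∨ crossings κ ϑ y z = ∅) :
    sl q Q hyz * sl q Q hxy = sl q Q hxz := by
  have := RingQuot.mkAlgHom_rel R (Rel.straighten (q := q) (Q := Q) hxy hyz hxz hc)
  rwa [map_mul] at this

theorem sl_top_mul {x y : Fin n → ℝ} (h : IsSlice κ ϑ x y) :
    affineIdem q Q h.top * sl q Q h = sl q Q h :=
  sl_mul_sl h h.top.isSlice h (Or.inr (crossings_self κ ϑ y))

theorem sl_mul_bottom {x y : Fin n → ℝ} (h : IsSlice κ ϑ x y) :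
    sl q Q h * affineIdem q Q h.bottom = sl q Q h :=
  sl_mul_sl h.bottom.isSlice h h (Or.inl (crossings_self κ ϑ x))

theorem affineIdem_mul_self {x : Fin n → ℝ} (h : Generic κ ϑ x) :
    affineIdem q Q h * affineIdem q Q h = affineIdem q Q h :=
  sl_top_mul h.isSlice

theorem affineIdem_comp {x : Fin n → ℝ} (h : Generic κ ϑ x) (σ : Equiv.Perm (Fin n)) :
    affineIdem q Q (h.comp σ) = affineIdem q Q h :=
  sl_comp σ h.isSlice

theorem sq_zero {x : Fin n → ℝ} (h : Generic κ ϑ x) (i : Fin n) :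
    sq q Q h i 0 = affineIdem q Q h :=
  RingQuot.mkAlgHom_rel R (Rel.square_zero h i)

theorem sq_mul_sq {x : Fin n → ℝ} (h : Generic κ ϑ x) (i : Fin n) (a b : ℤ) :
    sq q Q h i a * sq q Q h i b = sq q Q h i (a + b) := by
  have := RingQuot.mkAlgHom_rel R (Rel.square_add (q := q) (Q := Q) h i a b)
  rwa [map_mul] at this

theorem sq_comm {x : Fin n → ℝ} (h : Generic κ ϑ x) (i j : Fin n) (a b : ℤ) :
    sq q Q h i a * sq q Q h j b = sq q Q h j b * sq q Q h i a := by
  have := RingQuot.mkAlgHom_rel R (Rel.square_comm (q := q) (Q := Q) h i j a b)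
  rwa [map_mul, map_mul] at this

theorem idem_mul_sq {x : Fin n → ℝ} (h : Generic κ ϑ x) (i : Fin n) (a : ℤ) :
    affineIdem q Q h * sq q Q h i a = sq q Q h i a := by
  rw [← sq_zero h i, sq_mul_sq, zero_add]

theorem sq_mul_idem {x : Fin n → ℝ} (h : Generic κ ϑ x) (i : Fin n) (a : ℤ) :
    sq q Q h i a * affineIdem q Q h = sq q Q h i a := by
  rw [← sq_zero h i, sq_mul_sq, add_zero]

theorem sq_slide {x y : Fin n → ℝ} (h : IsSlice κ ϑ x y) (i : Fin n) (a : ℤ)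
    (hc : ∀ j, Crossing.strands s(i, j) ∉ crossings κ ϑ x y) :
    sq q Q h.top i a * sl q Q h = sl q Q h * sq q Q h.bottom i a := by
  have := RingQuot.mkAlgHom_rel R (Rel.square_slide (q := q) (Q := Q) h i a hc)
  rwa [map_mul, map_mul] at this

/-! ### Galleries -/

theorem crossings_eq (hκ : κ ≠ 0) (x y : Fin n → ℝ) :
    crossings κ ϑ x y = ((arr n hκ ϑ).sep x y : Set (Crossing n)) := (coe_sep hκ x y).symm

theorem crossings_eq_empty_iff (hκ : κ ≠ 0) {x y : Fin n → ℝ} :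
    crossings κ ϑ x y = ∅ ↔ (arr n hκ ϑ).sep x y = ∅ := by
  rw [crossings_eq hκ]; exact Finset.coe_eq_empty

theorem crossings_eq_singleton_iff (hκ : κ ≠ 0) {x y : Fin n → ℝ} {c : Crossing n} :
    crossings κ ϑ x y = {c} ↔ (arr n hκ ϑ).sep x y = {c} := by
  rw [crossings_eq hκ]; exact Finset.coe_eq_singleton

theorem isSlice_of_empty {x y : Fin n → ℝ} (hx : Generic κ ϑ x) (hy : Generic κ ϑ y)
    (h : crossings κ ϑ x y = ∅) : IsSlice κ ϑ x y :=
  ⟨hx, hy, by rw [h]; exact Set.subsingleton_empty⟩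

theorem isSlice_of_singleton {x y : Fin n → ℝ} (hx : Generic κ ϑ x) (hy : Generic κ ϑ y)
    {c : Crossing n} (h : crossings κ ϑ x y = {c}) : IsSlice κ ϑ x y :=
  ⟨hx, hy, by rw [h]; exact Set.subsingleton_singleton⟩

theorem mem_crossings_iff_not {x y z : Fin n → ℝ} (hx : Generic κ ϑ x) (hy : Generic κ ϑ y)
    (hz : Generic κ ϑ z) {c : Crossing n} (hκ : κ ≠ 0) : c ∈ crossings κ ϑ x z ↔
      (c ∈ crossings κ ϑ x y ∧ c ∉ crossings κ ϑ y z) ∨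
      (c ∈ crossings κ ϑ y z ∧ c ∉ crossings κ ϑ x y) := by
  rw [crossings_eq hκ, crossings_eq hκ, crossings_eq hκ, Finset.mem_coe, Finset.mem_coe,
    Finset.mem_coe,
    Arrangement.sep_symmDiff (𝒜 := arr n hκ ϑ) (y := y) (show x ∈ (arr n hκ ϑ).gen from hx) hy hz,
    Finset.mem_symmDiff]

theorem crossings_eq_of_empty_left (hκ : κ ≠ 0) {x y z : Fin n → ℝ} (hx : Generic κ ϑ x)
    (hy : Generic κ ϑ y) (hz : Generic κ ϑ z) (h : crossings κ ϑ x y = ∅) :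
    crossings κ ϑ x z = crossings κ ϑ y z := by
  ext c; rw [mem_crossings_iff_not hx hy hz hκ, h]; simp

theorem crossings_eq_of_empty_right (hκ : κ ≠ 0) {x y z : Fin n → ℝ} (hx : Generic κ ϑ x)
    (hy : Generic κ ϑ y) (hz : Generic κ ϑ z) (h : crossings κ ϑ y z = ∅) :
    crossings κ ϑ x z = crossings κ ϑ x y := by
  ext c; rw [mem_crossings_iff_not hx hy hz hκ, h]; simp

/-- Galleries with `N` crossings that start at `x₀`: stacks of slices. -/
inductive Gal (q : R) (Q : Fin ℓ → R) {x₀ : Fin n → ℝ} (h₀ : Generic κ ϑ x₀) :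
    ℕ → (Fin n → ℝ) → AffineWF κ ϑ q Q n → Prop
  | nil : Gal q Q h₀ 0 x₀ (affineIdem q Q h₀)
  | free {N : ℕ} {y z : Fin n → ℝ} {a : AffineWF κ ϑ q Q n} (h : IsSlice κ ϑ y z)
      (hc : crossings κ ϑ y z = ∅) (ha : Gal q Q h₀ N y a) : Gal q Q h₀ N z (sl q Q h * a)
  | cross {N : ℕ} {y z : Fin n → ℝ} {a : AffineWF κ ϑ q Q n} {c : Crossing n}
      (h : IsSlice κ ϑ y z) (hc : crossings κ ϑ y z = {c}) (ha : Gal q Q h₀ N y a) :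
      Gal q Q h₀ (N + 1) z (sl q Q h * a)

/-- Diagrams with `N` crossings that start at `x₀`: stacks of slices and squares. -/
inductive Diag (q : R) (Q : Fin ℓ → R) {x₀ : Fin n → ℝ} (h₀ : Generic κ ϑ x₀) :
    ℕ → (Fin n → ℝ) → AffineWF κ ϑ q Q n → Prop
  | nil : Diag q Q h₀ 0 x₀ (affineIdem q Q h₀)
  | free {N : ℕ} {y z : Fin n → ℝ} {a : AffineWF κ ϑ q Q n} (h : IsSlice κ ϑ y z)
      (hc : crossings κ ϑ y z = ∅) (ha : Diag q Q h₀ N y a) : Diag q Q h₀ N z (sl q Q h * a)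
  | cross {N : ℕ} {y z : Fin n → ℝ} {a : AffineWF κ ϑ q Q n} {c : Crossing n}
      (h : IsSlice κ ϑ y z) (hc : crossings κ ϑ y z = {c}) (ha : Diag q Q h₀ N y a) :
      Diag q Q h₀ (N + 1) z (sl q Q h * a)
  | square {N : ℕ} {y : Fin n → ℝ} {a : AffineWF κ ϑ q Q n} (h : Generic κ ϑ y) (i : Fin n) (m : ℤ)
      (ha : Diag q Q h₀ N y a) : Diag q Q h₀ N y (sq q Q h i m * a)
  | relabel {N : ℕ} {y : Fin n → ℝ} {a : AffineWF κ ϑ q Q n} (σ : Equiv.Perm (Fin n))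
      (ha : Diag q Q h₀ N y a) : Diag q Q h₀ N (y ∘ σ) a

section

variable {x₀ : Fin n → ℝ} {h₀ : Generic κ ϑ x₀}

theorem Gal.diag {N : ℕ} {y : Fin n → ℝ} {a : AffineWF κ ϑ q Q n} (h : Gal q Q h₀ N y a) :
    Diag q Q h₀ N y a := by
  induction h with
  | nil => exact .nil
  | free h hc _ ih => exact .free h hc ih
  | cross h hc _ ih => exact .cross h hc ih

theorem Diag.generic {N : ℕ} {y : Fin n → ℝ} {a : AffineWF κ ϑ q Q n} (h : Diag q Q h₀ N y a) :
    Generic κ ϑ y := by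
  induction h with
  | nil => exact h₀
  | free h => exact h.top
  | cross h => exact h.top
  | square h => exact h
  | relabel σ _ ih => exact ih.comp σ

theorem Diag.idem_mul {N : ℕ} {y : Fin n → ℝ} {a : AffineWF κ ϑ q Q n} (h : Diag q Q h₀ N y a)
    (hy : Generic κ ϑ y) : affineIdem q Q hy * a = a := by
  induction h with
  | nil => exact affineIdem_mul_self h₀
  | free h => rw [← mul_assoc]; congr 1; exact sl_top_mul h
  | cross h => rw [← mul_assoc]; congr 1; exact sl_top_mul h
  | square h => rw [← mul_assoc]; congr 1; exact idem_mul_sq h _ _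
  | relabel σ h ih => rw [affineIdem_comp h.generic σ]; exact ih _

variable (q Q h₀) in
/-- The span of the diagrams with less than `N` crossings. -/
def Low (N : ℕ) (y : Fin n → ℝ) : Submodule R (AffineWF κ ϑ q Q n) :=
  Submodule.span R {a | ∃ M < N, Diag q Q h₀ M y a}

theorem Diag.mem_low {M N : ℕ} {y : Fin n → ℝ} {a : AffineWF κ ϑ q Q n} (h : Diag q Q h₀ M y a)
    (hMN : M < N) : a ∈ Low q Q h₀ N y :=
  Submodule.subset_span ⟨M, hMN, h⟩

theorem mul_mem_span {S : Set (AffineWF κ ϑ q Q n)} {W : Submodule R (AffineWF κ ϑ q Q n)}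
    {b : AffineWF κ ϑ q Q n} (h : ∀ a ∈ S, b * a ∈ W) {a : AffineWF κ ϑ q Q n}
    (ha : a ∈ Submodule.span R S) : b * a ∈ W := by
  induction ha using Submodule.span_induction with
  | mem a ha => exact h a ha
  | zero => rw [mul_zero]; exact W.zero_mem
  | add a b _ _ h1 h2 => rw [mul_add]; exact W.add_mem h1 h2
  | smul r a _ h1 => rw [mul_smul_comm]; exact W.smul_mem r h1

theorem low_free {N : ℕ} {y z : Fin n → ℝ} (h : IsSlice κ ϑ y z) (hc : crossings κ ϑ y z = ∅)
    {a : AffineWF κ ϑ q Q n} (ha : a ∈ Low q Q h₀ N y) : sl q Q h * a ∈ Low q Q h₀ N z :=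
  mul_mem_span (by rintro a ⟨M, hM, h1⟩; exact (h1.free h hc).mem_low hM) ha

theorem low_cross {N : ℕ} {y z : Fin n → ℝ} {c : Crossing n} (h : IsSlice κ ϑ y z)
    (hc : crossings κ ϑ y z = {c}) {a : AffineWF κ ϑ q Q n} (ha : a ∈ Low q Q h₀ N y) :
    sl q Q h * a ∈ Low q Q h₀ (N + 1) z :=
  mul_mem_span (by rintro a ⟨M, hM, h1⟩; exact (h1.cross h hc).mem_low (by omega)) ha

theorem low_sq {N : ℕ} {y : Fin n → ℝ} (h : Generic κ ϑ y) (i : Fin n) (m : ℤ)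
    {a : AffineWF κ ϑ q Q n} (ha : a ∈ Low q Q h₀ N y) : sq q Q h i m * a ∈ Low q Q h₀ N y :=
  mul_mem_span (by rintro a ⟨M, hM, h1⟩; exact (h1.square h i m).mem_low hM) ha

theorem low_comp {N : ℕ} (y : Fin n → ℝ) (σ : Equiv.Perm (Fin n)) :
    Low q Q h₀ N (y ∘ σ) = Low q Q h₀ N y := by
  refine le_antisymm (Submodule.span_mono ?_) (Submodule.span_mono ?_)
  · rintro a ⟨M, hM, h⟩
    refine ⟨M, hM, ?_⟩
    have := h.relabel σ⁻¹
    rwa [Function.comp_assoc, ← Equiv.Perm.coe_mul, mul_inv_cancel, Equiv.Perm.coe_one,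
      Function.comp_id] at this
  · rintro a ⟨M, hM, h⟩
    exact ⟨M, hM, h.relabel σ⟩

theorem Gal.zero {y : Fin n → ℝ} {a : AffineWF κ ϑ q Q n} (hκ : κ ≠ 0) {N : ℕ}
    (h : Gal q Q h₀ N y a) (hN : N = 0) : ∃ h' : IsSlice κ ϑ x₀ y, crossings κ ϑ x₀ y = ∅ ∧ a = sl q Q h' := by
  induction h with
  | nil => exact ⟨h₀.isSlice, crossings_self _ _ _, rfl⟩
  | @free N y z a h hc ha ih =>
    obtain ⟨h', hc', rfl⟩ := ih hN
    have hc'' : crossings κ ϑ x₀ z = ∅ := by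
      rw [crossings_eq_of_empty_left hκ h'.bottom h'.top h.top hc', hc]
    exact ⟨isSlice_of_empty h'.bottom h.top hc'', hc'', sl_mul_sl h' h _ (Or.inr hc)⟩
  | cross => omega

/-- Crossing-free slices above the last crossing are absorbed into it. -/
theorem Gal.succ {y : Fin n → ℝ} {a : AffineWF κ ϑ q Q n} (hκ : κ ≠ 0) {N M : ℕ}
    (h : Gal q Q h₀ M y a) (hM : M = N + 1) : ∃ (z : Fin n → ℝ) (c : Crossing n) (h' : IsSlice κ ϑ z y)
      (b : AffineWF κ ϑ q Q n), crossings κ ϑ z y = {c} ∧ Gal q Q h₀ N z b ∧ a = sl q Q h' * b := by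
  induction h with
  | nil => omega
  | @free _ y y' a h hc ha ih =>
    obtain ⟨z, c, h', b, hc', hb, rfl⟩ := ih hM
    have hc'' : crossings κ ϑ z y' = {c} := by
      rw [crossings_eq_of_empty_right hκ h'.bottom h'.top h.top hc, hc']
    refine ⟨z, c, isSlice_of_singleton h'.bottom h.top hc'', b, hc'', hb, ?_⟩
    rw [← mul_assoc, sl_mul_sl h' h _ (Or.inr hc)]
  | @cross N' y y' a c h hc ha ih =>
    obtain rfl : N' = N := by omega
    exact ⟨y, c, h, a, hc, ha, rfl⟩

/-- A facet of the chamber of `y` that separates it from `x₀` serves as the last crossing, and the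
chamber behind it is one wall closer to `x₀`. -/
theorem exists_gal (hκ : κ ≠ 0) (N : ℕ) : ∀ y, Generic κ ϑ y → ((arr n hκ ϑ).sep x₀ y).card = N →
    ∃ g, Gal q Q h₀ N y g := by
  induction N with
  | zero =>
    intro y hy hN
    have hc : crossings κ ϑ x₀ y = ∅ := (crossings_eq_empty_iff hκ).mpr (Finset.card_eq_zero.mp hN)
    exact ⟨_, .free (isSlice_of_empty h₀ hy hc) hc .nil⟩
  | succ N ih =>
    intro y hy hN
    obtain ⟨H, hH, z, hz, hzy⟩ := Arrangement.exists_facet (𝒜 := arr n hκ ϑ)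
      (show x₀ ∈ (arr n hκ ϑ).gen from h₀) (show y ∈ (arr n hκ ϑ).gen from hy)
      (Finset.card_pos.mp (by omega))
    have h1 : (arr n hκ ϑ).sep x₀ z = ((arr n hκ ϑ).sep x₀ y).erase H := by
      rw [Arrangement.sep_symmDiff (y := y) (show x₀ ∈ (arr n hκ ϑ).gen from h₀)
        (show y ∈ (arr n hκ ϑ).gen from hy) hz, Arrangement.sep_comm y z, hzy]
      ext c
      simp only [Finset.mem_symmDiff, Finset.mem_singleton, Finset.mem_erase]
      constructor
      · rintro (h | ⟨rfl, h⟩)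
        · exact ⟨h.2, h.1⟩
        · exact absurd hH h
      · exact fun h => Or.inl ⟨h.2, h.1⟩
    obtain ⟨g, hg⟩ := ih z hz (by rw [h1, Finset.card_erase_of_mem hH, hN]; rfl)
    have hc := (crossings_eq_singleton_iff hκ).mpr hzy
    exact ⟨_, hg.cross (isSlice_of_singleton hz hy hc) hc⟩

/-- Each crossing changes the set of separating walls by one element. -/
theorem Gal.card_le (hκ : κ ≠ 0) {N : ℕ} {y : Fin n → ℝ} {a : AffineWF κ ϑ q Q n}
    (h : Gal q Q h₀ N y a) : ((arr n hκ ϑ).sep x₀ y).card ≤ N := by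
  induction h with
  | nil => simp [Arrangement.sep_self]
  | @free N y z a h hc ha ih =>
    have := crossings_eq_of_empty_right hκ h₀ h.bottom h.top hc
    rw [crossings_eq hκ, crossings_eq hκ, Finset.coe_inj] at this
    rwa [this]
  | @cross N y z a c h hc ha ih =>
    rw [Arrangement.sep_symmDiff (y := y) (show x₀ ∈ (arr n hκ ϑ).gen from h₀)
        (show y ∈ (arr n hκ ϑ).gen from h.bottom) h.top, (crossings_eq_singleton_iff hκ).mp hc]
    refine (Finset.card_le_card (show _ ⊆ insert c ((arr n hκ ϑ).sep x₀ y) from ?_)).trans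
      ((Finset.card_insert_le _ _).trans (by omega))
    intro d
    simp only [Finset.mem_symmDiff, Finset.mem_singleton, Finset.mem_insert]
    tauto

end

end

section

variable {R : Type*} [CommRing R] {n ℓ : ℕ} {κ : ℝ} {ϑ : Fin ℓ → ℝ} {q : R} {Q : Fin ℓ → R}

/-! ### Local moves modulo fewer crossings -/

/-- Only products of two values can be compared, because relabelling may reverse the sign chosen for
the functional of a pair of strands. -/
theorem ev_comp_mul (hκ : κ ≠ 0) (x y : Fin n → ℝ) (σ : Equiv.Perm (Fin n)) (c : Crossing n) :
    (arr n hκ ϑ).ev c (x ∘ σ) * (arr n hκ ϑ).ev c (y ∘ σ) =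
      (arr n hκ ϑ).ev (c.map σ) x * (arr n hκ ϑ).ev (c.map σ) y := by
  have hs : ∀ (x y : Fin n → ℝ) i j,
      (arr n hκ ϑ).ev (.strands s(i, j)) x * (arr n hκ ϑ).ev (.strands s(i, j)) y =
      (x i - x j) * (y i - y j) := by
    intro x y i j
    rcases le_total i j with h | h <;>
      simp [Arrangement.ev, arr, crossingLin, crossingConst, Sym2.inf_mk, Sym2.sup_mk, h]
    ring
  cases c with
  | strands p =>
    induction p with
    | _ i j => simp only [Crossing.map, Sym2.map_mk, hs, Function.comp_apply]
  | ghost i j => rfl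
  | red i a => rfl

theorem map_mem_wallSet (σ : Equiv.Perm (Fin n)) {c : Crossing n} (hc : c ∈ wallSet n ϑ) :
    c.map σ ∈ wallSet n ϑ := by
  rcases mem_wallSet.mp hc with ⟨i, j, h, rfl⟩ | ⟨i, j, h, rfl⟩ | ⟨i, t, rfl⟩
  · exact mem_wallSet.mpr (Or.inl ⟨σ i, σ j, by simpa using h, rfl⟩)
  · exact mem_wallSet.mpr (Or.inr (Or.inl ⟨σ i, σ j, by simpa using h, rfl⟩))
  · exact mem_wallSet.mpr (Or.inr (Or.inr ⟨σ i, t, rfl⟩))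

theorem map_swap_strands (i k : Fin n) :
    (Crossing.strands s(i, k)).map (Equiv.swap i k) = Crossing.strands s(i, k) := by
  simp only [Crossing.map, Sym2.map_mk, Equiv.swap_apply_left, Equiv.swap_apply_right]
  rw [Sym2.eq_swap]

/-- At an exceptional triple point, uncrossing the two strands removes all crossings. -/
theorem sep_swap_of_triple (hκ : κ ≠ 0) {A C : Crossing n} {i k : Fin n}
    (hAC : A.map (Equiv.swap i k) = C) (hCA : C.map (Equiv.swap i k) = A)
    (evA : ∀ x : Fin n → ℝ, (arr n hκ ϑ).ev A (x ∘ Equiv.swap i k) = (arr n hκ ϑ).ev C x)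
    (evC : ∀ x : Fin n → ℝ, (arr n hκ ϑ).ev C (x ∘ Equiv.swap i k) = (arr n hκ ϑ).ev A x)
    {ε : ℝ} (hε : ∀ x : Fin n → ℝ,
      (arr n hκ ϑ).ev A x - (arr n hκ ϑ).ev C x = ε * (x i - x k))
    {e y y₀ z₁ z₁' : Fin n → ℝ} (hy : Generic κ ϑ y) (hy₀ : Generic κ ϑ y₀) (hz₁ : Generic κ ϑ z₁)
    (hz₁' : Generic κ ϑ z₁') (heik : e i = e k)
    (he : ∀ c ∈ (arr n hκ ϑ).walls, c ≠ A → c ≠ .strands s(i, k) → c ≠ C →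
      0 < (arr n hκ ϑ).ev c e * (arr n hκ ϑ).ev c y)
    (s₀ : (arr n hκ ϑ).sep y₀ y = {A, .strands s(i, k), C})
    (s₁ : crossings κ ϑ y₀ z₁ = {A}) (s₁' : crossings κ ϑ y₀ z₁' = {C}) (hA : A ≠ .strands s(i, k))
    (hC : C ≠ .strands s(i, k)) (hne : A ≠ C) :
    (arr n hκ ϑ).sep y₀ (y ∘ Equiv.swap i k) = ∅ := by
  set 𝒜 := arr n hκ ϑ with h𝒜
  set s := Equiv.swap i k with hs
  -- The two strands meet at the triple point, so exchanging them does not move it.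
  have hes : e ∘ s = e := by
    funext a
    simp only [Function.comp_apply, hs, Equiv.swap_apply_def]
    split_ifs with h1 h2
    · rw [h1, heik]
    · rw [h2, heik]
    · rfl
  have hys : y ∘ s ∈ 𝒜.gen := hy.comp s
  have hyg : y ∈ 𝒜.gen := hy
  have hy₀g : y₀ ∈ 𝒜.gen := hy₀
  have hWA : A ∈ 𝒜.walls := (Arrangement.mem_sep.mp (s₀ ▸ (by simp : A ∈ ({A, Crossing.strands s(i, k), C} : Finset _)))).1
  have hWC : C ∈ 𝒜.walls := (Arrangement.mem_sep.mp (s₀ ▸ (by simp : C ∈ ({A, Crossing.strands s(i, k), C} : Finset _)))).1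
  have hAy : 𝒜.ev A y₀ * 𝒜.ev A y < 0 :=
    (Arrangement.mem_sep.mp (s₀ ▸ (by simp : A ∈ ({A, Crossing.strands s(i, k), C} : Finset _)))).2
  have hCy : 𝒜.ev C y₀ * 𝒜.ev C y < 0 :=
    (Arrangement.mem_sep.mp (s₀ ▸ (by simp : C ∈ ({A, Crossing.strands s(i, k), C} : Finset _)))).2
  have hBy : Crossing.strands s(i, k) ∈ crossings κ ϑ y₀ y := by
    rw [crossings_eq hκ, ← h𝒜, s₀]; simp
  -- the signs of `A` and `C` at `y₀` are opposite
  have hopp : 𝒜.ev A y₀ * 𝒜.ev C y₀ < 0 := by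
    have m1 : A ∈ 𝒜.sep y₀ z₁ := by
      rw [(crossings_eq_singleton_iff hκ).mp s₁]; simp
    have m2 : C ∉ 𝒜.sep y₀ z₁ := by
      rw [(crossings_eq_singleton_iff hκ).mp s₁]; simpa using hne.symm
    have m3 : C ∈ 𝒜.sep y₀ z₁' := by
      rw [(crossings_eq_singleton_iff hκ).mp s₁']; simp
    have m4 : A ∉ 𝒜.sep y₀ z₁' := by
      rw [(crossings_eq_singleton_iff hκ).mp s₁']; simpa using hne
    have b1 : Crossing.strands s(i, k) ∉ crossings κ ϑ y₀ z₁ := by rw [s₁]; simpa using hA.symm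
    have b2 : Crossing.strands s(i, k) ∉ crossings κ ϑ y₀ z₁' := by rw [s₁']; simpa using hC.symm
    rw [strands_mem_crossings, not_lt] at b1 b2
    have m1 := (Arrangement.mem_sep.mp m1).2
    have m3 := (Arrangement.mem_sep.mp m3).2
    rw [Arrangement.not_mem_sep_iff hWC hy₀g hz₁] at m2
    rw [Arrangement.not_mem_sep_iff hWA hy₀g hz₁'] at m4
    have e1 := hε z₁
    have e2 := hε z₁'
    have n0 := hy₀.strand_strand.ne (ne_of_strands_mem hBy)
    have n0' : y₀ i - y₀ k ≠ 0 := sub_ne_zero.mpr n0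
    have hA0 := Arrangement.ev_ne hy₀g hWA
    have hC0 := Arrangement.ev_ne hy₀g hWC
    by_contra hcon
    have hcon' := lt_of_le_of_ne (not_lt.mp hcon) (mul_ne_zero hA0 hC0).symm
    -- the difference `A - C` has opposite signs at `z₁` and `z₁'`
    have key : (𝒜.ev A z₁ - 𝒜.ev C z₁) * (𝒜.ev A z₁' - 𝒜.ev C z₁') < 0 := by
      rcases hA0.lt_or_gt with h | h
      · have h' : 𝒜.ev C y₀ < 0 := neg_of_mul_pos_right hcon' h.le
        have f1 : 0 < 𝒜.ev A z₁ := pos_of_mul_neg_right m1 h.le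
        have f2 : 𝒜.ev C z₁ < 0 := neg_of_mul_pos_right m2 h'.le
        have f3 : 0 < 𝒜.ev C z₁' := pos_of_mul_neg_right m3 h'.le
        have f4 : 𝒜.ev A z₁' < 0 := neg_of_mul_pos_right m4 h.le
        exact mul_neg_of_pos_of_neg (by linarith) (by linarith)
      · have h' : 0 < 𝒜.ev C y₀ := pos_of_mul_pos_right hcon' h.le
        have f1 : 𝒜.ev A z₁ < 0 := neg_of_mul_neg_right m1 h.le
        have f2 : 0 < 𝒜.ev C z₁ := pos_of_mul_pos_right m2 h'.le
        have f3 : 𝒜.ev C z₁' < 0 := neg_of_mul_neg_right m3 h'.le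
        have f4 : 0 < 𝒜.ev A z₁' := pos_of_mul_pos_right m4 h.le
        exact mul_neg_of_neg_of_pos (by linarith) (by linarith)
    rw [e1, e2] at key
    -- The strands do not cross on the way from `y₀` to `z₁` or to `z₁'`, hence are in the same
    -- order at both.
    have h5 : 0 ≤ (z₁ i - z₁ k) * (z₁' i - z₁' k) := by
      rcases n0'.lt_or_gt with h | h
      · exact mul_nonneg_of_nonpos_of_nonpos (by by_contra h'; nlinarith [not_le.mp h'])
          (by by_contra h'; nlinarith [not_le.mp h'])
      · exact mul_nonneg (by by_contra h'; nlinarith [not_le.mp h'])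
          (by by_contra h'; nlinarith [not_le.mp h'])
    nlinarith [mul_nonneg (mul_self_nonneg ε) h5]
  ext c
  simp only [Finset.notMem_empty, iff_false]
  by_cases hc : c ∈ 𝒜.walls
  swap
  · exact fun h => hc (Arrangement.mem_sep.mp h).1
  rw [Arrangement.not_mem_sep_iff hc hy₀g hys]
  by_cases hcA : c = A
  · rw [hcA, evA]
    by_contra h
    nlinarith [mul_pos_of_neg_of_neg hopp hCy, mul_self_pos.mpr (Arrangement.ev_ne hy₀g hWC),
      mul_nonneg (mul_self_nonneg (𝒜.ev C y₀)) (neg_nonneg.mpr (not_lt.mp h))]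
  by_cases hcC : c = C
  · rw [hcC, evC]
    by_contra h
    nlinarith [mul_pos_of_neg_of_neg hopp hAy, mul_self_pos.mpr (Arrangement.ev_ne hy₀g hWA),
      mul_nonneg (mul_self_nonneg (𝒜.ev A y₀)) (neg_nonneg.mpr (not_lt.mp h))]
  by_cases hcB : c = .strands s(i, k)
  · rw [hcB, ← Arrangement.not_mem_sep_iff (hcB ▸ hc) hy₀g hys, ← Finset.mem_coe, coe_sep,
      strands_mem_crossings, not_lt]
    rw [strands_mem_crossings] at hBy
    simp only [Function.comp_apply, hs, Equiv.swap_apply_left, Equiv.swap_apply_right]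
    linarith
  have hss : ∀ d : Crossing n, (d.map s).map s = d := by
    intro d
    cases d with
    | strands p =>
      induction p with | _ a b => simp [Crossing.map, hs]
    | ghost a b => simp [Crossing.map, hs]
    | red a b => simp [Crossing.map, hs]
  have hcs : c.map s ≠ A ∧ c.map s ≠ .strands s(i, k) ∧ c.map s ≠ C := by
    refine ⟨fun h => hcC ?_, fun h => hcB ?_, fun h => hcA ?_⟩
    · rw [← hss c, h, hAC]
    · rw [← hss c, h, map_swap_strands]
    · rw [← hss c, h, hCA]
  -- Another wall has at `y` the sign it has at `e`. The same holds for its image under the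
  -- exchange, and `e` is invariant, so the wall also has this sign at `y ∘ s`.
  have h1 := he c hc hcA hcB hcC
  have h2 := he (c.map s) (map_mem_wallSet s hc) hcs.1 hcs.2.1 hcs.2.2
  rw [← ev_comp_mul, hes] at h2
  have h3 : c ∉ 𝒜.sep y₀ y := by rw [s₀]; simp [hcA, hcB, hcC]
  rw [Arrangement.not_mem_sep_iff hc hy₀g hyg] at h3
  have h4 := mul_pos (mul_pos h1 h2) h3
  have h5 : 𝒜.ev c e * 𝒜.ev c y * (𝒜.ev c e * 𝒜.ev c (y ∘ s)) * (𝒜.ev c y₀ * 𝒜.ev c y) =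
    (𝒜.ev c e * 𝒜.ev c y) * (𝒜.ev c e * 𝒜.ev c y) * (𝒜.ev c y₀ * 𝒜.ev c (y ∘ s)) := by ring
  rw [h5] at h4
  exact pos_of_mul_pos_right h4 (mul_self_nonneg _)

section

variable {x₀ : Fin n → ℝ} {h₀ : Generic κ ϑ x₀}

theorem mk_square {x : Fin n → ℝ} (h : Generic κ ϑ x) (i : Fin n) (a : ℤ) :
    RingQuot.mkAlgHom R (Rel κ ϑ q Q n) (square R h i a) = sq q Q h i a := rfl

theorem mk_slice {x y : Fin n → ℝ} (h : IsSlice κ ϑ x y) :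
    RingQuot.mkAlgHom R (Rel κ ϑ q Q n) (slice R h) = sl q Q h := rfl

theorem low_polySquare {N : ℕ} {y : Fin n → ℝ} (h : Generic κ ϑ y) (i : Fin n) (p : R[X])
    {a : AffineWF κ ϑ q Q n} (ha : a ∈ Low q Q h₀ N y) :
    RingQuot.mkAlgHom R (Rel κ ϑ q Q n) (polySquare h i p) * a ∈ Low q Q h₀ N y := by
  rw [polySquare, map_sum, Finset.sum_mul]
  refine Submodule.sum_mem _ fun m _ => ?_
  rw [map_smul, smul_mul_assoc]
  exact Submodule.smul_mem _ _ (low_sq h i _ ha)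

theorem low_dividedDifference {N : ℕ} {y : Fin n → ℝ} (h : Generic κ ϑ y) (i k : Fin n) (p : R[X])
    {a : AffineWF κ ϑ q Q n} (ha : a ∈ Low q Q h₀ N y) :
    RingQuot.mkAlgHom R (Rel κ ϑ q Q n) (dividedDifference h i k p) * a ∈ Low q Q h₀ N y := by
  rw [dividedDifference, map_sum, Finset.sum_mul]
  refine Submodule.sum_mem _ fun m _ => ?_
  rw [map_smul, smul_mul_assoc, map_sum, Finset.sum_mul]
  refine Submodule.smul_mem _ _ (Submodule.sum_mem _ fun ab _ => ?_)
  rw [map_mul, mul_assoc]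
  exact low_sq h i _ (low_sq h k _ ha)

/-- A bigon lies in the span of the diagrams with less crossings. -/
theorem bigon_mem_low {N : ℕ} {y z : Fin n → ℝ} {c : Crossing n}
    (h : IsSlice κ ϑ y z) (h' : IsSlice κ ϑ z y) (hc : crossings κ ϑ y z = {c})
    {a : AffineWF κ ϑ q Q n} (ha : a ∈ Low q Q h₀ N y) :
    sl q Q h' * (sl q Q h * a) ∈ Low q Q h₀ N y := by
  have hc' : crossings κ ϑ z y = {c} := by rw [crossings_comm, hc]
  have hid : ∀ b ∈ Low q Q h₀ N y, sl q Q h.bottom.isSlice * b ∈ Low q Q h₀ N y := fun b hb =>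
    low_free _ (crossings_self _ _ _) hb
  rw [← mul_assoc]
  cases c with
  | strands p =>
    induction p with
    | _ i j =>
    have := RingQuot.mkAlgHom_rel R (Rel.bigon_strands (q := q) (Q := Q) h h' hc hc')
    rw [map_mul, mk_slice, mk_slice, map_zero] at this
    rw [this, zero_mul]
    exact Submodule.zero_mem _
  | ghost i j =>
    have := RingQuot.mkAlgHom_rel R
      (Rel.bigon_ghost (q := q) (Q := Q) h h' h.bottom.isSlice hc hc')
    rw [map_mul, map_mul, map_sub, map_smul, mk_slice, mk_slice, mk_slice, mk_square, mk_square]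
      at this
    rw [this, mul_assoc]
    refine hid _ ?_
    rw [sub_mul, smul_mul_assoc]
    exact Submodule.sub_mem _ (low_sq _ _ _ ha) (Submodule.smul_mem _ _ (low_sq _ _ _ ha))
  | red i b =>
    have := RingQuot.mkAlgHom_rel R
      (Rel.bigon_red (q := q) (Q := Q) h h' h.bottom.isSlice hc hc')
    rw [map_mul, map_mul, mk_slice, mk_slice, mk_slice] at this
    rw [this, mul_assoc]
    exact hid _ (low_polySquare _ _ _ ha)

theorem sub_mul_mem_of_sub_mul_mem {A : Type*} [Ring A] [Algebra R A] (W : Submodule R A)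
    {u v g : A} (h : (v - u) * g ∈ W) : (u - v) * g ∈ W := by
  have := Submodule.neg_mem _ h
  rwa [← neg_mul, neg_sub] at this

theorem neg_smul_mul_mem {A : Type*} [Ring A] [Algebra R A] (W : Submodule R A) (r : R)
    {u g : A} (h : u * g ∈ W) : -(r • u) * g ∈ W := by
  rw [neg_mul, smul_mul_assoc]
  exact Submodule.neg_mem _ (Submodule.smul_mem _ _ h)

/-- The two resolutions of a triple point agree modulo diagrams with less crossings. -/
theorem triple_mem_low (hκ : κ ≠ 0) {N : ℕ} {A B C : Crossing n} (hAB : A ≠ B) (hBC : B ≠ C)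
    (hAC : A ≠ C) {e y y₀ z₁ z₂ z₁' z₂' : Fin n → ℝ}
    (hA : (arr n hκ ϑ).ev A e = 0) (hB : (arr n hκ ϑ).ev B e = 0) (hC : (arr n hκ ϑ).ev C e = 0)
    (he : ∀ c ∈ (arr n hκ ϑ).walls, c ≠ A → c ≠ B → c ≠ C →
      0 < (arr n hκ ϑ).ev c e * (arr n hκ ϑ).ev c y)
    (s₀ : (arr n hκ ϑ).sep y₀ y = {A, B, C})
    (h₁ : IsSlice κ ϑ y₀ z₁) (h₂ : IsSlice κ ϑ z₁ z₂) (h₃ : IsSlice κ ϑ z₂ y)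
    (h₁' : IsSlice κ ϑ y₀ z₁') (h₂' : IsSlice κ ϑ z₁' z₂') (h₃' : IsSlice κ ϑ z₂' y)
    (hc₁ : crossings κ ϑ y₀ z₁ = {A}) (hc₂ : crossings κ ϑ z₁ z₂ = {B})
    (hc₃ : crossings κ ϑ z₂ y = {C}) (hc₁' : crossings κ ϑ y₀ z₁' = {C})
    (hc₂' : crossings κ ϑ z₁' z₂' = {B}) (hc₃' : crossings κ ϑ z₂' y = {A})
    {g : AffineWF κ ϑ q Q n} (hg : g ∈ Low q Q h₀ N y₀) :
    sl q Q h₃ * (sl q Q h₂ * (sl q Q h₁ * g)) - sl q Q h₃' * (sl q Q h₂' * (sl q Q h₁' * g)) ∈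
      Low q Q h₀ N y := by
  have hrew : ∀ (u v w u' v' w' : AffineWF κ ϑ q Q n),
      u * (v * (w * g)) - u' * (v' * (w' * g)) = (u * v * w - u' * v' * w') * g := by
    intros; simp only [sub_mul, mul_assoc]
  rw [hrew]
  by_cases hex : Exceptional A B C
  swap
  · have := RingQuot.mkAlgHom_rel R (Rel.triple (q := q) (Q := Q) h₁ h₂ h₃ h₁' h₂' h₃' hc₁ hc₂ hc₃
      hc₁' hc₂' hc₃' hex)
    simp only [map_mul, mk_slice] at this
    rw [this, sub_self, zero_mul]
    exact Submodule.zero_mem _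
  -- the strands of an exceptional triple point can be uncrossed
  have hik0 : ∀ i k, B = .strands s(i, k) → i ≠ k := by
    rintro i k rfl
    exact ne_of_strands_mem (hc₂ ▸ rfl : _ ∈ crossings κ ϑ z₁ z₂)
  have heik : ∀ i k, B = .strands s(i, k) → e i = e k := by
    rintro i k rfl
    rcases crossing_ev_strands (κ := κ) i k e with h | h <;>
      [have := h.symm.trans hB; have := h.symm.trans hB] <;> linarith
  have uncross : ∀ i k, B = .strands s(i, k) →
      A.map (Equiv.swap i k) = C → C.map (Equiv.swap i k) = A →
      (∀ x : Fin n → ℝ, (arr n hκ ϑ).ev A (x ∘ Equiv.swap i k) = (arr n hκ ϑ).ev C x) →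
      (∀ x : Fin n → ℝ, (arr n hκ ϑ).ev C (x ∘ Equiv.swap i k) = (arr n hκ ϑ).ev A x) →
      (∃ ε : ℝ, ∀ x : Fin n → ℝ,
        (arr n hκ ϑ).ev A x - (arr n hκ ϑ).ev C x = ε * (x i - x k)) →
      crossings κ ϑ y₀ (y ∘ Equiv.swap i k) = ∅ := by
    rintro i k rfl hA' hC' eA eC ⟨ε, hε⟩
    rw [crossings_eq_empty_iff hκ]
    exact sep_swap_of_triple hκ hA' hC' eA eC hε h₃.top h₁.bottom h₁.top h₁'.top (heik i k rfl) he s₀ hc₁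
      hc₁' hAB hBC.symm hAC
  have low_err : ∀ i k (hs : IsSlice κ ϑ y₀ (y ∘ Equiv.swap i k)),
      crossings κ ϑ y₀ (y ∘ Equiv.swap i k) = ∅ → ∀ b ∈ Low q Q h₀ N y₀,
        sl q Q hs * b ∈ Low q Q h₀ N y := by
    intro i k hs hc b hb
    have := low_free hs hc hb
    rwa [low_comp] at this
  have flip : ∀ u v : AffineWF κ ϑ q Q n, (v - u) * g ∈ Low q Q h₀ N y →
      (u - v) * g ∈ Low q Q h₀ N y := fun u v h => sub_mul_mem_of_sub_mul_mem _ h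
  have ev_ghost : ∀ (x : Fin n → ℝ) i j, (arr n hκ ϑ).ev (.ghost i j) x = x i - x j + -κ :=
    fun _ _ _ => rfl
  have ev_red : ∀ (x : Fin n → ℝ) i a, (arr n hκ ϑ).ev (.red i a) x = x i + -a := fun _ _ _ => rfl
  cases hex with
  | strand b i k =>
    have hik := hik0 i k rfl
    have hbi : b ≠ i := ne_of_ghost_mem (hc₁ ▸ rfl : Crossing.ghost b i ∈ crossings κ ϑ y₀ z₁)
    have hbk : b ≠ k := ne_of_ghost_mem (hc₃ ▸ rfl : Crossing.ghost b k ∈ crossings κ ϑ z₂ y)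
    have hsb : Equiv.swap i k b = b := Equiv.swap_apply_of_ne_of_ne hbi hbk
    have hc := uncross i k rfl (by simp [Crossing.map, hsb]) (by simp [Crossing.map, hsb])
      (fun x => by simp [ev_ghost, hsb]) (fun x => by simp [ev_ghost, hsb])
      ⟨-1, fun x => by rw [ev_ghost, ev_ghost]; ring⟩
    have hs := isSlice_of_empty h₁.bottom (h₃.top.comp (Equiv.swap i k)) hc
    rcases (h₁.bottom.strand_strand.ne hik).lt_or_gt with hlt | hlt
    · have := RingQuot.mkAlgHom_rel R (Rel.triple_strand (q := q) (Q := Q) h₁ h₂ h₃ h₁' h₂' h₃' hc₁ hc₂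
        hc₃ hc₁' hc₂' hc₃' hlt hs)
      simp only [map_mul, map_sub, map_neg, map_smul, mk_slice] at this
      rw [this]
      exact neg_smul_mul_mem _ q (low_err i k hs hc g hg)
    -- The relation is stated with the left strand first. In the other order `i` and `k` exchange
    -- roles and the two resolutions exchange places, which only changes the sign of the difference.
    · have hs' : IsSlice κ ϑ y₀ (y ∘ Equiv.swap k i) := by rwa [Equiv.swap_comm]
      have := RingQuot.mkAlgHom_rel R (Rel.triple_strand (q := q) (Q := Q) (b := b) (i := k) (k := i)
        h₁' h₂' h₃' h₁ h₂ h₃ hc₁' (by rw [hc₂', Sym2.eq_swap]) hc₃' hc₁ (by rw [hc₂, Sym2.eq_swap])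
        hc₃ hlt hs')
      simp only [map_mul, map_sub, map_neg, map_smul, mk_slice] at this
      refine flip _ _ ?_
      rw [this]
      exact neg_smul_mul_mem _ q (low_err k i hs' (by rwa [Equiv.swap_comm]) g hg)
  | ghost b i k =>
    have hik := hik0 i k rfl
    have hbi : i ≠ b := ne_of_ghost_mem (hc₁ ▸ rfl : Crossing.ghost i b ∈ crossings κ ϑ y₀ z₁)
    have hbk : k ≠ b := ne_of_ghost_mem (hc₃ ▸ rfl : Crossing.ghost k b ∈ crossings κ ϑ z₂ y)
    have hsb : Equiv.swap i k b = b := Equiv.swap_apply_of_ne_of_ne hbi.symm hbk.symm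
    have hc := uncross i k rfl (by simp [Crossing.map, hsb]) (by simp [Crossing.map, hsb])
      (fun x => by simp [ev_ghost, hsb]) (fun x => by simp [ev_ghost, hsb])
      ⟨1, fun x => by rw [ev_ghost, ev_ghost]; ring⟩
    have hs := isSlice_of_empty h₁.bottom (h₃.top.comp (Equiv.swap i k)) hc
    rcases (h₁.bottom.strand_strand.ne hik).lt_or_gt with hlt | hlt
    · have := RingQuot.mkAlgHom_rel R (Rel.triple_ghost (q := q) (Q := Q) h₁ h₂ h₃ h₁' h₂' h₃' hc₁ hc₂
        hc₃ hc₁' hc₂' hc₃' hlt hs)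
      simp only [map_mul, map_sub, mk_slice] at this
      rw [this]
      exact low_err i k hs hc g hg
    · have hs' : IsSlice κ ϑ y₀ (y ∘ Equiv.swap k i) := by rwa [Equiv.swap_comm]
      have := RingQuot.mkAlgHom_rel R (Rel.triple_ghost (q := q) (Q := Q) (b := b) (i := k) (k := i)
        h₁' h₂' h₃' h₁ h₂ h₃ hc₁' (by rw [hc₂', Sym2.eq_swap]) hc₃' hc₁ (by rw [hc₂, Sym2.eq_swap])
        hc₃ hlt hs')
      simp only [map_mul, map_sub, mk_slice] at this
      refine flip _ _ ?_
      rw [this]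
      exact low_err k i hs' (by rwa [Equiv.swap_comm]) g hg
  | red a i k =>
    have hik := hik0 i k rfl
    have hc := uncross i k rfl (by simp [Crossing.map]) (by simp [Crossing.map])
      (fun x => by simp [ev_red]) (fun x => by simp [ev_red])
      ⟨1, fun x => by rw [ev_red, ev_red]; ring⟩
    have hs := isSlice_of_empty h₁.bottom (h₃.top.comp (Equiv.swap i k)) hc
    rcases (h₁.bottom.strand_strand.ne hik).lt_or_gt with hlt | hlt
    · have := RingQuot.mkAlgHom_rel R (Rel.triple_red (q := q) (Q := Q) h₁ h₂ h₃ h₁' h₂' h₃' hc₁ hc₂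
        hc₃ hc₁' hc₂' hc₃' hlt hs)
      simp only [map_mul, map_sub, mk_slice] at this
      rw [this, mul_assoc]
      exact low_err i k hs hc _ (low_dividedDifference _ _ _ _ hg)
    · have hs' : IsSlice κ ϑ y₀ (y ∘ Equiv.swap k i) := by rwa [Equiv.swap_comm]
      have := RingQuot.mkAlgHom_rel R (Rel.triple_red (q := q) (Q := Q) (a := a) (i := k) (k := i)
        h₁' h₂' h₃' h₁ h₂ h₃ hc₁' (by rw [hc₂', Sym2.eq_swap]) hc₃' hc₁ (by rw [hc₂, Sym2.eq_swap])
        hc₃ hlt hs')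
      simp only [map_mul, map_sub, mk_slice] at this
      refine flip _ _ ?_
      rw [this, mul_assoc]
      exact low_err k i hs' (by rwa [Equiv.swap_comm]) _ (low_dividedDifference _ _ _ _ hg)

end

end

section

variable {R : Type*} [CommRing R] {n ℓ : ℕ} {κ : ℝ} {ϑ : Fin ℓ → ℝ} {q : R} {Q : Fin ℓ → R}

/-! ### Straightening galleries -/

/-- Under the inclusion, `z` lies on a geodesic from `x` to `y`, and distances add. -/
theorem card_sep_add (hκ : κ ≠ 0) {x y z : Fin n → ℝ} (hx : Generic κ ϑ x) (hy : Generic κ ϑ y)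
    (hz : Generic κ ϑ z) (h : (arr n hκ ϑ).sep z y ⊆ (arr n hκ ϑ).sep x y) :
    ((arr n hκ ϑ).sep x z).card + ((arr n hκ ϑ).sep z y).card = ((arr n hκ ϑ).sep x y).card := by
  have : (arr n hκ ϑ).sep x z = (arr n hκ ϑ).sep x y \ (arr n hκ ϑ).sep z y := by
    rw [Arrangement.sep_symmDiff (𝒜 := arr n hκ ϑ) (y := y) hx hy hz, Arrangement.sep_comm y z]
    ext c
    have := @h c
    simp only [Finset.mem_symmDiff, Finset.mem_sdiff]
    tauto
  rw [this, Finset.card_sdiff_add_card_eq_card h]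

theorem card_sep_of_singleton (hκ : κ ≠ 0) {x y z : Fin n → ℝ} (hx : Generic κ ϑ x)
    (hy : Generic κ ϑ y) (hz : Generic κ ϑ z) {c : Crossing n} (h : crossings κ ϑ z y = {c}) :
    (c ∈ (arr n hκ ϑ).sep x y ∧
      ((arr n hκ ϑ).sep x z).card + 1 = ((arr n hκ ϑ).sep x y).card) ∨
    (c ∈ (arr n hκ ϑ).sep x z ∧
      ((arr n hκ ϑ).sep x y).card + 1 = ((arr n hκ ϑ).sep x z).card) := by
  have h1 := (crossings_eq_singleton_iff hκ).mp h
  by_cases hc : c ∈ (arr n hκ ϑ).sep x y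
  · refine Or.inl ⟨hc, ?_⟩
    rw [← card_sep_add hκ hx hy hz (by rw [h1]; simpa using hc), h1, Finset.card_singleton]
  · have hc' : c ∈ (arr n hκ ϑ).sep x z := by
      rw [Arrangement.sep_symmDiff (𝒜 := arr n hκ ϑ) (y := y) hx hy hz, Arrangement.sep_comm y z, h1]
      simp [Finset.mem_symmDiff, hc]
    refine Or.inr ⟨hc', ?_⟩
    have h2 : (arr n hκ ϑ).sep y z = {c} := by rw [Arrangement.sep_comm, h1]
    rw [← card_sep_add hκ hx hz hy (by rw [h2]; simpa using hc'), h2, Finset.card_singleton]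

section

variable {x₀ : Fin n → ℝ} {h₀ : Generic κ ϑ x₀}

/-- Both `z` and `z'` lie across the wall `c` from `y`, hence in one chamber. A crossing-free slice
carries one gallery to the other end point, where the assumption applies. -/
theorem sub_mem_of_same_wall (hκ : κ ≠ 0) {N : ℕ} {y z z' : Fin n → ℝ} {c : Crossing n}
    (ih : ∀ a b, Gal q Q h₀ N z' a → Gal q Q h₀ N z' b → a - b ∈ Low q Q h₀ N z')
    (h : IsSlice κ ϑ z y) (h' : IsSlice κ ϑ z' y) (hc : crossings κ ϑ z y = {c})
    (hc' : crossings κ ϑ z' y = {c}) {g g' : AffineWF κ ϑ q Q n} (hg : Gal q Q h₀ N z g)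
    (hg' : Gal q Q h₀ N z' g') : sl q Q h * g - sl q Q h' * g' ∈ Low q Q h₀ (N + 1) y := by
  have he : crossings κ ϑ z z' = ∅ := by
    ext d
    rw [mem_crossings_iff_not h.bottom h.top h'.bottom hκ, crossings_comm y z', hc, hc']
    simp
  have k := isSlice_of_empty h.bottom h'.bottom he
  have h1 : sl q Q h * g = sl q Q h' * (sl q Q k * g) := by
    rw [← mul_assoc, sl_mul_sl k h' h (Or.inl he)]
  rw [h1, ← mul_sub]
  exact low_cross h' hc' (ih _ _ (hg.free k he) hg')

-- An analogue of Matsumoto's theorem modulo diagrams with fewer crossings: superfluous crossings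
-- can be removed, and minimal galleries depend only on their ends. The two claims are proved
-- together by induction on the number of crossings, because each uses the other for shorter
-- galleries.
set_option maxHeartbeats 1000000 in
theorem straighten_aux (hκ : κ ≠ 0) (N : ℕ) : ∀ y,
    (∀ a, Gal q Q h₀ N y a → ((arr n hκ ϑ).sep x₀ y).card ≠ N → a ∈ Low q Q h₀ N y) ∧
    (∀ a b, Gal q Q h₀ N y a → Gal q Q h₀ N y b → ((arr n hκ ϑ).sep x₀ y).card = N →
      a - b ∈ Low q Q h₀ N y) := by
  induction N with
  | zero =>
    intro y
    constructor
    · intro a ha hN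
      exact absurd (Nat.le_zero.mp (ha.card_le hκ)) hN
    · intro a b ha hb _
      obtain ⟨h, _, rfl⟩ := ha.zero hκ rfl
      obtain ⟨h', _, rfl⟩ := hb.zero hκ rfl
      rw [sub_self]
      exact Submodule.zero_mem _
  | succ N ih =>
    intro y
    constructor
    · intro a ha hN
      obtain ⟨z, c, h, b, hc, hb, rfl⟩ := ha.succ hκ rfl
      by_cases hz : ((arr n hκ ϑ).sep x₀ z).card = N
      swap
      · exact low_cross h hc ((ih z).1 b hb hz)
      rcases card_sep_of_singleton hκ h₀ h.top h.bottom hc with ⟨_, h1⟩ | ⟨_, h1⟩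
      · omega
      -- The last crossing leads back towards `x₀`. By induction the rest may be replaced by a
      -- minimal gallery through `y` followed by the same crossing, and then a bigon appears.
      obtain ⟨g, hg⟩ := exists_gal (q := q) (Q := Q) (h₀ := h₀) hκ _ y h.top rfl
      have hc' : crossings κ ϑ y z = {c} := by rw [crossings_comm, hc]
      have hg' : Gal q Q h₀ N z (sl q Q h.symm * g) := by
        have := hg.cross h.symm hc'
        rwa [h1, hz] at this
      have h2 := low_cross h hc ((ih z).2 b _ hb hg' hz)
      have h3 := bigon_mem_low h.symm h hc'
        (hg.diag.mem_low (show _ < N + 1 by omega))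
      have h4 := Submodule.add_mem _ h2 h3
      rwa [← mul_add, sub_add_cancel] at h4
    · intro a b ha hb hN
      have hy : Generic κ ϑ y := ha.diag.generic
      -- `P c` expresses that `a` agrees with all galleries whose last crossing is `c`. It is
      -- carried from the last crossing of `a` to that of `b` along the facets of the chamber of
      -- `y`.
      set P : Crossing n → Prop := fun c => ∀ z g (h : IsSlice κ ϑ z y), crossings κ ϑ z y = {c} →
        Gal q Q h₀ N z g → a - sl q Q h * g ∈ Low q Q h₀ (N + 1) y with hP
      -- One gallery ending with `c` is enough, because any two such galleries agree modulo fewer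
      -- crossings by `sub_mem_of_same_wall`.
      have wit : ∀ c z' g' (h' : IsSlice κ ϑ z' y), crossings κ ϑ z' y = {c} →
          Gal q Q h₀ N z' g' → a - sl q Q h' * g' ∈ Low q Q h₀ (N + 1) y → P c := by
        intro c z' g' h' hc' hg' hmem z g h hc hg
        have hz : ((arr n hκ ϑ).sep x₀ z).card = N := by
          have := hg.card_le hκ
          rcases card_sep_of_singleton hκ h₀ h.top h.bottom hc with ⟨_, h1⟩ | ⟨_, h1⟩ <;> omega
        have := sub_mem_of_same_wall hκ (fun a b ha hb => (ih z).2 a b ha hb hz) h' h hc' hc hg' hg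
        have := Submodule.add_mem _ hmem this
        rwa [sub_add_sub_cancel] at this
      obtain ⟨z, c, h, a', hc, ha', rfl⟩ := ha.succ hκ rfl
      obtain ⟨z', c', h', b', hc', hb', rfl⟩ := hb.succ hκ rfl
      have mem : ∀ {z c b} (h : IsSlice κ ϑ z y), crossings κ ϑ z y = {c} → Gal q Q h₀ N z b →
          c ∈ (arr n hκ ϑ).sep x₀ y := by
        intro z c b h hc hb
        have := hb.card_le hκ
        rcases card_sep_of_singleton hκ h₀ h.top h.bottom hc with ⟨h0, h1⟩ | ⟨_, h1⟩
        · exact h0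
        · omega
      have key : P c' := by
        refine Arrangement.facet_induction (𝒜 := arr n hκ ϑ) (x := x₀) (y := y) h₀ hy P ?_ ?_
          (H := c) (K := c') (mem h hc ha') (mem h' hc' hb') h.bottom h'.bottom
          ((crossings_eq_singleton_iff hκ).mp hc) ((crossings_eq_singleton_iff hκ).mp hc') ?_
        · intro A C hAC hA hC y₀ hy₀ zA hzA zC hzC s₀ sA sC hPA
          have cA : crossings κ ϑ zA y = {C} := (crossings_eq_singleton_iff hκ).mpr sA
          have cC : crossings κ ϑ zC y = {A} := (crossings_eq_singleton_iff hκ).mpr sC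
          have c0 : crossings κ ϑ y₀ y = {A, C} := by rw [crossings_eq hκ, s₀]; simp
          have cA' : crossings κ ϑ y₀ zA = {A} := by
            ext d
            rw [mem_crossings_iff_not hy₀ hy hzA hκ, crossings_comm y zA, c0, cA]
            simp only [Set.mem_insert_iff, Set.mem_singleton_iff]
            grind
          have cC' : crossings κ ϑ y₀ zC = {C} := by
            ext d
            rw [mem_crossings_iff_not hy₀ hy hzC hκ, crossings_comm y zC, c0, cC]
            simp only [Set.mem_insert_iff, Set.mem_singleton_iff]
            grind
          have hd := card_sep_add hκ h₀ hy hy₀ (by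
            rw [s₀]; intro d; simp only [Finset.mem_insert, Finset.mem_singleton]
            rintro (rfl | rfl) <;> assumption)
          rw [s₀, Finset.card_pair hAC] at hd
          obtain ⟨g, hg⟩ := exists_gal (q := q) (Q := Q) (h₀ := h₀) hκ _ y₀ hy₀ rfl
          have hM : ((arr n hκ ϑ).sep x₀ y₀).card + 1 = N := by omega
          have k₁ := isSlice_of_singleton hy₀ hzA cA'
          have k₂ := isSlice_of_singleton hzA hy cA
          have k₁' := isSlice_of_singleton hy₀ hzC cC'
          have k₂' := isSlice_of_singleton hzC hy cC
          -- A face on two walls: the crossings are independent, and exchanging their heights is an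
          -- exact equality.
          have hex := RingQuot.mkAlgHom_rel R
            (Rel.exchange (q := q) (Q := Q) k₁ k₂ k₁' k₂' cA' cA cC' cC)
          rw [map_mul, map_mul, mk_slice, mk_slice, mk_slice, mk_slice] at hex
          have h1 := hPA zC _ k₂' cC (hM ▸ hg.cross k₁' cC')
          refine wit C zA _ k₂ cA (hM ▸ hg.cross k₁ cA') ?_
          rwa [← mul_assoc, hex, mul_assoc]
        · intro A B C hAB hBC hAC hA hB hC e eA eB eC he y₀ hy₀ z₁ hz₁ z₂ hz₂ z₁' hz₁' z₂' hz₂'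
            s₀ s₁ s₂ s₁' s₂' hPA
          have c0 : crossings κ ϑ y₀ y = {A, B, C} := by rw [crossings_eq hκ, s₀]; simp
          have c1 : crossings κ ϑ z₁ y = {B, C} := by rw [crossings_eq hκ, s₁]; simp
          have c2 : crossings κ ϑ z₂ y = {C} := by rw [crossings_eq hκ, s₂]; simp
          have c1' : crossings κ ϑ z₁' y = {A, B} := by rw [crossings_eq hκ, s₁']; simp
          have c2' : crossings κ ϑ z₂' y = {A} := by rw [crossings_eq hκ, s₂']; simp
          have d1 : crossings κ ϑ y₀ z₁ = {A} := by
            ext d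
            rw [mem_crossings_iff_not hy₀ hy hz₁ hκ, crossings_comm y, c0, c1]
            simp only [Set.mem_insert_iff, Set.mem_singleton_iff]
            grind
          have d2 : crossings κ ϑ z₁ z₂ = {B} := by
            ext d
            rw [mem_crossings_iff_not hz₁ hy hz₂ hκ, crossings_comm y, c1, c2]
            simp only [Set.mem_insert_iff, Set.mem_singleton_iff]
            grind
          have d1' : crossings κ ϑ y₀ z₁' = {C} := by
            ext d
            rw [mem_crossings_iff_not hy₀ hy hz₁' hκ, crossings_comm y, c0, c1']
            simp only [Set.mem_insert_iff, Set.mem_singleton_iff]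
            grind
          have d2' : crossings κ ϑ z₁' z₂' = {B} := by
            ext d
            rw [mem_crossings_iff_not hz₁' hy hz₂' hκ, crossings_comm y, c1', c2']
            simp only [Set.mem_insert_iff, Set.mem_singleton_iff]
            grind
          have hd := card_sep_add hκ h₀ hy hy₀ (by
            rw [s₀]; intro d; simp only [Finset.mem_insert, Finset.mem_singleton]
            rintro (rfl | rfl | rfl) <;> assumption)
          rw [s₀, Finset.card_eq_three.mpr ⟨A, B, C, hAB, hAC, hBC, rfl⟩] at hd
          obtain ⟨g, hg⟩ := exists_gal (q := q) (Q := Q) (h₀ := h₀) hκ _ y₀ hy₀ rfl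
          have hM : ((arr n hκ ϑ).sep x₀ y₀).card + 1 + 1 = N := by omega
          have k₁ := isSlice_of_singleton hy₀ hz₁ d1
          have k₂ := isSlice_of_singleton hz₁ hz₂ d2
          have k₃ := isSlice_of_singleton hz₂ hy c2
          have k₁' := isSlice_of_singleton hy₀ hz₁' d1'
          have k₂' := isSlice_of_singleton hz₁' hz₂' d2'
          have k₃' := isSlice_of_singleton hz₂' hy c2'
          -- A face on three walls: the two ways round it are the two resolutions of a triple point.
          have ht := triple_mem_low hκ hAB hBC hAC eA eB eC he s₀ k₁ k₂ k₃ k₁' k₂' k₃' d1 d2 c2 d1'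
            d2' c2' (hg.diag.mem_low (show _ < N + 1 by omega))
          have h1 := hPA z₂' _ k₃' c2' (hM ▸ (hg.cross k₁' d1').cross k₂' d2')
          refine wit C z₂ _ k₃ c2 (hM ▸ (hg.cross k₁ d1).cross k₂ d2) ?_
          have := Submodule.sub_mem _ h1 ht
          rwa [sub_sub_sub_cancel_right] at this
        · exact wit c z a' h hc ha' (by rw [sub_self]; exact Submodule.zero_mem _)
      exact key z' b' h' hc' hb'

end

end

section

variable {R : Type*} [CommRing R] {n ℓ : ℕ} {κ : ℝ} {ϑ : Fin ℓ → ℝ} {q : R} {Q : Fin ℓ → R}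

/-! ### Crossings in terms of the order -/

theorem not_mul_neg_iff {u v : ℝ} (hu : u ≠ 0) (hv : v ≠ 0) : ¬ u * v < 0 ↔ (u < 0 ↔ v < 0) := by
  rw [mul_neg_iff]
  rcases hu.lt_or_gt with h | h <;> rcases hv.lt_or_gt with h' | h' <;>
    simp [h, h', not_lt_of_gt h, not_lt_of_gt h']

theorem strands_notMem_iff {x y : Fin n → ℝ} (hx : Generic κ ϑ x) (hy : Generic κ ϑ y)
    (i j : Fin n) : Crossing.strands s(i, j) ∉ crossings κ ϑ x y ↔ (x i < x j ↔ y i < y j) := by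
  rw [strands_mem_crossings]
  rcases eq_or_ne i j with rfl | hij
  · simp
  · rw [not_mul_neg_iff (sub_ne_zero.mpr (hx.strand_strand.ne hij))
      (sub_ne_zero.mpr (hy.strand_strand.ne hij)), sub_neg, sub_neg]

theorem ghost_notMem_iff {x y : Fin n → ℝ} (hx : Generic κ ϑ x) (hy : Generic κ ϑ y)
    (i j : Fin n) : Crossing.ghost i j ∉ crossings κ ϑ x y ↔ (x i < x j + κ ↔ y i < y j + κ) := by
  rw [ghost_mem_crossings, not_mul_neg_iff (sub_ne_zero.mpr (hx.strand_ghost i j))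
    (sub_ne_zero.mpr (hy.strand_ghost i j)), sub_neg, sub_neg]

theorem red_notMem_iff {x y : Fin n → ℝ} (hx : Generic κ ϑ x) (hy : Generic κ ϑ y)
    (i : Fin n) (t : Fin ℓ) :
    Crossing.red i (ϑ t) ∉ crossings κ ϑ x y ↔ (x i < ϑ t ↔ y i < ϑ t) := by
  rw [red_mem_crossings]
  simp only [exists_apply_eq_apply, true_and]
  rw [not_mul_neg_iff (sub_ne_zero.mpr (hx.strand_red i t))
    (sub_ne_zero.mpr (hy.strand_red i t)), sub_neg, sub_neg]

theorem exists_red_of_mem {x y : Fin n → ℝ} {i : Fin n} {a : ℝ}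
    (h : Crossing.red i a ∈ crossings κ ϑ x y) : ∃ t, ϑ t = a :=
  (red_mem_crossings.mp h).1

/-- Two generic configurations in which everything is in the same order. -/
theorem crossings_eq_empty_of_lt_iff {x y : Fin n → ℝ} (hx : Generic κ ϑ x) (hy : Generic κ ϑ y)
    (h₁ : ∀ i j, x i < x j ↔ y i < y j) (h₂ : ∀ i j, x i < x j + κ ↔ y i < y j + κ)
    (h₃ : ∀ i t, x i < ϑ t ↔ y i < ϑ t) : crossings κ ϑ x y = ∅ := by
  ext c
  simp only [Set.mem_empty_iff_false, iff_false]
  cases c with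
  | strands p => induction p with | _ i j => exact (strands_notMem_iff hx hy i j).mpr (h₁ i j)
  | ghost i j => exact (ghost_notMem_iff hx hy i j).mpr (h₂ i j)
  | red i a =>
    intro h
    obtain ⟨t, rfl⟩ := exists_red_of_mem h
    exact (red_notMem_iff hx hy i t).mpr (h₃ i t) h

theorem map_map_inv (σ : Equiv.Perm (Fin n)) (c : Crossing n) : (c.map σ⁻¹).map σ = c := by
  cases c with
  | strands p => induction p with | _ a b => simp [Crossing.map]
  | ghost a b => simp [Crossing.map]
  | red a b => simp [Crossing.map]

/-- If two strands cross and nothing else happens, then uncrossing them removes all crossings. -/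
theorem crossings_swap_eq_empty {x y : Fin n → ℝ} (hx : Generic κ ϑ x) (hy : Generic κ ϑ y)
    {i j : Fin n} (hc : crossings κ ϑ x y = {Crossing.strands s(i, j)}) :
    crossings κ ϑ x (y ∘ Equiv.swap i j) = ∅ := by
  wlog hij : x i < x j generalizing i j
  · have h1 : i ≠ j := ne_of_strands_mem (hc ▸ rfl : _ ∈ crossings κ ϑ x y)
    rw [Equiv.swap_comm]
    exact this (by rw [hc, Sym2.eq_swap])
      (lt_of_le_of_ne (not_lt.mp hij) (hx.strand_strand.ne h1.symm))
  have hne : i ≠ j := by rintro rfl; exact lt_irrefl _ hij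
  have hyij : y j < y i := by
    have : Crossing.strands s(i, j) ∈ crossings κ ϑ x y := hc ▸ rfl
    rw [strands_mem_crossings] at this
    nlinarith
  have f1 : ∀ a b, s(a, b) ≠ s(i, j) → (x a < x b ↔ y a < y b) := fun a b hab =>
    (strands_notMem_iff hx hy a b).mp (by rw [hc]; simpa using hab)
  have f2 : ∀ a b, (x a < x b + κ ↔ y a < y b + κ) := fun a b =>
    (ghost_notMem_iff hx hy a b).mp (by rw [hc]; simp)
  have f3 : ∀ a t, (x a < ϑ t ↔ y a < ϑ t) := fun a t =>
    (red_notMem_iff hx hy a t).mp (by rw [hc]; simp)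
  -- A third strand between `i` and `j` at the bottom would stay to the right of `i` and to the left
  -- of `j`, so `i` and `j` could not cross.
  have g1 : ∀ k, k ≠ i → k ≠ j → (x k < x i ↔ y k < y i) ∧ (x i < x k ↔ y i < y k) ∧
      (x k < x j ↔ y k < y j) ∧ (x j < x k ↔ y j < y k) := fun k hi hj =>
    ⟨f1 _ _ (by simp [hi, hj]), f1 _ _ (by simp [hi, hj]), f1 _ _ (by simp [hi, hj]),
      f1 _ _ (by simp [hi, hj])⟩
  have hinj : ∀ a b, a ≠ b → x a < x b ∨ x b < x a := fun a b h =>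
    (hx.strand_strand.ne h).lt_or_gt
  refine crossings_eq_empty_of_lt_iff hx (hy.comp _) (fun a b => ?_) (fun a b => ?_)
    (fun a t => ?_)
  · simp only [Function.comp_apply, Equiv.swap_apply_def]
    split_ifs <;> subst_vars
    · simp
    · exact iff_of_true hij hyij
    · have := g1 b ‹_› ‹_›; have := hinj b a; grind
    · exact iff_of_false hij.not_gt hyij.not_gt
    · simp
    · have := g1 b ‹_› ‹_›; have := hinj b a; grind
    · have := g1 a ‹_› ‹_›; have := hinj a b; grind
    · have := g1 a ‹_› ‹_›; have := hinj a b; grind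
    · exact f1 _ _ (by simp; tauto)
  · simp only [Function.comp_apply, Equiv.swap_apply_def]
    have e1 := f2 i j
    have e2 := f2 j i
    split_ifs <;> subst_vars
    · simp
    · grind
    · have := f2 a b; have := f2 j b; grind
    · grind
    · simp
    · have := f2 i b; have := f2 a b; grind
    · have := f2 a b; have := f2 a j; grind
    · have := f2 a i; have := f2 a b; grind
    · exact f2 _ _
  · simp only [Function.comp_apply, Equiv.swap_apply_def]
    have e1 := f3 i t
    have e2 := f3 j t
    split_ifs <;> subst_vars
    · grind
    · grind
    · exact f3 _ _

/-! ### Spanning sets -/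

theorem exists_perm_of_range_eq {α : Type*} {x y : Fin n → α} (hx : Function.Injective x)
    (hy : Function.Injective y) (h : Set.range x = Set.range y) :
    ∃ σ : Equiv.Perm (Fin n), x = y ∘ σ := by
  refine ⟨(Equiv.ofInjective x hx).trans ((Equiv.setCongr h).trans (Equiv.ofInjective y hy).symm),
    ?_⟩
  funext i
  simp only [Function.comp_apply, Equiv.trans_apply]
  exact (Equiv.apply_ofInjective_symm hy ((Equiv.setCongr h) ((Equiv.ofInjective x hx) i))).symm

section

variable {x₀ : Fin n → ℝ} {h₀ : Generic κ ϑ x₀}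

theorem Diag.mul_sq {N : ℕ} {y : Fin n → ℝ} {a : AffineWF κ ϑ q Q n} (h : Diag q Q h₀ N y a)
    (i : Fin n) (m : ℤ) : Diag q Q h₀ N y (a * sq q Q h₀ i m) := by
  induction h with
  | nil => rw [idem_mul_sq, ← sq_mul_idem]; exact .square h₀ i m .nil
  | free h hc _ ih => rw [mul_assoc]; exact .free h hc ih
  | cross h hc _ ih => rw [mul_assoc]; exact .cross h hc ih
  | square h i m _ ih => rw [mul_assoc]; exact .square h i m ih
  | relabel σ _ ih => exact .relabel σ ih

theorem low_mul_sq {N : ℕ} {y : Fin n → ℝ} {a : AffineWF κ ϑ q Q n} (h : a ∈ Low q Q h₀ N y)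
    (i : Fin n) (m : ℤ) : a * sq q Q h₀ i m ∈ Low q Q h₀ N y := by
  induction h using Submodule.span_induction with
  | mem a ha => obtain ⟨M, hM, h⟩ := ha; exact (h.mul_sq i m).mem_low hM
  | zero => rw [zero_mul]; exact Submodule.zero_mem _
  | add a b _ _ h1 h2 => rw [add_mul]; exact Submodule.add_mem _ h1 h2
  | smul r a _ h1 => rw [smul_mul_assoc]; exact Submodule.smul_mem _ r h1

/-- The exponents for which the squares pass `u` modulo `W'` are closed under addition. The exponent
`1` is given, and the exponent `-1` follows from it. -/
theorem commutator_mem_of_step {A : Type*} [Ring A] [Algebra R A] (W W' : Submodule R A)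
    (s t : ℤ → A) (u : A) (hs : ∀ a b, s a * s b = s (a + b)) (ht : ∀ a b, t a * t b = t (a + b))
    (hs0 : s 0 * u = u) (ht0 : u * t 0 = u)
    (hsW : ∀ m, ∀ w ∈ W', s m * w ∈ W') (htW : ∀ m, ∀ w ∈ W, t m * w ∈ W)
    (h1 : ∀ w ∈ W, (s 1 * u - u * t 1) * w ∈ W') (m : ℤ) :
    ∀ w ∈ W, (s m * u - u * t m) * w ∈ W' := by
  have step : ∀ a b, (∀ w ∈ W, (s a * u - u * t a) * w ∈ W') →
      (∀ w ∈ W, (s b * u - u * t b) * w ∈ W') →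
      ∀ w ∈ W, (s (a + b) * u - u * t (a + b)) * w ∈ W' := by
    intro a b ha hb w hw
    have : (s (a + b) * u - u * t (a + b)) * w =
        s a * ((s b * u - u * t b) * w) + (s a * u - u * t a) * (t b * w) := by
      rw [← hs, ← ht]; noncomm_ring
    rw [this]
    exact W'.add_mem (hsW a _ (hb w hw)) (ha _ (htW b w hw))
  -- Multiplying the commutator for `1` by the inverse squares on both sides gives minus the
  -- commutator for `-1`.
  have hneg : ∀ w ∈ W, (s (-1) * u - u * t (-1)) * w ∈ W' := by
    intro w hw
    have : (s (-1) * u - u * t (-1)) * w = -(s (-1) * ((s 1 * u - u * t 1) * (t (-1) * w))) := by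
      have e1 : s (-1) * (s 1 * u) = u := by rw [← mul_assoc, hs, neg_add_cancel, hs0]
      have e2 : u * t 1 * t (-1) = u := by rw [mul_assoc, ht, add_neg_cancel, ht0]
      calc (s (-1) * u - u * t (-1)) * w
          = s (-1) * (u * t 1 * t (-1)) * w - s (-1) * (s 1 * u) * t (-1) * w := by
            rw [e1, e2, sub_mul]
        _ = _ := by noncomm_ring
    rw [this]
    exact W'.neg_mem (hsW _ _ (h1 _ (htW _ _ hw)))
  induction m using Int.induction_on with
  | zero =>
    intro w _
    rw [hs0, ht0, sub_self, zero_mul]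
    exact W'.zero_mem
  | succ k ih => exact step _ _ ih h1
  | pred k ih => exact sub_eq_add_neg (-(k : ℤ)) 1 ▸ step _ _ ih hneg

theorem commutator_mul_split {A : Type*} [Ring A] (s s' t u a : A) :
    s * (u * a) - u * a * t = (s * u - u * s') * a + u * (s' * a - a * t) := by
  noncomm_ring

theorem mul_commutator_split {A : Type*} [Ring A] (s t g u : A) :
    s * (g * u) = g * (t * u) + (s * g - g * t) * u := by
  noncomm_ring

theorem sub_neg_comm_mul {A : Type*} [Ring A] (a b c w : A) (h : b - a = c) :
    (a - b) * w = -(c * w) := by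
  rw [← neg_sub b a, h, neg_mul]

/-- Squares pass through a crossing modulo diagrams with less crossings. -/
theorem sq_cross_mem_low {N : ℕ} {y z : Fin n → ℝ} {c : Crossing n}
    (h : IsSlice κ ϑ y z) (hc : crossings κ ϑ y z = {c}) (i : Fin n) (m : ℤ)
    {a : AffineWF κ ϑ q Q n} (ha : a ∈ Low q Q h₀ N y) :
    (sq q Q h.top i m * sl q Q h - sl q Q h * sq q Q h.bottom i m) * a ∈ Low q Q h₀ N z := by
  by_cases hi : ∀ j, Crossing.strands s(i, j) ∉ crossings κ ϑ y z
  · rw [sq_slide h i m hi, sub_self, zero_mul]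
    exact Submodule.zero_mem _
  push Not at hi
  obtain ⟨j, hj⟩ := hi
  have hij : i ≠ j := ne_of_strands_mem hj
  rw [hc, Set.mem_singleton_iff] at hj
  subst hj
  refine commutator_mem_of_step (Low q Q h₀ N y) (Low q Q h₀ N z) (sq q Q h.top i)
    (sq q Q h.bottom i) (sl q Q h) (sq_mul_sq _ _) (sq_mul_sq _ _) ?_ ?_
    (fun m w hw => low_sq _ _ _ hw) (fun m w hw => low_sq _ _ _ hw) ?_ m a ha
  · rw [sq_zero, sl_top_mul]
  · rw [sq_zero, sl_mul_bottom]
  intro w hw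
  have hs := crossings_swap_eq_empty h.bottom h.top hc
  have hs' := isSlice_of_empty h.bottom (h.top.comp _) hs
  have hlow : sl q Q hs' * w ∈ Low q Q h₀ N z := by
    have := low_free hs' hs hw
    rwa [low_comp] at this
  rcases (h.bottom.strand_strand.ne hij).lt_or_gt with hlt | hlt
  · have := RingQuot.mkAlgHom_rel R (Rel.square_cross_right (q := q) (Q := Q) h hc hlt hs')
    simp only [map_mul, map_sub, mk_slice, mk_square] at this
    rw [sub_neg_comm_mul _ _ _ _ this]
    exact Submodule.neg_mem _ hlow
  · have hs'' : IsSlice κ ϑ y (z ∘ Equiv.swap j i) := by rwa [Equiv.swap_comm]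
    have := RingQuot.mkAlgHom_rel R (Rel.square_cross_left (q := q) (Q := Q) (i := j) (j := i) h
      (by rw [hc, Sym2.eq_swap]) hlt hs'')
    simp only [map_mul, map_sub, mk_slice, mk_square] at this
    rw [this]
    convert hlow using 4
    rw [Equiv.swap_comm]

/-- Sliding a square down through the gallery, each crossing contributes an error in which this
crossing is resolved. -/
theorem Gal.sq_mul_sub_mem {N : ℕ} {y : Fin n → ℝ} {g : AffineWF κ ϑ q Q n}
    (hg : Gal q Q h₀ N y g) (hy : Generic κ ϑ y) (i : Fin n) (m : ℤ) :
    sq q Q hy i m * g - g * sq q Q h₀ i m ∈ Low q Q h₀ N y := by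
  induction hg with
  | nil =>
    rw [sq_mul_idem, idem_mul_sq, sub_self]
    exact Submodule.zero_mem _
  | @free N y z a h hc ha ih =>
    have h1 : sq q Q h.top i m * sl q Q h = sl q Q h * sq q Q h.bottom i m :=
      sq_slide h i m (by simp [hc])
    rw [← mul_assoc, h1, mul_assoc, mul_assoc, ← mul_sub]
    exact low_free h hc (ih h.bottom)
  | @cross N y z a c h hc ha ih =>
    have h1 : sq q Q hy i m * (sl q Q h * a) - sl q Q h * a * sq q Q h₀ i m =
        (sq q Q h.top i m * sl q Q h - sl q Q h * sq q Q h.bottom i m) * a +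
        sl q Q h * (sq q Q h.bottom i m * a - a * sq q Q h₀ i m) :=
      commutator_mul_split _ _ _ _ _
    rw [h1]
    exact Submodule.add_mem _ (sq_cross_mem_low h hc i m (ha.diag.mem_low (Nat.lt_succ_self _)))
      (low_cross h hc (ih h.bottom))

variable (q Q h₀) in
/-- The products of squares at the configuration `x₀`. -/
def sqMonoid : Submonoid (AffineWF κ ϑ q Q n) :=
  Submonoid.closure {a | ∃ i m, a = sq q Q h₀ i m}

theorem mem_of_mul_sqMonoid {W : Submodule R (AffineWF κ ϑ q Q n)}
    (hW : ∀ a ∈ W, ∀ i m, a * sq q Q h₀ i m ∈ W) {u : AffineWF κ ϑ q Q n}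
    (hu : u ∈ sqMonoid q Q h₀) : ∀ a ∈ W, a * u ∈ W := by
  refine Submonoid.closure_induction (motive := fun u _ => ∀ a ∈ W, a * u ∈ W) ?_ ?_ ?_ hu
  · rintro _ ⟨i, m, rfl⟩ a ha
    exact hW a ha i m
  · intro a ha
    rwa [mul_one]
  · intro u v _ _ h1 h2 a ha
    rw [← mul_assoc]
    exact h2 _ (h1 _ ha)

variable (q Q h₀) in
/-- The span of the galleries with `N` crossings multiplied by squares at the bottom. -/
def GalSpan (N : ℕ) (y : Fin n → ℝ) : Submodule R (AffineWF κ ϑ q Q n) :=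
  Submodule.span R {a | ∃ (σ : Equiv.Perm (Fin n)) (g u : AffineWF κ ϑ q Q n),
    Gal q Q h₀ N (y ∘ σ) g ∧ u ∈ sqMonoid q Q h₀ ∧ a = g * u}

theorem galSpan_comp {N : ℕ} (y : Fin n → ℝ) (σ : Equiv.Perm (Fin n)) :
    GalSpan q Q h₀ N y ≤ GalSpan q Q h₀ N (y ∘ σ) := by
  refine Submodule.span_mono ?_
  rintro a ⟨τ, g, u, hg, hu, rfl⟩
  refine ⟨σ⁻¹ * τ, g, u, ?_, hu, rfl⟩
  convert hg using 1
  funext i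
  simp

/-- Every diagram is, modulo diagrams with less crossings, a gallery with squares at the bottom. -/
theorem Diag.mem_sup {N : ℕ} {y : Fin n → ℝ} {a : AffineWF κ ϑ q Q n} (h : Diag q Q h₀ N y a) :
    a ∈ GalSpan q Q h₀ N y ⊔ Low q Q h₀ N y := by
  -- Left multiplication by `b` has to be checked only on galleries with squares at the bottom,
  -- provided that it respects the lower terms.
  have lift : ∀ {N N' : ℕ} {y z : Fin n → ℝ} (b : AffineWF κ ϑ q Q n),
      (∀ c, (∃ (σ : Equiv.Perm (Fin n)) (g u : AffineWF κ ϑ q Q n),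
        Gal q Q h₀ N (y ∘ σ) g ∧ u ∈ sqMonoid q Q h₀ ∧ c = g * u) →
          b * c ∈ GalSpan q Q h₀ N' z ⊔ Low q Q h₀ N' z) →
      (∀ c ∈ Low q Q h₀ N y, b * c ∈ Low q Q h₀ N' z) →
      ∀ a ∈ GalSpan q Q h₀ N y ⊔ Low q Q h₀ N y, b * a ∈ GalSpan q Q h₀ N' z ⊔ Low q Q h₀ N' z := by
    intro N N' y z b h1 h2 a ha
    obtain ⟨c, hc, d, hd, rfl⟩ := Submodule.mem_sup.mp ha
    rw [mul_add]
    exact Submodule.add_mem _ (mul_mem_span h1 hc) (Submodule.mem_sup_right (h2 d hd))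
  induction h with
  | nil =>
    exact Submodule.mem_sup_left (Submodule.subset_span ⟨1, _, 1, .nil, one_mem _, (mul_one _).symm⟩)
  | @free N y z a h hc ha ih =>
    refine lift _ ?_ (fun c hc' => low_free h hc hc') a ih
    rintro _ ⟨σ, g, u, hg, hu, rfl⟩
    rw [← mul_assoc, ← sl_comp σ h]
    exact Submodule.mem_sup_left (Submodule.subset_span
      ⟨σ, _, u, hg.free (h.comp σ) (crossings_comp_eq_empty σ hc), hu, rfl⟩)
  | @cross N y z a c h hc ha ih =>
    refine lift _ ?_ (fun c hc' => low_cross h hc hc') a ih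
    rintro _ ⟨σ, g, u, hg, hu, rfl⟩
    rw [← mul_assoc, ← sl_comp σ h]
    have hc' := crossings_comp_eq_singleton σ (c := c.map σ⁻¹) (by rw [hc, map_map_inv])
    exact Submodule.mem_sup_left (Submodule.subset_span
      ⟨σ, _, u, hg.cross (h.comp σ) hc', hu, rfl⟩)
  | @square N y a h i m ha ih =>
    refine lift _ ?_ (fun c hc' => low_sq h i m hc') a ih
    rintro _ ⟨σ, g, u, hg, hu, rfl⟩
    -- In the labelling in which the gallery ends, the strand `i` is called `σ⁻¹ i`, and this is its
    -- label at the bottom.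
    have h1 : sq q Q h i m = sq q Q (h.comp σ) (σ⁻¹ i) m := by
      rw [sq_comp (h := h)]; simp
    have h2 := hg.sq_mul_sub_mem (h.comp σ) (σ⁻¹ i) m
    have h3 : sq q Q h i m * (g * u) = g * (sq q Q h₀ (σ⁻¹ i) m * u) +
        (sq q Q (h.comp σ) (σ⁻¹ i) m * g - g * sq q Q h₀ (σ⁻¹ i) m) * u := by
      rw [h1]; exact mul_commutator_split _ _ _ _
    rw [h3]
    refine Submodule.add_mem _ (Submodule.mem_sup_left (Submodule.subset_span
      ⟨σ, g, _, hg, mul_mem (Submonoid.subset_closure ⟨_, _, rfl⟩) hu, rfl⟩))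
      (Submodule.mem_sup_right ?_)
    rw [low_comp] at h2
    exact mem_of_mul_sqMonoid (fun a ha i m => low_mul_sq ha i m) hu _ h2
  | @relabel N y a σ ha ih =>
    rw [low_comp]
    exact sup_le_sup_right (galSpan_comp y σ) _ ih

/-- A space of diagrams from `x₀` to `y` is everything if it contains, for every way to connect the
end points, a diagram with the minimal number of crossings, and is closed under multiplication by
squares. -/
theorem Diag.mem_of_gal (hκ : κ ≠ 0) {y : Fin n → ℝ} {V : Submodule R (AffineWF κ ϑ q Q n)}
    (hV : ∀ a ∈ V, ∀ i m, a * sq q Q h₀ i m ∈ V)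
    (hG : ∀ σ : Equiv.Perm (Fin n), ∃ g ∈ V,
      Gal q Q h₀ ((arr n hκ ϑ).sep x₀ (y ∘ σ)).card (y ∘ σ) g)
    {N : ℕ} {a : AffineWF κ ϑ q Q n} (ha : Diag q Q h₀ N y a) : a ∈ V := by
  induction N using Nat.strong_induction_on generalizing a with
  | _ N ih =>
  have hlow : Low q Q h₀ N y ≤ V := Submodule.span_le.mpr fun b ⟨M, hM, hb⟩ => ih M hM hb
  refine (sup_le ?_ hlow : GalSpan q Q h₀ N y ⊔ Low q Q h₀ N y ≤ V) ha.mem_sup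
  refine Submodule.span_le.mpr ?_
  rintro _ ⟨σ, g, u, hg, hu, rfl⟩
  have hlow' : ∀ b ∈ Low q Q h₀ N (y ∘ σ), b * u ∈ V := fun b hb => hlow (by
    rw [low_comp] at hb
    exact mem_of_mul_sqMonoid (fun a ha i m => low_mul_sq ha i m) hu _ hb)
  -- A minimal gallery differs from the given one in `V` by fewer crossings, and any other gallery
  -- is itself a combination of diagrams with fewer crossings.
  by_cases hN : ((arr n hκ ϑ).sep x₀ (y ∘ σ)).card = N
  · obtain ⟨g', hg', hgal⟩ := hG σ
    have h1 := hlow' _ ((straighten_aux hκ N (y ∘ σ)).2 g g' hg (hN ▸ hgal) hN)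
    have h2 := V.add_mem h1 (mem_of_mul_sqMonoid hV hu _ hg')
    rwa [← add_mul, sub_add_cancel] at h2
  · exact hlow' _ ((straighten_aux hκ N (y ∘ σ)).1 g hg hN)

theorem affineIdem_mul_of_ne {x y : Fin n → ℝ} (hx : Generic κ ϑ x) (hy : Generic κ ϑ y)
    (h : Set.range y ≠ Set.range x) : affineIdem q Q hx * affineIdem q Q hy = 0 :=
  sl_mul_sl_of_ne hy.isSlice hx.isSlice h

theorem Diag.of_range_eq {N : ℕ} {y z : Fin n → ℝ} {a : AffineWF κ ϑ q Q n}
    (h : Diag q Q h₀ N y a) (hz : Generic κ ϑ z) (he : Set.range y = Set.range z) :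
    Diag q Q h₀ N z a := by
  obtain ⟨σ, rfl⟩ := exists_perm_of_range_eq hz.strand_strand h.generic.strand_strand he.symm
  exact h.relabel σ

theorem Diag.idem_mul_of_ne {N : ℕ} {y z : Fin n → ℝ} {a : AffineWF κ ϑ q Q n}
    (h : Diag q Q h₀ N y a) (hz : Generic κ ϑ z) (he : Set.range y ≠ Set.range z) :
    affineIdem q Q hz * a = 0 := by
  rw [← h.idem_mul h.generic, ← mul_assoc, affineIdem_mul_of_ne hz h.generic he, zero_mul]

/-- Everything that starts at `x₀` is a linear combination of diagrams. -/
theorem mul_idem_mem_span (a : AffineWF κ ϑ q Q n) :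
    a * affineIdem q Q h₀ ∈ Submodule.span R {b | ∃ N y, Diag q Q h₀ N y b} := by
  set W : Submodule R (AffineWF κ ϑ q Q n) := Submodule.span R {b | ∃ N y, Diag q Q h₀ N y b}
    with hW
  obtain ⟨a, rfl⟩ := RingQuot.mkAlgHom_surjective R (Rel κ ϑ q Q n) a
  -- The span is a left ideal, which is checked on generators; products whose end points do not
  -- match vanish.
  suffices h : ∀ w ∈ W, RingQuot.mkAlgHom R (Rel κ ϑ q Q n) a * w ∈ W from
    h _ (Submodule.subset_span ⟨0, x₀, .nil⟩)
  induction a using FreeAlgebra.induction with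
  | grade0 r =>
    intro w hw
    rw [AlgHom.commutes, ← Algebra.smul_def]
    exact W.smul_mem r hw
  | add a b h1 h2 =>
    intro w hw
    rw [map_add, add_mul]
    exact W.add_mem (h1 w hw) (h2 w hw)
  | mul a b h1 h2 =>
    intro w hw
    rw [map_mul, mul_assoc]
    exact h1 _ (h2 w hw)
  | grade1 c =>
    intro w hw
    refine mul_mem_span ?_ hw
    rintro b ⟨N, y, hb⟩
    cases c with
    | slice u v h =>
      change sl q Q h * b ∈ W
      by_cases he : Set.range y = Set.range u
      · have hb' := hb.of_range_eq h.bottom he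
        rcases h.at_most_one.eq_empty_or_singleton with hc | ⟨c, hc⟩
        · exact Submodule.subset_span ⟨_, _, hb'.free h hc⟩
        · exact Submodule.subset_span ⟨_, _, hb'.cross h hc⟩
      · rw [← sl_mul_bottom h, mul_assoc, hb.idem_mul_of_ne h.bottom he, mul_zero]
        exact W.zero_mem
    | square x h i m =>
      change sq q Q h i m * b ∈ W
      by_cases he : Set.range y = Set.range x
      · exact Submodule.subset_span ⟨_, _, (hb.of_range_eq h he).square h i m⟩
      · rw [← sq_mul_idem h, mul_assoc, hb.idem_mul_of_ne h he, mul_zero]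
        exact W.zero_mem

/-- The working form of the spanning theorem. It bounds the size of the corner, shows that the
affine Hecke algebra maps onto it, and factors diagrams that start or end far to the left through
one chosen diagram. -/
theorem corner_mem_of_gal (hκ : κ ≠ 0) {y : Fin n → ℝ} (hy : Generic κ ϑ y)
    {V : Submodule R (AffineWF κ ϑ q Q n)} (hV : ∀ a ∈ V, ∀ i m, a * sq q Q h₀ i m ∈ V)
    (hG : ∀ σ : Equiv.Perm (Fin n), ∃ g ∈ V,
      Gal q Q h₀ ((arr n hκ ϑ).sep x₀ (y ∘ σ)).card (y ∘ σ) g)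
    (a : AffineWF κ ϑ q Q n) : affineIdem q Q hy * (a * affineIdem q Q h₀) ∈ V := by
  refine mul_mem_span ?_ (mul_idem_mem_span (h₀ := h₀) a)
  rintro b ⟨N, z, hb⟩
  by_cases he : Set.range z = Set.range y
  · have hb' := hb.of_range_eq hy he
    rw [hb'.idem_mul hy]
    exact hb'.mem_of_gal hκ hV hG
  · rw [hb.idem_mul_of_ne hy he]
    exact V.zero_mem

end

end

/-! ### Divided difference operators on functions on the symmetric group -/

section

variable (R : Type*) [CommRing R] {K : Type*} [Field K] [Algebra R K] {n : ℕ} (X : Fin n → K)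

/-- The variables attached to the strands if the strands are labelled by `σ`. -/
def vars (σ : Equiv.Perm (Fin n)) : Fin n → K := fun i => X (σ⁻¹ i)

theorem vars_mul (g σ : Equiv.Perm (Fin n)) (i : Fin n) :
    vars X (g * σ) i = vars X σ (g⁻¹ i) := by
  simp [vars]

theorem vars_swap_mul (i j : Fin n) (σ : Equiv.Perm (Fin n)) :
    vars X (Equiv.swap i j * σ) = vars X σ ∘ Equiv.swap i j := by
  funext k
  rw [vars_mul, Equiv.swap_inv]
  rfl

/-- Multiplication by a function of the variables. -/
def mulOp (m : (Fin n → K) → K) : (Equiv.Perm (Fin n) → K) →ₗ[R] (Equiv.Perm (Fin n) → K) where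
  toFun F σ := m (vars X σ) * F σ
  map_add' F G := by funext σ; exact mul_add _ _ _
  map_smul' r F := by funext σ; exact mul_smul_comm _ _ _

/-- The divided difference operator for the strands `i` and `j`. -/
def divDiff (i j : Fin n) : (Equiv.Perm (Fin n) → K) →ₗ[R] (Equiv.Perm (Fin n) → K) where
  toFun F σ := (F σ - F (Equiv.swap i j * σ)) / (vars X σ i - vars X σ j)
  map_add' F G := by funext σ; simp only [Pi.add_apply]; ring
  map_smul' r F := by
    funext σ
    simp only [Pi.smul_apply, RingHom.id_apply, Algebra.smul_def]
    ring

theorem mulOp_apply (m : (Fin n → K) → K) (F : Equiv.Perm (Fin n) → K) (σ : Equiv.Perm (Fin n)) :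
    mulOp R X m F σ = m (vars X σ) * F σ := rfl

theorem divDiff_apply (i j : Fin n) (F : Equiv.Perm (Fin n) → K) (σ : Equiv.Perm (Fin n)) :
    divDiff R X i j F σ = (F σ - F (Equiv.swap i j * σ)) / (vars X σ i - vars X σ j) := rfl

theorem mulOp_mul (m m' : (Fin n → K) → K) (F : Equiv.Perm (Fin n) → K) :
    mulOp R X m (mulOp R X m' F) = mulOp R X (fun ξ => m ξ * m' ξ) F := by
  funext σ; simp only [mulOp_apply]; ring

theorem mulOp_one (F : Equiv.Perm (Fin n) → K) : mulOp R X (fun _ => 1) F = F := by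
  funext σ; simp only [mulOp_apply, one_mul]

/-- A multiplier symmetric in the two strands passes through the divided difference. The separate
names `m` and `m'` allow the multiplier to be written differently on the two sides. -/
theorem divDiff_mulOp {i j : Fin n} {m m' : (Fin n → K) → K} (h : ∀ ξ, m ξ = m' ξ)
    (h' : ∀ ξ, m (ξ ∘ Equiv.swap i j) = m' ξ) (F : Equiv.Perm (Fin n) → K) :
    divDiff R X i j (mulOp R X m F) = mulOp R X m' (divDiff R X i j F) := by
  have h'' : ∀ ξ, m' (ξ ∘ Equiv.swap i j) = m' ξ := fun ξ => by rw [← h, h']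
  funext σ
  simp only [divDiff_apply, mulOp_apply, vars_swap_mul, h, h'']
  ring

theorem divDiff_sq (i j : Fin n) (F : Equiv.Perm (Fin n) → K) :
    divDiff R X i j (divDiff R X i j F) = 0 := by
  funext σ
  simp only [divDiff_apply, vars_swap_mul, Function.comp_apply, Equiv.swap_apply_left,
    Equiv.swap_apply_right, Pi.zero_apply, ← mul_assoc, Equiv.swap_mul_self, one_mul]
  rw [← neg_sub (vars X σ i) (vars X σ j), div_neg]
  ring

theorem divDiff_symm (i j : Fin n) (F : Equiv.Perm (Fin n) → K) :
    divDiff R X j i F = -divDiff R X i j F := by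
  funext σ
  simp only [divDiff_apply, Pi.neg_apply]
  rw [← neg_sub (vars X σ i) (vars X σ j), div_neg, Equiv.swap_comm]

theorem divDiff_sq' (i j : Fin n) (F : Equiv.Perm (Fin n) → K) :
    divDiff R X j i (divDiff R X i j F) = 0 := by
  rw [divDiff_symm, divDiff_sq, neg_zero]

theorem swap_mul_swap_of_disjoint {i j k l : Fin n} (hik : i ≠ k) (hil : i ≠ l) (hjk : j ≠ k)
    (hjl : j ≠ l) : Equiv.swap i j * Equiv.swap k l = Equiv.swap k l * Equiv.swap i j := by
  rw [Equiv.mul_swap_eq_swap_mul, Equiv.swap_apply_of_ne_of_ne hik.symm hjk.symm,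
    Equiv.swap_apply_of_ne_of_ne hil.symm hjl.symm]

theorem divDiff_comm {i j k l : Fin n} (hik : i ≠ k) (hil : i ≠ l) (hjk : j ≠ k)
    (hjl : j ≠ l) (F : Equiv.Perm (Fin n) → K) :
    divDiff R X i j (divDiff R X k l F) = divDiff R X k l (divDiff R X i j F) := by
  funext σ
  simp only [divDiff_apply, vars_swap_mul, Function.comp_apply,
    Equiv.swap_apply_of_ne_of_ne hik hil, Equiv.swap_apply_of_ne_of_ne hjk hjl,
    Equiv.swap_apply_of_ne_of_ne hik.symm hjk.symm, Equiv.swap_apply_of_ne_of_ne hil.symm hjl.symm,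
    ← mul_assoc, swap_mul_swap_of_disjoint hik hil hjk hjl]
  ring

variable {X}

theorem vars_sub_ne_zero (hX : Function.Injective X) (σ : Equiv.Perm (Fin n)) {i j : Fin n}
    (h : i ≠ j) : vars X σ i - vars X σ j ≠ 0 :=
  sub_ne_zero.mpr fun he => h (σ⁻¹.injective (hX he))

/-- Both sides are combinations of the six values of `F` on translates by permutations of the three
strands. Once the words in the transpositions are brought to common normal forms, an identity of
rational functions remains. -/
theorem divDiff_braid (hX : Function.Injective X) {i j k : Fin n} (hij : i ≠ j) (hik : i ≠ k)
    (hjk : j ≠ k) (F : Equiv.Perm (Fin n) → K) :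
    divDiff R X j k (divDiff R X i k (divDiff R X i j F)) =
      divDiff R X i j (divDiff R X i k (divDiff R X j k F)) := by
  funext σ
  have e1 : Equiv.swap i j * Equiv.swap i k = Equiv.swap j k * Equiv.swap i j := by
    rw [Equiv.mul_swap_eq_swap_mul, Equiv.swap_apply_left, Equiv.swap_apply_of_ne_of_ne hik.symm hjk.symm]
  have e2 : Equiv.swap i k * Equiv.swap j k = Equiv.swap j k * Equiv.swap i j := by
    rw [Equiv.mul_swap_eq_swap_mul, Equiv.swap_apply_of_ne_of_ne hij.symm hjk, Equiv.swap_apply_right,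
      Equiv.swap_comm j i, e1]
  have e3 : Equiv.swap j k * Equiv.swap i k = Equiv.swap i j * Equiv.swap j k := by
    have := congrArg (fun g => g⁻¹) e2
    simpa using this
  have e4 : Equiv.swap i k * Equiv.swap i j = Equiv.swap i j * Equiv.swap j k := by
    have := congrArg (fun g => g⁻¹) e1
    simpa using this
  have e5 : Equiv.swap j k * (Equiv.swap i j * Equiv.swap j k) = Equiv.swap i k := by
    rw [← e3, ← mul_assoc, Equiv.swap_mul_self, one_mul]
  have e6 : Equiv.swap i j * (Equiv.swap j k * Equiv.swap i j) = Equiv.swap i k := by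
    rw [← e1, ← mul_assoc, Equiv.swap_mul_self, one_mul]
  have e9 := (mul_assoc _ _ _).trans e5
  have e10 := (mul_assoc _ _ _).trans e6
  have n1 := vars_sub_ne_zero hX σ hij
  have n2 := vars_sub_ne_zero hX σ hik
  have n3 := vars_sub_ne_zero hX σ hjk
  have n1' := vars_sub_ne_zero hX σ hij.symm
  have n2' := vars_sub_ne_zero hX σ hik.symm
  have n3' := vars_sub_ne_zero hX σ hjk.symm
  simp only [divDiff_apply, vars_swap_mul, Function.comp_apply, Equiv.swap_apply_left,
    Equiv.swap_apply_right, Equiv.swap_apply_of_ne_of_ne hij hik,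
    Equiv.swap_apply_of_ne_of_ne hij.symm hjk, Equiv.swap_apply_of_ne_of_ne hik.symm hjk.symm]
  simp only [← mul_assoc]
  simp only [e1, e2, e3, e4, e9, e10]
  field_simp
  ring

end

/-! ### The operators attached to slices -/

section

variable {n ℓ : ℕ} (κ : ℝ) (ϑ : Fin ℓ → ℝ)

/-- The strands are in the same position with respect to ghosts and red lines. -/
structure SameSides (x y : Fin n → ℝ) : Prop where
  ghost : ∀ i j, x i < x j + κ ↔ y i < y j + κ
  red : ∀ i t, x i < ϑ t ↔ y i < ϑ t

/-- Everything is in the same order. -/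
structure Sim (x y : Fin n → ℝ) : Prop extends SameSides κ ϑ x y where
  strands : ∀ i j, x i < x j ↔ y i < y j

/-- Two generic configurations with exactly one crossing between them. -/
structure Step (x y : Fin n → ℝ) (c : Crossing n) : Prop where
  bottom : Generic κ ϑ x
  top : Generic κ ϑ y
  crossings_eq : crossings κ ϑ x y = {c}

variable {κ ϑ}

theorem SameSides.refl (x : Fin n → ℝ) : SameSides κ ϑ x x := ⟨fun _ _ => Iff.rfl, fun _ _ => Iff.rfl⟩

theorem SameSides.symm {x y : Fin n → ℝ} (h : SameSides κ ϑ x y) : SameSides κ ϑ y x :=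
  ⟨fun i j => (h.ghost i j).symm, fun i t => (h.red i t).symm⟩

theorem SameSides.trans {x y z : Fin n → ℝ} (h : SameSides κ ϑ x y) (h' : SameSides κ ϑ y z) :
    SameSides κ ϑ x z :=
  ⟨fun i j => (h.ghost i j).trans (h'.ghost i j), fun i t => (h.red i t).trans (h'.red i t)⟩

theorem SameSides.comp {x y : Fin n → ℝ} (h : SameSides κ ϑ x y) (σ : Equiv.Perm (Fin n)) :
    SameSides κ ϑ (x ∘ σ) (y ∘ σ) :=
  ⟨fun i j => h.ghost (σ i) (σ j), fun i t => h.red (σ i) t⟩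

theorem Sim.refl (x : Fin n → ℝ) : Sim κ ϑ x x := ⟨.refl x, fun _ _ => Iff.rfl⟩

theorem Sim.symm {x y : Fin n → ℝ} (h : Sim κ ϑ x y) : Sim κ ϑ y x :=
  ⟨h.toSameSides.symm, fun i j => (h.strands i j).symm⟩

theorem sim_of_crossings_eq_empty {x y : Fin n → ℝ} (hx : Generic κ ϑ x) (hy : Generic κ ϑ y)
    (h : crossings κ ϑ x y = ∅) : Sim κ ϑ x y where
  ghost i j := (ghost_notMem_iff hx hy i j).mp (by rw [h]; simp)
  red i t := (red_notMem_iff hx hy i t).mp (by rw [h]; simp)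
  strands i j := (strands_notMem_iff hx hy i j).mp (by rw [h]; simp)

theorem Sim.crossings_eq_empty {x y : Fin n → ℝ} (h : Sim κ ϑ x y) (hx : Generic κ ϑ x)
    (hy : Generic κ ϑ y) : crossings κ ϑ x y = ∅ :=
  crossings_eq_empty_of_lt_iff hx hy h.strands h.ghost h.red

theorem Step.symm {x y : Fin n → ℝ} {c : Crossing n} (h : Step κ ϑ x y c) : Step κ ϑ y x c :=
  ⟨h.top, h.bottom, by rw [crossings_comm, h.crossings_eq]⟩

theorem Step.isSlice {x y : Fin n → ℝ} {c : Crossing n} (h : Step κ ϑ x y c) : IsSlice κ ϑ x y :=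
  isSlice_of_singleton h.bottom h.top h.crossings_eq

theorem Step.strands {x y : Fin n → ℝ} {c : Crossing n} (h : Step κ ϑ x y c) (i j : Fin n) :
    (x i < x j ↔ y i < y j) ↔ c ≠ .strands s(i, j) := by
  rw [← strands_notMem_iff h.bottom h.top, h.crossings_eq, Set.mem_singleton_iff, ne_comm]

theorem Step.ghost {x y : Fin n → ℝ} {c : Crossing n} (h : Step κ ϑ x y c) (i j : Fin n) :
    (x i < x j + κ ↔ y i < y j + κ) ↔ c ≠ .ghost i j := by
  rw [← ghost_notMem_iff h.bottom h.top, h.crossings_eq, Set.mem_singleton_iff, ne_comm]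

theorem Step.red {x y : Fin n → ℝ} {c : Crossing n} (h : Step κ ϑ x y c) (i : Fin n) (t : Fin ℓ) :
    (x i < ϑ t ↔ y i < ϑ t) ↔ c ≠ .red i (ϑ t) := by
  rw [← red_notMem_iff h.bottom h.top, h.crossings_eq, Set.mem_singleton_iff, ne_comm]

theorem Step.comp {x y : Fin n → ℝ} {c : Crossing n} (h : Step κ ϑ x y c)
    (σ : Equiv.Perm (Fin n)) : Step κ ϑ (x ∘ σ) (y ∘ σ) (c.map σ⁻¹) :=
  ⟨h.bottom.comp σ, h.top.comp σ,
    crossings_comp_eq_singleton σ (by rw [map_map_inv, h.crossings_eq])⟩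

theorem Step.ne_of_strands {x y : Fin n → ℝ} {i j : Fin n}
    (h : Step κ ϑ x y (.strands s(i, j))) : i ≠ j :=
  ne_of_strands_mem (h.crossings_eq ▸ rfl : _ ∈ crossings κ ϑ x y)

theorem Step.ne_of_ghost {x y : Fin n → ℝ} {i j : Fin n}
    (h : Step κ ϑ x y (.ghost i j)) : i ≠ j :=
  ne_of_ghost_mem (h.crossings_eq ▸ rfl : _ ∈ crossings κ ϑ x y)

theorem Step.sim_swap {x y : Fin n → ℝ} {i j : Fin n} (h : Step κ ϑ x y (.strands s(i, j))) :
    Sim κ ϑ x (y ∘ Equiv.swap i j) :=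
  sim_of_crossings_eq_empty h.bottom (h.top.comp _)
    (crossings_swap_eq_empty h.bottom h.top h.crossings_eq)

theorem Step.swap_sim {x y : Fin n → ℝ} {i j : Fin n} (h : Step κ ϑ x y (.strands s(i, j))) :
    Sim κ ϑ (x ∘ Equiv.swap i j) y :=
  h.symm.sim_swap.symm

theorem Step.sameSides {x y : Fin n → ℝ} {p : Sym2 (Fin n)} (h : Step κ ϑ x y (.strands p)) :
    SameSides κ ϑ x y :=
  ⟨fun i j => (h.ghost i j).mpr (by simp), fun i t => (h.red i t).mpr (by simp)⟩

theorem Step.exists_lt {x y : Fin n → ℝ} {p : Sym2 (Fin n)} (h : Step κ ϑ x y (.strands p)) :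
    ∃ i j, p = s(i, j) ∧ x i < x j := by
  induction p with
  | _ i j =>
  rcases (h.bottom.strand_strand.ne h.ne_of_strands).lt_or_gt with h1 | h1
  · exact ⟨i, j, rfl, h1⟩
  · exact ⟨j, i, Sym2.eq_swap, h1⟩

end

section

variable {R : Type*} [CommRing R] {K : Type*} [Field K] [Algebra R K] {n ℓ : ℕ}
  (κ : ℝ) (ϑ : Fin ℓ → ℝ) (q : R) (Q : Fin ℓ → R) (X : Fin n → K)

/-- The product of the factors contributed by the crossings with ghosts and red lines. -/
def coef (x y : Fin n → ℝ) (ξ : Fin n → K) : K :=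
  -- Only one direction of each crossing carries the factor of its bigon: a strand passing a ghost
  -- from left to right, and a strand passing a red line from right to left.
  (∏ i, ∏ j, if x i < x j + κ ∧ ¬ y i < y j + κ then ξ i - algebraMap R K q * ξ j else 1) *
    ∏ i, ∏ t, if ¬ x i < ϑ t ∧ y i < ϑ t then ξ i - algebraMap R K (Q t) else 1

/-- The pairs of strands that cross. -/
def crossingPairs (x y : Fin n → ℝ) : Finset (Fin n × Fin n) :=
  Finset.univ.filter fun p => x p.1 < x p.2 ∧ ¬ y p.1 < y p.2

open Classical in
/-- The operator of a slice. -/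
def sliceOp (x y : Fin n → ℝ) : (Equiv.Perm (Fin n) → K) →ₗ[R] (Equiv.Perm (Fin n) → K) :=
  mulOp R X (coef κ ϑ q Q x y) ∘ₗ
    -- In a slice at most one pair of strands crosses, and the sum picks it out with the strand on
    -- the left at the bottom first.
    if crossingPairs x y = ∅ then LinearMap.id else ∑ p ∈ crossingPairs x y, divDiff R X p.1 p.2

variable {κ ϑ q Q X}

theorem coef_congr {x x' y y' : Fin n → ℝ} (hx : SameSides κ ϑ x x') (hy : SameSides κ ϑ y y') :
    coef (K := K) κ ϑ q Q x y = coef κ ϑ q Q x' y' := by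
  funext ξ
  simp only [coef, hx.ghost, hx.red, hy.ghost, hy.red]

theorem coef_eq_one {x y : Fin n → ℝ} (h : SameSides κ ϑ x y) (ξ : Fin n → K) :
    coef κ ϑ q Q x y ξ = 1 := by
  simp only [coef, h.ghost, h.red, and_not_self, not_and_self, if_false, Finset.prod_const_one,
    mul_one]

theorem coef_comp (x y : Fin n → ℝ) (ξ : Fin n → K) (σ : Equiv.Perm (Fin n)) :
    coef κ ϑ q Q (x ∘ σ) (y ∘ σ) (ξ ∘ σ) = coef κ ϑ q Q x y ξ := by
  unfold coef
  congr 1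
  · refine Fintype.prod_equiv σ _ _ fun i => Fintype.prod_equiv σ _ _ fun j => ?_
    rfl
  · refine Fintype.prod_equiv σ _ _ fun i => ?_
    rfl

theorem coef_comp_swap (x y : Fin n → ℝ) (ξ : Fin n → K) (i j : Fin n) :
    coef κ ϑ q Q x y (ξ ∘ Equiv.swap i j) =
      coef κ ϑ q Q (x ∘ Equiv.swap i j) (y ∘ Equiv.swap i j) ξ := by
  rw [← coef_comp x y (ξ ∘ Equiv.swap i j) (Equiv.swap i j)]
  congr 1
  funext k
  simp

theorem sliceOp_of_empty {x y : Fin n → ℝ} (h : ∀ i j, x i < x j ↔ y i < y j) :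
    sliceOp κ ϑ q Q X x y = mulOp R X (coef κ ϑ q Q x y) := by
  have : crossingPairs x y = ∅ := by
    simp [crossingPairs, h]
  simp [sliceOp, this]

theorem sliceOp_of_sim {x y : Fin n → ℝ} (h : Sim κ ϑ x y) (F : Equiv.Perm (Fin n) → K) :
    sliceOp κ ϑ q Q X x y F = F := by
  rw [sliceOp_of_empty h.strands]
  funext σ
  rw [mulOp_apply, coef_eq_one h.toSameSides, one_mul]

theorem sliceOp_congr {x x' y y' : Fin n → ℝ} (hx : Sim κ ϑ x x') (hy : Sim κ ϑ y y') :
    sliceOp κ ϑ q Q X x y = sliceOp κ ϑ q Q X x' y' := by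
  have : crossingPairs x y = crossingPairs x' y' := by
    simp only [crossingPairs, hx.strands, hy.strands]
  rw [sliceOp, sliceOp, this, coef_congr hx.toSameSides hy.toSameSides]

theorem sliceOp_of_strands {x y : Fin n → ℝ} {i j : Fin n}
    (h : Step κ ϑ x y (.strands s(i, j))) (hij : x i < x j) :
    sliceOp κ ϑ q Q X x y = divDiff R X i j := by
  have hp : crossingPairs x y = {(i, j)} := by
    ext ⟨a, b⟩
    simp only [crossingPairs, Finset.mem_filter, Finset.mem_univ, true_and, Finset.mem_singleton,
      Prod.mk.injEq]
    have h1 := h.strands a b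
    have h2 := h.strands i j
    constructor
    · rintro ⟨h3, h4⟩
      have h5 : ¬ (Crossing.strands s(i, j) ≠ .strands s(a, b)) := fun h' =>
        h4 ((h1.mpr h').mp h3)
      rw [not_not, Crossing.strands.injEq, Sym2.eq_iff] at h5
      rcases h5 with ⟨rfl, rfl⟩ | ⟨rfl, rfl⟩
      · exact ⟨rfl, rfl⟩
      · exact absurd h3 hij.not_gt
    · rintro ⟨rfl, rfl⟩
      refine ⟨hij, fun h' => ?_⟩
      exact h2.mp (iff_of_true hij h') rfl
  rw [sliceOp, hp]
  ext F σ
  simp [mulOp_apply, coef_eq_one h.sameSides]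

theorem Step.sliceOp_eq {x y : Fin n → ℝ} {c : Crossing n} (h : Step κ ϑ x y c)
    (hc : ∀ p, c ≠ .strands p) : sliceOp κ ϑ q Q X x y = mulOp R X (coef κ ϑ q Q x y) :=
  sliceOp_of_empty fun i j => (h.strands i j).mpr (hc _)

/-- Renaming the strands by `τ` is absorbed by left translation of the functions, which is what the
relation `relabel` needs. -/
theorem sliceOp_comp (x y : Fin n → ℝ) (τ σ : Equiv.Perm (Fin n)) (F : Equiv.Perm (Fin n) → K) :
    sliceOp κ ϑ q Q X (x ∘ τ) (y ∘ τ) (fun σ => F (τ * σ)) σ = sliceOp κ ϑ q Q X x y F (τ * σ) := by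
  have hv : vars X σ = vars X (τ * σ) ∘ τ := by
    funext i
    simp [vars]
  have hp : crossingPairs x y = (crossingPairs (x ∘ τ) (y ∘ τ)).map
      ((Equiv.prodCongr τ τ).toEmbedding) := by
    ext ⟨a, b⟩
    simp [crossingPairs, Finset.mem_map_equiv]
  have hc : coef κ ϑ q Q (x ∘ τ) (y ∘ τ) (vars X σ) = coef κ ϑ q Q x y (vars X (τ * σ)) := by
    rw [hv, coef_comp]
  unfold sliceOp
  simp only [LinearMap.comp_apply, mulOp_apply, hc]
  congr 1
  by_cases h : crossingPairs (x ∘ τ) (y ∘ τ) = ∅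
  · have h' : crossingPairs x y = ∅ := by rw [hp, Finset.map_eq_empty, h]
    rw [if_pos h, if_pos h']
    rfl
  · have h' : crossingPairs x y ≠ ∅ := by rwa [hp, Ne, Finset.map_eq_empty]
    rw [if_neg h, if_neg h', hp, Finset.sum_map, LinearMap.sum_apply, LinearMap.sum_apply, Finset.sum_apply,
      Finset.sum_apply]
    refine Finset.sum_congr rfl fun p _ => ?_
    simp only [divDiff_apply, Equiv.coe_toEmbedding, Equiv.prodCongr_apply, Prod.map_fst, Prod.map_snd]
    rw [hv]
    simp only [Function.comp_apply]
    rw [← mul_assoc, Equiv.mul_swap_eq_swap_mul, mul_assoc]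

end

/-! ### Relations between the operators of slices -/

section

variable {n ℓ : ℕ} {κ : ℝ} {ϑ : Fin ℓ → ℝ}

variable (κ ϑ) in
/-- At most the crossing `c` with ghosts and red lines happens between `x` and `y`. -/
structure SideStep (x y : Fin n → ℝ) (c : Crossing n) : Prop where
  ghost : ∀ i j, (x i < x j + κ ↔ y i < y j + κ) ↔ c ≠ .ghost i j
  red : ∀ i t, (x i < ϑ t ↔ y i < ϑ t) ↔ c ≠ .red i (ϑ t)

theorem Step.sideStep {x y : Fin n → ℝ} {c : Crossing n} (h : Step κ ϑ x y c) :
    SideStep κ ϑ x y c :=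
  ⟨h.ghost, h.red⟩

theorem SideStep.congr {x x' y y' : Fin n → ℝ} {c : Crossing n} (h : SideStep κ ϑ x y c)
    (hx : SameSides κ ϑ x x') (hy : SameSides κ ϑ y y') : SideStep κ ϑ x' y' c :=
  ⟨fun i j => by rw [← hx.ghost, ← hy.ghost, h.ghost], fun i t => by
    rw [← hx.red, ← hy.red, h.red]⟩

theorem SideStep.comp_swap {x y : Fin n → ℝ} {c : Crossing n} (h : Step κ ϑ x y c) (i j : Fin n) :
    SideStep κ ϑ (x ∘ Equiv.swap i j) (y ∘ Equiv.swap i j) (c.map (Equiv.swap i j)) := by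
  have := (h.comp (Equiv.swap i j)).sideStep
  rwa [Equiv.swap_inv] at this

theorem Step.congr {x x' y y' : Fin n → ℝ} {c : Crossing n} (h : Step κ ϑ x y c)
    (hx : Sim κ ϑ x x') (hy : Sim κ ϑ y y') (hx' : Generic κ ϑ x') (hy' : Generic κ ϑ y') :
    Step κ ϑ x' y' c := by
  refine ⟨hx', hy', ?_⟩
  ext d
  rw [← h.crossings_eq]
  refine not_iff_not.mp ?_
  cases d with
  | strands p =>
    induction p with
    | _ i j =>
      rw [strands_notMem_iff hx' hy', strands_notMem_iff h.bottom h.top, hx.strands, hy.strands]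
  | ghost i j => rw [ghost_notMem_iff hx' hy', ghost_notMem_iff h.bottom h.top, hx.ghost, hy.ghost]
  | red i a =>
    by_cases ha : ∃ t, ϑ t = a
    · obtain ⟨t, rfl⟩ := ha
      rw [red_notMem_iff hx' hy', red_notMem_iff h.bottom h.top, hx.red, hy.red]
    · exact iff_of_true (fun h => ha (exists_red_of_mem h)) (fun h => ha (exists_red_of_mem h))

theorem Step.sim_of_same {x y y' : Fin n → ℝ} {c : Crossing n} (h : Step κ ϑ x y c)
    (h' : Step κ ϑ x y' c) : Sim κ ϑ y y' where
  ghost i j := by have := h.ghost i j; have := h'.ghost i j; tauto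
  red i t := by have := h.red i t; have := h'.red i t; tauto
  strands i j := by have := h.strands i j; have := h'.strands i j; tauto

/-- Steps with crossings `c, d` and `d` form a square with a fourth step with crossing `c`. -/
theorem Step.square (hκ : κ ≠ 0) {x y y' z : Fin n → ℝ} {c d : Crossing n} (h₁ : Step κ ϑ x y c)
    (h₂ : Step κ ϑ y z d) (h₃ : Step κ ϑ x y' d) : Step κ ϑ y' z c := by
  refine ⟨h₃.top, h₂.top, ?_⟩
  ext e
  have e1 := mem_crossings_iff_not (c := e) h₃.top h₃.bottom h₂.top hκ
  have e2 := mem_crossings_iff_not (c := e) h₁.bottom h₁.top h₂.top hκ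
  rw [h₁.crossings_eq, h₂.crossings_eq] at e2
  rw [crossings_comm y' x, h₃.crossings_eq] at e1
  simp only [Set.mem_singleton_iff] at *
  tauto

theorem Step.strands_iff {x y : Fin n → ℝ} {p : Sym2 (Fin n)} (h : Step κ ϑ x y (.strands p))
    (i j : Fin n) : (x i < x j ↔ y i < y j) ↔ p ≠ s(i, j) := by
  rw [h.strands, Ne, Crossing.strands.injEq]

theorem Step.strands_of_ne {x y : Fin n → ℝ} {c : Crossing n} (h : Step κ ϑ x y c)
    (hc : ∀ p, c ≠ .strands p) (i j : Fin n) : x i < x j ↔ y i < y j :=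
  (h.strands i j).mpr (hc _)

/-- Two crossings of strands that can be done in both orders are disjoint, unless a third crossing
of the same strands is involved. -/
theorem disjoint_or_triangle {A B B' C : Fin n → ℝ} {i j k l : Fin n} {e : Sym2 (Fin n)}
    (hij : i ≠ j) (hkl : k ≠ l) (hne : s(i, j) ≠ s(k, l)) (hce : s(i, j) ≠ e) (hde : s(k, l) ≠ e)
    (h₁ : ∀ a b, e ≠ s(a, b) → ((A a < A b ↔ B a < B b) ↔ s(i, j) ≠ s(a, b)))
    (h₂ : ∀ a b, e ≠ s(a, b) → ((A a < A b ↔ B' a < B' b) ↔ s(k, l) ≠ s(a, b)))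
    (h₃ : ∀ a b, e ≠ s(a, b) → ((B a < B b ↔ C a < C b) ↔ s(k, l) ≠ s(a, b))) :
    (i ≠ k ∧ i ≠ l ∧ j ≠ k ∧ j ≠ l) ∨ ∃ a b g, a ≠ b ∧ a ≠ g ∧ b ≠ g ∧ s(i, j) = s(a, b) ∧
      s(k, l) = s(a, g) ∧ e = s(b, g) := by
  have key : ∀ a b g, a ≠ b → a ≠ g → b ≠ g → s(i, j) = s(a, b) → s(k, l) = s(a, g) →
      e = s(b, g) := by
    intro a b g hab hag hbg e1 e2
    by_contra he
    have n1 : s(a, b) ≠ s(a, g) := by simp [hbg, hag]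
    have n2 : s(a, b) ≠ s(b, g) := by simp [hab, hag]
    have n3 : s(a, g) ≠ s(b, g) := by simp [hab, hag]
    rw [e1] at hce h₁
    rw [e2] at hde h₂ h₃
    have a1 := (h₁ a b hce.symm)
    have a2 := (h₁ a g hde.symm)
    have a3 := (h₁ b g he)
    have b1 := (h₂ a b hce.symm)
    have b2 := (h₂ a g hde.symm)
    have b3 := (h₂ b g he)
    have c1 := (h₃ a b hce.symm)
    have c2 := (h₃ a g hde.symm)
    have c3 := (h₃ b g he)
    -- Transitivity and totality of the order of three strands at each of the four configurations,
    -- with the order relations treated as propositions. If `b` and `g` did not cross, the three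
    -- strands would be in a cyclic order somewhere.
    have T : ∀ W : Fin n → ℝ, (W a < W b → W b < W g → W a < W g) ∧
        (W a < W g → W a < W b ∨ W b < W g) := fun W => ⟨lt_trans, fun h => by
      by_contra! h'; exact absurd h (h'.2.trans h'.1).not_gt⟩
    simp only [ne_eq, not_true_eq_false, n1, n1.symm, n2, n3, not_false_iff, iff_true,
      iff_false] at a1 a2 a3 b1 b2 b3 c1 c2 c3
    have tA := T A
    have tB := T B
    have tB' := T B'
    have tC := T C
    clear T hab hag hbg h₁ h₂ h₃ hij hkl hne hce hde e1 e2 n1 n2 n3 he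
    generalize (A a < A b) = p₁, (A a < A g) = p₂, (A b < A g) = p₃, (B a < B b) = p₄,
      (B a < B g) = p₅, (B b < B g) = p₆, (B' a < B' b) = p₇, (B' a < B' g) = p₈,
      (B' b < B' g) = p₉, (C a < C b) = p₁₀, (C a < C g) = p₁₁, (C b < C g) = p₁₂ at *
    grind
  by_cases c1 : i = k
  · subst c1
    have : j ≠ l := by rintro rfl; exact hne rfl
    exact Or.inr ⟨i, j, l, hij, hkl, this, rfl, rfl, key i j l hij hkl this rfl rfl⟩
  by_cases c2 : i = l
  · subst c2
    exact Or.inr ⟨i, j, k, hij, c1, by rintro rfl; exact hne Sym2.eq_swap, rfl, Sym2.eq_swap,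
      key i j k hij c1 (by rintro rfl; exact hne Sym2.eq_swap) rfl Sym2.eq_swap⟩
  by_cases c3 : j = k
  · subst c3
    exact Or.inr ⟨j, i, l, hij.symm, hkl, c2, Sym2.eq_swap, rfl,
      key j i l hij.symm hkl c2 Sym2.eq_swap rfl⟩
  by_cases c4 : j = l
  · subst c4
    exact Or.inr ⟨j, i, k, hij.symm, c3, c1, Sym2.eq_swap, Sym2.eq_swap,
      key j i k hij.symm c3 c1 Sym2.eq_swap Sym2.eq_swap⟩
  exact Or.inl ⟨c1, c2, c3, c4⟩

theorem disjoint_of_square {A B B' C : Fin n → ℝ} {i j k l : Fin n}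
    (hij : i ≠ j) (hkl : k ≠ l) (hne : s(i, j) ≠ s(k, l))
    (h₁ : ∀ a b, ((A a < A b ↔ B a < B b) ↔ s(i, j) ≠ s(a, b)))
    (h₂ : ∀ a b, ((A a < A b ↔ B' a < B' b) ↔ s(k, l) ≠ s(a, b)))
    (h₃ : ∀ a b, ((B a < B b ↔ C a < C b) ↔ s(k, l) ≠ s(a, b))) :
    i ≠ k ∧ i ≠ l ∧ j ≠ k ∧ j ≠ l := by
  rcases disjoint_or_triangle (e := s(i, i)) hij hkl hne (by simp [hij.symm]) (by simp; grind)
    (fun a b _ => h₁ a b) (fun a b _ => h₂ a b) (fun a b _ => h₃ a b) with h | ⟨a, b, g, _, _, h, _, _, h'⟩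
  · exact h
  · rw [Sym2.eq_iff] at h'
    grind

end

/-! ### Factors along paths, and independent crossings -/

section

variable {R : Type*} [CommRing R] {K : Type*} [Field K] [Algebra R K] {n ℓ : ℕ}
  {κ : ℝ} {ϑ : Fin ℓ → ℝ} {q : R} {Q : Fin ℓ → R} {X : Fin n → K}

theorem eq_or_eq_not {a b w : Prop} (h : (a ↔ b) ↔ ¬ w) : (w ∧ b = ¬ a) ∨ (¬ w ∧ a = b) := by
  by_cases hw : w <;> by_cases ha : a <;> by_cases hb : b <;> simp_all

/-- Each factor belongs to one order relation, and this relation changes on at most one of the two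
legs because `c ≠ d`. The excluded case is a bigon, where a factor may occur although the end points
are on the same sides. -/
theorem coef_mul {x y z : Fin n → ℝ} {c d : Crossing n} (h₁ : SideStep κ ϑ x y c)
    (h₂ : SideStep κ ϑ y z d) (hcd : c ≠ d) (ξ : Fin n → K) :
    coef κ ϑ q Q x y ξ * coef κ ϑ q Q y z ξ = coef κ ϑ q Q x z ξ := by
  have aux : ∀ (p : K) (a₀ a₁ a₂ : Prop) (wc wd : Prop) (_ : (a₀ ↔ a₁) ↔ ¬ wc)
      (_ : (a₁ ↔ a₂) ↔ ¬ wd) (_ : ¬ (wc ∧ wd)) [Decidable a₀] [Decidable a₁] [Decidable a₂],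
      (if a₀ ∧ ¬ a₁ then p else 1) * (if a₁ ∧ ¬ a₂ then p else 1) = if a₀ ∧ ¬ a₂ then p else 1 := by
    intro p a₀ a₁ a₂ wc wd h1 h2 h3 _ _ _
    by_cases a₀ <;> by_cases a₁ <;> by_cases a₂ <;> simp_all
  have aux' : ∀ (p : K) (a₀ a₁ a₂ : Prop) (wc wd : Prop) (_ : (a₀ ↔ a₁) ↔ ¬ wc)
      (_ : (a₁ ↔ a₂) ↔ ¬ wd) (_ : ¬ (wc ∧ wd)) [Decidable a₀] [Decidable a₁] [Decidable a₂],
      (if ¬ a₀ ∧ a₁ then p else 1) * (if ¬ a₁ ∧ a₂ then p else 1) = if ¬ a₀ ∧ a₂ then p else 1 := by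
    intro p a₀ a₁ a₂ wc wd h1 h2 h3 _ _ _
    by_cases a₀ <;> by_cases a₁ <;> by_cases a₂ <;> simp_all
  unfold coef
  rw [mul_mul_mul_comm, ← Finset.prod_mul_distrib, ← Finset.prod_mul_distrib]
  congr 1
  · refine Finset.prod_congr rfl fun i _ => ?_
    rw [← Finset.prod_mul_distrib]
    exact Finset.prod_congr rfl fun j _ => aux _ _ _ _ _ _ (h₁.ghost i j) (h₂.ghost i j)
      (fun h => hcd (h.1.trans h.2.symm))
  · refine Finset.prod_congr rfl fun i _ => ?_
    rw [← Finset.prod_mul_distrib]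
    exact Finset.prod_congr rfl fun t _ => aux' _ _ _ _ _ _ (h₁.red i t) (h₂.red i t)
      (fun h => hcd (h.1.trans h.2.symm))

theorem coef_exchange {x y y' z : Fin n → ℝ} {c d : Crossing n} (h₁ : SideStep κ ϑ x y c)
    (h₂ : SideStep κ ϑ y z d) (h₁' : SideStep κ ϑ x y' d) (h₂' : SideStep κ ϑ y' z c)
    (ξ : Fin n → K) :
    coef κ ϑ q Q x y ξ * coef κ ϑ q Q y z ξ = coef κ ϑ q Q x y' ξ * coef κ ϑ q Q y' z ξ := by
  by_cases hcd : c = d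
  · subst hcd
    have : SameSides κ ϑ y y' :=
      ⟨fun i j => by have := h₁.ghost i j; have := h₁'.ghost i j; tauto,
        fun i t => by have := h₁.red i t; have := h₁'.red i t; tauto⟩
    rw [coef_congr (.refl x) this, coef_congr this (.refl z)]
  · rw [coef_mul h₁ h₂ hcd, coef_mul h₁' h₂' (Ne.symm hcd)]

/-- For each factor, an order relation is flipped along both paths the same number of times from the
same starting value. The number of changes in the direction that carries the factor is then the
same. -/
theorem coef_triple {x y₁ y₂ y₁' y₂' z : Fin n → ℝ} {c d f : Crossing n}
    (h₁ : SideStep κ ϑ x y₁ c) (h₂ : SideStep κ ϑ y₁ y₂ d) (h₃ : SideStep κ ϑ y₂ z f)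
    (h₁' : SideStep κ ϑ x y₁' f) (h₂' : SideStep κ ϑ y₁' y₂' d) (h₃' : SideStep κ ϑ y₂' z c)
    (ξ : Fin n → K) :
    coef κ ϑ q Q x y₁ ξ * coef κ ϑ q Q y₁ y₂ ξ * coef κ ϑ q Q y₂ z ξ =
      coef κ ϑ q Q x y₁' ξ * coef κ ϑ q Q y₁' y₂' ξ * coef κ ϑ q Q y₂' z ξ := by
  have aux : ∀ (p : K) (a₀ a₁ a₂ a₃ b₁ b₂ : Prop) (wc wd wf : Prop) (_ : (a₀ ↔ a₁) ↔ ¬ wc)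
      (_ : (a₁ ↔ a₂) ↔ ¬ wd) (_ : (a₂ ↔ a₃) ↔ ¬ wf) (_ : (a₀ ↔ b₁) ↔ ¬ wf)
      (_ : (b₁ ↔ b₂) ↔ ¬ wd) (_ : (b₂ ↔ a₃) ↔ ¬ wc)
      [Decidable a₀] [Decidable a₁] [Decidable a₂] [Decidable a₃] [Decidable b₁] [Decidable b₂],
      (if a₀ ∧ ¬ a₁ then p else 1) * (if a₁ ∧ ¬ a₂ then p else 1) * (if a₂ ∧ ¬ a₃ then p else 1) =
      (if a₀ ∧ ¬ b₁ then p else 1) * (if b₁ ∧ ¬ b₂ then p else 1) * (if b₂ ∧ ¬ a₃ then p else 1) := by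
    intro p a₀ a₁ a₂ a₃ b₁ b₂ wc wd wf h1 h2 h3 h4 h5 h6 _ _ _ _ _ _
    rcases eq_or_eq_not h1 with ⟨w1, rfl⟩ | ⟨w1, rfl⟩ <;>
    rcases eq_or_eq_not h2 with ⟨w2, rfl⟩ | ⟨w2, rfl⟩ <;>
    rcases eq_or_eq_not h3 with ⟨w3, rfl⟩ | ⟨w3, rfl⟩ <;>
    rcases eq_or_eq_not h4 with ⟨w4, rfl⟩ | ⟨w4, rfl⟩ <;> try contradiction
    all_goals rcases eq_or_eq_not h5 with ⟨w5, rfl⟩ | ⟨w5, rfl⟩ <;> try contradiction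
    all_goals clear h1 h2 h3 h4 h5 h6; by_cases h : a₀ <;> simp [h]
  have aux' : ∀ (p : K) (a₀ a₁ a₂ a₃ b₁ b₂ : Prop) (wc wd wf : Prop) (_ : (a₀ ↔ a₁) ↔ ¬ wc)
      (_ : (a₁ ↔ a₂) ↔ ¬ wd) (_ : (a₂ ↔ a₃) ↔ ¬ wf) (_ : (a₀ ↔ b₁) ↔ ¬ wf)
      (_ : (b₁ ↔ b₂) ↔ ¬ wd) (_ : (b₂ ↔ a₃) ↔ ¬ wc)
      [Decidable a₀] [Decidable a₁] [Decidable a₂] [Decidable a₃] [Decidable b₁] [Decidable b₂],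
      (if ¬ a₀ ∧ a₁ then p else 1) * (if ¬ a₁ ∧ a₂ then p else 1) * (if ¬ a₂ ∧ a₃ then p else 1) =
      (if ¬ a₀ ∧ b₁ then p else 1) * (if ¬ b₁ ∧ b₂ then p else 1) * (if ¬ b₂ ∧ a₃ then p else 1) := by
    intro p a₀ a₁ a₂ a₃ b₁ b₂ wc wd wf h1 h2 h3 h4 h5 h6 _ _ _ _ _ _
    rcases eq_or_eq_not h1 with ⟨w1, rfl⟩ | ⟨w1, rfl⟩ <;>
    rcases eq_or_eq_not h2 with ⟨w2, rfl⟩ | ⟨w2, rfl⟩ <;>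
    rcases eq_or_eq_not h3 with ⟨w3, rfl⟩ | ⟨w3, rfl⟩ <;>
    rcases eq_or_eq_not h4 with ⟨w4, rfl⟩ | ⟨w4, rfl⟩ <;> try contradiction
    all_goals rcases eq_or_eq_not h5 with ⟨w5, rfl⟩ | ⟨w5, rfl⟩ <;> try contradiction
    all_goals clear h1 h2 h3 h4 h5 h6; by_cases h : a₀ <;> simp [h]
  unfold coef
  have rearrange : ∀ a b c d e f : K, a * b * (c * d) * (e * f) = (a * c * e) * (b * d * f) := by
    intros; ring
  refine (rearrange _ _ _ _ _ _).trans (Eq.trans ?_ (rearrange _ _ _ _ _ _).symm)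
  congr 1
  · simp only [← Finset.prod_mul_distrib]
    exact Finset.prod_congr rfl fun i _ => Finset.prod_congr rfl fun j _ =>
      aux _ _ _ _ _ _ _ _ _ _ (h₁.ghost i j) (h₂.ghost i j) (h₃.ghost i j) (h₁'.ghost i j)
        (h₂'.ghost i j) (h₃'.ghost i j)
  · simp only [← Finset.prod_mul_distrib]
    exact Finset.prod_congr rfl fun i _ => Finset.prod_congr rfl fun t _ =>
      aux' _ _ _ _ _ _ _ _ _ _ (h₁.red i t) (h₂.red i t) (h₃.red i t) (h₁'.red i t)
        (h₂'.red i t) (h₃'.red i t)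

theorem sliceOp_bigon_strands {x y z : Fin n → ℝ} {p : Sym2 (Fin n)}
    (h : Step κ ϑ x y (.strands p)) (h' : Step κ ϑ y z (.strands p))
    (F : Equiv.Perm (Fin n) → K) :
    sliceOp κ ϑ q Q X y z (sliceOp κ ϑ q Q X x y F) = 0 := by
  obtain ⟨i, j, rfl, hij⟩ := h.exists_lt
  have hij' : y j < y i := by
    have h1 := h.strands_iff i j
    have h2 := (h.top.strand_strand.ne h.ne_of_strands).lt_or_gt
    simp at h1
    grind
  rw [sliceOp_of_strands h hij, sliceOp_of_strands (i := j) (j := i) (by rwa [Sym2.eq_swap]) hij',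
    divDiff_sq']

theorem sliceOp_exchange {x y y' z : Fin n → ℝ} {c d : Crossing n} (h₁ : Step κ ϑ x y c)
    (h₂ : Step κ ϑ y z d) (h₁' : Step κ ϑ x y' d) (h₂' : Step κ ϑ y' z c)
    (F : Equiv.Perm (Fin n) → K) :
    sliceOp κ ϑ q Q X y z (sliceOp κ ϑ q Q X x y F) =
      sliceOp κ ϑ q Q X y' z (sliceOp κ ϑ q Q X x y' F) := by
  by_cases hcd : c = d
  · subst hcd
    have h := h₁.sim_of_same h₁'
    rw [sliceOp_congr h (.refl z), sliceOp_congr (.refl x) h]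
  -- A crossing of strands against one with a ghost or red line: the factor is the same below and
  -- above the crossing of strands. It is symmetric in these strands, because exchanging them
  -- returns to configurations with the same sides.
  have one : ∀ {y y' : Fin n → ℝ} {p} {d : Crossing n}, (∀ p, d ≠ .strands p) →
      Step κ ϑ x y (.strands p) → Step κ ϑ y z d → Step κ ϑ x y' d → Step κ ϑ y' z (.strands p) →
      sliceOp κ ϑ q Q X y z (sliceOp κ ϑ q Q X x y F) =
      sliceOp κ ϑ q Q X y' z (sliceOp κ ϑ q Q X x y' F) := by
    intro y y' p d hd h₁ h₂ h₁' h₂'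
    obtain ⟨i, j, rfl, hij⟩ := h₁.exists_lt
    have hij' : y' i < y' j := (h₁'.strands_of_ne hd i j).mp hij
    rw [sliceOp_of_strands h₁ hij, sliceOp_of_strands h₂' hij', h₂.sliceOp_eq hd,
      h₁'.sliceOp_eq hd]
    refine (divDiff_mulOp R X (fun ξ => ?_) (fun ξ => ?_) F).symm
    · rw [coef_congr h₁.sameSides h₂'.sameSides]
    · rw [coef_comp_swap, coef_congr h₁.swap_sim.toSameSides h₂'.swap_sim.toSameSides]
  by_cases hc : ∃ p, c = .strands p <;> by_cases hd : ∃ p, d = .strands p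
  · obtain ⟨p, rfl⟩ := hc
    obtain ⟨p', rfl⟩ := hd
    obtain ⟨i, j, rfl, hij⟩ := h₁.exists_lt
    obtain ⟨k, l, rfl, hkl⟩ := h₂.exists_lt
    have hne : s(i, j) ≠ s(k, l) := fun h => hcd (congrArg _ h)
    have hdis := disjoint_of_square h₁.ne_of_strands h₂.ne_of_strands hne h₁.strands_iff
      h₁'.strands_iff h₂.strands_iff
    rw [sliceOp_of_strands h₁ hij, sliceOp_of_strands h₂ hkl,
      sliceOp_of_strands h₁' (((h₁.strands_iff k l).mpr hne).mpr hkl),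
      sliceOp_of_strands h₂' (((h₁'.strands_iff i j).mpr hne.symm).mp hij)]
    exact (divDiff_comm R X hdis.1 hdis.2.1 hdis.2.2.1 hdis.2.2.2 F).symm
  · obtain ⟨p, rfl⟩ := hc
    exact one (not_exists.mp hd) h₁ h₂ h₁' h₂'
  · obtain ⟨p, rfl⟩ := hd
    exact (one (not_exists.mp hc) h₁' h₂' h₁ h₂).symm
  · rw [h₁.sliceOp_eq (not_exists.mp hc), h₂.sliceOp_eq (not_exists.mp hd),
      h₁'.sliceOp_eq (not_exists.mp hd), h₂'.sliceOp_eq (not_exists.mp hc), mulOp_mul, mulOp_mul]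
    congr 2
    funext ξ
    rw [mul_comm, coef_exchange h₁.sideStep h₂.sideStep h₁'.sideStep h₂'.sideStep, mul_comm]

end

section

variable {R : Type*} [CommRing R] {K : Type*} [Field K] [Algebra R K] {n ℓ : ℕ}
  {κ : ℝ} {ϑ : Fin ℓ → ℝ} {q : R} {Q : Fin ℓ → R} {X : Fin n → K}

/-! ### Triple points -/

theorem map_swap_swap (i k : Fin n) (c : Crossing n) :
    (c.map (Equiv.swap i k)).map (Equiv.swap i k) = c := by
  have := map_map_inv (Equiv.swap i k) c
  rwa [Equiv.swap_inv] at this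

/-- The two ghost crossings between `i` and `k` do not form a triple point with the crossing of
these strands. -/
theorem not_triple_ghost_ghost {x y₁ y₁' y₂ : Fin n → ℝ} {i k : Fin n} (hκ : κ ≠ 0)
    (h₁ : Step κ ϑ x y₁ (.ghost i k)) (h₂ : Step κ ϑ y₁ y₂ (.strands s(i, k)))
    (h₁' : Step κ ϑ x y₁' (.ghost k i)) : False := by
  have hik := h₁.ne_of_ghost
  have e1 := h₁.ghost i k
  have e2 := h₁.ghost k i
  have e3 := h₁.strands i k
  have f1 := h₁'.ghost i k
  have f2 := h₁'.ghost k i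
  have f3 := h₁'.strands i k
  have g1 := h₂.ghost i k
  have g2 := h₂.ghost k i
  have g3 := h₂.strands i k
  simp only [ne_eq, Crossing.ghost.injEq, hik, hik.symm, not_true, not_false_iff, and_self,
    iff_true, iff_false, reduceCtorEq] at e1 e2 e3 f1 f2 f3 g1 g2 g3
  have n1 := h₁.bottom.strand_strand.ne hik
  have n2 := h₁.top.strand_strand.ne hik
  have n3 := h₁'.top.strand_strand.ne hik
  have n4 := h₂.top.strand_strand.ne hik
  rcases lt_or_gt_of_ne hκ with h | h <;>
  rcases n1.lt_or_gt with m1 | m1 <;> rcases n2.lt_or_gt with m2 | m2 <;>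
  rcases n3.lt_or_gt with m3 | m3 <;> rcases n4.lt_or_gt with m4 | m4 <;> grind

/-- Going through the kinds of crossing, the only possibility outside the exceptional list is that
each of `i` and `k` meets the ghost of the other, and this is excluded by `not_triple_ghost_ghost`.
-/
theorem exceptional_of_map_eq {x y₁ y₁' y₂ : Fin n → ℝ} {c : Crossing n} {i k : Fin n} (hκ : κ ≠ 0)
    (hc : ∀ p, c ≠ .strands p) (h₁ : Step κ ϑ x y₁ c) (h₂ : Step κ ϑ y₁ y₂ (.strands s(i, k)))
    (h₁' : Step κ ϑ x y₁' (c.map (Equiv.swap i k))) (hne : c ≠ c.map (Equiv.swap i k)) :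
    Exceptional c (.strands s(i, k)) (c.map (Equiv.swap i k)) := by
  have hik := h₂.ne_of_strands
  cases c with
  | strands p => exact absurd rfl (hc p)
  | ghost a b =>
    have hab := h₁.ne_of_ghost
    simp only [Crossing.map] at h₁' hne ⊢
    by_cases hai : a = i
    · subst hai
      by_cases hbk : b = k
      · subst hbk
        rw [Equiv.swap_apply_left, Equiv.swap_apply_right] at h₁'
        exact (not_triple_ghost_ghost hκ h₁ h₂ h₁').elim
      · rw [Equiv.swap_apply_left, Equiv.swap_apply_of_ne_of_ne (Ne.symm hab) hbk]
        exact .ghost b a k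
    by_cases hak : a = k
    · subst hak
      by_cases hbi : b = i
      · subst hbi
        rw [Equiv.swap_apply_left, Equiv.swap_apply_right] at h₁'
        rw [Sym2.eq_swap] at h₂
        exact (not_triple_ghost_ghost hκ h₁ h₂ h₁').elim
      · rw [Equiv.swap_apply_right, Equiv.swap_apply_of_ne_of_ne hbi (Ne.symm hab), Sym2.eq_swap]
        exact .ghost b a i
    rw [Equiv.swap_apply_of_ne_of_ne hai hak] at hne ⊢
    by_cases hbi : b = i
    · subst hbi
      rw [Equiv.swap_apply_left]
      exact .strand a b k
    by_cases hbk : b = k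
    · subst hbk
      rw [Equiv.swap_apply_right, Sym2.eq_swap]
      exact .strand a b i
    rw [Equiv.swap_apply_of_ne_of_ne hbi hbk] at hne
    exact absurd rfl hne
  | red a r =>
    simp only [Crossing.map] at hne ⊢
    by_cases hai : a = i
    · subst hai
      rw [Equiv.swap_apply_left]
      exact .red r a k
    by_cases hak : a = k
    · subst hak
      rw [Equiv.swap_apply_right, Sym2.eq_swap]
      exact .red r a i
    rw [Equiv.swap_apply_of_ne_of_ne hai hak] at hne
    exact absurd rfl hne

section

variable {x y₁ y₂ y₁' y₂' z : Fin n → ℝ} {c d f : Crossing n}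

/-- The product of the factors of `d` and `f` is symmetric in the two crossing strands and passes
through the divided difference. -/
theorem sliceOp_triple_first (hκ : κ ≠ 0) {p : Sym2 (Fin n)} (hd : ∀ p, d ≠ .strands p)
    (hf : ∀ p, f ≠ .strands p)
    (h₁ : Step κ ϑ x y₁ (.strands p)) (h₂ : Step κ ϑ y₁ y₂ d) (h₃ : Step κ ϑ y₂ z f)
    (h₁' : Step κ ϑ x y₁' f) (h₂' : Step κ ϑ y₁' y₂' d) (h₃' : Step κ ϑ y₂' z (.strands p))
    (F : Equiv.Perm (Fin n) → K) :
    sliceOp κ ϑ q Q X y₂ z (sliceOp κ ϑ q Q X y₁ y₂ (sliceOp κ ϑ q Q X x y₁ F)) =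
      sliceOp κ ϑ q Q X y₂' z (sliceOp κ ϑ q Q X y₁' y₂' (sliceOp κ ϑ q Q X x y₁' F)) := by
  obtain ⟨i, j, rfl, hij⟩ := h₁.exists_lt
  have hij' : y₂' i < y₂' j :=
    (h₂'.strands_of_ne hd i j).mp ((h₁'.strands_of_ne hf i j).mp hij)
  rw [sliceOp_of_strands h₁ hij, sliceOp_of_strands h₃' hij', h₂.sliceOp_eq hd, h₃.sliceOp_eq hf,
      h₁'.sliceOp_eq hf, h₂'.sliceOp_eq hd, mulOp_mul, mulOp_mul]
  refine (divDiff_mulOp R X (fun ξ => ?_) (fun ξ => ?_) F).symm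
  · rw [mul_comm, mul_comm (coef κ ϑ q Q y₂ z ξ),
      coef_exchange h₂.sideStep h₃.sideStep (h₁'.sideStep.congr h₁.sameSides (.refl _))
        (h₂'.sideStep.congr (.refl _) h₃'.sameSides),
      coef_congr h₁.sameSides (.refl _), coef_congr (.refl y₁') h₃'.sameSides]
  · have g1 := h₁.swap_sim.toSameSides
    have g3 := h₃'.swap_sim.toSameSides
    rw [coef_comp_swap, coef_comp_swap]
    -- If `d = f`, the path goes back where it came from and the factors do not combine, so the two
    -- legs are compared separately.
    by_cases hdf : d = f
    · subst hdf
      have g2 := (h₁.square hκ h₂ h₁').swap_sim.toSameSides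
      rw [coef_congr g2 g3, coef_congr g1 g2, mul_comm, mul_comm]
    · have k1 := SideStep.comp_swap h₁' i j
      have k2 := SideStep.comp_swap h₂' i j
      rw [mul_comm, coef_mul k1 k2, coef_congr g1 g3, mul_comm,
        coef_mul h₂.sideStep h₃.sideStep hdf]
      intro h
      apply hdf
      rw [← map_swap_swap i j d, ← h, map_swap_swap]

/-- Let `c'` and `f'` be the images of `c` and `f` under the exchange of the two strands. Comparing
the two paths from the exchanged bottom to `z` gives `{c', f} = {f', c}`. Outside the exceptional
cases this means `c' = c` and `f' = f`, so the factors are symmetric and pass through the divided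
difference. -/
theorem sliceOp_triple_middle (hκ : κ ≠ 0) {p : Sym2 (Fin n)} (hc : ∀ p, c ≠ .strands p)
    (hf : ∀ p, f ≠ .strands p) (hcf : c ≠ f)
    (h₁ : Step κ ϑ x y₁ c) (h₂ : Step κ ϑ y₁ y₂ (.strands p)) (h₃ : Step κ ϑ y₂ z f)
    (h₁' : Step κ ϑ x y₁' f) (h₂' : Step κ ϑ y₁' y₂' (.strands p)) (h₃' : Step κ ϑ y₂' z c)
    (hne : ¬ Exceptional c (.strands p) f) (F : Equiv.Perm (Fin n) → K) :
    sliceOp κ ϑ q Q X y₂ z (sliceOp κ ϑ q Q X y₁ y₂ (sliceOp κ ϑ q Q X x y₁ F)) =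
      sliceOp κ ϑ q Q X y₂' z (sliceOp κ ϑ q Q X y₁' y₂' (sliceOp κ ϑ q Q X x y₁' F)) := by
  obtain ⟨i, j, rfl, hij⟩ := h₂.exists_lt
  have hij' : y₁' i < y₁' j := (h₁'.strands_of_ne hf i j).mp ((h₁.strands_of_ne hc i j).mpr hij)
  have hmap : f ≠ c.map (Equiv.swap i j) := by
    rintro rfl
    exact hne (exceptional_of_map_eq hκ hc h₁ h₂ h₁' hcf)
  have hmap' : c ≠ f.map (Equiv.swap i j) := by
    intro h
    apply hmap
    rw [h, map_swap_swap]
  have g₁ : Step κ ϑ (x ∘ Equiv.swap i j) y₂ (c.map (Equiv.swap i j)) := by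
    have := (h₁.comp (Equiv.swap i j)).congr (.refl _) h₂.swap_sim (h₁.bottom.comp _) h₂.top
    rwa [Equiv.swap_inv] at this
  have g₁' : Step κ ϑ (x ∘ Equiv.swap i j) y₂' (f.map (Equiv.swap i j)) := by
    have := (h₁'.comp (Equiv.swap i j)).congr (.refl _) h₂'.swap_sim (h₁'.bottom.comp _) h₂'.top
    rwa [Equiv.swap_inv] at this
  have key : ∀ e, e ∈ crossings κ ϑ (x ∘ Equiv.swap i j) z ↔ _ := fun e =>
    mem_crossings_iff_not g₁.bottom g₁.top h₃.top hκ
  have key' : ∀ e, e ∈ crossings κ ϑ (x ∘ Equiv.swap i j) z ↔ _ := fun e =>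
    mem_crossings_iff_not g₁'.bottom g₁'.top h₃.top hκ
  rw [g₁.crossings_eq, h₃.crossings_eq] at key
  rw [g₁'.crossings_eq, h₃'.crossings_eq] at key'
  simp only [Set.mem_singleton_iff] at key key'
  have hcc : c.map (Equiv.swap i j) = c := by
    have e1 := key c
    have e2 := key' c
    grind
  have hff : f.map (Equiv.swap i j) = f := by
    have e1 := key f
    have e2 := key' f
    grind
  rw [hcc] at g₁
  rw [hff] at g₁'
  have hx : SameSides κ ϑ (x ∘ Equiv.swap i j) x := by
    refine ⟨fun a b => ?_, fun a t => ?_⟩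
    · have := g₁.ghost a b
      have := h₁.ghost a b
      have := h₂.sameSides.ghost a b
      tauto
    · have := g₁.red a t
      have := h₁.red a t
      have := h₂.sameSides.red a t
      tauto
  have inv : ∀ ξ, coef (K := K) κ ϑ q Q x y₁ (ξ ∘ Equiv.swap i j) = coef κ ϑ q Q x y₁ ξ := fun ξ => by
    rw [coef_comp_swap, coef_congr hx (h₂.swap_sim.toSameSides.trans h₂.sameSides.symm)]
  have inv' : ∀ ξ, coef (K := K) κ ϑ q Q x y₁' (ξ ∘ Equiv.swap i j) = coef κ ϑ q Q x y₁' ξ :=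
    fun ξ => by
      rw [coef_comp_swap, coef_congr hx (h₂'.swap_sim.toSameSides.trans h₂'.sameSides.symm)]
  rw [sliceOp_of_strands h₂ hij, sliceOp_of_strands h₂' hij', h₁.sliceOp_eq hc, h₃.sliceOp_eq hf,
    h₁'.sliceOp_eq hf, h₃'.sliceOp_eq hc, divDiff_mulOp R X (fun _ => rfl) inv,
    divDiff_mulOp R X (fun _ => rfl) inv', mulOp_mul, mulOp_mul]
  congr 2
  funext ξ
  rw [mul_comm, mul_comm (coef κ ϑ q Q y₂' z ξ), ← coef_congr h₂.sameSides (.refl z),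
    ← coef_congr h₂'.sameSides (.refl z)]
  exact coef_exchange h₁.sideStep (h₃.sideStep.congr h₂.sameSides.symm (.refl _)) h₁'.sideStep
    (h₃'.sideStep.congr h₂'.sameSides.symm (.refl _)) ξ

/-- If the two pairs of strands coincide, both sides contain a bigon and vanish. Otherwise the pairs
are disjoint, the divided differences commute, and the factor of `f` is symmetric in both pairs. -/
theorem sliceOp_triple_first_middle {p p' : Sym2 (Fin n)} (hf : ∀ p, f ≠ .strands p)
    (h₁ : Step κ ϑ x y₁ (.strands p)) (h₂ : Step κ ϑ y₁ y₂ (.strands p')) (h₃ : Step κ ϑ y₂ z f)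
    (h₁' : Step κ ϑ x y₁' f) (h₂' : Step κ ϑ y₁' y₂' (.strands p'))
    (h₃' : Step κ ϑ y₂' z (.strands p)) (F : Equiv.Perm (Fin n) → K) :
    sliceOp κ ϑ q Q X y₂ z (sliceOp κ ϑ q Q X y₁ y₂ (sliceOp κ ϑ q Q X x y₁ F)) =
      sliceOp κ ϑ q Q X y₂' z (sliceOp κ ϑ q Q X y₁' y₂' (sliceOp κ ϑ q Q X x y₁' F)) := by
  by_cases hpp : p = p'
  · subst hpp
    rw [sliceOp_bigon_strands h₁ h₂, sliceOp_bigon_strands h₂' h₃', map_zero]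
  obtain ⟨i, j, rfl, hij⟩ := h₁.exists_lt
  obtain ⟨k, l, rfl, hkl⟩ := h₂.exists_lt
  have hdis := disjoint_of_square (A := x) (B := y₁) (B' := y₂') (C := y₂) h₁.ne_of_strands
    h₂.ne_of_strands hpp h₁.strands_iff
    (fun a b => by rw [h₁'.strands_of_ne hf, h₂'.strands_iff]) h₂.strands_iff
  have hkl' : y₁' k < y₁' l :=
    (h₁'.strands_of_ne hf k l).mp (((h₁.strands_iff k l).mpr hpp).mpr hkl)
  have hij' : y₂' i < y₂' j :=
    ((h₂'.strands_iff i j).mpr (Ne.symm hpp)).mp ((h₁'.strands_of_ne hf i j).mp hij)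
  have sx : SameSides κ ϑ x y₂ := h₁.sameSides.trans h₂.sameSides
  have sz : SameSides κ ϑ y₁' z := h₂'.sameSides.trans h₃'.sameSides
  rw [sliceOp_of_strands h₁ hij, sliceOp_of_strands h₂ hkl, h₃.sliceOp_eq hf, h₁'.sliceOp_eq hf,
    sliceOp_of_strands h₂' hkl', sliceOp_of_strands h₃' hij',
    divDiff_mulOp R X (i := k) (j := l) (fun _ => rfl), divDiff_mulOp R X (i := i) (j := j),
    divDiff_comm R X hdis.1 hdis.2.1 hdis.2.2.1 hdis.2.2.2]
  · intro ξ
    rw [coef_congr sx sz]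
  · intro ξ
    rw [coef_comp_swap, coef_congr (h₁.swap_sim.toSameSides.trans h₂.sameSides)
      ((h₂'.sameSides.comp _).trans h₃'.swap_sim.toSameSides)]
  · intro ξ
    rw [coef_comp_swap, coef_congr
      (((h₁.sameSides.comp _).trans h₂.swap_sim.toSameSides).trans sx.symm)
      (h₂'.swap_sim.toSameSides.trans h₂'.sameSides.symm)]

/-- The two pairs of strands are disjoint, so the divided differences commute, and the factor of `d`
is symmetric in each pair. -/
theorem sliceOp_triple_first_last {p p' : Sym2 (Fin n)} (hd : ∀ p, d ≠ .strands p) (hpp : p ≠ p')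
    (h₁ : Step κ ϑ x y₁ (.strands p)) (h₂ : Step κ ϑ y₁ y₂ d) (h₃ : Step κ ϑ y₂ z (.strands p'))
    (h₁' : Step κ ϑ x y₁' (.strands p')) (h₂' : Step κ ϑ y₁' y₂' d)
    (h₃' : Step κ ϑ y₂' z (.strands p)) (F : Equiv.Perm (Fin n) → K) :
    sliceOp κ ϑ q Q X y₂ z (sliceOp κ ϑ q Q X y₁ y₂ (sliceOp κ ϑ q Q X x y₁ F)) =
      sliceOp κ ϑ q Q X y₂' z (sliceOp κ ϑ q Q X y₁' y₂' (sliceOp κ ϑ q Q X x y₁' F)) := by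
  obtain ⟨i, j, rfl, hij⟩ := h₁.exists_lt
  obtain ⟨k, l, rfl, hkl⟩ := h₃.exists_lt
  have hdis := disjoint_of_square (A := x) (B := y₁) (B' := y₁') (C := z) h₁.ne_of_strands
    h₃.ne_of_strands hpp h₁.strands_iff h₁'.strands_iff
    (fun a b => by rw [h₂.strands_of_ne hd, h₃.strands_iff])
  have hkl' : x k < x l := ((h₁.strands_iff k l).mpr hpp).mpr ((h₂.strands_of_ne hd k l).mpr hkl)
  have hij' : y₂' i < y₂' j :=
    (h₂'.strands_of_ne hd i j).mp (((h₁'.strands_iff i j).mpr (Ne.symm hpp)).mp hij)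
  have sx : SameSides κ ϑ y₁' y₁ := h₁'.sameSides.symm.trans h₁.sameSides
  have sz : SameSides κ ϑ y₂' y₂ := h₃'.sameSides.trans h₃.sameSides.symm
  rw [sliceOp_of_strands h₁ hij, sliceOp_of_strands h₃ hkl, h₂.sliceOp_eq hd, h₂'.sliceOp_eq hd,
    sliceOp_of_strands h₁' hkl', sliceOp_of_strands h₃' hij',
    divDiff_mulOp R X (i := k) (j := l) (fun _ => rfl),
    divDiff_mulOp R X (i := i) (j := j) (m' := coef κ ϑ q Q y₁ y₂),
    divDiff_comm R X hdis.1 hdis.2.1 hdis.2.2.1 hdis.2.2.2]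
  · intro ξ
    rw [coef_congr sx sz]
  · intro ξ
    rw [coef_comp_swap, coef_congr
      ((h₁'.sameSides.symm.comp _).trans h₁.swap_sim.toSameSides)
      (h₃'.swap_sim.toSameSides.trans h₃.sameSides.symm)]
  · intro ξ
    rw [coef_comp_swap, coef_congr
      (((h₁.sameSides.symm.comp _).trans h₁'.swap_sim.toSameSides).trans sx)
      (h₃.swap_sim.toSameSides.trans h₃.sameSides.symm)]

/-- A repeated pair gives a bigon on both sides. Otherwise either the three pairs are disjoint and
everything commutes, or two of them share a strand; then the third pair completes a triangle and the
braid relation applies. -/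
theorem sliceOp_triple_strands (hX : Function.Injective X) {p₁ p₂ p₃ : Sym2 (Fin n)}
    (h₁₃ : p₁ ≠ p₃)
    (h₁ : Step κ ϑ x y₁ (.strands p₁)) (h₂ : Step κ ϑ y₁ y₂ (.strands p₂))
    (h₃ : Step κ ϑ y₂ z (.strands p₃))
    (h₁' : Step κ ϑ x y₁' (.strands p₃)) (h₂' : Step κ ϑ y₁' y₂' (.strands p₂))
    (h₃' : Step κ ϑ y₂' z (.strands p₁)) (F : Equiv.Perm (Fin n) → K) :
    sliceOp κ ϑ q Q X y₂ z (sliceOp κ ϑ q Q X y₁ y₂ (sliceOp κ ϑ q Q X x y₁ F)) =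
      sliceOp κ ϑ q Q X y₂' z (sliceOp κ ϑ q Q X y₁' y₂' (sliceOp κ ϑ q Q X x y₁' F)) := by
  by_cases h₁₂ : p₁ = p₂
  · subst h₁₂
    rw [sliceOp_bigon_strands h₁ h₂, sliceOp_bigon_strands h₂' h₃', map_zero]
  by_cases h₂₃ : p₂ = p₃
  · subst h₂₃
    rw [sliceOp_bigon_strands h₂ h₃, sliceOp_bigon_strands h₁' h₂', map_zero]
  have braid : ∀ i j k, i ≠ j → i ≠ k → j ≠ k → p₁ = s(i, j) → p₂ = s(i, k) → p₃ = s(j, k) →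
      sliceOp κ ϑ q Q X y₂ z (sliceOp κ ϑ q Q X y₁ y₂ (sliceOp κ ϑ q Q X x y₁ F)) =
      sliceOp κ ϑ q Q X y₂' z (sliceOp κ ϑ q Q X y₁' y₂' (sliceOp κ ϑ q Q X x y₁' F)) := by
    rintro i j k hij hik hjk rfl rfl rfl
    have T : ∀ W : Fin n → ℝ, (W i < W j → W j < W k → W i < W k) ∧
        (W i < W k → W i < W j ∨ W j < W k) := fun W => ⟨lt_trans, fun h => by
      by_contra! h'; exact absurd h (h'.2.trans h'.1).not_gt⟩
    have st : ∀ {a b : Fin n → ℝ} {p}, Step κ ϑ a b (.strands p) →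
      ((a i < a j ↔ b i < b j) ↔ p ≠ s(i, j)) ∧ ((a i < a k ↔ b i < b k) ↔ p ≠ s(i, k)) ∧
      ((a j < a k ↔ b j < b k) ↔ p ≠ s(j, k)) := fun h =>
        ⟨h.strands_iff _ _, h.strands_iff _ _, h.strands_iff _ _⟩
    have n1 : s(i, j) ≠ s(i, k) := h₁₂
    have n2 : s(i, j) ≠ s(j, k) := h₁₃
    have n3 : s(i, k) ≠ s(j, k) := h₂₃
    have a1 := st h₁
    have a2 := st h₂
    have a3 := st h₁'
    have a4 := st h₂'
    simp only [ne_eq, not_true_eq_false, n1, n1.symm, n2, n2.symm, n3, n3.symm, not_false_iff,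
      iff_true, iff_false] at a1 a2 a3 a4
    have t0 := T x
    have t1 := T y₁
    have t2 := T y₂
    have t3 := T y₁'
    have t4 := T y₂'
    have inv : ∀ {a b : Fin n}, a ≠ b → ∀ {y : Fin n → ℝ}, Generic κ ϑ y → ¬ y a < y b → y b < y a :=
      fun hab _ hy h => lt_of_le_of_ne (not_lt.mp h) (hy.strand_strand.ne hab.symm)
    -- The pattern of crossings forces the middle index `j` to lie between `i` and `k` at the
    -- bottom, leaving two mirror cases.
    have hord : (x i < x j ∧ x i < x k ∧ x j < x k) ∨
        (¬ x i < x j ∧ ¬ x i < x k ∧ ¬ x j < x k) := by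
      clear inv st T
      generalize (x i < x j) = p₁, (x i < x k) = p₂, (x j < x k) = p₃, (y₁ i < y₁ j) = p₄,
        (y₁ i < y₁ k) = p₅, (y₁ j < y₁ k) = p₆, (y₂ i < y₂ j) = p₇, (y₂ i < y₂ k) = p₈,
        (y₂ j < y₂ k) = p₉, (y₁' i < y₁' j) = p₁₀, (y₁' i < y₁' k) = p₁₁, (y₁' j < y₁' k) = p₁₂,
        (y₂' i < y₂' j) = p₁₃, (y₂' i < y₂' k) = p₁₄, (y₂' j < y₂' k) = p₁₅ at *
      grind
    rcases hord with ⟨o1, o2, o3⟩ | ⟨o1, o2, o3⟩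
    · rw [sliceOp_of_strands h₁ o1, sliceOp_of_strands h₂ (a1.2.1.mp o2),
        sliceOp_of_strands h₃ (a2.2.2.mp (a1.2.2.mp o3)), sliceOp_of_strands h₁' o3,
        sliceOp_of_strands h₂' (a3.2.1.mp o2), sliceOp_of_strands h₃' (a4.1.mp (a3.1.mp o1)),
        divDiff_braid R hX hij hik hjk]
    · have h₁s := Sym2.eq_swap (a := i) (b := j) ▸ h₁
      have h₂s := Sym2.eq_swap (a := i) (b := k) ▸ h₂
      have h₃s := Sym2.eq_swap (a := j) (b := k) ▸ h₃
      have h₁s' := Sym2.eq_swap (a := j) (b := k) ▸ h₁'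
      have h₂s' := Sym2.eq_swap (a := i) (b := k) ▸ h₂'
      have h₃s' := Sym2.eq_swap (a := i) (b := j) ▸ h₃'
      rw [sliceOp_of_strands h₁s (inv hij h₁.bottom o1),
        sliceOp_of_strands h₂s (inv hik h₁.top (a1.2.1.not.mp o2)),
        sliceOp_of_strands h₃s (inv hjk h₂.top (a2.2.2.not.mp (a1.2.2.not.mp o3))),
        sliceOp_of_strands h₁s' (inv hjk h₁.bottom o3),
        sliceOp_of_strands h₂s' (inv hik h₁'.top (a3.2.1.not.mp o2)),
        sliceOp_of_strands h₃s' (inv hij h₂'.top (a4.1.not.mp (a3.1.not.mp o1))),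
        divDiff_braid R hX hjk.symm hik.symm hij.symm]
  obtain ⟨i, j, rfl, hij⟩ := h₁.exists_lt
  obtain ⟨k, l, rfl, hkl⟩ := h₂.exists_lt
  obtain ⟨r, u, rfl, hru⟩ := h₃.exists_lt
  have n1 := h₁.ne_of_strands
  have n2 := h₂.ne_of_strands
  have n3 := h₃.ne_of_strands
  rcases disjoint_or_triangle (A := x) (B := y₁) (B' := y₂') (C := y₂) (e := s(r, u)) n1 n2 h₁₂ h₁₃
    h₂₃ (fun a b _ => h₁.strands_iff a b)
    (fun a b h => by rw [(h₁'.strands_iff a b).mpr h, h₂'.strands_iff])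
    (fun a b _ => h₂.strands_iff a b) with hd₁₂ | ⟨a, b, g, hab, hag, hbg, e1, e2, e3⟩
  swap
  · exact braid a b g hab hag hbg e1 e2 e3
  rcases disjoint_or_triangle (A := x) (B := y₁) (B' := y₁') (C := z) (e := s(k, l)) n1 n3 h₁₃ h₁₂
    (Ne.symm h₂₃) (fun a b _ => h₁.strands_iff a b) (fun a b _ => h₁'.strands_iff a b)
    (fun a b h => by rw [(h₂.strands_iff a b).mpr h, h₃.strands_iff])
    with hd₁₃ | ⟨a, b, g, hab, hag, hbg, e1, e2, e3⟩
  swap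
  · exact braid b a g hab.symm hbg hag (e1.trans Sym2.eq_swap) e3 e2
  rcases disjoint_or_triangle (A := y₁) (B := y₂) (B' := y₁') (C := z) (e := s(i, j)) n2 n3 h₂₃
    (Ne.symm h₁₂) (Ne.symm h₁₃) (fun a b _ => h₂.strands_iff a b)
    (fun a b h => by rw [← (h₁.strands_iff a b).mpr h, h₁'.strands_iff])
    (fun a b _ => h₃.strands_iff a b)
    with hd₂₃ | ⟨a, b, g, hab, hag, hbg, e1, e2, e3⟩
  swap
  · exact braid b g a hbg hab.symm hag.symm e3 (e1.trans Sym2.eq_swap) (e2.trans Sym2.eq_swap)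
  have ru₁ := ((h₂.strands_iff r u).mpr h₂₃).mpr hru
  have ru₀ := ((h₁.strands_iff r u).mpr h₁₃).mpr ru₁
  have kl₀ := ((h₁.strands_iff k l).mpr h₁₂).mpr hkl
  have kl₁ := ((h₁'.strands_iff k l).mpr (Ne.symm h₂₃)).mp kl₀
  have ij₁ := ((h₁'.strands_iff i j).mpr (Ne.symm h₁₃)).mp hij
  have ij₂ := ((h₂'.strands_iff i j).mpr (Ne.symm h₁₂)).mp ij₁
  rw [sliceOp_of_strands h₁ hij, sliceOp_of_strands h₂ hkl, sliceOp_of_strands h₃ hru,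
    sliceOp_of_strands h₁' ru₀, sliceOp_of_strands h₂' kl₁, sliceOp_of_strands h₃' ij₂,
    ← divDiff_comm R X hd₁₂.1 hd₁₂.2.1 hd₁₂.2.2.1 hd₁₂.2.2.2,
    ← divDiff_comm R X hd₁₃.1 hd₁₃.2.1 hd₁₃.2.2.1 hd₁₃.2.2.2,
    ← divDiff_comm R X hd₂₃.1 hd₂₃.2.1 hd₂₃.2.2.1 hd₂₃.2.2.2]

theorem sliceOp_triple (hκ : κ ≠ 0) (hX : Function.Injective X)
    (h₁ : Step κ ϑ x y₁ c) (h₂ : Step κ ϑ y₁ y₂ d) (h₃ : Step κ ϑ y₂ z f)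
    (h₁' : Step κ ϑ x y₁' f) (h₂' : Step κ ϑ y₁' y₂' d) (h₃' : Step κ ϑ y₂' z c)
    (hne : ¬ Exceptional c d f) (F : Equiv.Perm (Fin n) → K) :
    sliceOp κ ϑ q Q X y₂ z (sliceOp κ ϑ q Q X y₁ y₂ (sliceOp κ ϑ q Q X x y₁ F)) =
      sliceOp κ ϑ q Q X y₂' z (sliceOp κ ϑ q Q X y₁' y₂' (sliceOp κ ϑ q Q X x y₁' F)) := by
  by_cases hcf : c = f
  · subst hcf
    have g₁ := h₁.sim_of_same h₁'
    have g₂ := h₃.symm.sim_of_same h₃'.symm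
    rw [sliceOp_congr (.refl x) g₁, sliceOp_congr g₁ g₂, sliceOp_congr g₂ (.refl z)]
  by_cases hc : ∃ p, c = .strands p <;> by_cases hd : ∃ p, d = .strands p <;>
    by_cases hf : ∃ p, f = .strands p
  · obtain ⟨p, rfl⟩ := hc
    obtain ⟨p', rfl⟩ := hd
    obtain ⟨p'', rfl⟩ := hf
    exact sliceOp_triple_strands hX (fun h => hcf (congrArg _ h)) h₁ h₂ h₃ h₁' h₂' h₃' F
  · obtain ⟨p, rfl⟩ := hc
    obtain ⟨p', rfl⟩ := hd
    exact sliceOp_triple_first_middle (not_exists.mp hf) h₁ h₂ h₃ h₁' h₂' h₃' F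
  · obtain ⟨p, rfl⟩ := hc
    obtain ⟨p', rfl⟩ := hf
    exact sliceOp_triple_first_last (not_exists.mp hd) (fun h => hcf (congrArg _ h)) h₁ h₂ h₃ h₁' h₂'
      h₃' F
  · obtain ⟨p, rfl⟩ := hc
    exact sliceOp_triple_first hκ (not_exists.mp hd) (not_exists.mp hf) h₁ h₂ h₃ h₁' h₂' h₃' F
  · obtain ⟨p, rfl⟩ := hd
    obtain ⟨p', rfl⟩ := hf
    exact (sliceOp_triple_first_middle (not_exists.mp hc) h₁' h₂' h₃' h₁ h₂ h₃ F).symm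
  · obtain ⟨p, rfl⟩ := hd
    exact sliceOp_triple_middle hκ (not_exists.mp hc) (not_exists.mp hf) hcf h₁ h₂ h₃ h₁' h₂' h₃'
      hne F
  · obtain ⟨p, rfl⟩ := hf
    exact (sliceOp_triple_first hκ (not_exists.mp hd) (not_exists.mp hc) h₁' h₂' h₃' h₁ h₂ h₃ F).symm
  · rw [not_exists] at hc hd hf
    rw [h₁.sliceOp_eq hc, h₂.sliceOp_eq hd, h₃.sliceOp_eq hf, h₁'.sliceOp_eq hf, h₂'.sliceOp_eq hd,
      h₃'.sliceOp_eq hc, mulOp_mul, mulOp_mul, mulOp_mul, mulOp_mul]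
    congr 2
    funext ξ
    have := coef_triple (K := K) (q := q) (Q := Q) h₁.sideStep h₂.sideStep h₃.sideStep h₁'.sideStep
      h₂'.sideStep h₃'.sideStep ξ
    linear_combination this

end

end

section

variable {R : Type*} [CommRing R] {K : Type*} [Field K] [Algebra R K] {n ℓ : ℕ}
  {κ : ℝ} {ϑ : Fin ℓ → ℝ} {q : R} {Q : Fin ℓ → R} {X : Fin n → K}

/-! ### Bigons and exceptional triple points -/

theorem coef_of_ghost {x y : Fin n → ℝ} {a b : Fin n} (h : Step κ ϑ x y (.ghost a b))
    (ξ : Fin n → K) :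
    coef κ ϑ q Q x y ξ = if x a < x b + κ then ξ a - algebraMap R K q * ξ b else 1 := by
  have h1 : ∀ i t, ¬ (¬ x i < ϑ t ∧ y i < ϑ t) := fun i t => by
    have := (h.red i t).mpr (by simp)
    tauto
  have h2 : ∀ i j, ¬ (i = a ∧ j = b) → ¬ (x i < x j + κ ∧ ¬ y i < y j + κ) := fun i j hij => by
    have := (h.ghost i j).mpr (by
      rw [Ne, Crossing.ghost.injEq]; exact fun h => hij ⟨h.1.symm, h.2.symm⟩)
    tauto
  have h3 : x a < x b + κ ∧ ¬ y a < y b + κ ↔ x a < x b + κ := by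
    have := (h.ghost a b).not.mpr (by simp)
    tauto
  unfold coef
  simp only [h1, if_false, Finset.prod_const_one, mul_one]
  rw [Finset.prod_eq_single a, Finset.prod_eq_single b]
  · simp only [h3]
  · exact fun j _ hj => if_neg (h2 a j (fun h => hj h.2))
  · exact fun h => absurd (Finset.mem_univ _) h
  · exact fun i _ hi => Finset.prod_eq_one fun j _ => if_neg (h2 i j (fun h => hi h.1))
  · exact fun h => absurd (Finset.mem_univ _) h

theorem aeval_redPoly (a : ℝ) (u : K) : Polynomial.aeval u (redPoly ϑ Q a) =
    ∏ t, if ϑ t = a then u - algebraMap R K (Q t) else 1 := by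
  classical
  rw [redPoly, map_prod, Finset.prod_filter]
  refine Finset.prod_congr rfl fun t _ => ?_
  split_ifs <;> simp

theorem coef_of_red {x y : Fin n → ℝ} {a : Fin n} {r : ℝ} (h : Step κ ϑ x y (.red a r))
    (ξ : Fin n → K) :
    coef κ ϑ q Q x y ξ = if x a < r then 1 else Polynomial.aeval (ξ a) (redPoly ϑ Q r) := by
  have h1 : ∀ i j, ¬ (x i < x j + κ ∧ ¬ y i < y j + κ) := fun i t => by
    have := (h.ghost i t).mpr (by simp)
    tauto
  have h2 : ∀ i t, ¬ (i = a ∧ ϑ t = r) → ¬ (¬ x i < ϑ t ∧ y i < ϑ t) := fun i t hij => by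
    have := (h.red i t).mpr (by
      rw [Ne, Crossing.red.injEq]; exact fun h => hij ⟨h.1.symm, h.2.symm⟩)
    tauto
  have h3 : ∀ t, ϑ t = r → ((¬ x a < ϑ t ∧ y a < ϑ t) ↔ ¬ x a < r) := fun t ht => by
    have := (h.red a t).not.mpr (by simp [ht])
    rw [ht] at *
    tauto
  unfold coef
  simp only [h1, if_false, Finset.prod_const_one, one_mul]
  rw [Finset.prod_eq_single a]
  · rw [aeval_redPoly]
    split_ifs with h4
    · refine Finset.prod_eq_one fun t _ => ?_
      by_cases ht : ϑ t = r
      · rw [if_neg]; rw [h3 t ht]; simpa using h4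
      · exact if_neg (h2 a t (fun h => ht h.2))
    · refine Finset.prod_congr rfl fun t _ => ?_
      by_cases ht : ϑ t = r
      · rw [if_pos ht, if_pos]; rwa [h3 t ht]
      · rw [if_neg ht, if_neg (h2 a t (fun h => ht h.2))]
  · exact fun i _ hi => Finset.prod_eq_one fun j _ => if_neg (h2 i j (fun h => hi h.1))
  · exact fun h => absurd (Finset.mem_univ _) h

theorem sliceOp_bigon_ghost {x y z : Fin n → ℝ} {i j : Fin n} (h : Step κ ϑ x y (.ghost i j))
    (h' : Step κ ϑ y z (.ghost i j)) (F : Equiv.Perm (Fin n) → K) :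
    sliceOp κ ϑ q Q X y z (sliceOp κ ϑ q Q X x y F) =
      mulOp R X (fun ξ => ξ i - algebraMap R K q * ξ j) F := by
  rw [h.sliceOp_eq (by simp), h'.sliceOp_eq (by simp), mulOp_mul]
  congr 2
  funext ξ
  rw [coef_of_ghost h, coef_of_ghost h']
  have := (h.ghost i j).not.mpr (by simp)
  by_cases h1 : x i < x j + κ
  · have h2 : ¬ y i < y j + κ := by tauto
    rw [if_pos h1, if_neg h2, one_mul]
  · have h2 : y i < y j + κ := by tauto
    rw [if_neg h1, if_pos h2, mul_one]

theorem sliceOp_bigon_red {x y z : Fin n → ℝ} {i : Fin n} {a : ℝ} (h : Step κ ϑ x y (.red i a))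
    (h' : Step κ ϑ y z (.red i a)) (F : Equiv.Perm (Fin n) → K) :
    sliceOp κ ϑ q Q X y z (sliceOp κ ϑ q Q X x y F) =
      mulOp R X (fun ξ => Polynomial.aeval (ξ i) (redPoly ϑ Q a)) F := by
  rw [h.sliceOp_eq (by simp), h'.sliceOp_eq (by simp), mulOp_mul]
  congr 2
  funext ξ
  rw [coef_of_red h, coef_of_red h']
  obtain ⟨t, rfl⟩ := exists_red_of_mem
    (h.crossings_eq ▸ rfl : Crossing.red i a ∈ crossings κ ϑ x y)
  have := (h.red i t).not.mpr (by simp)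
  by_cases h1 : x i < ϑ t
  · have h2 : ¬ y i < ϑ t := by tauto
    rw [if_pos h1, if_neg h2, mul_one]
  · have h2 : y i < ϑ t := by tauto
    rw [if_neg h1, if_pos h2, one_mul]

theorem mulOp_divDiff_mulOp_apply (i k : Fin n) (α β : (Fin n → K) → K)
    (F : Equiv.Perm (Fin n) → K) (σ : Equiv.Perm (Fin n)) :
    mulOp R X β (divDiff R X i k (mulOp R X α F)) σ =
      β (vars X σ) * ((α (vars X σ) * F σ - α (vars X σ ∘ Equiv.swap i k) *
        F (Equiv.swap i k * σ)) / (vars X σ i - vars X σ k)) := by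
  simp only [mulOp_apply, divDiff_apply, vars_swap_mul]

section

variable {x y₁ y₂ y₁' y₂' z : Fin n → ℝ}

/-- Only the passage of `b` over the ghost of `k` carries a factor. It comes after the divided
difference on one path and before it on the other, so the difference is the Leibniz term of `ξ b - q
* ξ k`. -/
theorem sliceOp_triple_strand (hX : Function.Injective X) {b i k : Fin n}
    (h₁ : Step κ ϑ x y₁ (.ghost b i)) (h₂ : Step κ ϑ y₁ y₂ (.strands s(i, k)))
    (h₃ : Step κ ϑ y₂ z (.ghost b k)) (h₁' : Step κ ϑ x y₁' (.ghost b k))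
    (h₂' : Step κ ϑ y₁' y₂' (.strands s(i, k))) (h₃' : Step κ ϑ y₂' z (.ghost b i))
    (hik : x i < x k) (F : Equiv.Perm (Fin n) → K) (σ : Equiv.Perm (Fin n)) :
    sliceOp κ ϑ q Q X y₂ z (sliceOp κ ϑ q Q X y₁ y₂ (sliceOp κ ϑ q Q X x y₁ F)) σ -
      sliceOp κ ϑ q Q X y₂' z (sliceOp κ ϑ q Q X y₁' y₂' (sliceOp κ ϑ q Q X x y₁' F)) σ =
      -(algebraMap R K q * F (Equiv.swap i k * σ)) := by
  have nik := h₂.ne_of_strands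
  have nbi := h₁.ne_of_ghost
  have nbk := h₃.ne_of_ghost
  have hy₁ : y₁ i < y₁ k := (h₁.strands_of_ne (by simp) i k).mp hik
  have hy₁' : y₁' i < y₁' k := (h₁'.strands_of_ne (by simp) i k).mp hik
  have a1 := (h₁.ghost b i).not.mpr (by simp)
  have a2 := (h₁.ghost b k).mpr (by simp [nik])
  have b1 := (h₁'.ghost b i).mpr (by simp [nik.symm])
  have b2 := (h₁'.ghost b k).not.mpr (by simp)
  have c2 := h₂.sameSides.ghost b k
  have d1 := h₂'.sameSides.ghost b i
  -- All three orders being reversed at the top, the strand `b` must start between the ghost of `i`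
  -- and the ghost of `k`.
  have e1 : ¬ x b < x i + κ := by
    intro h
    have f1 : x b < x k + κ := by linarith
    have f2 : ¬ y₁' b < y₁' k + κ := by tauto
    have f3 := b1.mp h
    linarith
  have e2 : x b < x k + κ := by
    by_contra h
    have f1 : y₁ b < y₁ i + κ := by tauto
    have f2 := a2.not.mp h
    linarith
  have e3 : y₂ b < y₂ k + κ := c2.mp (a2.mp e2)
  have e4 : ¬ y₂' b < y₂' i + κ := fun h => e1 (b1.mpr (d1.mpr h))
  have hne := vars_sub_ne_zero hX σ nik
  rw [sliceOp_of_strands h₂ hy₁, sliceOp_of_strands h₂' hy₁', h₁.sliceOp_eq (by simp),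
    h₃.sliceOp_eq (by simp), h₁'.sliceOp_eq (by simp), h₃'.sliceOp_eq (by simp),
    mulOp_divDiff_mulOp_apply, mulOp_divDiff_mulOp_apply]
  simp only [coef_of_ghost h₁, coef_of_ghost h₃, coef_of_ghost h₁', coef_of_ghost h₃', e1, e2, e3, e4,
    if_true, if_false, Function.comp_apply, Equiv.swap_apply_right,
    Equiv.swap_apply_of_ne_of_ne nbi nbk]
  field_simp
  ring

/-- Here `i` starts to the left of the ghost of `b` and passes it rightwards, `k` passes it without
a factor, and the error is the Leibniz term of `ξ i - q * ξ b`. -/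
theorem sliceOp_triple_ghost (hX : Function.Injective X) {b i k : Fin n}
    (h₁ : Step κ ϑ x y₁ (.ghost i b)) (h₂ : Step κ ϑ y₁ y₂ (.strands s(i, k)))
    (h₃ : Step κ ϑ y₂ z (.ghost k b)) (h₁' : Step κ ϑ x y₁' (.ghost k b))
    (h₂' : Step κ ϑ y₁' y₂' (.strands s(i, k))) (h₃' : Step κ ϑ y₂' z (.ghost i b))
    (hik : x i < x k) (F : Equiv.Perm (Fin n) → K) (σ : Equiv.Perm (Fin n)) :
    sliceOp κ ϑ q Q X y₂ z (sliceOp κ ϑ q Q X y₁ y₂ (sliceOp κ ϑ q Q X x y₁ F)) σ -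
      sliceOp κ ϑ q Q X y₂' z (sliceOp κ ϑ q Q X y₁' y₂' (sliceOp κ ϑ q Q X x y₁' F)) σ =
      F (Equiv.swap i k * σ) := by
  have nik := h₂.ne_of_strands
  have nbi := h₁.ne_of_ghost.symm
  have nbk := h₃.ne_of_ghost.symm
  have hy₁ : y₁ i < y₁ k := (h₁.strands_of_ne (by simp) i k).mp hik
  have hy₁' : y₁' i < y₁' k := (h₁'.strands_of_ne (by simp) i k).mp hik
  have a1 := (h₁.ghost i b).not.mpr (by simp)
  have a2 := (h₁.ghost k b).mpr (by simp [nik])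
  have b1 := (h₁'.ghost i b).mpr (by simp [nik.symm])
  have b2 := (h₁'.ghost k b).not.mpr (by simp)
  have c2 := h₂.sameSides.ghost k b
  have d1 := h₂'.sameSides.ghost i b
  have e2 : ¬ x k < x b + κ := by
    intro h
    have f1 : x i < x b + κ := by linarith
    have f2 : ¬ y₁ i < y₁ b + κ := by tauto
    have f3 := a2.mp h
    linarith
  have e1 : x i < x b + κ := by
    by_contra h
    have f1 : y₁' k < y₁' b + κ := by tauto
    have f2 := b1.not.mp h
    linarith
  have e3 : ¬ y₂ k < y₂ b + κ := fun h => e2 (a2.mpr (c2.mpr h))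
  have e4 : y₂' i < y₂' b + κ := d1.mp (b1.mp e1)
  have hne := vars_sub_ne_zero hX σ nik
  rw [sliceOp_of_strands h₂ hy₁, sliceOp_of_strands h₂' hy₁', h₁.sliceOp_eq (by simp),
    h₃.sliceOp_eq (by simp), h₁'.sliceOp_eq (by simp), h₃'.sliceOp_eq (by simp),
    mulOp_divDiff_mulOp_apply, mulOp_divDiff_mulOp_apply]
  simp only [coef_of_ghost h₁, coef_of_ghost h₃, coef_of_ghost h₁', coef_of_ghost h₃', e1, e2, e3, e4,
    if_true, if_false, Function.comp_apply, Equiv.swap_apply_left,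
    Equiv.swap_apply_of_ne_of_ne nbi nbk]
  field_simp
  ring

/-- Only `k`, which starts to the right of the red line, carries a factor, and the error is the
Leibniz term of the polynomial of the red line. -/
theorem sliceOp_triple_red (hX : Function.Injective X) {a : ℝ} {i k : Fin n}
    (h₁ : Step κ ϑ x y₁ (.red i a)) (h₂ : Step κ ϑ y₁ y₂ (.strands s(i, k)))
    (h₃ : Step κ ϑ y₂ z (.red k a)) (h₁' : Step κ ϑ x y₁' (.red k a))
    (h₂' : Step κ ϑ y₁' y₂' (.strands s(i, k))) (h₃' : Step κ ϑ y₂' z (.red i a))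
    (hik : x i < x k) (F : Equiv.Perm (Fin n) → K) (σ : Equiv.Perm (Fin n)) :
    sliceOp κ ϑ q Q X y₂ z (sliceOp κ ϑ q Q X y₁ y₂ (sliceOp κ ϑ q Q X x y₁ F)) σ -
      sliceOp κ ϑ q Q X y₂' z (sliceOp κ ϑ q Q X y₁' y₂' (sliceOp κ ϑ q Q X x y₁' F)) σ =
      (Polynomial.aeval (vars X σ i) (redPoly ϑ Q a) -
        Polynomial.aeval (vars X σ k) (redPoly ϑ Q a)) / (vars X σ i - vars X σ k) *
        F (Equiv.swap i k * σ) := by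
  have nik := h₂.ne_of_strands
  have hy₁ : y₁ i < y₁ k := (h₁.strands_of_ne (by simp) i k).mp hik
  have hy₁' : y₁' i < y₁' k := (h₁'.strands_of_ne (by simp) i k).mp hik
  obtain ⟨t, rfl⟩ := exists_red_of_mem
    (h₁.crossings_eq ▸ rfl : Crossing.red i a ∈ crossings κ ϑ x y₁)
  have a1 := (h₁.red i t).not.mpr (by simp)
  have a2 := (h₁.red k t).mpr (by simp [nik])
  have b1 := (h₁'.red i t).mpr (by simp [nik.symm])
  have b2 := (h₁'.red k t).not.mpr (by simp)
  have c2 := h₂.sameSides.red k t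
  have d1 := h₂'.sameSides.red i t
  have e2 : ¬ x k < ϑ t := by
    intro h
    have f1 : x i < ϑ t := by linarith
    have f2 : ¬ y₁ i < ϑ t := by tauto
    have f3 := a2.mp h
    linarith
  have e1 : x i < ϑ t := by
    by_contra h
    have f1 : y₁' k < ϑ t := by tauto
    have f2 := b1.not.mp h
    linarith
  have e3 : ¬ y₂ k < ϑ t := fun h => e2 (a2.mpr (c2.mpr h))
  have e4 : y₂' i < ϑ t := d1.mp (b1.mp e1)
  have hne := vars_sub_ne_zero hX σ nik
  rw [sliceOp_of_strands h₂ hy₁, sliceOp_of_strands h₂' hy₁', h₁.sliceOp_eq (by simp),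
    h₃.sliceOp_eq (by simp), h₁'.sliceOp_eq (by simp), h₃'.sliceOp_eq (by simp),
    mulOp_divDiff_mulOp_apply, mulOp_divDiff_mulOp_apply]
  simp only [coef_of_red h₁, coef_of_red h₃, coef_of_red h₁', coef_of_red h₃', e1, e2, e3, e4,
    if_true, if_false, Function.comp_apply, Equiv.swap_apply_right]
  field_simp
  ring

/-- At an exceptional triple point, uncrossing the two strands removes all crossings. -/
theorem sim_swap_of_triple {c f : Crossing n} {i k : Fin n} (h₁ : Step κ ϑ x y₁ c)
    (h₂ : Step κ ϑ y₁ y₂ (.strands s(i, k))) (h₃ : Step κ ϑ y₂ z f)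
    (h : c.map (Equiv.swap i k) = f) : Sim κ ϑ x (z ∘ Equiv.swap i k) := by
  have g := (h₃.comp (Equiv.swap i k)).symm
  rw [Equiv.swap_inv, ← h, map_swap_swap] at g
  have g' := g.congr (.refl _) h₂.sim_swap.symm g.bottom h₁.top
  exact h₁.symm.sim_of_same g'.symm

end

end

/-! ### The polynomial representation -/

section

variable (R : Type*) [CommRing R] {K : Type*} [Field K] [Algebra R K] {n ℓ : ℕ}

/-- The restriction of a function to the labelled configurations above `x`. -/
def restrictAt (x : Fin n → ℝ) : ((Fin n → ℝ) → K) →ₗ[R] (Equiv.Perm (Fin n) → K) where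
  toFun f σ := f (x ∘ σ)
  map_add' _ _ := rfl
  map_smul' _ _ := rfl

open Classical in
/-- The extension by zero of a function on the labelled configurations above `y`. -/
def extendAt (y : Fin n → ℝ) : (Equiv.Perm (Fin n) → K) →ₗ[R] ((Fin n → ℝ) → K) where
  toFun F w := ∑ σ : Equiv.Perm (Fin n), if w = y ∘ σ then F σ else 0
  map_add' F G := by
    funext w
    simp only [Pi.add_apply, ← Finset.sum_add_distrib]
    exact Finset.sum_congr rfl fun σ _ => by split_ifs <;> simp
  map_smul' r F := by
    funext w
    simp only [Pi.smul_apply, Finset.smul_sum, RingHom.id_apply]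
    exact Finset.sum_congr rfl fun σ _ => by split_ifs <;> simp

theorem extendAt_apply {y : Fin n → ℝ} (hy : Function.Injective y)
    (F : Equiv.Perm (Fin n) → K) (σ : Equiv.Perm (Fin n)) : extendAt R y F (y ∘ σ) = F σ := by
  classical
  change (∑ τ : Equiv.Perm (Fin n), if y ∘ σ = y ∘ τ then F τ else 0) = F σ
  rw [Finset.sum_eq_single σ]
  · simp
  · intro τ _ hτ
    refine if_neg fun h => hτ ?_
    ext i
    exact congrArg _ (hy (congrFun h i)).symm
  · exact fun h => absurd (Finset.mem_univ _) h

theorem restrictAt_extendAt {y : Fin n → ℝ} (hy : Function.Injective y)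
    (F : Equiv.Perm (Fin n) → K) : restrictAt R y (extendAt R y F) = F := by
  funext σ
  exact extendAt_apply R hy F σ

theorem extendAt_apply_of_ne {y w : Fin n → ℝ} (h : Set.range w ≠ Set.range y)
    (F : Equiv.Perm (Fin n) → K) : extendAt R y F w = 0 := by
  classical
  refine Finset.sum_eq_zero fun σ _ => if_neg ?_
  rintro rfl
  exact h (σ.surjective.range_comp y)

theorem restrictAt_extendAt_of_ne {y y' : Fin n → ℝ} (h : Set.range y ≠ Set.range y')
    (F : Equiv.Perm (Fin n) → K) : restrictAt R y' (extendAt R y F) = 0 := by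
  funext σ
  refine extendAt_apply_of_ne R ?_ F
  rw [σ.surjective.range_comp]
  exact h.symm

theorem extendAt_comp (y : Fin n → ℝ) (τ : Equiv.Perm (Fin n)) (F : Equiv.Perm (Fin n) → K) :
    extendAt R (y ∘ τ) (fun σ => F (τ * σ)) = extendAt R y F := by
  classical
  funext w
  exact Fintype.sum_equiv (Equiv.mulLeft τ) _ _ fun σ => by
    simp only [Equiv.coe_mulLeft, Equiv.Perm.coe_mul, Function.comp_assoc]
    congr

theorem restrictAt_comp (x : Fin n → ℝ) (τ : Equiv.Perm (Fin n)) (f : (Fin n → ℝ) → K) :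
    restrictAt R (x ∘ τ) f = fun σ => restrictAt R x f (τ * σ) := rfl

end

section

variable {R : Type*} [CommRing R] {K : Type*} [Field K] [Algebra R K] {n ℓ : ℕ}

variable (κ : ℝ) (ϑ : Fin ℓ → ℝ) (q : R) (Q : Fin ℓ → R) (X : Fin n → K) in
/-- The action of the generators on functions on labelled configurations. -/
def repGen : Gen κ ϑ n → Module.End R ((Fin n → ℝ) → K)
  | .slice x y _ => extendAt R y ∘ₗ sliceOp κ ϑ q Q X x y ∘ₗ restrictAt R x
  | .square x _ i a => extendAt R x ∘ₗ mulOp R X (fun ξ => ξ i ^ a) ∘ₗ restrictAt R x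

variable {κ : ℝ} {ϑ : Fin ℓ → ℝ} {q : R} {Q : Fin ℓ → R} {X : Fin n → K}

theorem lift_slice {x y : Fin n → ℝ} (h : IsSlice κ ϑ x y) (f : (Fin n → ℝ) → K) :
    FreeAlgebra.lift R (repGen κ ϑ q Q X) (slice R h) f =
      extendAt R y (sliceOp κ ϑ q Q X x y (restrictAt R x f)) := by
  rw [slice, FreeAlgebra.lift_ι_apply]
  rfl

theorem lift_square {x : Fin n → ℝ} (h : Generic κ ϑ x) (i : Fin n) (a : ℤ)
    (f : (Fin n → ℝ) → K) :
    FreeAlgebra.lift R (repGen κ ϑ q Q X) (square R h i a) f =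
      extendAt R x (mulOp R X (fun ξ => ξ i ^ a) (restrictAt R x f)) := by
  rw [square, FreeAlgebra.lift_ι_apply]
  rfl

theorem lift_mul (a b : FreeAlgebra R (Gen κ ϑ n)) (f : (Fin n → ℝ) → K) :
    FreeAlgebra.lift R (repGen κ ϑ q Q X) (a * b) f =
      FreeAlgebra.lift R (repGen κ ϑ q Q X) a (FreeAlgebra.lift R (repGen κ ϑ q Q X) b f) := by
  rw [map_mul]
  rfl

theorem lift_sub (a b : FreeAlgebra R (Gen κ ϑ n)) (f : (Fin n → ℝ) → K) :
    FreeAlgebra.lift R (repGen κ ϑ q Q X) (a - b) f =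
      FreeAlgebra.lift R (repGen κ ϑ q Q X) a f - FreeAlgebra.lift R (repGen κ ϑ q Q X) b f := by
  rw [map_sub]
  rfl

theorem lift_neg (a : FreeAlgebra R (Gen κ ϑ n)) (f : (Fin n → ℝ) → K) :
    FreeAlgebra.lift R (repGen κ ϑ q Q X) (-a) f =
      -FreeAlgebra.lift R (repGen κ ϑ q Q X) a f := by
  rw [map_neg]
  rfl

theorem lift_smul (r : R) (a : FreeAlgebra R (Gen κ ϑ n)) (f : (Fin n → ℝ) → K) :
    FreeAlgebra.lift R (repGen κ ϑ q Q X) (r • a) f =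
      r • FreeAlgebra.lift R (repGen κ ϑ q Q X) a f := by
  rw [map_smul]
  rfl

theorem extend_mulOp_sum {ι : Type*} (s : Finset ι) (x : Fin n → ℝ)
    (m : ι → (Fin n → K) → K) (F : Equiv.Perm (Fin n) → K) :
    ∑ a ∈ s, extendAt R x (mulOp R X (m a) F) = extendAt R x (mulOp R X (fun ξ => ∑ a ∈ s, m a ξ) F) := by
  rw [← map_sum]
  congr 1
  funext σ
  simp only [Finset.sum_apply, mulOp_apply, Finset.sum_mul]

theorem smul_extend_mulOp (r : R) (x : Fin n → ℝ) (m : (Fin n → K) → K)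
    (F : Equiv.Perm (Fin n) → K) :
    r • extendAt R x (mulOp R X m F) = extendAt R x (mulOp R X (fun ξ => r • m ξ) F) := by
  rw [← map_smul]
  congr 1
  funext σ
  simp only [Pi.smul_apply, mulOp_apply, smul_mul_assoc]

theorem lift_polySquare {x : Fin n → ℝ} (h : Generic κ ϑ x) (i : Fin n) (p : R[X])
    (f : (Fin n → ℝ) → K) :
    FreeAlgebra.lift R (repGen κ ϑ q Q X) (polySquare h i p) f =
      extendAt R x (mulOp R X (fun ξ => Polynomial.aeval (ξ i) p) (restrictAt R x f)) := by
  rw [polySquare, map_sum, LinearMap.sum_apply]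
  simp only [lift_smul, lift_square, smul_extend_mulOp, extend_mulOp_sum, zpow_natCast,
    Polynomial.aeval_eq_sum_range]

/-- The value of the divided difference of a polynomial. -/
def divDiffValue (p : R[X]) (u v : K) : K :=
  ∑ m ∈ Finset.range p.natDegree, p.coeff (m + 1) •
    ∑ ab ∈ Finset.HasAntidiagonal.antidiagonal m, u ^ ab.1 * v ^ ab.2

theorem divDiffValue_mul (p : R[X]) (u v : K) :
    divDiffValue p u v * (u - v) = Polynomial.aeval u p - Polynomial.aeval v p := by
  rw [divDiffValue, Finset.sum_mul, Polynomial.aeval_eq_sum_range, Polynomial.aeval_eq_sum_range,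
    ← Finset.sum_sub_distrib, Finset.sum_range_succ' (fun m => p.coeff m • u ^ m - p.coeff m • v ^ m)]
  simp only [pow_zero, sub_self, add_zero]
  refine Finset.sum_congr rfl fun m _ => ?_
  rw [smul_mul_assoc, ← smul_sub, ← geom_sum₂_mul,
    Finset.Nat.sum_antidiagonal_eq_sum_range_succ (fun a b => u ^ a * v ^ b)]
  rfl

theorem lift_dividedDifference {x : Fin n → ℝ} (h : Generic κ ϑ x) (i k : Fin n) (p : R[X])
    (f : (Fin n → ℝ) → K) :
    FreeAlgebra.lift R (repGen κ ϑ q Q X) (dividedDifference h i k p) f =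
      extendAt R x (mulOp R X (fun ξ => divDiffValue p (ξ i) (ξ k)) (restrictAt R x f)) := by
  rw [dividedDifference, map_sum, LinearMap.sum_apply]
  simp only [lift_smul, map_sum, LinearMap.sum_apply, lift_mul, lift_square,
    restrictAt_extendAt R h.strand_strand, mulOp_mul, smul_extend_mulOp, extend_mulOp_sum,
    zpow_natCast, divDiffValue]

theorem rep_square_cross (hX : Function.Injective X) {i j : Fin n} (hij : i ≠ j)
    (F : Equiv.Perm (Fin n) → K) :
    mulOp R X (fun ξ => ξ j ^ (1 : ℤ)) (divDiff R X i j F) -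
      divDiff R X i j (mulOp R X (fun ξ => ξ j ^ (1 : ℤ)) F) =
      (fun σ => F (Equiv.swap i j * σ)) ∧
    divDiff R X i j (mulOp R X (fun ξ => ξ i ^ (1 : ℤ)) F) -
      mulOp R X (fun ξ => ξ i ^ (1 : ℤ)) (divDiff R X i j F) =
      (fun σ => F (Equiv.swap i j * σ)) := by
  constructor <;>
  · funext σ
    have := vars_sub_ne_zero hX σ hij
    simp only [Pi.sub_apply, mulOp_apply, divDiff_apply, vars_swap_mul, Function.comp_apply,
      Equiv.swap_apply_right, Equiv.swap_apply_left, zpow_one]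
    field_simp
    ring

theorem extendAt_comp_swap (y : Fin n → ℝ) (i j : Fin n) (F : Equiv.Perm (Fin n) → K) :
    extendAt R (y ∘ Equiv.swap i j) F = extendAt R y (fun σ => F (Equiv.swap i j * σ)) := by
  rw [← extendAt_comp R y (Equiv.swap i j)]
  congr 1
  funext σ
  rw [← mul_assoc, Equiv.swap_mul_self, one_mul]

/-- Every generator restricts to the labellings of its bottom and extends by zero from those of its
top. Each relation thus reduces to an identity between slice operators. -/
theorem lift_rel (hκ : κ ≠ 0) (hX : Function.Injective X) (hX0 : ∀ i, X i ≠ 0)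
    {a b : FreeAlgebra R (Gen κ ϑ n)} (h : Rel κ ϑ q Q n a b) :
    FreeAlgebra.lift R (repGen κ ϑ q Q X) a = FreeAlgebra.lift R (repGen κ ϑ q Q X) b := by
  refine LinearMap.ext fun f => ?_
  have hinj : ∀ {x : Fin n → ℝ}, Generic κ ϑ x → ∀ F : Equiv.Perm (Fin n) → K,
      restrictAt R x (extendAt R x F) = F := fun h F => restrictAt_extendAt R h.strand_strand F
  have hv : ∀ σ i, vars X σ i ≠ 0 := fun σ i => hX0 _
  cases h with
  | @relabel x y σ h h' =>
    rw [lift_slice, lift_slice, restrictAt_comp, ← extendAt_comp R y σ]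
    congr 1
    funext τ
    exact sliceOp_comp x y σ τ _
  | @relabel_square x σ h h' i a =>
    rw [lift_square, lift_square, restrictAt_comp, ← extendAt_comp R x σ]
    congr 1
    funext τ
    simp [mulOp_apply, vars_mul]
  | mismatch h h' hne =>
    rw [lift_mul, lift_slice, lift_slice, restrictAt_extendAt_of_ne R hne, map_zero, map_zero, map_zero]
    rfl
  | straighten hxy hyz hxz hc =>
    rw [lift_mul, lift_slice, lift_slice, lift_slice, hinj hyz.bottom]
    congr 1
    rcases hc with hc | hc
    · have hs := sim_of_crossings_eq_empty hxy.bottom hxy.top hc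
      rw [sliceOp_of_sim hs, sliceOp_congr hs (.refl _)]
    · have hs := sim_of_crossings_eq_empty hyz.bottom hyz.top hc
      rw [sliceOp_of_sim hs, sliceOp_congr (.refl _) hs]
  | exchange hxy hyz hxy' hy'z h₁ h₂ h₁' h₂' =>
    rw [lift_mul, lift_slice, lift_slice, hinj hyz.bottom, lift_mul, lift_slice, lift_slice,
      hinj hy'z.bottom]
    congr 1
    exact sliceOp_exchange ⟨hxy.bottom, hxy.top, h₁⟩ ⟨hyz.bottom, hyz.top, h₂⟩
      ⟨hxy'.bottom, hxy'.top, h₁'⟩ ⟨hy'z.bottom, hy'z.top, h₂'⟩ _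
  | @square_zero x h i =>
    rw [vertical, lift_square, lift_slice, sliceOp_of_sim (.refl x)]
    simp only [zpow_zero, mulOp_one]
  | square_add h i a b =>
    rw [lift_mul, lift_square, lift_square, lift_square, hinj h, mulOp_mul]
    congr 1
    funext σ
    simp only [mulOp_apply, zpow_add₀ (hv σ i)]
  | square_comm h i j a b =>
    rw [lift_mul, lift_square, lift_square, lift_mul, lift_square, lift_square, hinj h, hinj h,
      mulOp_mul, mulOp_mul]
    congr 1
    funext σ
    simp only [mulOp_apply, mul_comm]
  | @square_slide x y h i a hc =>
    rw [lift_mul, lift_slice, lift_square, lift_mul, lift_square, lift_slice, hinj h.top,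
      hinj h.bottom]
    congr 1
    rcases h.at_most_one.eq_empty_or_singleton with h0 | ⟨c, h0⟩
    · have hs := sim_of_crossings_eq_empty h.bottom h.top h0
      rw [sliceOp_of_sim hs, sliceOp_of_sim hs]
    · have hs : Step κ ϑ x y c := ⟨h.bottom, h.top, h0⟩
      by_cases hp : ∃ p, c = .strands p
      · obtain ⟨p, rfl⟩ := hp
        obtain ⟨k, l, rfl, hkl⟩ := hs.exists_lt
        have hik : i ≠ k := by
          rintro rfl
          exact hc l (h0 ▸ rfl)
        have hil : i ≠ l := by
          rintro rfl
          exact hc k (h0 ▸ by rw [Sym2.eq_swap]; rfl)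
        rw [sliceOp_of_strands hs hkl, ← divDiff_mulOp R X (fun _ => rfl)]
        intro ξ
        simp only [Function.comp_apply, Equiv.swap_apply_of_ne_of_ne hik hil]
      · rw [hs.sliceOp_eq (not_exists.mp hp), mulOp_mul, mulOp_mul]
        congr 2
        funext ξ
        exact mul_comm _ _
  | @square_cross_left x y i j h hc hij h' =>
    have hs : Step κ ϑ x y (.strands s(i, j)) := ⟨h.bottom, h.top, hc⟩
    rw [lift_sub, lift_mul, lift_mul, lift_slice, lift_square, lift_square, lift_slice, lift_slice,
      hinj h.top, hinj h.bottom, ← map_sub, sliceOp_of_strands hs hij, sliceOp_of_sim hs.sim_swap,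
      extendAt_comp_swap, (rep_square_cross hX hs.ne_of_strands _).1]
  | @square_cross_right x y i j h hc hij h' =>
    have hs : Step κ ϑ x y (.strands s(i, j)) := ⟨h.bottom, h.top, hc⟩
    rw [lift_sub, lift_mul, lift_mul, lift_slice, lift_square, lift_square, lift_slice, lift_slice,
      hinj h.top, hinj h.bottom, ← map_sub, sliceOp_of_strands hs hij, sliceOp_of_sim hs.sim_swap,
      extendAt_comp_swap, (rep_square_cross hX hs.ne_of_strands _).2]
  | bigon_strands hxy hyz h₁ h₂ =>
    rw [lift_mul, lift_slice, lift_slice, hinj hyz.bottom,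
      sliceOp_bigon_strands ⟨hxy.bottom, hxy.top, h₁⟩ ⟨hyz.bottom, hyz.top, h₂⟩, map_zero, map_zero]
    rfl
  | @bigon_ghost x y z i j hxy hyz hxz h₁ h₂ =>
    have s₁ : Step κ ϑ x y (.ghost i j) := ⟨hxy.bottom, hxy.top, h₁⟩
    have s₂ : Step κ ϑ y z (.ghost i j) := ⟨hyz.bottom, hyz.top, h₂⟩
    rw [lift_mul, lift_slice, lift_slice, hinj hyz.bottom, sliceOp_bigon_ghost s₁ s₂, lift_mul,
      lift_slice, sliceOp_of_sim (s₁.symm.sim_of_same s₂), lift_sub, lift_smul, lift_square,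
      lift_square, smul_extend_mulOp, ← map_sub, hinj hxz.bottom]
    congr 1
    funext σ
    simp only [Pi.sub_apply, mulOp_apply, zpow_one, Algebra.smul_def]
    ring
  | @bigon_red x y z i a hxy hyz hxz h₁ h₂ =>
    have s₁ : Step κ ϑ x y (.red i a) := ⟨hxy.bottom, hxy.top, h₁⟩
    have s₂ : Step κ ϑ y z (.red i a) := ⟨hyz.bottom, hyz.top, h₂⟩
    rw [lift_mul, lift_slice, lift_slice, hinj hyz.bottom, sliceOp_bigon_red s₁ s₂, lift_mul,
      lift_slice, sliceOp_of_sim (s₁.symm.sim_of_same s₂), lift_polySquare, hinj hxz.bottom]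
  | triple h₁ h₂ h₃ h₁' h₂' h₃' hc₁ hc₂ hc₃ hc₁' hc₂' hc₃' hcdf =>
    rw [lift_mul, lift_mul, lift_slice, lift_slice, lift_slice, hinj h₂.bottom, hinj h₃.bottom,
      lift_mul, lift_mul, lift_slice, lift_slice, lift_slice, hinj h₂'.bottom, hinj h₃'.bottom,
      sliceOp_triple hκ hX ⟨h₁.bottom, h₁.top, hc₁⟩ ⟨h₂.bottom, h₂.top, hc₂⟩
        ⟨h₃.bottom, h₃.top, hc₃⟩ ⟨h₁'.bottom, h₁'.top, hc₁'⟩ ⟨h₂'.bottom, h₂'.top, hc₂'⟩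
        ⟨h₃'.bottom, h₃'.top, hc₃'⟩ hcdf]
  | @triple_strand x y₁ y₂ y₁' y₂' z b i k h₁ h₂ h₃ h₁' h₂' h₃' hc₁ hc₂ hc₃ hc₁' hc₂' hc₃' hik hs =>
    have s₁ : Step κ ϑ x y₁ _ := ⟨h₁.bottom, h₁.top, hc₁⟩
    have s₂ : Step κ ϑ y₁ y₂ _ := ⟨h₂.bottom, h₂.top, hc₂⟩
    have s₃ : Step κ ϑ y₂ z _ := ⟨h₃.bottom, h₃.top, hc₃⟩
    have hsim := sim_swap_of_triple s₁ s₂ s₃ (by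
      simp [Crossing.map, Equiv.swap_apply_of_ne_of_ne s₁.ne_of_ghost s₃.ne_of_ghost])
    rw [lift_sub, lift_mul, lift_mul, lift_slice, lift_slice, lift_slice, hinj h₂.bottom,
      hinj h₃.bottom, lift_mul, lift_mul, lift_slice, lift_slice, lift_slice, hinj h₂'.bottom,
      hinj h₃'.bottom, lift_neg, lift_smul, lift_slice, sliceOp_of_sim hsim, extendAt_comp_swap,
      ← map_sub, ← map_smul, ← map_neg]
    congr 1
    funext σ
    rw [Pi.sub_apply, sliceOp_triple_strand hX s₁ s₂ s₃ ⟨h₁'.bottom, h₁'.top, hc₁'⟩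
      ⟨h₂'.bottom, h₂'.top, hc₂'⟩ ⟨h₃'.bottom, h₃'.top, hc₃'⟩ hik, Pi.neg_apply, Pi.smul_apply,
      Algebra.smul_def]
  | @triple_ghost x y₁ y₂ y₁' y₂' z b i k h₁ h₂ h₃ h₁' h₂' h₃' hc₁ hc₂ hc₃ hc₁' hc₂' hc₃' hik hs =>
    have s₁ : Step κ ϑ x y₁ _ := ⟨h₁.bottom, h₁.top, hc₁⟩
    have s₂ : Step κ ϑ y₁ y₂ _ := ⟨h₂.bottom, h₂.top, hc₂⟩
    have s₃ : Step κ ϑ y₂ z _ := ⟨h₃.bottom, h₃.top, hc₃⟩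
    have hsim := sim_swap_of_triple s₁ s₂ s₃ (by
      simp [Crossing.map, Equiv.swap_apply_of_ne_of_ne s₁.ne_of_ghost.symm s₃.ne_of_ghost.symm])
    rw [lift_sub, lift_mul, lift_mul, lift_slice, lift_slice, lift_slice, hinj h₂.bottom,
      hinj h₃.bottom, lift_mul, lift_mul, lift_slice, lift_slice, lift_slice, hinj h₂'.bottom,
      hinj h₃'.bottom, lift_slice, sliceOp_of_sim hsim, extendAt_comp_swap, ← map_sub]
    congr 1
    funext σ
    rw [Pi.sub_apply, sliceOp_triple_ghost hX s₁ s₂ s₃ ⟨h₁'.bottom, h₁'.top, hc₁'⟩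
      ⟨h₂'.bottom, h₂'.top, hc₂'⟩ ⟨h₃'.bottom, h₃'.top, hc₃'⟩ hik]
  | @triple_red x y₁ y₂ y₁' y₂' z a i k h₁ h₂ h₃ h₁' h₂' h₃' hc₁ hc₂ hc₃ hc₁' hc₂' hc₃' hik hs =>
    have s₁ : Step κ ϑ x y₁ _ := ⟨h₁.bottom, h₁.top, hc₁⟩
    have s₂ : Step κ ϑ y₁ y₂ _ := ⟨h₂.bottom, h₂.top, hc₂⟩
    have s₃ : Step κ ϑ y₂ z _ := ⟨h₃.bottom, h₃.top, hc₃⟩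
    have hsim := sim_swap_of_triple s₁ s₂ s₃ (by simp [Crossing.map])
    rw [lift_sub, lift_mul, lift_mul, lift_slice, lift_slice, lift_slice, hinj h₂.bottom,
      hinj h₃.bottom, lift_mul, lift_mul, lift_slice, lift_slice, lift_slice, hinj h₂'.bottom,
      hinj h₃'.bottom, lift_mul, lift_slice, lift_dividedDifference, hinj hs.bottom,
      sliceOp_of_sim hsim, extendAt_comp_swap, ← map_sub]
    congr 1
    funext σ
    rw [Pi.sub_apply, sliceOp_triple_red hX s₁ s₂ s₃ ⟨h₁'.bottom, h₁'.top, hc₁'⟩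
      ⟨h₂'.bottom, h₂'.top, hc₂'⟩ ⟨h₃'.bottom, h₃'.top, hc₃'⟩ hik, mulOp_apply, vars_swap_mul]
    have hne := vars_sub_ne_zero hX σ s₂.ne_of_strands
    simp only [Function.comp_apply, Equiv.swap_apply_left, Equiv.swap_apply_right]
    congr 1
    rw [div_eq_iff hne]
    -- The squares sit below the uncrossed strands, where the labels are exchanged, so the symmetric
    -- divided difference arrives with its arguments in the order `k`, `i`.
    have := divDiffValue_mul (redPoly ϑ Q a) (vars X σ k) (vars X σ i)
    linear_combination this

variable (κ ϑ q Q X) in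
/-- The polynomial representation of the affine algebra. -/
def rep (hκ : κ ≠ 0) (hX : Function.Injective X) (hX0 : ∀ i, X i ≠ 0) :
    AffineWF κ ϑ q Q n →ₐ[R] Module.End R ((Fin n → ℝ) → K) :=
  RingQuot.liftAlgHom R ⟨FreeAlgebra.lift R (repGen κ ϑ q Q X), fun _ _ h => lift_rel hκ hX hX0 h⟩

section

variable (hκ : κ ≠ 0) (hX : Function.Injective X) (hX0 : ∀ i, X i ≠ 0)

theorem rep_sl {x y : Fin n → ℝ} (h : IsSlice κ ϑ x y) (f : (Fin n → ℝ) → K) :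
    rep κ ϑ q Q X hκ hX hX0 (sl q Q h) f =
      extendAt R y (sliceOp κ ϑ q Q X x y (restrictAt R x f)) := by
  rw [sl, rep, RingQuot.liftAlgHom_mkAlgHom_apply]
  exact lift_slice h f

theorem rep_sq {x : Fin n → ℝ} (h : Generic κ ϑ x) (i : Fin n) (a : ℤ) (f : (Fin n → ℝ) → K) :
    rep κ ϑ q Q X hκ hX hX0 (sq q Q h i a) f =
      extendAt R x (mulOp R X (fun ξ => ξ i ^ a) (restrictAt R x f)) := by
  rw [sq, rep, RingQuot.liftAlgHom_mkAlgHom_apply]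
  exact lift_square h i a f

theorem rep_mul (a b : AffineWF κ ϑ q Q n) (f : (Fin n → ℝ) → K) :
    rep κ ϑ q Q X hκ hX hX0 (a * b) f =
      rep κ ϑ q Q X hκ hX hX0 a (rep κ ϑ q Q X hκ hX hX0 b f) := by
  rw [map_mul]
  rfl

theorem rep_idem {x : Fin n → ℝ} (h : Generic κ ϑ x) (f : (Fin n → ℝ) → K) :
    rep κ ϑ q Q X hκ hX hX0 (affineIdem q Q h) f = extendAt R x (restrictAt R x f) := by
  rw [affineIdem_eq_sl, rep_sl, sliceOp_of_sim (.refl x)]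

end

end

/-! ### Laurent polynomials acting on an algebra through commuting units -/

section Laurent

/-- Laurent polynomials in `n` variables. -/
abbrev Laurent (R : Type*) [CommRing R] (n : ℕ) : Type _ :=
  MonoidAlgebra R (Fin n → Multiplicative ℤ)

variable {R : Type*} [CommRing R] {n : ℕ}

/-- A power of a variable. -/
def Laurent.var (R : Type*) [CommRing R] {n : ℕ} (i : Fin n) (a : ℤ) : Laurent R n :=
  MonoidAlgebra.of R _ (Pi.mulSingle i (Multiplicative.ofAdd a))

theorem Laurent.var_mul (i : Fin n) (a b : ℤ) :
    var R i a * var R i b = var R i (a + b) := by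
  rw [var, var, ← map_mul, ← Pi.mulSingle_mul, ← ofAdd_add, var]

theorem Laurent.var_zero (i : Fin n) : var R i 0 = 1 := by
  rw [var, ofAdd_zero, Pi.mulSingle_one, map_one]

theorem Laurent.var_injective [Nontrivial R] : Function.Injective fun i : Fin n => var R i 1 := by
  intro i j h
  by_contra hij
  have h1 := congrFun (MonoidAlgebra.of_injective h) i
  rw [Pi.mulSingle_eq_same, Pi.mulSingle_eq_of_ne hij] at h1
  exact absurd (Multiplicative.ofAdd.injective (h1.trans ofAdd_zero.symm)) one_ne_zero

theorem Laurent.subalgebra_eq_top {S : Subalgebra R (Laurent R n)}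
    (h₁ : ∀ i, var R i 1 ∈ S) (h₂ : ∀ i, var R i (-1) ∈ S) : S = ⊤ := by
  have hv : ∀ i a, var R i a ∈ S := fun i a => by
    induction a using Int.induction_on with
    | zero => rw [var_zero]; exact S.one_mem
    | succ k ih => rw [← var_mul]; exact S.mul_mem ih (h₁ i)
    | pred k ih => rw [sub_eq_add_neg, ← var_mul]; exact S.mul_mem ih (h₂ i)
  refine eq_top_iff.mpr fun p _ => ?_
  induction p using MonoidAlgebra.induction_on with
  | of g =>
    rw [← Finset.univ_prod_mulSingle g, map_prod]
    exact S.prod_mem fun i _ => hv i _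
  | add f g hf hg => exact S.add_mem (hf trivial) (hg trivial)
  | smul r f hf => exact S.smul_mem (hf trivial) r

variable {B : Type*} [Semiring B] [Algebra R B]

theorem pairwise_commute_zpowersHom {G : Type*} [Group G] (u : Fin n → G)
    (hu : ∀ i j, Commute (u i) (u j)) :
    Pairwise fun i j => ∀ a b, Commute (zpowersHom G (u i) a) (zpowersHom G (u j) b) :=
  fun i j _ a b => (hu i j).zpow_zpow a.toAdd b.toAdd

/-- Evaluation of Laurent polynomials at commuting units. -/
def laurentEval (u : Fin n → Bˣ) (hu : ∀ i j, Commute (u i) (u j)) : Laurent R n →ₐ[R] B :=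
  MonoidAlgebra.lift R B _ ((Units.coeHom B).comp
    (MonoidHom.noncommPiCoprod (fun i => zpowersHom Bˣ (u i)) (pairwise_commute_zpowersHom u hu)))

theorem laurentEval_var (u : Fin n → Bˣ) (hu : ∀ i j, Commute (u i) (u j)) (i : Fin n) (a : ℤ) :
    laurentEval (R := R) u hu (Laurent.var R i a) = ((u i ^ a : Bˣ) : B) := by
  rw [laurentEval, Laurent.var, MonoidAlgebra.lift_of, MonoidHom.comp_apply,
    MonoidHom.noncommPiCoprod_mulSingle]
  rfl

/-- If `B` is spanned over Laurent polynomials by at most `dim V` elements, and the images of `B`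
under an equivariant map to `V` span `V`, then this map is injective. -/
theorem injective_of_equivariant {L K V : Type*} [CommRing L] [IsDomain L] [Algebra R L]
    [Field K] [Algebra L K] [IsFractionRing L K] [AddCommGroup V] [Module K V]
    [FiniteDimensional K V] (mon : L → B) (ev : B →+ V)
    (hev : ∀ b p, ev (b * mon p) = algebraMap L K p • ev b)
    (N : Finset B) (hcard : N.card ≤ Module.finrank K V)
    (hN : ∀ b, ∃ p : B → L, b = ∑ h ∈ N, h * mon (p h))
    (hspan : Submodule.span K (Set.range ev) = ⊤) : Function.Injective ev := by
  have h1 : ∀ p : B → L, ev (∑ h ∈ N, h * mon (p h)) =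
      ∑ h : N, algebraMap L K (p h) • ev h := fun p => by
    rw [map_sum, ← Finset.sum_coe_sort]
    simp only [hev]
  have h2 : ⊤ ≤ Submodule.span K (Set.range fun h : N => ev h) := by
    rw [← hspan, Submodule.span_le]
    rintro _ ⟨b, rfl⟩
    obtain ⟨p, hp⟩ := hN b
    rw [hp, h1]
    exact Submodule.sum_mem _ fun h _ => Submodule.smul_mem _ _ (Submodule.subset_span ⟨h, rfl⟩)
  -- Spanning forces at least `dim V` elements. With the upper bound on `N` the images form a basis,
  -- and the coefficients of an element can be read off its image.
  have h3 : Fintype.card N = Module.finrank K V := by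
    refine le_antisymm (by rwa [Fintype.card_coe]) ?_
    have h4 := finrank_range_le_card (R := K) fun h : N => ev h
    rw [Set.finrank, eq_top_iff.mpr h2, finrank_top] at h4
    exact h4
  have h4 := linearIndependent_of_top_le_span_of_card_eq_finrank h2 h3
  intro b b' hb
  obtain ⟨p, hp⟩ := hN b
  obtain ⟨p', hp'⟩ := hN b'
  rw [hp, hp', h1, h1, ← sub_eq_zero, ← Finset.sum_sub_distrib] at hb
  simp only [← sub_smul] at hb
  have h5 := Fintype.linearIndependent_iff.mp h4 _ hb
  rw [hp, hp']
  refine Finset.sum_congr rfl fun h hh => ?_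
  rw [(IsFractionRing.injective L K) (sub_eq_zero.mp (h5 ⟨h, hh⟩))]

end Laurent

/-! ### A spanning set of the affine Hecke algebra -/

section Hecke

variable {R : Type*} [CommRing R] {q : R} {n : ℕ}

/-- The generator `X_i` of the affine Hecke algebra. -/
def hX (q : R) (i : Fin n) : AffineHecke q n := RingQuot.mkAlgHom R _ (HeckeGen.x R i)

/-- The generator `X_i⁻¹` of the affine Hecke algebra. -/
def hXinv (q : R) (i : Fin n) : AffineHecke q n := RingQuot.mkAlgHom R _ (HeckeGen.xinv R i)

/-- The generator `T_r` of the affine Hecke algebra. -/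
def hT (q : R) (r : ℕ) (h : r + 1 < n) : AffineHecke q n :=
  RingQuot.mkAlgHom R _ (HeckeGen.t R r h)

theorem hX_comm (i j : Fin n) : hX q i * hX q j = hX q j * hX q i := by
  unfold hX
  rw [← map_mul, ← map_mul]
  exact RingQuot.mkAlgHom_rel R (.x_comm i j)

theorem hX_mul_hXinv (i : Fin n) : hX q i * hXinv q i = 1 := by
  unfold hX hXinv
  rw [← map_mul, RingQuot.mkAlgHom_rel R (.x_xinv i), map_one]

theorem hXinv_mul_hX (i : Fin n) : hXinv q i * hX q i = 1 := by
  unfold hX hXinv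
  rw [← map_mul, RingQuot.mkAlgHom_rel R (.xinv_x i), map_one]

theorem hT_mul_self (r : ℕ) (h : r + 1 < n) :
    hT q r h * hT q r h = (q - 1) • hT q r h + algebraMap R _ q := by
  unfold hT
  rw [← map_mul, RingQuot.mkAlgHom_rel R (.quadratic r h), map_add, map_smul, AlgHom.commutes]

theorem hT_mul_hX_mul_hT (r : ℕ) (h : r + 1 < n) :
    hT q r h * hX q ⟨r, Nat.lt_of_succ_lt h⟩ * hT q r h = q • hX q ⟨r + 1, h⟩ := by
  unfold hT hX
  rw [← map_mul, ← map_mul, RingQuot.mkAlgHom_rel R (.txt r h), map_smul]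

theorem hT_braid (r : ℕ) (h : r + 1 < n) (h' : r + 1 + 1 < n) :
    hT q r h * hT q (r + 1) h' * hT q r h = hT q (r + 1) h' * hT q r h * hT q (r + 1) h' := by
  unfold hT
  rw [← map_mul, ← map_mul, RingQuot.mkAlgHom_rel R (.braid r h h'), map_mul, map_mul]

theorem hT_mul_hX (r : ℕ) (h : r + 1 < n) (j : Fin n) (h₁ : (j : ℕ) ≠ r) (h₂ : (j : ℕ) ≠ r + 1) :
    hT q r h * hX q j = hX q j * hT q r h := by
  unfold hT hX
  rw [← map_mul, RingQuot.mkAlgHom_rel R (.t_x r h j h₁ h₂), map_mul]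

theorem hT_comm (r r' : ℕ) (h : r + 1 < n) (h' : r' + 1 < n) (h₁ : r' ≠ r + 1) (h₂ : r ≠ r' + 1) :
    hT q r h * hT q r' h' = hT q r' h' * hT q r h := by
  unfold hT
  rw [← map_mul, RingQuot.mkAlgHom_rel R (.t_t r r' h h' h₁ h₂), map_mul]

/-- An induction principle: a subalgebra containing the generators is everything. -/
theorem AffineHecke.subalgebra_eq_top {S : Subalgebra R (AffineHecke q n)}
    (h₁ : ∀ i, hX q i ∈ S) (h₂ : ∀ i, hXinv q i ∈ S) (h₃ : ∀ r h, hT q r h ∈ S) : S = ⊤ := by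
  refine eq_top_iff.mpr fun a _ => ?_
  obtain ⟨a, rfl⟩ := RingQuot.mkAlgHom_surjective R _ a
  induction a using FreeAlgebra.induction with
  | grade0 r => rw [AlgHom.commutes]; exact S.algebraMap_mem r
  | grade1 g =>
    cases g with
    | X i => exact h₁ i
    | Xinv i => exact h₂ i
    | T r h => exact h₃ r h
  | mul a b ha hb => rw [map_mul]; exact S.mul_mem (ha trivial) (hb trivial)
  | add a b ha hb => rw [map_add]; exact S.add_mem (ha trivial) (hb trivial)

/-- `X_i` as a unit. -/
def hXUnit (q : R) (i : Fin n) : (AffineHecke q n)ˣ :=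
  ⟨hX q i, hXinv q i, hX_mul_hXinv i, hXinv_mul_hX i⟩

theorem hXUnit_comm (i j : Fin n) : Commute (hXUnit q i) (hXUnit q j) :=
  Units.ext (hX_comm i j)

/-- Laurent polynomials in the `X_i`. -/
def hLaurent (q : R) (n : ℕ) : Laurent R n →ₐ[R] AffineHecke q n :=
  laurentEval (hXUnit q) hXUnit_comm

theorem hLaurent_var_one (i : Fin n) : hLaurent q n (Laurent.var R i 1) = hX q i := by
  rw [hLaurent, laurentEval_var, zpow_one]
  rfl

theorem hLaurent_var_neg_one (i : Fin n) : hLaurent q n (Laurent.var R i (-1)) = hXinv q i := by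
  rw [hLaurent, laurentEval_var, zpow_neg_one]
  rfl

section Ring

variable {A : Type*} [Ring A] [Algebra R A] {T x y x' y' : A}

/-- Multiplying `T * x * T = q • y` by `T` on the right and applying the quadratic relation gives
`q` times the claim, and `q` can be cancelled. -/
theorem demazure_right (hq : IsUnit q) (h1 : T * T = (q - 1) • T + algebraMap R A q)
    (h2 : T * x * T = q • y) : y * T = T * x + (q - 1) • y := by
  have h3 : q • (y * T) = q • (T * x + (q - 1) • y) := by
    calc q • (y * T) = T * x * (T * T) := by rw [← smul_mul_assoc, ← h2]; noncomm_ring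
      _ = (q - 1) • (T * x * T) + q • (T * x) := by
        rw [h1, mul_add, mul_smul_comm, ← Algebra.commutes, ← Algebra.smul_def]
      _ = _ := by rw [h2, smul_add, smul_comm, add_comm]
  exact hq.smul_left_cancel.mp h3

theorem demazure_left (hq : IsUnit q) (h1 : T * T = (q - 1) • T + algebraMap R A q)
    (h2 : T * x * T = q • y) : x * T = T * y - (q - 1) • y := by
  have h3 : q • (T * y) = q • (x * T + (q - 1) • y) := by
    calc q • (T * y) = (T * T) * (x * T) := by rw [← mul_smul_comm, ← h2]; noncomm_ring
      _ = (q - 1) • (T * x * T) + q • (x * T) := by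
        rw [h1, add_mul, smul_mul_assoc, ← Algebra.smul_def, mul_assoc]
      _ = _ := by rw [h2, smul_add, smul_comm, add_comm]
  rw [hq.smul_left_cancel.mp h3]
  abel

/-- Conjugating the exchange rule by the inverses of `x` and `y` gives the rule for the inverse
variables. -/
theorem inv_demazure {c : A} (hx : x' * x = 1) (hz : y * y' = 1) (h : x * T = T * y + c) :
    x' * T = T * y' - x' * c * y' := by
  calc x' * T = x' * (T * (y * y')) := by rw [hz, mul_one]
    _ = x' * (x * T - c) * y' := by rw [h]; noncomm_ring
    _ = (x' * x) * T * y' - x' * c * y' := by noncomm_ring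
    _ = _ := by rw [hx, one_mul]

end Ring

end Hecke

section Hecke

variable {R : Type*} [CommRing R] {q : R} {n : ℕ}

theorem exists_hX_mul_hT (hq : IsUnit q) (r : ℕ) (h : r + 1 < n) (i : Fin n) :
    ∃ (j : Fin n) (c : Laurent R n), hX q i * hT q r h = hT q r h * hX q j + hLaurent q n c := by
  have h1 := hT_mul_self (q := q) r h
  have h2 := hT_mul_hX_mul_hT (q := q) r h
  by_cases hi : (i : ℕ) = r
  · obtain rfl : i = ⟨r, Nat.lt_of_succ_lt h⟩ := Fin.ext hi
    refine ⟨⟨r + 1, h⟩, -((q - 1) • Laurent.var R ⟨r + 1, h⟩ 1), ?_⟩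
    rw [map_neg, map_smul, hLaurent_var_one, demazure_left hq h1 h2, sub_eq_add_neg]
  · by_cases hi' : (i : ℕ) = r + 1
    · obtain rfl : i = ⟨r + 1, h⟩ := Fin.ext hi'
      refine ⟨⟨r, Nat.lt_of_succ_lt h⟩, (q - 1) • Laurent.var R ⟨r + 1, h⟩ 1, ?_⟩
      rw [map_smul, hLaurent_var_one, demazure_right hq h1 h2]
    · exact ⟨i, 0, by rw [map_zero, add_zero, hT_mul_hX r h i hi hi']⟩

/-- A weak form of the Bernstein relation. The Laurent polynomials that can be moved past `T_r` in
this sense form a subalgebra, which contains all `X_i` and their inverses. -/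
theorem exists_hLaurent_mul_hT (hq : IsUnit q) (r : ℕ) (h : r + 1 < n) (p : Laurent R n) :
    ∃ p₁ p₂, hLaurent q n p * hT q r h = hT q r h * hLaurent q n p₁ + hLaurent q n p₂ := by
  let S : Subalgebra R (Laurent R n) :=
    { carrier := {p | ∃ p₁ p₂, hLaurent q n p * hT q r h =
        hT q r h * hLaurent q n p₁ + hLaurent q n p₂}
      mul_mem' := by
        rintro a b ⟨a₁, a₂, ha⟩ ⟨b₁, b₂, hb⟩
        refine ⟨a₁ * b₁, a₂ * b₁ + a * b₂, ?_⟩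
        rw [map_mul, mul_assoc, hb, mul_add, ← mul_assoc, ha, map_mul, map_add, map_mul, map_mul,
          add_mul, mul_assoc, add_assoc]
      add_mem' := by
        rintro a b ⟨a₁, a₂, ha⟩ ⟨b₁, b₂, hb⟩
        refine ⟨a₁ + b₁, a₂ + b₂, ?_⟩
        rw [map_add, add_mul, ha, hb, map_add, map_add, mul_add]
        abel
      algebraMap_mem' := fun c => ⟨algebraMap R _ c, 0, by
        rw [AlgHom.commutes, map_zero, add_zero, Algebra.commutes]⟩ }
  have hS : S = ⊤ := by
    refine Laurent.subalgebra_eq_top (fun i => ?_) (fun i => ?_)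
    · obtain ⟨j, c, hc⟩ := exists_hX_mul_hT hq r h i
      exact ⟨Laurent.var R j 1, c, by rw [hLaurent_var_one, hLaurent_var_one, hc]⟩
    · obtain ⟨j, c, hc⟩ := exists_hX_mul_hT hq r h i
      refine ⟨Laurent.var R j (-1), -(Laurent.var R i (-1) * c * Laurent.var R j (-1)), ?_⟩
      rw [map_neg, map_mul, map_mul, hLaurent_var_neg_one, hLaurent_var_neg_one,
        inv_demazure (hXinv_mul_hX i) (hX_mul_hXinv j) hc, sub_eq_add_neg]
  exact (hS ▸ Algebra.mem_top : p ∈ S)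

/-- The generator `T_r`, with junk value `1` if there is no such generator. -/
def hT' (q : R) (n r : ℕ) : AffineHecke q n := if h : r + 1 < n then hT q r h else 1

theorem hT'_comm {r r' : ℕ} (h : r + 1 < r') : hT' q n r * hT' q n r' = hT' q n r' * hT' q n r := by
  unfold hT'
  split_ifs with h1 h2
  · exact hT_comm r r' h1 h2 (by omega) (by omega)
  all_goals simp

theorem hT'_braid {r : ℕ} (h' : r + 1 + 1 < n) :
    hT' q n r * hT' q n (r + 1) * hT' q n r = hT' q n (r + 1) * hT' q n r * hT' q n (r + 1) := by
  have h : r + 1 < n := by omega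
  rw [hT', hT', dif_pos h, dif_pos h', hT_braid]

theorem hT'_mul_self {r : ℕ} (h : r + 1 < n) :
    hT' q n r * hT' q n r = (q - 1) • hT' q n r + q • 1 := by
  rw [hT', dif_pos h, hT_mul_self, Algebra.algebraMap_eq_smul_one]

/-- The product `T_{m-1} T_{m-2} ⋯ T_{m-j}`. -/
def descend (q : R) (n m : ℕ) : ℕ → AffineHecke q n
  | 0 => 1
  | j + 1 => descend q n m j * hT' q n (m - (j + 1))

theorem descend_comm {m r : ℕ} : ∀ {j : ℕ}, r + j + 1 < m →
    descend q n m j * hT' q n r = hT' q n r * descend q n m j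
  | 0, _ => by rw [descend, one_mul, mul_one]
  | j + 1, h => by
    rw [descend, mul_assoc, ← hT'_comm (by omega), ← mul_assoc, descend_comm (by omega), mul_assoc]

/-- A letter `T_r` lying inside the descending string meets `T_r T_{r-1}`. The braid relation turns
it into `T_{r-1}`, which commutes with the remaining letters on the left. -/
theorem descend_shift {m r : ℕ} (hm : m < n) (hr : r < m) : ∀ {j : ℕ}, j ≤ m → m < r + j →
    descend q n m j * hT' q n r = hT' q n (r - 1) * descend q n m j
  | 0, _, h => absurd hr (by omega)
  | j + 1, hj, h => by
    by_cases h1 : m < r + j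
    · rw [descend, mul_assoc, hT'_comm (by omega), ← mul_assoc, descend_shift hm hr (by omega) h1,
        mul_assoc]
    · obtain ⟨j, rfl⟩ : ∃ i, j = i + 1 := ⟨j - 1, by omega⟩
      obtain ⟨r, rfl⟩ : ∃ i, r = i + 1 := ⟨r - 1, by omega⟩
      have e1 : m - (j + 1) = r + 1 := by omega
      have e2 : m - (j + 1 + 1) = r := by omega
      rw [descend, descend, e1, e2, Nat.add_sub_cancel, mul_assoc, mul_assoc, ← mul_assoc (hT' q n (r + 1)),
        ← hT'_braid (by omega), ← mul_assoc, ← mul_assoc, descend_comm (by omega)]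
      simp only [mul_assoc]

-- This mirrors the decomposition of the symmetric group on `m + 1` letters into cosets of the one
-- on `m` letters: each step multiplies by the `m + 1` descending strings, including the empty one.
-- Only the span has to be stable, so no normal form or independence is needed.
open scoped Pointwise in
open Classical in
theorem exists_finset_span_mul_hT' (q : R) (n : ℕ) : ∀ m ≤ n, ∃ N : Finset (AffineHecke q n),
    N.card ≤ m.factorial ∧ 1 ∈ N ∧
      ∀ r, r + 1 < m → ∀ a ∈ Submodule.span R (N : Set (AffineHecke q n)),
        a * hT' q n r ∈ Submodule.span R (N : Set (AffineHecke q n))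
  | 0, _ => ⟨{1}, by simp, by simp, fun r h => absurd h (by omega)⟩
  | m + 1, hm => by
    obtain ⟨N, hN, h1, hT⟩ := exists_finset_span_mul_hT' q n m (by omega)
    have hmem : ∀ a ∈ Submodule.span R (N : Set (AffineHecke q n)), ∀ j ≤ m, a * descend q n m j ∈
        Submodule.span R
          ((N * (Finset.range (m + 1)).image (descend q n m) : Finset (AffineHecke q n)) :
            Set (AffineHecke q n)) := fun a ha j hj => by
      rw [Finset.coe_mul, ← Submodule.span_mul_span]
      refine Submodule.mul_mem_mul ha (Submodule.subset_span ?_)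
      exact Finset.mem_coe.mpr (Finset.mem_image_of_mem _ (Finset.mem_range.mpr (by omega)))
    refine ⟨N * (Finset.range (m + 1)).image (descend q n m), ?_, ?_, fun r hr a ha => ?_⟩
    · refine Finset.card_mul_le.trans ?_
      rw [Nat.factorial_succ, mul_comm]
      exact Nat.mul_le_mul (Finset.card_image_le.trans (by simp)) hN
    · exact Finset.mem_mul.mpr ⟨1, h1, descend q n m 0,
        Finset.mem_image_of_mem _ (by simp), by rw [descend, mul_one]⟩
    · induction ha using Submodule.span_induction with
      | zero => rw [zero_mul]; exact Submodule.zero_mem _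
      | add a b _ _ ha hb => rw [add_mul]; exact Submodule.add_mem _ ha hb
      | smul c a _ ha => rw [smul_mul_assoc]; exact Submodule.smul_mem _ c ha
      | mem a ha =>
        obtain ⟨a, haN, d, hd, rfl⟩ := Finset.mem_mul.mp (Finset.mem_coe.mp ha)
        clear ha
        obtain ⟨j, hj, rfl⟩ := Finset.mem_image.mp hd
        have hj := Finset.mem_range.mp hj
        have ha : a ∈ Submodule.span R (N : Set (AffineHecke q n)) :=
          Submodule.subset_span (Finset.mem_coe.mpr haN)
        rw [mul_assoc]
        -- According to the position of `T_r` relative to the string, it commutes with it, prolongs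
        -- it, is shifted through it, or repeats its last letter; in the last case the quadratic
        -- relation applies.
        rcases lt_trichotomy (r + j + 1) m with h | h | h
        · rw [descend_comm h, ← mul_assoc]
          exact hmem _ (hT r (by omega) a ha) j (by omega)
        · have e : hT' q n r = hT' q n (m - (j + 1)) := by congr 1; omega
          rw [e, ← descend]
          exact hmem a ha (j + 1) (by omega)
        · rcases Nat.lt_or_ge m (r + j) with h2 | h2
          · rw [descend_shift (by omega) (by omega) (by omega) h2, ← mul_assoc]
            exact hmem _ (hT (r - 1) (by omega) a ha) j (by omega)
          · obtain ⟨j, rfl⟩ : ∃ i, j = i + 1 := ⟨j - 1, by omega⟩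
            have e : m - (j + 1) = r := by omega
            rw [descend, e, mul_assoc, hT'_mul_self (by omega), mul_add, mul_smul_comm, mul_smul_comm,
              mul_one, mul_add, mul_smul_comm, mul_smul_comm, ← e, ← descend]
            exact Submodule.add_mem _ (Submodule.smul_mem _ _ (hmem a ha _ (by omega)))
              (Submodule.smul_mem _ _ (hmem a ha _ (by omega)))

/-- The affine Hecke algebra is spanned over Laurent polynomials by `n!` elements. -/
theorem exists_finset_hecke (hq : IsUnit q) (n : ℕ) : ∃ N : Finset (AffineHecke q n),
    N.card ≤ n.factorial ∧ ∀ b, ∃ p : AffineHecke q n → Laurent R n,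
      b = ∑ h ∈ N, h * hLaurent q n (p h) := by
  obtain ⟨N, hN, h1, hclosed⟩ := exists_finset_span_mul_hT' q n n le_rfl
  refine ⟨N, hN, ?_⟩
  let W : Submodule R (AffineHecke q n) :=
    Submodule.span R (N : Set (AffineHecke q n)) * Subalgebra.toSubmodule (hLaurent q n).range
  have hmem : ∀ a ∈ Submodule.span R (N : Set (AffineHecke q n)), ∀ p, a * hLaurent q n p ∈ W :=
    fun a ha p => Submodule.mul_mem_mul ha ⟨p, rfl⟩
  -- The elements that preserve `W` under right multiplication form a subalgebra. It contains the
  -- generators, so `W`, which contains `1`, is everything.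
  let S : Subalgebra R (AffineHecke q n) :=
    { carrier := {b | ∀ w ∈ W, w * b ∈ W}
      mul_mem' := fun {a b} ha hb w hw => by rw [← mul_assoc]; exact hb _ (ha _ hw)
      add_mem' := fun {a b} ha hb w hw => by rw [mul_add]; exact W.add_mem (ha _ hw) (hb _ hw)
      algebraMap_mem' := fun c w hw => by
        rw [← Algebra.commutes, ← Algebra.smul_def]
        exact W.smul_mem c hw }
  have hL : ∀ p, hLaurent q n p ∈ S := fun p w hw => by
    induction hw using Submodule.mul_induction_on' with
    | mem_mul_mem a ha b hb =>
      obtain ⟨b, rfl⟩ := hb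
      change a * hLaurent q n b * hLaurent q n p ∈ W
      rw [mul_assoc, ← map_mul]
      exact hmem a ha _
    | add a _ b _ ha hb => rw [add_mul]; exact W.add_mem ha hb
  have hS : S = ⊤ := by
    refine AffineHecke.subalgebra_eq_top (fun i => ?_) (fun i => ?_) (fun r h w hw => ?_)
    · exact hLaurent_var_one (q := q) i ▸ hL _
    · exact hLaurent_var_neg_one (q := q) i ▸ hL _
    · induction hw using Submodule.mul_induction_on' with
      | mem_mul_mem a ha b hb =>
        obtain ⟨b, rfl⟩ := hb
        obtain ⟨p₁, p₂, hp⟩ := exists_hLaurent_mul_hT hq r h b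
        change a * hLaurent q n b * WFHecke.hT q r h ∈ W
        rw [mul_assoc, hp, mul_add, ← mul_assoc]
        have h2 := hclosed r h a ha
        rw [hT', dif_pos h] at h2
        exact W.add_mem (hmem _ h2 _) (hmem a ha _)
      | add a _ b _ ha hb => rw [add_mul]; exact W.add_mem ha hb
  intro b
  have hb : b ∈ W := by
    have h2 : b ∈ S := hS ▸ Algebra.mem_top
    have h3 := hmem 1 (Submodule.subset_span (Finset.mem_coe.mpr h1)) 1
    rw [map_one, mul_one] at h3
    simpa using h2 1 h3
  induction hb using Submodule.mul_induction_on' with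
  | mem_mul_mem a ha p hp =>
    obtain ⟨p, rfl⟩ := hp
    change ∃ p', a * hLaurent q n p = _
    induction ha using Submodule.span_induction with
    | mem a ha =>
      classical
      refine ⟨Pi.single a p, ?_⟩
      rw [Finset.sum_eq_single_of_mem a (Finset.mem_coe.mp ha), Pi.single_eq_same]
      intro c _ hc
      rw [Pi.single_eq_of_ne hc, map_zero, mul_zero]
    | zero => exact ⟨0, by simp⟩
    | add a b _ _ ha hb =>
      obtain ⟨f, hf⟩ := ha
      obtain ⟨g, hg⟩ := hb
      refine ⟨f + g, ?_⟩
      rw [add_mul, hf, hg, ← Finset.sum_add_distrib]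
      exact Finset.sum_congr rfl fun h _ => by rw [Pi.add_apply, map_add, mul_add]
    | smul c a _ ha =>
      obtain ⟨f, hf⟩ := ha
      refine ⟨c • f, ?_⟩
      rw [smul_mul_assoc, hf, Finset.smul_sum]
      exact Finset.sum_congr rfl fun h _ => by rw [Pi.smul_apply, map_smul, mul_smul_comm]
  | add a _ b _ ha hb =>
    obtain ⟨f, hf⟩ := ha
    obtain ⟨g, hg⟩ := hb
    refine ⟨f + g, ?_⟩
    rw [hf, hg, ← Finset.sum_add_distrib]
    exact Finset.sum_congr rfl fun h _ => by rw [Pi.add_apply, map_add, mul_add]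

end Hecke

/-! ### The representation of a corner of the affine algebra -/

section

variable {R : Type*} [CommRing R] {K : Type*} [Field K] [Algebra R K] {n ℓ : ℕ}
  {κ : ℝ} {ϑ : Fin ℓ → ℝ} {q : R} {Q : Fin ℓ → R} {X : Fin n → K}

theorem mulOp_smul (m : (Fin n → K) → K) (c : K) (F : Equiv.Perm (Fin n) → K) :
    mulOp R X m (c • F) = c • mulOp R X m F := by
  funext σ
  simp only [mulOp_apply, Pi.smul_apply, smul_eq_mul]
  ring

theorem divDiff_smul (i j : Fin n) (c : K) (F : Equiv.Perm (Fin n) → K) :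
    divDiff R X i j (c • F) = c • divDiff R X i j F := by
  funext σ
  simp only [divDiff_apply, Pi.smul_apply, smul_eq_mul]
  ring

theorem sliceOp_smul (x y : Fin n → ℝ) (c : K) (F : Equiv.Perm (Fin n) → K) :
    sliceOp κ ϑ q Q X x y (c • F) = c • sliceOp κ ϑ q Q X x y F := by
  unfold sliceOp
  rw [LinearMap.comp_apply, LinearMap.comp_apply, ← mulOp_smul]
  congr 1
  split_ifs
  · rfl
  · simp only [LinearMap.sum_apply, Finset.smul_sum, divDiff_smul]

theorem extendAt_smul (x : Fin n → ℝ) (c : K) (F : Equiv.Perm (Fin n) → K) :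
    extendAt R x (c • F) = c • extendAt R x F := by
  classical
  funext w
  change (∑ σ : Equiv.Perm (Fin n), if w = x ∘ σ then c * F σ else 0) =
    c * ∑ σ : Equiv.Perm (Fin n), if w = x ∘ σ then F σ else 0
  rw [Finset.mul_sum]
  exact Finset.sum_congr rfl fun σ _ => by split_ifs <;> simp

theorem restrictAt_smul (x : Fin n → ℝ) (c : K) (f : (Fin n → ℝ) → K) :
    restrictAt R x (c • f) = c • restrictAt R x f := rfl

variable (hκ : κ ≠ 0) (hX : Function.Injective X) (hX0 : ∀ i, X i ≠ 0)

/-- The variables are attached to the labels and are never permuted themselves, so the operators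
commute with all scalars of the field. This makes the dimension count over `K` possible. -/
theorem rep_smul (a : AffineWF κ ϑ q Q n) (c : K) (f : (Fin n → ℝ) → K) :
    rep κ ϑ q Q X hκ hX hX0 a (c • f) = c • rep κ ϑ q Q X hκ hX hX0 a f := by
  obtain ⟨a, rfl⟩ := RingQuot.mkAlgHom_surjective R (Rel κ ϑ q Q n) a
  induction a using FreeAlgebra.induction generalizing f with
  | grade0 r =>
    rw [AlgHom.commutes, AlgHom.commutes, Module.algebraMap_end_apply, Module.algebraMap_end_apply,
      smul_comm]
  | grade1 g =>
    cases g with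
    | slice x y h =>
      have e : ∀ f, rep κ ϑ q Q X hκ hX hX0 (RingQuot.mkAlgHom R (Rel κ ϑ q Q n)
          (FreeAlgebra.ι R (Gen.slice x y h))) f = _ := fun f => rep_sl hκ hX hX0 h f
      rw [e, e, restrictAt_smul, sliceOp_smul, extendAt_smul]
    | square x h i m =>
      have e : ∀ f, rep κ ϑ q Q X hκ hX hX0 (RingQuot.mkAlgHom R (Rel κ ϑ q Q n)
          (FreeAlgebra.ι R (Gen.square x h i m))) f = _ := fun f => rep_sq hκ hX hX0 h i m f
      rw [e, e, restrictAt_smul, mulOp_smul, extendAt_smul]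
  | mul a b ha hb => rw [map_mul, rep_mul, rep_mul, hb, ha]
  | add a b ha hb =>
    rw [map_add, map_add, LinearMap.add_apply, LinearMap.add_apply, ha, hb, smul_add]

theorem isIdempotentElem_affineIdem {x : Fin n → ℝ} (h : Generic κ ϑ x) :
    IsIdempotentElem (affineIdem q Q h) :=
  affineIdem_mul_self h

variable (q Q) in
/-- The corner `e_B A e_B` of the affine algebra. -/
abbrev AffineCorner {x : Fin n → ℝ} (h : Generic κ ϑ x) : Type _ :=
  (isIdempotentElem_affineIdem (q := q) (Q := Q) h).Corner

variable {x : Fin n → ℝ} {h : Generic κ ϑ x}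

/-- The inclusion of the corner. -/
def AffineCorner.val : AffineCorner q Q h →ₗ[R] AffineWF κ ϑ q Q n where
  toFun a := Subtype.val a
  map_add' _ _ := rfl
  map_smul' _ _ := rfl

theorem AffineCorner.val_injective :
    Function.Injective (AffineCorner.val : AffineCorner q Q h → AffineWF κ ϑ q Q n) :=
  Subtype.val_injective

theorem AffineCorner.idem_mul (a : AffineCorner q Q h) : affineIdem q Q h * a.val = a.val :=
  ((Subsemigroup.mem_corner_iff (isIdempotentElem_affineIdem h)).mp a.2).1

theorem AffineCorner.mul_idem (a : AffineCorner q Q h) : a.val * affineIdem q Q h = a.val :=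
  ((Subsemigroup.mem_corner_iff (isIdempotentElem_affineIdem h)).mp a.2).2

/-- An element of the corner. -/
def AffineCorner.mk (a : AffineWF κ ϑ q Q n) (h₁ : affineIdem q Q h * a = a)
    (h₂ : a * affineIdem q Q h = a) : AffineCorner q Q h :=
  ⟨a, (Subsemigroup.mem_corner_iff (isIdempotentElem_affineIdem h)).mpr ⟨h₁, h₂⟩⟩

theorem AffineCorner.val_mk (a : AffineWF κ ϑ q Q n) (h₁ : affineIdem q Q h * a = a)
    (h₂ : a * affineIdem q Q h = a) : (AffineCorner.mk a h₁ h₂).val = a := rfl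

theorem AffineCorner.val_mul (a b : AffineCorner q Q h) : (a * b).val = a.val * b.val := rfl

variable (h) in
/-- The representation of the corner at `x` on functions of the labellings of `x`. -/
def cornerRep : AffineCorner q Q h →ₐ[R] Module.End K (Equiv.Perm (Fin n) → K) where
  toFun a :=
    { toFun := fun F => restrictAt R x (rep κ ϑ q Q X hκ hX hX0 a.val (extendAt R x F))
      map_add' := fun F G => by rw [map_add, map_add, map_add]
      map_smul' := fun c F => by rw [extendAt_smul, rep_smul, restrictAt_smul]; rfl }
  map_one' := by
    refine LinearMap.ext fun F => ?_
    change restrictAt R x (rep κ ϑ q Q X hκ hX hX0 (affineIdem q Q h) (extendAt R x F)) = F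
    rw [rep_idem, restrictAt_extendAt R h.strand_strand, restrictAt_extendAt R h.strand_strand]
  map_mul' a b := by
    refine LinearMap.ext fun F => ?_
    change restrictAt R x (rep κ ϑ q Q X hκ hX hX0 (a.val * b.val) (extendAt R x F)) =
      restrictAt R x (rep κ ϑ q Q X hκ hX hX0 a.val (extendAt R x (restrictAt R x
        (rep κ ϑ q Q X hκ hX hX0 b.val (extendAt R x F)))))
    rw [← rep_idem hκ hX hX0 h, ← rep_mul, ← rep_mul, a.mul_idem]
  map_zero' := by
    refine LinearMap.ext fun F => ?_
    change restrictAt R x (rep κ ϑ q Q X hκ hX hX0 0 (extendAt R x F)) = 0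
    rw [map_zero, LinearMap.zero_apply, map_zero]
  map_add' a b := by
    refine LinearMap.ext fun F => ?_
    change restrictAt R x (rep κ ϑ q Q X hκ hX hX0 (a.val + b.val) (extendAt R x F)) = _
    rw [map_add, LinearMap.add_apply, map_add]
    rfl
  commutes' r := by
    refine LinearMap.ext fun F => ?_
    change restrictAt R x (rep κ ϑ q Q X hκ hX hX0 (r • affineIdem q Q h) (extendAt R x F)) = _
    rw [map_smul, LinearMap.smul_apply, map_smul, rep_idem, restrictAt_extendAt R h.strand_strand,
      restrictAt_extendAt R h.strand_strand, Module.algebraMap_end_apply]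

theorem cornerRep_apply (a : AffineCorner q Q h) (F : Equiv.Perm (Fin n) → K) :
    cornerRep hκ hX hX0 h a F =
      restrictAt R x (rep κ ϑ q Q X hκ hX hX0 a.val (extendAt R x F)) := rfl

/-- Squares on a strand, as a unit of the corner. -/
def sqUnit (q : R) (Q : Fin ℓ → R) (h : Generic κ ϑ x) (i : Fin n) : (AffineCorner q Q h)ˣ where
  val := .mk (sq q Q h i 1) (idem_mul_sq h i 1) (sq_mul_idem h i 1)
  inv := .mk (sq q Q h i (-1)) (idem_mul_sq h i _) (sq_mul_idem h i _)
  val_inv := Subtype.ext (by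
    change sq q Q h i 1 * sq q Q h i (-1) = affineIdem q Q h
    rw [sq_mul_sq, add_neg_cancel, sq_zero])
  inv_val := Subtype.ext (by
    change sq q Q h i (-1) * sq q Q h i 1 = affineIdem q Q h
    rw [sq_mul_sq, neg_add_cancel, sq_zero])

theorem sqUnit_comm (i j : Fin n) : Commute (sqUnit q Q h i) (sqUnit q Q h j) :=
  Units.ext (Subtype.ext (sq_comm h i j 1 1))

theorem cornerRep_sq (a : AffineCorner q Q h) (i : Fin n) (m : ℤ) (ha : a.val = sq q Q h i m)
    (F : Equiv.Perm (Fin n) → K) :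
    cornerRep hκ hX hX0 h a F = mulOp R X (fun ξ => ξ i ^ m) F := by
  rw [cornerRep_apply, ha, rep_sq, restrictAt_extendAt R h.strand_strand,
    restrictAt_extendAt R h.strand_strand]

/-- The indicator function of the identity is a joint eigenvector of all multiplication operators,
with eigenvalues given by the variables. It is the test vector for faithfulness. -/
theorem mulOp_single_one (m : (Fin n → K) → K) :
    mulOp R X m (Pi.single 1 1) = m X • (Pi.single 1 1 : Equiv.Perm (Fin n) → K) := by
  funext σ
  rw [mulOp_apply, Pi.smul_apply, smul_eq_mul]
  rcases eq_or_ne σ 1 with rfl | hσ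
  · rfl
  · rw [Pi.single_eq_of_ne hσ, mul_zero, mul_zero]

end

section

variable {R : Type*} [CommRing R] {K : Type*} [Field K] {n : ℕ} [Algebra R K]
  [Algebra (Laurent R n) K]

/-- The Laurent polynomials that act on `v` by their own value form a subalgebra, so checking the
variables and their inverses suffices. -/
theorem laurent_act {V : Type*} [AddCommGroup V] [Module K V] [Module R V] [IsScalarTower R K V]
    [SMulCommClass K R V] [SMulCommClass R K V] [IsScalarTower R (Laurent R n) K]
    (lam : Laurent R n →ₐ[R] Module.End K V) (v : V)
    (h₁ : ∀ i, lam (Laurent.var R i 1) v = algebraMap (Laurent R n) K (Laurent.var R i 1) • v)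
    (h₂ : ∀ i, lam (Laurent.var R i (-1)) v = algebraMap (Laurent R n) K (Laurent.var R i (-1)) • v)
    (p : Laurent R n) : lam p v = algebraMap (Laurent R n) K p • v := by
  let S : Subalgebra R (Laurent R n) :=
    { carrier := {p | lam p v = algebraMap (Laurent R n) K p • v}
      mul_mem' := fun {a b} (ha : _ = _) (hb : _ = _) => by
        change lam (a * b) v = _
        rw [map_mul, Module.End.mul_apply, hb, map_smul, ha, map_mul, smul_smul, mul_comm]
      add_mem' := fun {a b} (ha : _ = _) (hb : _ = _) => by
        change lam (a + b) v = _
        rw [map_add, LinearMap.add_apply, ha, hb, map_add, add_smul]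
      algebraMap_mem' := fun c => by
        change lam (algebraMap R _ c) v = _
        rw [AlgHom.commutes, Module.algebraMap_end_apply, ← IsScalarTower.algebraMap_apply,
          algebraMap_smul] }
  have hS : S = ⊤ := Laurent.subalgebra_eq_top h₁ h₂
  exact (hS ▸ Algebra.mem_top : p ∈ S)

end

/-! ### The operators of the generators `T_r` -/

section

variable (R : Type*) [CommRing R] {K : Type*} [Field K] [Algebra R K] {n : ℕ} (q : R) (X : Fin n → K)

/-- The operator of a generator of the affine Hecke algebra exchanging the strands `i` and `j`. -/
def heckeOp (i j : Fin n) : (Equiv.Perm (Fin n) → K) →ₗ[K] (Equiv.Perm (Fin n) → K) where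
  -- A Demazure–Lusztig operator, in which the action of the transposition is left translation on
  -- permutations.
  toFun F σ := ((1 - algebraMap R K q) * vars X σ j * F σ +
    (algebraMap R K q * vars X σ i - vars X σ j) * F (Equiv.swap i j * σ)) /
      (vars X σ i - vars X σ j)
  map_add' F G := by funext σ; simp only [Pi.add_apply]; ring
  map_smul' c F := by funext σ; simp only [Pi.smul_apply, smul_eq_mul, RingHom.id_apply]; ring

theorem heckeOp_apply (i j : Fin n) (F : Equiv.Perm (Fin n) → K) (σ : Equiv.Perm (Fin n)) :
    heckeOp R q X i j F σ = ((1 - algebraMap R K q) * vars X σ j * F σ +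
      (algebraMap R K q * vars X σ i - vars X σ j) * F (Equiv.swap i j * σ)) /
        (vars X σ i - vars X σ j) := rfl

variable {X}

theorem heckeOp_mul_self (hX : Function.Injective X) {i j : Fin n} (hij : i ≠ j)
    (F : Equiv.Perm (Fin n) → K) (σ : Equiv.Perm (Fin n)) :
    heckeOp R q X i j (heckeOp R q X i j F) σ =
      (algebraMap R K q - 1) * heckeOp R q X i j F σ + algebraMap R K q * F σ := by
  have h := vars_sub_ne_zero hX σ hij
  have h' := vars_sub_ne_zero hX σ hij.symm
  simp only [heckeOp_apply, vars_swap_mul, Function.comp_apply, Equiv.swap_apply_left,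
    Equiv.swap_apply_right, ← mul_assoc, Equiv.swap_mul_self, one_mul]
  rw [← neg_sub (vars X σ i) (vars X σ j), div_neg]
  field_simp
  ring

theorem heckeOp_mul_heckeOp (hX : Function.Injective X) {i j : Fin n} (hij : i ≠ j)
    (F : Equiv.Perm (Fin n) → K) (σ : Equiv.Perm (Fin n)) :
    heckeOp R q X i j (mulOp R X (fun ξ => ξ i) (heckeOp R q X i j F)) σ =
      algebraMap R K q * (vars X σ j * F σ) := by
  have h := vars_sub_ne_zero hX σ hij
  simp only [heckeOp_apply, mulOp_apply, vars_swap_mul, Function.comp_apply, Equiv.swap_apply_left,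
    Equiv.swap_apply_right, ← mul_assoc, Equiv.swap_mul_self, one_mul]
  rw [← neg_sub (vars X σ i) (vars X σ j), div_neg]
  field_simp
  ring

theorem heckeOp_mulOp {i j k : Fin n} (hki : k ≠ i) (hkj : k ≠ j)
    (F : Equiv.Perm (Fin n) → K) (σ : Equiv.Perm (Fin n)) :
    heckeOp R q X i j (mulOp R X (fun ξ => ξ k) F) σ =
      mulOp R X (fun ξ => ξ k) (heckeOp R q X i j F) σ := by
  simp only [heckeOp_apply, mulOp_apply, vars_swap_mul, Function.comp_apply,
    Equiv.swap_apply_of_ne_of_ne hki hkj]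
  ring

theorem heckeOp_comm {i j k l : Fin n} (hik : i ≠ k) (hil : i ≠ l) (hjk : j ≠ k) (hjl : j ≠ l)
    (F : Equiv.Perm (Fin n) → K) (σ : Equiv.Perm (Fin n)) :
    heckeOp R q X i j (heckeOp R q X k l F) σ = heckeOp R q X k l (heckeOp R q X i j F) σ := by
  have e : Equiv.swap k l * (Equiv.swap i j * σ) = Equiv.swap i j * (Equiv.swap k l * σ) := by
    rw [← mul_assoc, ← mul_assoc, swap_mul_swap_of_disjoint hik hil hjk hjl]
  simp only [heckeOp_apply, vars_swap_mul, Function.comp_apply,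
    Equiv.swap_apply_of_ne_of_ne hik hil, Equiv.swap_apply_of_ne_of_ne hjk hjl,
    Equiv.swap_apply_of_ne_of_ne hik.symm hjk.symm, Equiv.swap_apply_of_ne_of_ne hil.symm hjl.symm, e]
  ring

/-- Both sides are combinations of the values of `F` at six translates of `σ`, and the claim becomes
an identity of rational functions in three variables. -/
theorem heckeOp_braid (hX : Function.Injective X) {i j k : Fin n} (hij : i ≠ j) (hik : i ≠ k)
    (hjk : j ≠ k) (F : Equiv.Perm (Fin n) → K) (σ : Equiv.Perm (Fin n)) :
    heckeOp R q X i j (heckeOp R q X j k (heckeOp R q X i j F)) σ =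
      heckeOp R q X j k (heckeOp R q X i j (heckeOp R q X j k F)) σ := by
  have e : Equiv.swap i j * (Equiv.swap j k * (Equiv.swap i j * σ)) =
      Equiv.swap j k * (Equiv.swap i j * (Equiv.swap j k * σ)) := by
    have e1 : Equiv.swap i j * Equiv.swap j k * Equiv.swap i j =
        Equiv.swap j k * Equiv.swap i j * Equiv.swap j k := by
      rw [Equiv.swap_mul_swap_mul_swap hij hik, Equiv.swap_comm i j, Equiv.swap_comm j k,
        Equiv.swap_mul_swap_mul_swap hjk.symm hik.symm, Equiv.swap_comm]
    simp only [← mul_assoc, e1]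
  have n1 := vars_sub_ne_zero hX σ hij
  have n2 := vars_sub_ne_zero hX σ hik
  have n3 := vars_sub_ne_zero hX σ hjk
  have n1' := vars_sub_ne_zero hX σ hij.symm
  have n2' := vars_sub_ne_zero hX σ hik.symm
  have n3' := vars_sub_ne_zero hX σ hjk.symm
  simp only [heckeOp_apply, vars_swap_mul, Function.comp_apply, Equiv.swap_apply_left,
    Equiv.swap_apply_right, Equiv.swap_apply_of_ne_of_ne hij hik,
    Equiv.swap_apply_of_ne_of_ne hik.symm hjk.symm, Equiv.swap_mul_self_mul, e]
  rw [← neg_sub (vars X σ i) (vars X σ j), ← neg_sub (vars X σ j) (vars X σ k)]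
  generalize F σ = f₀, F (Equiv.swap i j * σ) = f₁, F (Equiv.swap j k * σ) = f₂,
    F (Equiv.swap i j * (Equiv.swap j k * σ)) = f₃, F (Equiv.swap j k * (Equiv.swap i j * σ)) = f₄,
    F (Equiv.swap j k * (Equiv.swap i j * (Equiv.swap j k * σ))) = f₅
  generalize vars X σ i = u, vars X σ j = v, vars X σ k = w at *
  simp only [div_neg]
  field_simp
  ring

end

section

variable (R : Type*) [CommRing R] {K : Type*} [Field K] [Algebra R K] {n : ℕ} {q : R} {X : Fin n → K}

/-- The operator maps the indicator of `σ` to a combination of the indicators of `σ` and `swap i j *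
σ`. The second coefficient has a numerator of the form `q * X a - X b`, which does not vanish. -/
theorem heckeOp_single (hX : Function.Injective X) {i j : Fin n} (hij : i ≠ j)
    (hq : ∀ a b, a ≠ b → algebraMap R K q * X a ≠ X b) {M : Submodule K (Equiv.Perm (Fin n) → K)}
    (hM : ∀ F ∈ M, heckeOp R q X i j F ∈ M) {σ : Equiv.Perm (Fin n)}
    (h : Pi.single σ 1 ∈ M) : Pi.single (Equiv.swap i j * σ) 1 ∈ M := by
  have hne : Equiv.swap i j * σ ≠ σ := fun he => hij (by
    rw [mul_eq_right] at he
    exact Equiv.swap_eq_one_iff.mp he)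
  set s := Equiv.swap i j with hs
  set a := (1 - algebraMap R K q) * vars X σ j / (vars X σ i - vars X σ j) with ha
  set b := (algebraMap R K q * vars X (s * σ) i - vars X (s * σ) j) /
    (vars X (s * σ) i - vars X (s * σ) j) with hb
  have hb0 : b ≠ 0 := div_ne_zero
    (sub_ne_zero.mpr (hq _ _ fun he => hij ((s * σ)⁻¹.injective he)))
    (vars_sub_ne_zero hX _ hij)
  have h1 : heckeOp R q X i j (Pi.single σ 1) = a • Pi.single σ 1 + b • Pi.single (s * σ) 1 := by
    funext τ
    rw [heckeOp_apply, Pi.add_apply, Pi.smul_apply, Pi.smul_apply, smul_eq_mul, smul_eq_mul]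
    rcases eq_or_ne τ σ with rfl | h1
    · rw [Pi.single_eq_same, Pi.single_eq_of_ne hne, Pi.single_eq_of_ne hne.symm]
      simp [ha]
    · rw [Pi.single_eq_of_ne h1]
      rcases eq_or_ne τ (s * σ) with rfl | h2
      · rw [hs, Equiv.swap_mul_self_mul, Pi.single_eq_same, Pi.single_eq_same]
        simp [hb, hs]
      · rw [Pi.single_eq_of_ne h2, Pi.single_eq_of_ne (fun h3 => h2 (by
          rw [← h3, hs, Equiv.swap_mul_self_mul]))]
        simp
  have h2 : b • (Pi.single (s * σ) 1 : Equiv.Perm (Fin n) → K) ∈ M := by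
    have h3 := M.sub_mem (hM _ h) (M.smul_mem a h)
    rwa [h1, add_sub_cancel_left] at h3
  exact (M.smul_mem_iff hb0).mp h2

/-- Functions on permutations are generated by the indicator function of `1`. -/
theorem eq_top_of_heckeOp (hX : Function.Injective X)
    (hq : ∀ a b, a ≠ b → algebraMap R K q * X a ≠ X b) {M : Submodule K (Equiv.Perm (Fin n) → K)}
    (hM : ∀ r (h : r + 1 < n), ∀ F ∈ M,
      heckeOp R q X ⟨r, Nat.lt_of_succ_lt h⟩ ⟨r + 1, h⟩ F ∈ M)
    (h : Pi.single 1 1 ∈ M) : M = ⊤ := by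
  have h1 : ∀ σ : Equiv.Perm (Fin n), Pi.single σ 1 ∈ M := by
    cases n with
    | zero => intro σ; rwa [Subsingleton.elim σ 1]
    | succ n =>
      intro σ
      have hσ : σ ∈ Submonoid.closure (Set.range fun i : Fin n => Equiv.swap i.castSucc i.succ) := by
        rw [Equiv.Perm.mclosure_swap_castSucc_succ]; trivial
      induction hσ using Submonoid.closure_induction_left with
      | one => exact h
      | mul_left g hg τ _ ih =>
        obtain ⟨i, rfl⟩ := hg
        exact heckeOp_single R hX (Fin.castSucc_lt_succ).ne hq
          (hM i (Nat.succ_lt_succ i.2)) ih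
  refine eq_top_iff.mpr fun F _ => ?_
  rw [← Finset.univ_sum_single F]
  refine M.sum_mem fun σ _ => ?_
  have := M.smul_mem (F σ) (h1 σ)
  rwa [← Pi.single_smul, smul_eq_mul, mul_one] at this

end

/-! ### The field of rational functions -/

section

variable (R : Type*) [CommRing R] [IsDomain R] (n : ℕ)

/-- Rational functions in `n` variables. -/
abbrev RatField : Type _ := FractionRing (Laurent R n)

variable {n}

/-- The variables, as rational functions. -/
def ratVar (i : Fin n) : RatField R n := algebraMap (Laurent R n) _ (Laurent.var R i 1)

theorem ratVar_injective : Function.Injective (ratVar R : Fin n → RatField R n) :=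
  (IsFractionRing.injective (Laurent R n) _).comp Laurent.var_injective

theorem ratVar_mul (i : Fin n) :
    ratVar R i * algebraMap (Laurent R n) _ (Laurent.var R i (-1)) = 1 := by
  rw [ratVar, ← map_mul, Laurent.var_mul, add_neg_cancel, Laurent.var_zero, map_one]

theorem ratVar_ne_zero (i : Fin n) : ratVar R i ≠ 0 :=
  left_ne_zero_of_mul_eq_one (ratVar_mul R i)

theorem ratVar_inv (i : Fin n) :
    algebraMap (Laurent R n) (RatField R n) (Laurent.var R i (-1)) = ratVar R i ^ (-1 : ℤ) := by
  rw [zpow_neg_one]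
  exact eq_inv_of_mul_eq_one_right (ratVar_mul R i)

/-- The monomial of the variable `j` has coefficient `0` on one side and `1` on the other. -/
theorem algebraMap_mul_ratVar_ne (q : R) {i j : Fin n} (hij : i ≠ j) :
    algebraMap R (RatField R n) q * ratVar R i ≠ ratVar R j := by
  rw [IsScalarTower.algebraMap_apply R (Laurent R n), ratVar, ratVar, ← map_mul]
  intro h
  have h1 := IsFractionRing.injective (Laurent R n) (RatField R n) h
  rw [← Algebra.smul_def] at h1
  have h2 := congrArg (fun p : Laurent R n => p.coeff (Pi.mulSingle j (Multiplicative.ofAdd 1))) h1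
  have h3 : (Pi.mulSingle i (Multiplicative.ofAdd 1) : Fin n → Multiplicative ℤ) ≠
      Pi.mulSingle j (Multiplicative.ofAdd 1) := fun he => by
    have := congrFun he i
    rw [Pi.mulSingle_eq_same, Pi.mulSingle_eq_of_ne hij] at this
    exact absurd (Multiplicative.ofAdd.injective (this.trans ofAdd_zero.symm)) one_ne_zero
  simp only [Laurent.var, MonoidAlgebra.of_apply] at h2
  rw [MonoidAlgebra.coeff_smul_apply, MonoidAlgebra.coeff_single, MonoidAlgebra.coeff_single,
    Finsupp.single_eq_of_ne h3.symm, Finsupp.single_eq_same, smul_zero] at h2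
  exact zero_ne_one h2

end

/-! ### Moving a strand next to its neighbour -/

section

variable {n ℓ : ℕ} {κ : ℝ} {ϑ : Fin ℓ → ℝ}

theorem Step.of_iff {x y : Fin n → ℝ} {c : Crossing n} (hx : Generic κ ϑ x) (hy : Generic κ ϑ y)
    (h₁ : ∀ i j, (x i < x j ↔ y i < y j) ↔ c ≠ .strands s(i, j))
    (h₂ : ∀ i j, (x i < x j + κ ↔ y i < y j + κ) ↔ c ≠ .ghost i j)
    (h₃ : ∀ i t, (x i < ϑ t ↔ y i < ϑ t) ↔ c ≠ .red i (ϑ t)) (hc : ∀ i a, c = .red i a → ∃ t, ϑ t = a) :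
    Step κ ϑ x y c := by
  refine ⟨hx, hy, ?_⟩
  ext d
  rw [Set.mem_singleton_iff, eq_comm (a := d)]
  rw [← not_iff_not]
  cases d with
  | strands p =>
    induction p with
    | _ i j => exact (strands_notMem_iff hx hy i j).trans (h₁ i j)
  | ghost i j => exact (ghost_notMem_iff hx hy i j).trans (h₂ i j)
  | red i a =>
    by_cases ha : ∃ t, ϑ t = a
    · obtain ⟨t, rfl⟩ := ha
      exact (red_notMem_iff hx hy i t).trans (h₃ i t)
    · exact iff_of_true (fun h => ha (exists_red_of_mem h)) (fun h => ha (hc i a h))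

/-- The strand `j` is the right neighbour of the strand `i`, and nothing else is close. -/
structure Neighbours (κ : ℝ) (ϑ : Fin ℓ → ℝ) (x : Fin n → ℝ) (i j : Fin n) : Prop where
  generic : Generic κ ϑ x
  gap : x i + |κ| < x j
  others : ∀ k, k ≠ i → k ≠ j → x k + |κ| < x i ∨ x j + |κ| < x k
  reds : ∀ t, ϑ t + |κ| < x i

/-- The strand `j` is moved towards the strand `i`. -/
def approach (κ : ℝ) (x : Fin n → ℝ) (i j : Fin n) : Fin n → ℝ :=
  -- Half of `|κ|` is close enough for `j` to pass the ghost of `i` (if `κ > 0`), or for its own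
  -- ghost to pass `i` (if `κ < 0`), while the strands themselves do not meet.
  Function.update x j (x i + |κ| / 2)

variable {x : Fin n → ℝ} {i j : Fin n}

theorem approach_self : approach κ x i j j = x i + |κ| / 2 := Function.update_self ..

theorem approach_of_ne {k : Fin n} (h : k ≠ j) : approach κ x i j k = x k :=
  Function.update_of_ne h ..

theorem Neighbours.ne (h : Neighbours κ ϑ x i j) : i ≠ j := by
  rintro rfl
  have := h.gap
  have := abs_nonneg κ
  linarith

theorem Neighbours.generic_approach (hκ : κ ≠ 0) (h : Neighbours κ ϑ x i j) :
    Generic κ ϑ (approach κ x i j) := by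
  have h0 := abs_pos.mpr hκ
  have h1 : κ = |κ| ∨ κ = -|κ| := by rcases abs_choice κ with h | h <;> [left; right] <;> linarith
  have h2 := h.gap
  have hij := h.ne
  have key : ∀ k, k ≠ j → approach κ x i j k ≠ approach κ x i j j ∧
      approach κ x i j k ≠ approach κ x i j j + κ ∧
      approach κ x i j j ≠ approach κ x i j k + κ := fun k hk => by
    rw [approach_self, approach_of_ne hk]
    rcases eq_or_ne k i with rfl | hki
    · refine ⟨?_, ?_, ?_⟩ <;> intro he <;> rcases h1 with h1 | h1 <;> linarith
    · rcases h.others k hki hk with h3 | h3 <;> refine ⟨?_, ?_, ?_⟩ <;> intro he <;>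
        rcases h1 with h1 | h1 <;> linarith
  refine ⟨fun a b hab => ?_, fun a b => ?_, fun a t => ?_, fun a t => ?_⟩
  · by_contra hne
    by_cases ha : a = j
    · subst ha
      exact (key b (Ne.symm hne)).1 hab.symm
    · by_cases hb : b = j
      · subst hb
        exact (key a ha).1 hab
      · rw [approach_of_ne ha, approach_of_ne hb] at hab
        exact hne (h.generic.strand_strand hab)
  · by_cases ha : a = j
    · subst ha
      by_cases hb : b = a
      · subst hb
        intro he
        exact hκ (by linarith)
      · exact (key b hb).2.2
    · by_cases hb : b = j
      · subst hb
        exact (key a ha).2.1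
      · rw [approach_of_ne ha, approach_of_ne hb]
        exact h.generic.strand_ghost a b
  · have h3 := h.reds t
    by_cases ha : a = j
    · subst ha
      rw [approach_self]
      intro he
      linarith
    · rw [approach_of_ne ha]
      exact h.generic.strand_red a t
  · have h3 := h.reds t
    by_cases ha : a = j
    · subst ha
      rw [approach_self]
      intro he
      rcases h1 with h1 | h1 <;> linarith
    · rw [approach_of_ne ha]
      exact h.generic.ghost_red a t

/-- The crossing that occurs when `j` approaches `i`. -/
def approachCrossing (κ : ℝ) (i j : Fin n) : Crossing n := if 0 < κ then .ghost j i else .ghost i j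

/-- All other strands and the red lines are further than `|κ|` from the region in which `j` moves,
so exactly one passage of a strand and a ghost occurs. -/
theorem Neighbours.step (hκ : κ ≠ 0) (h : Neighbours κ ϑ x i j) :
    Step κ ϑ x (approach κ x i j) (approachCrossing κ i j) := by
  have h0 := abs_pos.mpr hκ
  have h2 := h.gap
  have hij := h.ne
  have hc : ∀ p, approachCrossing κ i j ≠ .strands p := fun p => by
    unfold approachCrossing; split_ifs <;> simp
  have hc' : ∀ a r, approachCrossing κ i j ≠ .red a r := fun a r => by
    unfold approachCrossing; split_ifs <;> simp
  refine .of_iff h.generic (h.generic_approach hκ) (fun a b => ?_) (fun a b => ?_) (fun a t => ?_)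
    (fun a r he => absurd he (hc' a r))
  · refine iff_of_true ?_ (hc _)
    by_cases ha : a = j <;> by_cases hb : b = j
    · simp [ha, hb]
    · subst ha
      rw [approach_self, approach_of_ne hb]
      rcases eq_or_ne b i with rfl | hbi
      · exact iff_of_false (by linarith) (by linarith)
      · rcases h.others b hbi hb with h3 | h3
        · exact iff_of_false (by linarith) (by linarith)
        · exact iff_of_true (by linarith) (by linarith)
    · subst hb
      rw [approach_self, approach_of_ne ha]
      rcases eq_or_ne a i with rfl | hai
      · exact iff_of_true (by linarith) (by linarith)
      · rcases h.others a hai ha with h3 | h3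
        · exact iff_of_true (by linarith) (by linarith)
        · exact iff_of_false (by linarith) (by linarith)
    · rw [approach_of_ne ha, approach_of_ne hb]
  · by_cases hpos : 0 < κ
    · have hk : |κ| = κ := abs_of_pos hpos
      rw [approachCrossing, if_pos hpos, Ne, Crossing.ghost.injEq]
      by_cases ha : a = j <;> by_cases hb : b = j
      · subst ha
        subst hb
        exact iff_of_true (by simp) fun h => hij h.2
      · subst ha
        rw [approach_self, approach_of_ne hb]
        rcases eq_or_ne b i with rfl | hbi
        · refine iff_of_false (fun h3 => ?_) (by simp)
          have := h3.mpr (by linarith)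
          linarith
        · refine iff_of_true ?_ fun h => hbi h.2.symm
          rcases h.others b hbi hb with h3 | h3
          · exact iff_of_false (by linarith) (by linarith)
          · exact iff_of_true (by linarith) (by linarith)
      · subst hb
        rw [approach_self, approach_of_ne ha]
        refine iff_of_true ?_ fun h => hij h.2
        rcases eq_or_ne a i with rfl | hai
        · exact iff_of_true (by linarith) (by linarith)
        · rcases h.others a hai ha with h3 | h3
          · exact iff_of_true (by linarith) (by linarith)
          · exact iff_of_false (by linarith) (by linarith)
      · rw [approach_of_ne ha, approach_of_ne hb]
        exact iff_of_true Iff.rfl fun h => ha h.1.symm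
    · have hneg : κ < 0 := lt_of_le_of_ne (not_lt.mp hpos) hκ
      have hk : |κ| = -κ := abs_of_neg hneg
      rw [approachCrossing, if_neg hpos, Ne, Crossing.ghost.injEq]
      by_cases ha : a = j <;> by_cases hb : b = j
      · subst ha
        subst hb
        exact iff_of_true (by simp) fun h => hij h.1
      · subst ha
        rw [approach_self, approach_of_ne hb]
        refine iff_of_true ?_ fun h => hij h.1
        rcases eq_or_ne b i with rfl | hbi
        · exact iff_of_false (by linarith) (by linarith)
        · rcases h.others b hbi hb with h3 | h3
          · exact iff_of_false (by linarith) (by linarith)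
          · exact iff_of_true (by linarith) (by linarith)
      · subst hb
        rw [approach_self, approach_of_ne ha]
        rcases eq_or_ne a i with rfl | hai
        · refine iff_of_false (fun h3 => ?_) (by simp)
          have := h3.mp (by linarith)
          linarith
        · refine iff_of_true ?_ fun h => hai h.1.symm
          rcases h.others a hai ha with h3 | h3
          · exact iff_of_true (by linarith) (by linarith)
          · exact iff_of_false (by linarith) (by linarith)
      · rw [approach_of_ne ha, approach_of_ne hb]
        exact iff_of_true Iff.rfl fun h => hb h.2.symm
  · refine iff_of_true ?_ (hc' _ _)
    have h3 := h.reds t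
    by_cases ha : a = j
    · subst ha
      rw [approach_self]
      exact iff_of_false (by linarith) (by linarith)
    · rw [approach_of_ne ha]

/-- At distance `|κ| / 2` the ghosts of the two strands are out of reach, so the strands can change
places without meeting anything else. -/
theorem Neighbours.step_swap (hκ : κ ≠ 0) (h : Neighbours κ ϑ x i j) :
    Step κ ϑ (approach κ x i j) (approach κ x i j ∘ Equiv.swap i j) (.strands s(i, j)) := by
  have h0 := abs_pos.mpr hκ
  have h1 : κ = |κ| ∨ κ = -|κ| := by rcases abs_choice κ with h | h <;> [left; right] <;> linarith
  have h2 := h.gap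
  have hij := h.ne
  have hg := h.generic_approach hκ
  have yi : approach κ x i j i = x i := approach_of_ne hij
  have yj : approach κ x i j j = x i + |κ| / 2 := approach_self
  have zi : (approach κ x i j ∘ Equiv.swap i j) i = x i + |κ| / 2 := by
    rw [Function.comp_apply, Equiv.swap_apply_left, yj]
  have zj : (approach κ x i j ∘ Equiv.swap i j) j = x i := by
    rw [Function.comp_apply, Equiv.swap_apply_right, yi]
  have yk : ∀ k, k ≠ i → k ≠ j → approach κ x i j k = x k := fun k _ hk => approach_of_ne hk
  have zk : ∀ k, k ≠ i → k ≠ j → (approach κ x i j ∘ Equiv.swap i j) k = x k := fun k h1 h2 => by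
    rw [Function.comp_apply, Equiv.swap_apply_of_ne_of_ne h1 h2, yk k h1 h2]
  refine .of_iff hg (hg.comp _) ?_ ?_ ?_ (by simp)
  all_goals generalize approach κ x i j ∘ Equiv.swap i j = z at *
  all_goals generalize approach κ x i j = y at *
  · intro a b
    rw [Ne, Crossing.strands.injEq, Sym2.eq_iff]
    rcases (eq_or_ne a i).imp_left Eq.symm with rfl | hai <;>
      rcases (eq_or_ne b i).imp_left Eq.symm with rfl | hbi
    · exact iff_of_true (by simp) fun h => by tauto
    · rcases eq_or_ne b j with rfl | hbj
      · refine iff_of_false (fun h3 => ?_) (by simp)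
        have := h3.mp (by linarith)
        linarith
      · rw [yi, zi, yk b hbi hbj, zk b hbi hbj]
        refine iff_of_true ?_ fun h => by tauto
        rcases h.others b hbi hbj with h3 | h3
        · exact iff_of_false (by linarith) (by linarith)
        · exact iff_of_true (by linarith) (by linarith)
    · rcases eq_or_ne a j with rfl | haj
      · refine iff_of_false (fun h3 => ?_) (by simp)
        have := h3.mpr (by linarith)
        linarith
      · rw [yi, zi, yk a hai haj, zk a hai haj]
        refine iff_of_true ?_ fun h => by tauto
        rcases h.others a hai haj with h3 | h3
        · exact iff_of_true (by linarith) (by linarith)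
        · exact iff_of_false (by linarith) (by linarith)
    · refine iff_of_true ?_ fun h => by tauto
      rcases (eq_or_ne a j).imp_left Eq.symm with rfl | haj <;>
        rcases (eq_or_ne b j).imp_left Eq.symm with rfl | hbj
      · simp
      · rw [yj, zj, yk b hbi hbj, zk b hbi hbj]
        rcases h.others b hbi hbj with h3 | h3
        · exact iff_of_false (by linarith) (by linarith)
        · exact iff_of_true (by linarith) (by linarith)
      · rw [yj, zj, yk a hai haj, zk a hai haj]
        rcases h.others a hai haj with h3 | h3
        · exact iff_of_true (by linarith) (by linarith)
        · exact iff_of_false (by linarith) (by linarith)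
      · rw [yk a hai haj, zk a hai haj, yk b hbi hbj, zk b hbi hbj]
  · intro a b
    refine iff_of_true ?_ (by simp)
    have near : ∀ u v u' v', (u = x i ∨ u = x i + |κ| / 2) → (v = x i ∨ v = x i + |κ| / 2) →
        (u' = x i ∨ u' = x i + |κ| / 2) → (v' = x i ∨ v' = x i + |κ| / 2) →
        (u < v + κ ↔ u' < v' + κ) := by
      intro u v u' v' hu hv hu' hv'
      rcases h1 with h1 | h1
      · exact iff_of_true (by rcases hu with rfl | rfl <;> rcases hv with rfl | rfl <;> linarith)
          (by rcases hu' with rfl | rfl <;> rcases hv' with rfl | rfl <;> linarith)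
      · exact iff_of_false (by rcases hu with rfl | rfl <;> rcases hv with rfl | rfl <;> linarith)
          (by rcases hu' with rfl | rfl <;> rcases hv' with rfl | rfl <;> linarith)
    have far : ∀ k, k ≠ i → k ≠ j → ∀ u v, (u = x i ∨ u = x i + |κ| / 2) →
        (v = x i ∨ v = x i + |κ| / 2) → (u < x k + κ ↔ v < x k + κ) ∧ (x k < u + κ ↔ x k < v + κ) := by
      intro k hki hkj u v hu hv
      rcases h.others k hki hkj with h3 | h3
      · exact ⟨iff_of_false (by rcases h1 with h1 | h1 <;> rcases hu with rfl | rfl <;> linarith)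
          (by rcases h1 with h1 | h1 <;> rcases hv with rfl | rfl <;> linarith),
          iff_of_true (by rcases h1 with h1 | h1 <;> rcases hu with rfl | rfl <;> linarith)
          (by rcases h1 with h1 | h1 <;> rcases hv with rfl | rfl <;> linarith)⟩
      · exact ⟨iff_of_true (by rcases h1 with h1 | h1 <;> rcases hu with rfl | rfl <;> linarith)
          (by rcases h1 with h1 | h1 <;> rcases hv with rfl | rfl <;> linarith),
          iff_of_false (by rcases h1 with h1 | h1 <;> rcases hu with rfl | rfl <;> linarith)
          (by rcases h1 with h1 | h1 <;> rcases hv with rfl | rfl <;> linarith)⟩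
    have hy : ∀ k, k = i ∨ k = j → y k = x i ∨ y k = x i + |κ| / 2 := by
      rintro k (rfl | rfl) <;> tauto
    have hz : ∀ k, k = i ∨ k = j → z k = x i ∨ z k = x i + |κ| / 2 := by
      rintro k (rfl | rfl) <;> tauto
    by_cases ha : a = i ∨ a = j <;> by_cases hb : b = i ∨ b = j
    · exact near _ _ _ _ (hy a ha) (hy b hb) (hz a ha) (hz b hb)
    · rw [not_or] at hb
      rw [yk b hb.1 hb.2, zk b hb.1 hb.2]
      exact (far b hb.1 hb.2 _ _ (hy a ha) (hz a ha)).1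
    · rw [not_or] at ha
      rw [yk a ha.1 ha.2, zk a ha.1 ha.2]
      exact (far a ha.1 ha.2 _ _ (hy b hb) (hz b hb)).2
    · rw [not_or] at ha hb
      rw [yk a ha.1 ha.2, zk a ha.1 ha.2, yk b hb.1 hb.2, zk b hb.1 hb.2]
  · intro a t
    refine iff_of_true ?_ (by simp)
    have h3 := h.reds t
    rcases eq_or_ne a i with rfl | hai
    · rw [yi, zi]
      exact iff_of_false (by linarith) (by linarith)
    · rcases eq_or_ne a j with rfl | haj
      · rw [yj, zj]
        exact iff_of_false (by linarith) (by linarith)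
      · rw [yk a hai haj, zk a hai haj]

end

/-! ### The elements `T_r` of the corner -/

section

variable {R : Type*} [CommRing R] {K : Type*} [Field K] [Algebra R K] {n ℓ : ℕ}
  {κ : ℝ} {ϑ : Fin ℓ → ℝ} {q : R} {Q : Fin ℓ → R} {X : Fin n → K} {x : Fin n → ℝ} {i j : Fin n}

/-- The two strands `i` and `j` cross, together with their ghosts. -/
def crossEl (q : R) (Q : Fin ℓ → R) (hκ : κ ≠ 0) (h : Neighbours κ ϑ x i j) :
    AffineCorner q Q h.generic :=
  -- After the crossing, the strands move apart by the inverse of the approach with the labels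
  -- exchanged. The diagram ends at `x` relabelled, which has the same idempotent.
  .mk (sl q Q ((h.step hκ).symm.comp (Equiv.swap i j)).isSlice *
      (sl q Q (h.step_swap hκ).isSlice * sl q Q (h.step hκ).isSlice))
    (by rw [← affineIdem_comp h.generic (Equiv.swap i j), ← mul_assoc, sl_top_mul])
    (by rw [mul_assoc, mul_assoc, sl_mul_bottom])

/-- Of the two passages of a strand and a ghost, only one carries a factor: the one after the
crossing if `κ > 0`, the one before it if `κ < 0`. The Leibniz rule accounts for the two different
scalars. -/
theorem cornerRep_crossEl (hκ : κ ≠ 0) (hX : Function.Injective X) (hX0 : ∀ i, X i ≠ 0)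
    (h : Neighbours κ ϑ x i j) (F : Equiv.Perm (Fin n) → K) (σ : Equiv.Perm (Fin n)) :
    cornerRep hκ hX hX0 h.generic (crossEl q Q hκ h) F σ =
      heckeOp R q X i j F σ - (if 0 < κ then algebraMap R K q else -1) * F σ := by
  have h0 := abs_pos.mpr hκ
  have hij := h.ne
  have hgap := h.gap
  have e : ∀ G : Equiv.Perm (Fin n) → K, ∀ y, Generic κ ϑ y → restrictAt R y (extendAt R y G) = G :=
    fun G y hy => restrictAt_extendAt R hy.strand_strand G
  have h3 := (h.step hκ).symm.comp (Equiv.swap i j)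
  have hlt : approach κ x i j i < approach κ x i j j := by
    rw [approach_self, approach_of_ne hij]; linarith
  have n1 := vars_sub_ne_zero hX σ hij
  rw [cornerRep_apply, crossEl, AffineCorner.val_mk, rep_mul, rep_mul, rep_sl, rep_sl, rep_sl,
    e _ _ h.generic, e _ _ (h.generic_approach hκ), e _ _ ((h.generic_approach hκ).comp _),
    extendAt_comp_swap, e _ _ h.generic, sliceOp_of_strands (h.step_swap hκ) hlt]
  by_cases hpos : 0 < κ
  · have hk : |κ| = κ := abs_of_pos hpos
    have hs : Step κ ϑ x (approach κ x i j) (.ghost j i) := by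
      have := h.step hκ
      rwa [approachCrossing, if_pos hpos] at this
    have hs' : Step κ ϑ (approach κ x i j ∘ Equiv.swap i j) (x ∘ Equiv.swap i j) (.ghost i j) := by
      have := hs.symm.comp (Equiv.swap i j)
      rwa [Crossing.map, Equiv.swap_inv, Equiv.swap_apply_left, Equiv.swap_apply_right] at this
    have c1 : coef (K := K) κ ϑ q Q x (approach κ x i j) = fun _ => 1 := by
      funext ξ
      rw [coef_of_ghost hs, if_neg (by linarith)]
    have c2 : coef (K := K) κ ϑ q Q (approach κ x i j ∘ Equiv.swap i j) (x ∘ Equiv.swap i j) =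
        fun ξ => ξ i - algebraMap R K q * ξ j := by
      funext ξ
      rw [coef_of_ghost hs', if_pos]
      simp only [Function.comp_apply, Equiv.swap_apply_left, Equiv.swap_apply_right]
      rw [approach_self, approach_of_ne hij]
      linarith
    rw [hs.sliceOp_eq (by simp), hs'.sliceOp_eq (by simp), c1, c2, if_pos hpos, heckeOp_apply]
    simp only [mulOp_apply, divDiff_apply, vars_swap_mul, Function.comp_apply,
      Equiv.swap_apply_left, Equiv.swap_apply_right, Equiv.swap_mul_self_mul, one_mul]
    rw [← neg_sub (vars X σ i) (vars X σ j), div_neg]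
    field_simp
    ring
  · have hk : |κ| = -κ := abs_of_neg (lt_of_le_of_ne (not_lt.mp hpos) hκ)
    have hs : Step κ ϑ x (approach κ x i j) (.ghost i j) := by
      have := h.step hκ
      rwa [approachCrossing, if_neg hpos] at this
    have hs' : Step κ ϑ (approach κ x i j ∘ Equiv.swap i j) (x ∘ Equiv.swap i j) (.ghost j i) := by
      have := hs.symm.comp (Equiv.swap i j)
      rwa [Crossing.map, Equiv.swap_inv, Equiv.swap_apply_left, Equiv.swap_apply_right] at this
    have c1 : coef (K := K) κ ϑ q Q x (approach κ x i j) = fun ξ => ξ i - algebraMap R K q * ξ j := by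
      funext ξ
      rw [coef_of_ghost hs, if_pos (by linarith)]
    have c2 : coef (K := K) κ ϑ q Q (approach κ x i j ∘ Equiv.swap i j) (x ∘ Equiv.swap i j) =
        fun _ => 1 := by
      funext ξ
      rw [coef_of_ghost hs', if_neg]
      simp only [Function.comp_apply, Equiv.swap_apply_left, Equiv.swap_apply_right]
      rw [approach_self, approach_of_ne hij]
      linarith
    rw [hs.sliceOp_eq (by simp), hs'.sliceOp_eq (by simp), c1, c2, if_neg hpos, heckeOp_apply]
    simp only [mulOp_apply, divDiff_apply, vars_swap_mul, Function.comp_apply,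
      Equiv.swap_apply_left, Equiv.swap_apply_right, Equiv.swap_mul_self_mul, one_mul]
    rw [← neg_sub (vars X σ i) (vars X σ j), div_neg]
    field_simp
    ring

/-- The element `T_r` of the corner. -/
def heckeEl (q : R) (Q : Fin ℓ → R) (hκ : κ ≠ 0) (h : Neighbours κ ϑ x i j) :
    AffineCorner q Q h.generic :=
  crossEl q Q hκ h + (if 0 < κ then q else -1) • 1

theorem cornerRep_heckeEl (hκ : κ ≠ 0) (hX : Function.Injective X) (hX0 : ∀ i, X i ≠ 0)
    (h : Neighbours κ ϑ x i j) (F : Equiv.Perm (Fin n) → K) :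
    cornerRep hκ hX hX0 h.generic (heckeEl q Q hκ h) F = heckeOp R q X i j F := by
  funext σ
  rw [heckeEl, map_add, map_smul, map_one, LinearMap.add_apply, LinearMap.smul_apply,
    Module.End.one_apply, Pi.add_apply, cornerRep_crossEl, Pi.smul_apply, Algebra.smul_def,
    apply_ite (algebraMap R K), map_neg, map_one]
  ring

end

/-! ### The corner is spanned by `n!` elements, and acts faithfully -/

section

variable {R : Type*} [CommRing R] {n ℓ : ℕ} {κ : ℝ} {ϑ : Fin ℓ → ℝ} {q : R} {Q : Fin ℓ → R}
  {x : Fin n → ℝ}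

/-- Laurent polynomials in the squares. -/
def sqLaurent (q : R) (Q : Fin ℓ → R) (h : Generic κ ϑ x) :
    Laurent R n →ₐ[R] AffineCorner q Q h :=
  laurentEval (sqUnit q Q h) sqUnit_comm

theorem sqLaurent_var (h : Generic κ ϑ x) (i : Fin n) (a : ℤ) :
    (sqLaurent q Q h (Laurent.var R i a)).val = sq q Q h i a := by
  have key : ∀ k : ℕ, ((sqUnit q Q h i ^ k : (AffineCorner q Q h)ˣ) : AffineCorner q Q h).val =
      sq q Q h i k ∧ ((sqUnit q Q h i ^ (-(k : ℤ)) : (AffineCorner q Q h)ˣ) :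
        AffineCorner q Q h).val = sq q Q h i (-(k : ℤ)) := fun k => by
    induction k with
    | zero =>
      simp only [pow_zero, CharP.cast_eq_zero, neg_zero, zpow_zero, sq_zero]
      exact ⟨rfl, rfl⟩
    | succ k ih =>
      refine ⟨?_, ?_⟩
      · rw [pow_succ, Units.val_mul, AffineCorner.val_mul, ih.1, Nat.cast_succ, ← sq_mul_sq]
        rfl
      · rw [Nat.cast_succ, neg_add, zpow_add, zpow_neg_one, Units.val_mul, AffineCorner.val_mul,
          ih.2, ← sq_mul_sq]
        rfl
  rw [sqLaurent, laurentEval_var]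
  rcases Int.eq_nat_or_neg a with ⟨k, rfl | rfl⟩
  · rw [zpow_natCast, (key k).1]
  · exact (key k).2

theorem Gal.mul_idem {h₀ : Generic κ ϑ x} {N : ℕ} {y : Fin n → ℝ} {a : AffineWF κ ϑ q Q n}
    (h : Gal q Q h₀ N y a) : a * affineIdem q Q h₀ = a := by
  induction h with
  | nil => exact affineIdem_mul_self h₀
  | free h hc ha ih => rw [mul_assoc, ih]
  | cross h hc ha ih => rw [mul_assoc, ih]

/-- One minimal gallery is chosen for each permutation of the end points. Their right multiples by
Laurent polynomials in the squares fill the corner by `corner_mem_of_gal`. -/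
theorem exists_finset_corner (hκ : κ ≠ 0) (h : Generic κ ϑ x) :
    ∃ N : Finset (AffineCorner q Q h), N.card ≤ n.factorial ∧ ∀ b, ∃ p : AffineCorner q Q h →
      Laurent R n, b = ∑ g ∈ N, g * sqLaurent q Q h (p g) := by
  classical
  have hex : ∀ σ : Equiv.Perm (Fin n), ∃ g : AffineCorner q Q h,
      Gal q Q h ((arr n hκ ϑ).sep x (x ∘ σ)).card (x ∘ σ) g.val := fun σ => by
    obtain ⟨g, hg⟩ := exists_gal (q := q) (Q := Q) (h₀ := h) hκ _ _ (h.comp σ) rfl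
    exact ⟨.mk g (by rw [← affineIdem_comp h σ]; exact hg.diag.idem_mul _) hg.mul_idem, hg⟩
  choose g hg using hex
  refine ⟨Finset.univ.image g, Finset.card_image_le.trans (by
    rw [Finset.card_univ, Fintype.card_perm, Fintype.card_fin]), fun b => ?_⟩
  let W : Submodule R (AffineCorner q Q h) :=
    { carrier := {b | ∃ p : AffineCorner q Q h → Laurent R n,
        b = ∑ g ∈ Finset.univ.image g, g * sqLaurent q Q h (p g)}
      add_mem' := by
        rintro a b ⟨p, rfl⟩ ⟨p', rfl⟩
        refine ⟨p + p', ?_⟩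
        rw [← Finset.sum_add_distrib]
        exact Finset.sum_congr rfl fun g _ => by rw [Pi.add_apply, map_add, mul_add]
      zero_mem' := ⟨0, by simp⟩
      smul_mem' := by
        rintro c b ⟨p, rfl⟩
        refine ⟨c • p, ?_⟩
        rw [Finset.smul_sum]
        exact Finset.sum_congr rfl fun g _ => by rw [Pi.smul_apply, map_smul, mul_smul_comm] }
  have hW : ∀ a ∈ W, ∀ p, a * sqLaurent q Q h p ∈ W := by
    rintro _ ⟨p, rfl⟩ p'
    refine ⟨fun g => p g * p', ?_⟩
    rw [Finset.sum_mul]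
    exact Finset.sum_congr rfl fun g _ => by rw [map_mul, mul_assoc]
  have hmem := corner_mem_of_gal (q := q) (Q := Q) (h₀ := h) hκ h (V := W.map AffineCorner.val) ?_ ?_ b.val
  · rw [b.mul_idem, b.idem_mul] at hmem
    obtain ⟨b', hb', he⟩ := hmem
    rw [← AffineCorner.val_injective he]
    exact hb'
  · rintro _ ⟨a, ha, rfl⟩ i m
    refine ⟨_, hW a ha (Laurent.var R i m), ?_⟩
    rw [AffineCorner.val_mul, sqLaurent_var]
  · intro σ
    refine ⟨_, ⟨g σ, ⟨Pi.single (g σ) 1, ?_⟩, rfl⟩, hg σ⟩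
    rw [Finset.sum_eq_single_of_mem (g σ) (Finset.mem_image_of_mem _ (Finset.mem_univ _)),
      Pi.single_eq_same, map_one, mul_one]
    intro g' _ hg'
    rw [Pi.single_eq_of_ne hg', map_zero, mul_zero]

end

section

variable {R : Type*} [CommRing R] [IsDomain R] {n : ℕ} {q : R}

/-- Algebras that contain the operators `T_r` and are spanned over Laurent polynomials by `n!`
elements are determined by their action on one vector. -/
theorem injective_of_heckeOp {B : Type*} [Semiring B] [Algebra R B]
    (ρ : B →ₐ[R] Module.End (RatField R n) (Equiv.Perm (Fin n) → RatField R n))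
    (lam : Laurent R n →ₐ[R] B)
    (h₁ : ∀ i F, ρ (lam (Laurent.var R i 1)) F = mulOp R (ratVar R) (fun ξ => ξ i ^ (1 : ℤ)) F)
    (h₂ : ∀ i F, ρ (lam (Laurent.var R i (-1))) F = mulOp R (ratVar R) (fun ξ => ξ i ^ (-1 : ℤ)) F)
    (hT : ∀ r (h : r + 1 < n), ∃ b, ∀ F,
      ρ b F = heckeOp R q (ratVar R) ⟨r, Nat.lt_of_succ_lt h⟩ ⟨r + 1, h⟩ F)
    (hN : ∃ N : Finset B, N.card ≤ n.factorial ∧ ∀ b, ∃ p : B → Laurent R n,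
      b = ∑ g ∈ N, g * lam (p g)) :
    Function.Injective fun b => ρ b (Pi.single 1 1) := by
  obtain ⟨N, hcard, hN⟩ := hN
  let ev : B →+ (Equiv.Perm (Fin n) → RatField R n) :=
    { toFun := fun b => ρ b (Pi.single 1 1)
      map_zero' := by rw [map_zero, LinearMap.zero_apply]
      map_add' := fun a b => by rw [map_add, LinearMap.add_apply] }
  refine injective_of_equivariant (R := R) (K := RatField R n) (fun p => lam p) ev (fun b p => ?_) N ?_ hN ?_
  -- Right multiplication by a Laurent polynomial acts first on the eigenvector, and so becomes
  -- multiplication by a scalar.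
  · have h : (ρ.comp lam) p (Pi.single 1 1) = _ := laurent_act (ρ.comp lam) (Pi.single 1 1)
      (fun i => by
        rw [AlgHom.comp_apply, h₁, mulOp_single_one, zpow_one]; rfl)
      (fun i => by
        rw [AlgHom.comp_apply, h₂, mulOp_single_one, ratVar_inv]) p
    change ρ (b * lam p) _ = _ • ρ b _
    rw [map_mul, Module.End.mul_apply]
    rw [AlgHom.comp_apply] at h
    rw [h, map_smul]
  · rw [Module.finrank_fintype_fun_eq_card, Fintype.card_perm, Fintype.card_fin]
    exact hcard
  -- The span of the images of the test vector is stable under the Hecke operators, which come from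
  -- left multiplication, and contains the test vector.
  · refine eq_top_of_heckeOp R (ratVar_injective R) (q := q)
      (fun a b hab => algebraMap_mul_ratVar_ne R q hab) (fun r h F hF => ?_)
      (Submodule.subset_span ⟨1, ?_⟩)
    · obtain ⟨t, ht⟩ := hT r h
      rw [← ht]
      refine Submodule.span_induction (p := fun F _ => ρ t F ∈ Submodule.span _ (Set.range ev))
        ?_ ?_ ?_ ?_ hF
      · rintro _ ⟨b, rfl⟩
        exact Submodule.subset_span ⟨t * b, by
          change ρ (t * b) _ = ρ t (ρ b _); rw [map_mul]; rfl⟩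
      · rw [map_zero]; exact Submodule.zero_mem _
      · intro F G _ _ hF hG
        rw [map_add]; exact Submodule.add_mem _ hF hG
      · intro c F _ hF
        rw [map_smul]; exact Submodule.smul_mem _ c hF
    · change ρ 1 _ = _
      rw [map_one]; rfl

end

/-! ### The map from the affine Hecke algebra to the corner at `spaced n s` -/

section

variable {R : Type*} [CommRing R] {n ℓ : ℕ} {κ s : ℝ} {ϑ : Fin ℓ → ℝ} {q : R} {Q : Fin ℓ → R}

theorem spaced_add_le (hs : 0 ≤ s) {a b : Fin n} (h : a < b) : spaced n s a + s ≤ spaced n s b := by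
  have h1 : ((a : ℕ) : ℝ) + 1 ≤ (b : ℕ) := by exact_mod_cast h
  unfold spaced
  nlinarith

theorem le_spaced (hs : 0 ≤ s) (a : Fin n) : s ≤ spaced n s a := by
  have : (0 : ℝ) ≤ (a : ℕ) := Nat.cast_nonneg _
  unfold spaced
  nlinarith

theorem neighbours_spaced (hκ : κ ≠ 0) (hs : |κ| < s) (hϑ : ∀ t, |ϑ t| + |κ| < s) {r : ℕ}
    (h : r + 1 < n) :
    Neighbours κ ϑ (spaced n s) ⟨r, Nat.lt_of_succ_lt h⟩ ⟨r + 1, h⟩ := by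
  have h0 : 0 ≤ s := (abs_nonneg κ).trans hs.le
  refine ⟨generic_spaced n hκ hs hϑ, ?_, fun k hk hk' => ?_, fun t => ?_⟩
  · have := spaced_add_le h0 (a := (⟨r, Nat.lt_of_succ_lt h⟩ : Fin n)) (b := ⟨r + 1, h⟩) (by simp)
    linarith
  · rcases lt_or_ge (k : ℕ) r with h1 | h1
    · left
      have := spaced_add_le h0 (a := k) (b := (⟨r, Nat.lt_of_succ_lt h⟩ : Fin n)) h1
      linarith
    · right
      have h2 : (k : ℕ) ≠ r := fun he => hk (Fin.ext he)
      have h3 : (k : ℕ) ≠ r + 1 := fun he => hk' (Fin.ext he)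
      have := spaced_add_le h0 (a := (⟨r + 1, h⟩ : Fin n)) (b := k)
        (by rw [Fin.lt_def]; change r + 1 < (k : ℕ); omega)
      linarith
  · have := hϑ t
    have := le_abs_self (ϑ t)
    have := le_spaced h0 (⟨r, Nat.lt_of_succ_lt h⟩ : Fin n)
    linarith

variable [IsDomain R] (hκ : κ ≠ 0) (hs : |κ| < s) (hϑ : ∀ t, |ϑ t| + |κ| < s)

/-- The representation of the corner at `B_s`. -/
def spacedRep : AffineCorner q Q (generic_spaced n hκ hs hϑ) →ₐ[R]
    Module.End (RatField R n) (Equiv.Perm (Fin n) → RatField R n) :=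
  cornerRep hκ (ratVar_injective R) (ratVar_ne_zero R) (generic_spaced n hκ hs hϑ)

/-- Faithfulness of the polynomial representation on the corner: identities between diagrams may be
checked on operators. -/
theorem spacedRep_injective : Function.Injective (spacedRep (q := q) (Q := Q) (n := n) hκ hs hϑ) := by
  intro a b hab
  refine injective_of_heckeOp (q := q) (spacedRep hκ hs hϑ) (sqLaurent q Q (generic_spaced n hκ hs hϑ))
    (fun i F => ?_) (fun i F => ?_) (fun r h => ?_) (exists_finset_corner hκ _)
    (congrArg (fun f => f (Pi.single 1 1)) hab)
  · exact cornerRep_sq _ _ _ _ _ _ (sqLaurent_var _ i 1) F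
  · exact cornerRep_sq _ _ _ _ _ _ (sqLaurent_var _ i (-1)) F
  · exact ⟨_, fun F => cornerRep_heckeEl hκ _ _ (neighbours_spaced hκ hs hϑ h) F⟩

/-- The images of the generators of the affine Hecke algebra. -/
def spacedGen : HeckeGen n → AffineCorner q Q (generic_spaced n hκ hs hϑ)
  | .X i => sqLaurent q Q _ (Laurent.var R i 1)
  | .Xinv i => sqLaurent q Q _ (Laurent.var R i (-1))
  | .T _ h => heckeEl q Q hκ (neighbours_spaced hκ hs hϑ h)

theorem spacedRep_x (i : Fin n) (F : Equiv.Perm (Fin n) → RatField R n) :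
    spacedRep (q := q) (Q := Q) hκ hs hϑ (sqLaurent q Q _ (Laurent.var R i 1)) F =
      mulOp R (ratVar R) (fun ξ => ξ i) F := by
  have := cornerRep_sq hκ (ratVar_injective R) (ratVar_ne_zero R) _ _ _
    (sqLaurent_var (q := q) (Q := Q) (generic_spaced n hκ hs hϑ) i 1) F
  simp only [zpow_one] at this
  exact this

theorem spacedRep_t {r : ℕ} (h : r + 1 < n) (F : Equiv.Perm (Fin n) → RatField R n) :
    spacedRep hκ hs hϑ (heckeEl q Q hκ (neighbours_spaced hκ hs hϑ h)) F =
      heckeOp R q (ratVar R) ⟨r, Nat.lt_of_succ_lt h⟩ ⟨r + 1, h⟩ F :=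
  cornerRep_heckeEl hκ _ _ (neighbours_spaced hκ hs hϑ h) F

/-- The relations between the `X_i` alone hold already for Laurent polynomials. Those involving some
`T_r` are checked on Demazure–Lusztig operators. -/
theorem spacedGen_rel {a b : FreeAlgebra R (HeckeGen n)} (hab : HeckeRel q n a b) :
    FreeAlgebra.lift R (spacedGen (q := q) (Q := Q) hκ hs hϑ) a =
      FreeAlgebra.lift R (spacedGen (q := q) (Q := Q) hκ hs hϑ) b := by
  have ex : ∀ i : Fin n, FreeAlgebra.lift R (spacedGen (q := q) (Q := Q) hκ hs hϑ) (HeckeGen.x R i) =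
    sqLaurent q Q _ (Laurent.var R i 1) := fun i => FreeAlgebra.lift_ι_apply _ _
  have ex' : ∀ i : Fin n, FreeAlgebra.lift R (spacedGen (q := q) (Q := Q) hκ hs hϑ) (HeckeGen.xinv R i) =
    sqLaurent q Q _ (Laurent.var R i (-1)) := fun i => FreeAlgebra.lift_ι_apply _ _
  have et : ∀ r (h : r + 1 < n), FreeAlgebra.lift R (spacedGen (q := q) (Q := Q) hκ hs hϑ) (HeckeGen.t R r h) =
    heckeEl q Q hκ (neighbours_spaced hκ hs hϑ h) := fun r h => FreeAlgebra.lift_ι_apply _ _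
  have hX := ratVar_injective (n := n) R
  cases hab with
  | x_comm i j => rw [map_mul, map_mul, ex, ex, ← map_mul, ← map_mul, mul_comm]
  | x_xinv i =>
    rw [map_mul, map_one, ex, ex', ← map_mul, Laurent.var_mul, add_neg_cancel, Laurent.var_zero,
      map_one]
  | xinv_x i =>
    rw [map_mul, map_one, ex, ex', ← map_mul, Laurent.var_mul, neg_add_cancel, Laurent.var_zero,
      map_one]
  | quadratic r h =>
    refine spacedRep_injective hκ hs hϑ (LinearMap.ext fun F => funext fun σ => ?_)
    rw [map_mul, map_add, map_smul, AlgHom.commutes, et, map_mul, map_add, map_smul,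
      AlgHom.commutes, Module.End.mul_apply, LinearMap.add_apply, LinearMap.smul_apply,
      Module.algebraMap_end_apply, spacedRep_t, spacedRep_t, heckeOp_mul_self R q hX (by simp),
      Pi.add_apply, Pi.smul_apply, Pi.smul_apply, Algebra.smul_def, Algebra.smul_def, map_sub,
      map_one]
  | txt r h =>
    refine spacedRep_injective hκ hs hϑ (LinearMap.ext fun F => funext fun σ => ?_)
    simp only [map_mul, map_smul, et, ex, Module.End.mul_apply, LinearMap.smul_apply, spacedRep_t,
      spacedRep_x]
    rw [heckeOp_mul_heckeOp R q hX (by simp), Pi.smul_apply, Algebra.smul_def, mulOp_apply]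
  | braid r h h' =>
    refine spacedRep_injective hκ hs hϑ (LinearMap.ext fun F => funext fun σ => ?_)
    simp only [map_mul, et, Module.End.mul_apply, spacedRep_t]
    exact heckeOp_braid R q hX (by simp) (by simp; omega) (by simp) F σ
  | t_x r h j h₁ h₂ =>
    refine spacedRep_injective hκ hs hϑ (LinearMap.ext fun F => funext fun σ => ?_)
    simp only [map_mul, et, ex, Module.End.mul_apply, spacedRep_t, spacedRep_x]
    exact heckeOp_mulOp R q (fun he => h₁ (congrArg Fin.val he))
      (fun he => h₂ (congrArg Fin.val he)) F σ
  | t_t r r' h h' h₁ h₂ =>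
    refine spacedRep_injective hκ hs hϑ (LinearMap.ext fun F => funext fun σ => ?_)
    simp only [map_mul, et, Module.End.mul_apply, spacedRep_t]
    rcases eq_or_ne r r' with rfl | hne
    · rfl
    · exact heckeOp_comm R q (by simpa using hne) (by simpa using h₂) (by simpa using h₁.symm)
        (by simpa using hne) F σ

/-- The homomorphism from the affine Hecke algebra to the corner at `B_s`. -/
def heckeToCorner (q : R) (Q : Fin ℓ → R) :
    AffineHecke q n →ₐ[R] AffineCorner q Q (generic_spaced n hκ hs hϑ) :=
  RingQuot.liftAlgHom R ⟨FreeAlgebra.lift R (spacedGen hκ hs hϑ), fun _ _ h =>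
    spacedGen_rel hκ hs hϑ h⟩

theorem heckeToCorner_hX (i : Fin n) : heckeToCorner hκ hs hϑ q Q (hX q i) =
    sqLaurent q Q _ (Laurent.var R i 1) := by
  rw [heckeToCorner, hX, RingQuot.liftAlgHom_mkAlgHom_apply]
  exact FreeAlgebra.lift_ι_apply _ _

theorem heckeToCorner_hXinv (i : Fin n) : heckeToCorner hκ hs hϑ q Q (hXinv q i) =
    sqLaurent q Q _ (Laurent.var R i (-1)) := by
  rw [heckeToCorner, hXinv, RingQuot.liftAlgHom_mkAlgHom_apply]
  exact FreeAlgebra.lift_ι_apply _ _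

theorem heckeToCorner_hT (r : ℕ) (h : r + 1 < n) : heckeToCorner hκ hs hϑ q Q (hT q r h) =
    heckeEl q Q hκ (neighbours_spaced hκ hs hϑ h) := by
  rw [heckeToCorner, hT, RingQuot.liftAlgHom_mkAlgHom_apply]
  exact FreeAlgebra.lift_ι_apply _ _

/-- The composite with the representation of the corner satisfies the criterion of
`injective_of_heckeOp`. Invertibility of `q` enters through the bound on the affine Hecke algebra
itself. -/
theorem heckeToCorner_injective (hq : IsUnit q) :
    Function.Injective (heckeToCorner (n := n) hκ hs hϑ q Q) := by
  intro a b hab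
  refine injective_of_heckeOp (q := q) ((spacedRep hκ hs hϑ).comp (heckeToCorner hκ hs hϑ q Q))
    (hLaurent q n) (fun i F => ?_) (fun i F => ?_) (fun r h => ?_) (exists_finset_hecke hq n)
    (congrArg (fun c => spacedRep hκ hs hϑ c (Pi.single 1 1)) hab)
  · rw [AlgHom.comp_apply, hLaurent_var_one, heckeToCorner_hX]
    exact cornerRep_sq _ _ _ _ _ _ (sqLaurent_var _ i 1) F
  · rw [AlgHom.comp_apply, hLaurent_var_neg_one, heckeToCorner_hXinv]
    exact cornerRep_sq _ _ _ _ _ _ (sqLaurent_var _ i (-1)) F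
  · refine ⟨hT q r h, fun F => ?_⟩
    rw [AlgHom.comp_apply, heckeToCorner_hT, spacedRep_t]

end

/-! ### Concatenation of galleries -/

section

variable {R : Type*} [CommRing R] {n ℓ : ℕ} {κ : ℝ} {ϑ : Fin ℓ → ℝ} {q : R} {Q : Fin ℓ → R}
  {x₀ : Fin n → ℝ} {h₀ : Generic κ ϑ x₀}

theorem Gal.generic {N : ℕ} {y : Fin n → ℝ} {a : AffineWF κ ϑ q Q n} (h : Gal q Q h₀ N y a) :
    Generic κ ϑ y := h.diag.generic

theorem Gal.trans {N M : ℕ} {y z : Fin n → ℝ} {a b : AffineWF κ ϑ q Q n} {hz : Generic κ ϑ z}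
    (ha : Gal q Q h₀ N z a) (hb : Gal q Q hz M y b) : Gal q Q h₀ (N + M) y (b * a) := by
  induction hb with
  | nil => rw [ha.diag.idem_mul hz]; exact ha
  | free h hc _ ih => rw [mul_assoc]; exact .free h hc ih
  | cross h hc _ ih => rw [mul_assoc]; exact .cross h hc ih

theorem Gal.comp {N : ℕ} {y : Fin n → ℝ} {a : AffineWF κ ϑ q Q n} (ha : Gal q Q h₀ N y a)
    (σ : Equiv.Perm (Fin n)) : Gal q Q (h₀.comp σ) N (y ∘ σ) a := by
  induction ha with
  | nil => rw [← affineIdem_comp h₀ σ]; exact .nil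
  | free h hc _ ih =>
    rw [← sl_comp σ h]
    exact .free _ (crossings_comp_eq_empty σ hc) ih
  | cross h hc _ ih =>
    rw [← sl_comp σ h]
    exact .cross _ (Step.comp ⟨h.bottom, h.top, hc⟩ σ).crossings_eq ih

theorem Step.gal {y : Fin n → ℝ} {c : Crossing n} (h : Step κ ϑ x₀ y c) :
    Gal q Q h.bottom 1 y (sl q Q h.isSlice) := by
  have := Gal.cross (q := q) (Q := Q) (h₀ := h.bottom) h.isSlice h.crossings_eq .nil
  rwa [sl_mul_bottom] at this

theorem Step.card_sep (hκ : κ ≠ 0) {y z : Fin n → ℝ} {c : Crossing n} (h : Step κ ϑ z y c)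
    (h₀ : Generic κ ϑ x₀) (hc : c ∈ crossings κ ϑ x₀ y) :
    ((arr n hκ ϑ).sep x₀ y).card = ((arr n hκ ϑ).sep x₀ z).card + 1 := by
  rcases card_sep_of_singleton hκ h₀ h.top h.bottom h.crossings_eq with h1 | h1
  · exact h1.2.symm
  · exfalso
    have h2 : c ∈ crossings κ ϑ x₀ z := by rw [WFHecke.crossings_eq hκ]; exact h1.1
    have h3 : c ∈ crossings κ ϑ y z := by rw [crossings_comm, h.crossings_eq]; rfl
    rw [mem_crossings_iff_not h₀ h.top h.bottom hκ] at h2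
    tauto

theorem Neighbours.comp {x : Fin n → ℝ} {i j : Fin n} (σ : Equiv.Perm (Fin n))
    (h : Neighbours κ ϑ x (σ i) (σ j)) : Neighbours κ ϑ (x ∘ σ) i j :=
  ⟨h.generic.comp σ, h.gap, fun k hk hk' => h.others (σ k) (σ.injective.ne hk) (σ.injective.ne hk'),
    h.reds⟩

/-- If the two strands start far apart and in the order they have at `x`, all three crossings of
`crossEl` are new. Prolonging a minimal gallery by this element therefore keeps it minimal. -/
theorem Neighbours.card_sep (hκ : κ ≠ 0) {x : Fin n → ℝ} {i j : Fin n} (h : Neighbours κ ϑ x i j)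
    (h₀ : Generic κ ϑ x₀) (hij : x₀ i + |κ| < x₀ j) :
    ((arr n hκ ϑ).sep x₀ (x ∘ Equiv.swap i j)).card = ((arr n hκ ϑ).sep x₀ x).card + 3 := by
  have h0 := abs_pos.mpr hκ
  have hne := h.ne
  have s1 := h.step hκ
  have s2 := h.step_swap hκ
  have s3 := s1.symm.comp (Equiv.swap i j)
  have hgap := h.gap
  have yi : approach κ x i j i = x i := approach_of_ne hne
  have yj : approach κ x i j j = x i + |κ| / 2 := approach_self
  have k2 : Crossing.strands s(i, j) ∈ crossings κ ϑ x₀ (approach κ x i j ∘ Equiv.swap i j) := by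
    by_contra hc
    rw [strands_notMem_iff h₀ s2.top, Function.comp_apply, Function.comp_apply,
      Equiv.swap_apply_left, Equiv.swap_apply_right, yi, yj] at hc
    have := hc.mp (by linarith)
    linarith
  have k1 : approachCrossing κ i j ∈ crossings κ ϑ x₀ (approach κ x i j) := by
    by_contra hc
    by_cases hpos : 0 < κ
    · have hk : |κ| = κ := abs_of_pos hpos
      rw [approachCrossing, if_pos hpos, ghost_notMem_iff h₀ s1.top, yi, yj] at hc
      have := hc.mpr (by linarith)
      linarith
    · have hk : |κ| = -κ := abs_of_neg (lt_of_le_of_ne (not_lt.mp hpos) hκ)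
      rw [approachCrossing, if_neg hpos, ghost_notMem_iff h₀ s1.top, yi, yj] at hc
      have := hc.mp (by linarith)
      linarith
  have k3 : (approachCrossing κ i j).map (Equiv.swap i j)⁻¹ ∈
      crossings κ ϑ x₀ (x ∘ Equiv.swap i j) := by
    by_contra hc
    rw [Equiv.swap_inv] at hc
    by_cases hpos : 0 < κ
    · have hk : |κ| = κ := abs_of_pos hpos
      rw [approachCrossing, if_pos hpos, Crossing.map, ghost_notMem_iff h₀ s3.top,
        Equiv.swap_apply_right, Equiv.swap_apply_left, Function.comp_apply, Function.comp_apply,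
        Equiv.swap_apply_right, Equiv.swap_apply_left] at hc
      have := hc.mp (by linarith)
      linarith
    · have hk : |κ| = -κ := abs_of_neg (lt_of_le_of_ne (not_lt.mp hpos) hκ)
      rw [approachCrossing, if_neg hpos, Crossing.map, ghost_notMem_iff h₀ s3.top,
        Equiv.swap_apply_right, Equiv.swap_apply_left, Function.comp_apply, Function.comp_apply,
        Equiv.swap_apply_right, Equiv.swap_apply_left] at hc
      have := hc.mpr (by linarith)
      linarith
  rw [s3.card_sep hκ h₀ k3, s2.card_sep hκ h₀ k2, s1.card_sep hκ h₀ k1]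

theorem crossEl_gal (hκ : κ ≠ 0) {x : Fin n → ℝ} {i j : Fin n} (h : Neighbours κ ϑ x i j) :
    Gal q Q h.generic 3 (x ∘ Equiv.swap i j) (crossEl q Q hκ h).val := by
  have s1 := h.step hκ
  have s2 := h.step_swap hκ
  have s3 := s1.symm.comp (Equiv.swap i j)
  have h3 := ((s1.gal (q := q) (Q := Q)).trans (s2.gal (q := q) (Q := Q))).trans
    (s3.gal (q := q) (Q := Q))
  exact h3

end

/-! ### The affine Hecke algebra maps onto the corner -/

section

/-- A permutation without descents is strictly monotone, hence the identity. -/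
theorem exists_descent {n : ℕ} {σ : Equiv.Perm (Fin n)} (hσ : σ ≠ 1) :
    ∃ (r : ℕ) (h : r + 1 < n), σ ⟨r + 1, h⟩ < σ ⟨r, Nat.lt_of_succ_lt h⟩ := by
  by_contra hcon
  push Not at hcon
  refine hσ ?_
  have hmono : StrictMono σ := by
    cases n with
    | zero => exact fun a => a.elim0
    | succ n =>
      refine Fin.strictMono_iff_lt_succ.mpr fun i => ?_
      exact lt_of_le_of_ne (hcon i (Nat.succ_lt_succ i.2))
        (σ.injective.ne (Fin.castSucc_lt_succ).ne)
  have h1 := hmono.range_inj (g := id) strictMono_id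
  rw [σ.surjective.range_eq, Set.range_id] at h1
  exact Equiv.ext fun i => congrFun (h1.mp rfl) i

variable {R : Type*} [CommRing R] [IsDomain R] {n ℓ : ℕ} {κ s : ℝ} {ϑ : Fin ℓ → ℝ} {q : R}
  {Q : Fin ℓ → R} (hκ : κ ≠ 0) (hs : |κ| < s) (hϑ : ∀ t, |ϑ t| + |κ| < s)

theorem add_smul_one_add_neg_smul_one {R A : Type*} [CommRing R] [Semiring A] [Algebra R A] (a : A)
    (c : R) : a + c • 1 + (-c) • 1 = a := by
  rw [add_assoc, ← add_smul, add_neg_cancel, zero_smul, add_zero]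

theorem crossEl_mem_range (r : ℕ) (h : r + 1 < n) :
    crossEl q Q hκ (neighbours_spaced hκ hs hϑ h) ∈ (heckeToCorner hκ hs hϑ q Q).range := by
  have h1 : heckeEl q Q hκ (neighbours_spaced hκ hs hϑ h) ∈ (heckeToCorner hκ hs hϑ q Q).range :=
    ⟨hT q r h, heckeToCorner_hT hκ hs hϑ r h⟩
  have h2 : crossEl q Q hκ (neighbours_spaced hκ hs hϑ h) =
      heckeEl q Q hκ (neighbours_spaced hκ hs hϑ h) + (-(if 0 < κ then q else -1)) • 1 :=
    (add_smul_one_add_neg_smul_one _ _).symm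
  rw [h2]
  exact Subalgebra.add_mem _ h1 (Subalgebra.smul_mem _ (Subalgebra.one_mem _) _)

/-- The lift of a reduced word: each simple transposition contributes one `crossEl`, with three
crossings, and the number of separating walls drops by three when it is removed. -/
theorem exists_gal_mem_range (N : ℕ) : ∀ σ : Equiv.Perm (Fin n),
    ((arr n hκ ϑ).sep (spaced n s) (spaced n s ∘ σ)).card = N →
    ∃ g ∈ (heckeToCorner hκ hs hϑ q Q).range,
      Gal q Q (generic_spaced n hκ hs hϑ) N (spaced n s ∘ σ) g.val := by
  induction N using Nat.strong_induction_on with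
  | _ N ih =>
  intro σ hN
  by_cases hσ : σ = 1
  · subst hσ
    rw [Equiv.Perm.coe_one, Function.comp_id, Arrangement.sep_self, Finset.card_empty] at hN
    subst hN
    exact ⟨1, Subalgebra.one_mem _, .nil⟩
  -- The inverse occurs because the strand at place `r` of `spaced n s ∘ σ` carries the label `σ⁻¹
  -- r`. A descent means that the strands at places `r` and `r + 1` are in the opposite order at the
  -- bottom.
  obtain ⟨r, h, hr⟩ := exists_descent (inv_ne_one.mpr hσ)
  set i : Fin n := ⟨r, Nat.lt_of_succ_lt h⟩ with hi
  set j : Fin n := ⟨r + 1, h⟩ with hj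
  have hnb := neighbours_spaced hκ hs hϑ h
  set τ := Equiv.swap i j * σ with hτ
  have ea : τ (σ⁻¹ j) = i := by simp [hτ]
  have eb : τ (σ⁻¹ i) = j := by simp [hτ]
  have hnb' : Neighbours κ ϑ (spaced n s ∘ τ) (σ⁻¹ j) (σ⁻¹ i) :=
    Neighbours.comp τ (by rw [ea, eb]; exact hnb)
  have e : (spaced n s ∘ τ) ∘ Equiv.swap (σ⁻¹ j) (σ⁻¹ i) = spaced n s ∘ σ := by
    rw [Function.comp_assoc, ← Equiv.Perm.coe_mul, Equiv.mul_swap_eq_swap_mul, ea, eb, hτ,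
      Equiv.swap_mul_self_mul]
  have hcard := hnb'.card_sep hκ hnb.generic (by
    have := spaced_add_le ((abs_nonneg κ).trans hs.le) hr
    linarith)
  rw [e, hN] at hcard
  obtain ⟨g, hg, hgal⟩ := ih _ (by omega) τ rfl
  refine ⟨_, Subalgebra.mul_mem _ (crossEl_mem_range hκ hs hϑ r h) hg, ?_⟩
  have h3 := hgal.trans ((crossEl_gal (q := q) (Q := Q) hκ hnb).comp τ)
  rw [hcard, AffineCorner.val_mul]
  have e' : (spaced n s ∘ Equiv.swap i j) ∘ τ = spaced n s ∘ σ := by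
    rw [Function.comp_assoc, ← Equiv.Perm.coe_mul, hτ, Equiv.swap_mul_self_mul]
  rw [← e']
  exact h3

/-- The range contains the squares and, by `exists_gal_mem_range`, a minimal gallery for each
permutation. -/
theorem heckeToCorner_surjective : Function.Surjective (heckeToCorner (n := n) hκ hs hϑ q Q) := by
  intro b
  have hmem := corner_mem_of_gal (q := q) (Q := Q) (h₀ := generic_spaced n hκ hs hϑ) hκ
    (generic_spaced n hκ hs hϑ)
    (V := (Subalgebra.toSubmodule (heckeToCorner hκ hs hϑ q Q).range).map AffineCorner.val)
    ?_ ?_ b.val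
  · rw [b.mul_idem, b.idem_mul] at hmem
    obtain ⟨b', hb', he⟩ := hmem
    rw [← AffineCorner.val_injective he]
    exact hb'
  · rintro _ ⟨a, ha, rfl⟩ i m
    refine ⟨a * sqLaurent q Q _ (Laurent.var R i m), Subalgebra.mul_mem _ ha ?_, ?_⟩
    · have hS : (heckeToCorner (n := n) hκ hs hϑ q Q).range.comap (sqLaurent q Q _) = ⊤ :=
        Laurent.subalgebra_eq_top (fun i => ⟨hX q i, heckeToCorner_hX hκ hs hϑ i⟩)
          (fun i => ⟨hXinv q i, heckeToCorner_hXinv hκ hs hϑ i⟩)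
      exact (hS ▸ Algebra.mem_top : Laurent.var R i m ∈ _)
    · rw [AffineCorner.val_mul, sqLaurent_var]
  · intro σ
    obtain ⟨g, hg, hgal⟩ := exists_gal_mem_range (q := q) (Q := Q) hκ hs hϑ _ σ rfl
    exact ⟨_, ⟨g, hg, rfl⟩, hgal⟩

end

/-! ### Galleries in which no strands cross -/

section

variable {R : Type*} [CommRing R] {K : Type*} [Field K] [Algebra R K] {n ℓ : ℕ}
  {κ : ℝ} {ϑ : Fin ℓ → ℝ} {q : R} {Q : Fin ℓ → R} {X : Fin n → K}
  {x₀ : Fin n → ℝ} {h₀ : Generic κ ϑ x₀}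

theorem coef_mul_of_or {x y z : Fin n → ℝ}
    (hg : ∀ i j, (x i < x j + κ ↔ y i < y j + κ) ∨ (y i < y j + κ ↔ z i < z j + κ))
    (hr : ∀ i t, (x i < ϑ t ↔ y i < ϑ t) ∨ (y i < ϑ t ↔ z i < ϑ t)) (ξ : Fin n → K) :
    coef κ ϑ q Q x y ξ * coef κ ϑ q Q y z ξ = coef κ ϑ q Q x z ξ := by
  have aux : ∀ (p : K) (a b c : Prop) (_ : (a ↔ b) ∨ (b ↔ c)) [Decidable a] [Decidable b]
      [Decidable c],
      (if a ∧ ¬ b then p else 1) * (if b ∧ ¬ c then p else 1) = if a ∧ ¬ c then p else 1 := by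
    intro p a b c h _ _ _
    by_cases a <;> by_cases b <;> by_cases c <;> simp_all
  have aux' : ∀ (p : K) (a b c : Prop) (_ : (a ↔ b) ∨ (b ↔ c)) [Decidable a] [Decidable b]
      [Decidable c],
      (if ¬ a ∧ b then p else 1) * (if ¬ b ∧ c then p else 1) = if ¬ a ∧ c then p else 1 := by
    intro p a b c h _ _ _
    by_cases a <;> by_cases b <;> by_cases c <;> simp_all
  unfold coef
  rw [mul_mul_mul_comm, ← Finset.prod_mul_distrib, ← Finset.prod_mul_distrib]
  congr 1
  · refine Finset.prod_congr rfl fun i _ => ?_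
    rw [← Finset.prod_mul_distrib]
    exact Finset.prod_congr rfl fun j _ => aux _ _ _ _ (hg i j)
  · refine Finset.prod_congr rfl fun i _ => ?_
    rw [← Finset.prod_mul_distrib]
    exact Finset.prod_congr rfl fun t _ => aux' _ _ _ _ (hr i t)

/-- An induction principle for minimal galleries without crossings of strands. -/
theorem Gal.induction_of_lt_iff (hκ : κ ≠ 0)
    {P : ∀ y : Fin n → ℝ, AffineWF κ ϑ q Q n → Generic κ ϑ y → Prop}
    (nil : P x₀ (affineIdem q Q h₀) h₀)
    (free : ∀ {y z a} (h : IsSlice κ ϑ y z), Sim κ ϑ y z → P y a h.bottom →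
      P z (sl q Q h * a) h.top)
    (cross : ∀ {y z a c} (h : Step κ ϑ y z c), (∀ p, c ≠ .strands p) → c ∈ crossings κ ϑ x₀ z →
      P y a h.bottom → P z (sl q Q h.isSlice * a) h.top)
    {N : ℕ} {y : Fin n → ℝ} {a : AffineWF κ ϑ q Q n} (h : Gal q Q h₀ N y a)
    (hN : ((arr n hκ ϑ).sep x₀ y).card = N) (hlt : ∀ i j, x₀ i < x₀ j ↔ y i < y j) :
    P y a h.generic := by
  induction h with
  | nil => exact nil
  | free h hc ha ih =>
    have hs := sim_of_crossings_eq_empty h.bottom h.top hc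
    refine free h hs (ih ?_ fun i j => (hlt i j).trans (hs.strands i j).symm)
    have := crossings_eq_of_empty_right hκ h₀ h.bottom h.top hc
    rw [crossings_eq hκ, crossings_eq hκ, Finset.coe_inj] at this
    rw [← this, hN]
  | @cross N y z a c h hc ha ih =>
    have hle := ha.card_le hκ
    rcases card_sep_of_singleton hκ h₀ h.top h.bottom hc with h1 | h1
    · have hmem := h1.1
      rw [← Finset.mem_coe, ← crossings_eq hκ] at hmem
      have hst : ∀ p, c ≠ Crossing.strands p := fun p hp => by
        rw [hp] at hmem
        induction p with
        | _ i j => exact (strands_notMem_iff h₀ h.top i j).mpr (hlt i j) hmem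
      have step : Step κ ϑ y z c := ⟨h.bottom, h.top, hc⟩
      exact cross step hst hmem (ih (by omega) fun i j =>
        (hlt i j).trans ((step.strands i j).mpr (hst _)).symm)
    · omega

/-- No divided differences occur, and in a minimal gallery each order relation changes at most once,
so the factors combine into one that depends only on the end points. -/
theorem Gal.rep_eq (hκ : κ ≠ 0) (hX : Function.Injective X) (hX0 : ∀ i, X i ≠ 0) {N : ℕ}
    {y : Fin n → ℝ} {a : AffineWF κ ϑ q Q n} (h : Gal q Q h₀ N y a)
    (hN : ((arr n hκ ϑ).sep x₀ y).card = N) (hlt : ∀ i j, x₀ i < x₀ j ↔ y i < y j)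
    (f : (Fin n → ℝ) → K) : rep κ ϑ q Q X hκ hX hX0 a f =
      extendAt R y (mulOp R X (coef κ ϑ q Q x₀ y) (restrictAt R x₀ f)) := by
  refine Gal.induction_of_lt_iff hκ (P := fun y a _ => rep κ ϑ q Q X hκ hX hX0 a f =
    extendAt R y (mulOp R X (coef κ ϑ q Q x₀ y) (restrictAt R x₀ f))) ?_ ?_ ?_ h hN hlt
  · rw [rep_idem, show coef κ ϑ q Q x₀ x₀ = fun _ => (1 : K) from
      funext fun ξ => coef_eq_one (.refl x₀) ξ, mulOp_one]
  · intro y z a h hs ih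
    rw [rep_mul, ih, rep_sl, restrictAt_extendAt R h.bottom.strand_strand, sliceOp_of_sim hs,
      coef_congr (.refl x₀) hs.toSameSides]
  · intro y z a c h hst hmem ih
    rw [rep_mul, ih, rep_sl, restrictAt_extendAt R h.bottom.strand_strand, h.sliceOp_eq hst,
      mulOp_mul]
    congr 3
    funext ξ
    rw [mul_comm]
    refine coef_mul_of_or (fun i j => ?_) (fun i t => ?_) ξ
    · by_cases hc : c = .ghost i j
      · rw [hc] at hmem
        have h1 := (ghost_notMem_iff h₀ h.top i j).not.mp (not_not.mpr hmem)
        have h2 := (h.ghost i j).not.mpr (not_not.mpr hc)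
        tauto
      · exact Or.inr ((h.ghost i j).mpr hc)
    · by_cases hc : c = .red i (ϑ t)
      · rw [hc] at hmem
        have h1 := (red_notMem_iff h₀ h.top i t).not.mp (not_not.mpr hmem)
        have h2 := (h.red i t).not.mpr (not_not.mpr hc)
        tauto
      · exact Or.inr ((h.red i t).mpr hc)

/-- Squares are obstructed only by crossings of strands, so here they slide through without error
terms. -/
theorem Gal.sq_mul (hκ : κ ≠ 0) {N : ℕ} {y : Fin n → ℝ} {a : AffineWF κ ϑ q Q n}
    (h : Gal q Q h₀ N y a) (hN : ((arr n hκ ϑ).sep x₀ y).card = N)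
    (hlt : ∀ i j, x₀ i < x₀ j ↔ y i < y j) (i : Fin n) (m : ℤ) :
    sq q Q h.generic i m * a = a * sq q Q h₀ i m := by
  refine Gal.induction_of_lt_iff hκ (P := fun y a hy => sq q Q hy i m * a = a * sq q Q h₀ i m)
    ?_ ?_ ?_ h hN hlt
  · rw [sq_mul_idem, idem_mul_sq]
  · intro y z a h hs ih
    rw [← mul_assoc, sq_slide h i m, mul_assoc, ih, mul_assoc]
    rw [hs.crossings_eq_empty h.bottom h.top]
    simp
  · intro y z a c h hst _ ih
    rw [← mul_assoc, sq_slide h.isSlice i m, mul_assoc, ih, mul_assoc]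
    rw [h.crossings_eq]
    intro j hj
    exact hst _ (Set.mem_singleton_iff.mp hj).symm

/-- Relabelling a minimal gallery gives a gallery with as many crossings, so the distance cannot
grow, and the inverse relabelling gives the converse. Galleries live in an algebra, and one over the
integers serves here. -/
theorem card_sep_comp (hκ : κ ≠ 0) {x y : Fin n → ℝ} (hx : Generic κ ϑ x) (hy : Generic κ ϑ y)
    (σ : Equiv.Perm (Fin n)) :
    ((arr n hκ ϑ).sep (x ∘ σ) (y ∘ σ)).card = ((arr n hκ ϑ).sep x y).card := by
  have key : ∀ {x y : Fin n → ℝ} (_ : Generic κ ϑ x) (_ : Generic κ ϑ y) (σ : Equiv.Perm (Fin n)),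
      ((arr n hκ ϑ).sep (x ∘ σ) (y ∘ σ)).card ≤ ((arr n hκ ϑ).sep x y).card := by
    intro x y hx hy σ
    obtain ⟨g, hg⟩ := exists_gal (q := (1 : ℤ)) (Q := fun _ => 1) (h₀ := hx) hκ _ y hy rfl
    exact (hg.comp σ).card_le hκ
  refine le_antisymm (key hx hy σ) ?_
  have h1 := key (hx.comp σ) (hy.comp σ) σ⁻¹
  have h2 : ∀ z : Fin n → ℝ, (z ∘ σ) ∘ (σ⁻¹ : Equiv.Perm (Fin n)) = z := fun z => by
    rw [Function.comp_assoc, ← Equiv.Perm.coe_mul, mul_inv_cancel, Equiv.Perm.coe_one,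
      Function.comp_id]
  rwa [h2, h2] at h1

theorem card_sep_add_of_subset (hκ : κ ≠ 0) {x y z : Fin n → ℝ} (hx : Generic κ ϑ x)
    (hy : Generic κ ϑ y) (hz : Generic κ ϑ z) (h : crossings κ ϑ x z ⊆ crossings κ ϑ x y) :
    ((arr n hκ ϑ).sep x z).card + ((arr n hκ ϑ).sep z y).card = ((arr n hκ ϑ).sep x y).card := by
  refine card_sep_add hκ hx hy hz fun c hc => ?_
  rw [← Finset.mem_coe, ← crossings_eq hκ] at hc ⊢
  have h1 := @h c
  have h2 := mem_crossings_iff_not (c := c) hx hy hz hκ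
  rw [crossings_comm z y] at hc
  tauto

theorem crossings_subset {x y z : Fin n → ℝ} (hx : Generic κ ϑ x)
    (hy : Generic κ ϑ y) (hz : Generic κ ϑ z)
    (h₁ : ∀ i j, i ≠ j → (x i < x j ↔ y i < y j) → (x i < x j ↔ z i < z j))
    (h₂ : ∀ i j, i ≠ j → (x i < x j + κ ↔ y i < y j + κ) → (x i < x j + κ ↔ z i < z j + κ))
    (h₃ : ∀ i t, (x i < ϑ t ↔ y i < ϑ t) → (x i < ϑ t ↔ z i < ϑ t)) :
    crossings κ ϑ x z ⊆ crossings κ ϑ x y := by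
  intro c hc
  by_contra hcon
  cases c with
  | strands p =>
    induction p with
    | _ i j =>
      rw [strands_notMem_iff hx hy] at hcon
      refine (strands_notMem_iff hx hz i j).mpr ?_ hc
      rcases eq_or_ne i j with rfl | hij
      · simp
      · exact h₁ i j hij hcon
  | ghost i j =>
    rw [ghost_notMem_iff hx hy] at hcon
    refine (ghost_notMem_iff hx hz i j).mpr ?_ hc
    rcases eq_or_ne i j with rfl | hij
    · simp
    · exact h₂ i j hij hcon
  | red i a =>
    obtain ⟨t, rfl⟩ := exists_red_of_mem hc
    rw [red_notMem_iff hx hy] at hcon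
    exact (red_notMem_iff hx hz i t).mpr (h₃ i t hcon) hc

end

/-! ### Moving the first strand to the far left -/

section

variable {n ℓ : ℕ} {κ s : ℝ} {ϑ : Fin ℓ → ℝ}

/-- The first strand is moved to the left of all red lines. -/
def pulled (hn : 0 < n) (s : ℝ) : Fin n → ℝ := Function.update (spaced n s) ⟨0, hn⟩ (-s)

variable (hn : 0 < n)

theorem pulled_zero : pulled hn s ⟨0, hn⟩ = -s := Function.update_self ..

theorem pulled_of_ne {i : Fin n} (h : i ≠ ⟨0, hn⟩) : pulled hn s i = spaced n s i :=
  Function.update_of_ne h ..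

theorem two_mul_le_spaced (hs : 0 ≤ s) {i : Fin n} (h : i ≠ ⟨0, hn⟩) : s + s ≤ spaced n s i := by
  have h1 : (⟨0, hn⟩ : Fin n) < i := lt_of_le_of_ne (Nat.zero_le _) h.symm
  have h2 := spaced_add_le hs h1
  have h3 := le_spaced hs (⟨0, hn⟩ : Fin n)
  linarith

theorem pulled_lt_iff (hs : |κ| < s) (i j : Fin n) :
    spaced n s i < spaced n s j ↔ pulled hn s i < pulled hn s j := by
  have h0 := (abs_nonneg κ).trans hs.le
  have h1 := (abs_nonneg κ).trans_lt hs
  by_cases hi : i = ⟨0, hn⟩ <;> by_cases hj : j = ⟨0, hn⟩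
  · subst hi; subst hj; simp
  · have := two_mul_le_spaced hn h0 hj
    rw [pulled_of_ne hn hj, hi, pulled_zero]
    have e : spaced n s ⟨0, hn⟩ = s := by simp [spaced]
    exact iff_of_true (by linarith) (by linarith)
  · have := two_mul_le_spaced hn h0 hi
    rw [pulled_of_ne hn hi, hj, pulled_zero]
    have e : spaced n s ⟨0, hn⟩ = s := by simp [spaced]
    exact iff_of_false (by linarith) (by linarith)
  · rw [pulled_of_ne hn hi, pulled_of_ne hn hj]

theorem pulled_lt_add_iff (hs : |κ| < s) (i j : Fin n) :
    spaced n s i < spaced n s j + κ ↔ pulled hn s i < pulled hn s j + κ := by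
  have h0 := (abs_nonneg κ).trans hs.le
  have h1 := neg_abs_le κ
  have h2 := le_abs_self κ
  have e : spaced n s ⟨0, hn⟩ = s := by simp [spaced]
  by_cases hi : i = ⟨0, hn⟩ <;> by_cases hj : j = ⟨0, hn⟩
  · subst hi; subst hj; simp
  · have := two_mul_le_spaced hn h0 hj
    rw [pulled_of_ne hn hj, hi, pulled_zero]
    exact iff_of_true (by linarith) (by linarith)
  · have := two_mul_le_spaced hn h0 hi
    rw [pulled_of_ne hn hi, hj, pulled_zero]
    exact iff_of_false (by linarith) (by linarith)
  · rw [pulled_of_ne hn hi, pulled_of_ne hn hj]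

theorem spaced_not_lt (hϑ : ∀ t, |ϑ t| + |κ| < s) (i : Fin n) (t : Fin ℓ) : ¬ spaced n s i < ϑ t := by
  have h1 := hϑ t
  have h2 := abs_nonneg (ϑ t)
  have h3 := abs_nonneg κ
  have h4 := le_abs_self (ϑ t)
  have h5 := le_spaced (by linarith : 0 ≤ s) i
  linarith

theorem pulled_lt_red (hϑ : ∀ t, |ϑ t| + |κ| < s) (i : Fin n) (t : Fin ℓ) :
    pulled hn s i < ϑ t ↔ i = ⟨0, hn⟩ := by
  by_cases hi : i = ⟨0, hn⟩
  · rw [hi, pulled_zero]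
    have h1 := hϑ t
    have h3 := abs_nonneg κ
    have h4 := neg_abs_le (ϑ t)
    exact iff_of_true (by linarith) rfl
  · rw [pulled_of_ne hn hi]
    exact iff_of_false (spaced_not_lt hϑ i t) hi

theorem generic_pulled (hκ : κ ≠ 0) (hs : |κ| < s) (hϑ : ∀ t, |ϑ t| + |κ| < s) :
    Generic κ ϑ (pulled hn s) := by
  have hg := generic_spaced n hκ hs hϑ
  have h0 := (abs_nonneg κ).trans hs.le
  have h1 := neg_abs_le κ
  have h2 := le_abs_self κ
  refine ⟨fun i j hij => ?_, fun i j => ?_, fun i t => ?_, fun i t => ?_⟩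
  · by_contra hne
    rcases (hg.strand_strand.ne hne).lt_or_gt with h | h
    · exact ((pulled_lt_iff hn hs i j).mp h).ne hij
    · exact ((pulled_lt_iff hn hs j i).mp h).ne hij.symm
  · by_cases hi : i = ⟨0, hn⟩ <;> by_cases hj : j = ⟨0, hn⟩
    · rw [hi, hj]
      intro h
      exact hκ (by linarith)
    · have := two_mul_le_spaced hn h0 hj
      rw [pulled_of_ne hn hj, hi, pulled_zero]
      intro h
      linarith
    · have := two_mul_le_spaced hn h0 hi
      rw [pulled_of_ne hn hi, hj, pulled_zero]
      intro h
      linarith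
    · rw [pulled_of_ne hn hi, pulled_of_ne hn hj]
      exact hg.strand_ghost i j
  · by_cases hi : i = ⟨0, hn⟩
    · exact ((pulled_lt_red hn hϑ i t).mpr hi).ne
    · rw [pulled_of_ne hn hi]
      exact hg.strand_red i t
  · by_cases hi : i = ⟨0, hn⟩
    · rw [hi, pulled_zero]
      have h3 := hϑ t
      have h4 := neg_abs_le (ϑ t)
      intro h
      linarith
    · rw [pulled_of_ne hn hi]
      exact hg.ghost_red i t

theorem isUnsteady_pulled (hs : |κ| < s) (hϑ : ∀ t, |ϑ t| + |κ| < s) :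
    IsUnsteady κ ϑ (pulled hn s) := by
  refine ⟨{⟨0, hn⟩}, Set.singleton_nonempty _, ?_, ?_⟩
  · rintro _ rfl j hj
    have h0 := (abs_nonneg κ).trans hs.le
    have := two_mul_le_spaced hn h0 hj
    rw [pulled_zero, pulled_of_ne hn hj]
    linarith
  · rintro _ rfl t
    exact (pulled_lt_red hn hϑ _ t).mpr rfl

end

/-! ### Polynomials in one square -/

theorem aeval_mulOp {R : Type*} [CommRing R] {K : Type*} [Field K] [Algebra R K] {n : ℕ}
    {X : Fin n → K} {f : Module.End K (Equiv.Perm (Fin n) → K)} {m : (Fin n → K) → K}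
    (hf : ∀ F, f F = mulOp R X m F) (P : R[X]) (F : Equiv.Perm (Fin n) → K) :
    Polynomial.aeval f P F = mulOp R X (fun ξ => Polynomial.aeval (m ξ) P) F := by
  have hpow : ∀ k : ℕ, ∀ F, (f ^ k) F = mulOp R X (fun ξ => m ξ ^ k) F := by
    intro k
    induction k with
    | zero => intro F; simp only [pow_zero, mulOp_one, Module.End.one_apply]
    | succ k ih =>
      intro F
      rw [pow_succ, Module.End.mul_apply, hf, ih, mulOp_mul]
      simp only [pow_succ]
  induction P using Polynomial.induction_on' with
  | add p p' hp hp' =>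
    rw [map_add, LinearMap.add_apply, hp, hp']
    funext σ
    simp only [Pi.add_apply, mulOp_apply, map_add, add_mul]
  | monomial k r =>
    simp only [Polynomial.aeval_monomial]
    rw [← Algebra.smul_def, LinearMap.smul_apply, hpow]
    funext σ
    simp only [Pi.smul_apply, mulOp_apply, Algebra.smul_def, mul_assoc]

theorem IsUnsteady.comp {n ℓ : ℕ} {κ : ℝ} {ϑ : Fin ℓ → ℝ} {y : Fin n → ℝ} (h : IsUnsteady κ ϑ y)
    (σ : Equiv.Perm (Fin n)) : IsUnsteady κ ϑ (y ∘ σ) := by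
  obtain ⟨S, ⟨i, hi⟩, hgap, hred⟩ := h
  exact ⟨σ ⁻¹' S, ⟨σ.symm i, by simpa using hi⟩, fun i hi j hj => hgap _ hi _ hj,
    fun i hi t => hred _ hi t⟩

/-! ### The cyclotomic element and unsteady configurations -/

section

variable {R : Type*} [CommRing R] [IsDomain R] {n ℓ : ℕ} {κ s : ℝ} {ϑ : Fin ℓ → ℝ} {q : R}
  {Q : Fin ℓ → R} (hn : 0 < n) (hκ : κ ≠ 0) (hs : |κ| < s) (hϑ : ∀ t, |ϑ t| + |κ| < s)

variable (q) in
/-- The element of the affine Hecke algebra that is set to zero in the cyclotomic quotient. -/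
def cyclotomicEl (Q : Fin ℓ → R) : AffineHecke q n :=
  Polynomial.aeval (hX q ⟨0, hn⟩) (∏ t, (Polynomial.X - Polynomial.C (Q t)))

variable (q Q) in
/-- The diagram pulling the first strand to the far left. -/
def pullEl : AffineWF κ ϑ q Q n :=
  (exists_gal (q := q) (Q := Q) (h₀ := generic_spaced n hκ hs hϑ) hκ _ _
    (generic_pulled hn hκ hs hϑ) rfl).choose

variable (q Q) in
/-- The diagram pushing the first strand back from the far left. -/
def pushEl : AffineWF κ ϑ q Q n :=
  (exists_gal (q := q) (Q := Q) (h₀ := generic_pulled hn hκ hs hϑ) hκ _ _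
    (generic_spaced n hκ hs hϑ) rfl).choose

theorem pullEl_gal : Gal q Q (generic_spaced n hκ hs hϑ)
    ((arr n hκ ϑ).sep (spaced n s) (pulled hn s)).card (pulled hn s) (pullEl q Q hn hκ hs hϑ) :=
  (exists_gal (q := q) (Q := Q) (h₀ := generic_spaced n hκ hs hϑ) hκ _ _
    (generic_pulled hn hκ hs hϑ) rfl).choose_spec

theorem pushEl_gal : Gal q Q (generic_pulled hn hκ hs hϑ)
    ((arr n hκ ϑ).sep (pulled hn s) (spaced n s)).card (spaced n s) (pushEl q Q hn hκ hs hϑ) :=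
  (exists_gal (q := q) (Q := Q) (h₀ := generic_pulled hn hκ hs hϑ) hκ _ _
    (generic_spaced n hκ hs hϑ) rfl).choose_spec

/-- The first strand passes every red line from right to left, the direction with a factor, and no
strand passes a ghost. -/
theorem coef_pull (hs : |κ| < s) (hϑ : ∀ t, |ϑ t| + |κ| < s) {K : Type*} [Field K] [Algebra R K]
    (ξ : Fin n → K) :
    coef κ ϑ q Q (spaced n s) (pulled hn s) ξ =
      Polynomial.aeval (ξ ⟨0, hn⟩) (∏ t, (Polynomial.X - Polynomial.C (Q t))) := by
  unfold coef
  rw [Finset.prod_eq_one fun i _ => Finset.prod_eq_one fun j _ => ?_, one_mul,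
    Finset.prod_eq_single_of_mem ⟨0, hn⟩ (Finset.mem_univ _) fun i _ hi =>
      Finset.prod_eq_one fun t _ => ?_, map_prod]
  · refine Finset.prod_congr rfl fun t _ => ?_
    rw [if_pos ⟨spaced_not_lt hϑ _ t, (pulled_lt_red hn hϑ _ t).mpr rfl⟩]
    simp
  · rw [if_neg fun h => hi ((pulled_lt_red hn hϑ i t).mp h.2)]
  · rw [if_neg fun h => h.2 ((pulled_lt_add_iff hn hs i j).mp h.1)]

/-- On the way back the red lines are passed in the direction without a factor. -/
theorem coef_push (hs : |κ| < s) (hϑ : ∀ t, |ϑ t| + |κ| < s) {K : Type*} [Field K] [Algebra R K]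
    (ξ : Fin n → K) :
    coef κ ϑ q Q (pulled hn s) (spaced n s) ξ = 1 := by
  unfold coef
  rw [Finset.prod_eq_one fun i _ => Finset.prod_eq_one fun j _ => ?_, one_mul,
    Finset.prod_eq_one fun i _ => Finset.prod_eq_one fun t _ => ?_]
  · rw [if_neg fun h => spaced_not_lt hϑ i t h.2]
  · rw [if_neg fun h => h.2 ((pulled_lt_add_iff hn hs i j).mpr h.1)]

/-- Both sides act by multiplication with `∏ (ξ - Q t)` in the first variable, and the corner acts
faithfully. -/
theorem heckeToCorner_cyclotomicEl :
    (heckeToCorner hκ hs hϑ q Q (cyclotomicEl q hn Q)).val =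
      pushEl q Q hn hκ hs hϑ * pullEl q Q hn hκ hs hϑ := by
  have e₁ := (pushEl_gal (q := q) (Q := Q) hn hκ hs hϑ).diag.idem_mul (generic_spaced n hκ hs hϑ)
  have e₂ := (pullEl_gal (q := q) (Q := Q) hn hκ hs hϑ).mul_idem
  have key : heckeToCorner hκ hs hϑ q Q (cyclotomicEl q hn Q) =
      .mk (pushEl q Q hn hκ hs hϑ * pullEl q Q hn hκ hs hϑ) (by rw [← mul_assoc, e₁])
        (by rw [mul_assoc, e₂]) := by
    refine spacedRep_injective hκ hs hϑ (LinearMap.ext fun F => ?_)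
    rw [cyclotomicEl, ← Polynomial.aeval_algHom_apply, heckeToCorner_hX,
      ← Polynomial.aeval_algHom_apply, aeval_mulOp (K := RatField R n) (X := ratVar R) (m := fun ξ => ξ ⟨0, hn⟩)
        (spacedRep_x hκ hs hϑ _), spacedRep,
      cornerRep_apply, AffineCorner.val_mk, rep_mul,
      (pullEl_gal hn hκ hs hϑ).rep_eq hκ _ _ rfl (pulled_lt_iff hn hs),
      (pushEl_gal hn hκ hs hϑ).rep_eq hκ _ _ rfl fun i j => (pulled_lt_iff hn hs i j).symm,
      restrictAt_extendAt R (generic_spaced n hκ hs hϑ).strand_strand,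
      restrictAt_extendAt R (generic_spaced n hκ hs hϑ).strand_strand,
      restrictAt_extendAt R (generic_pulled hn hκ hs hϑ).strand_strand, mulOp_mul]
    congr 2
    funext ξ
    rw [coef_push hn hs hϑ, one_mul, coef_pull hn hs hϑ]
  rw [key, AffineCorner.val_mk]

/-- Whatever ends in the configuration with the first strand on the far left, ends with pushing it
back. -/
theorem idem_mul_pulled (a : AffineWF κ ϑ q Q n) :
    ∃ b : AffineCorner q Q (generic_spaced n hκ hs hϑ),
      affineIdem q Q (generic_spaced n hκ hs hϑ) * (a * affineIdem q Q (generic_pulled hn hκ hs hϑ)) =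
        b.val * pushEl q Q hn hκ hs hϑ := by
  have hx := generic_spaced n hκ hs hϑ
  have hxm := generic_pulled hn hκ hs hϑ
  have hgal := pushEl_gal (q := q) (Q := Q) hn hκ hs hϑ
  let V : Submodule R (AffineWF κ ϑ q Q n) := LinearMap.range
    ((LinearMap.mulRight R (pushEl q Q hn hκ hs hϑ)).comp
      (AffineCorner.val : AffineCorner q Q hx →ₗ[R] _))
  have hmem := corner_mem_of_gal (q := q) (Q := Q) (h₀ := hxm) hκ hx (V := V) ?_ ?_ a
  · obtain ⟨b, hb⟩ := hmem
    exact ⟨b, hb.symm⟩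
  · rintro _ ⟨b, rfl⟩ i m
    refine ⟨b * sqLaurent q Q hx (Laurent.var R i m), ?_⟩
    change (b * _).val * pushEl q Q hn hκ hs hϑ = b.val * pushEl q Q hn hκ hs hϑ * _
    rw [AffineCorner.val_mul, sqLaurent_var, mul_assoc, mul_assoc,
      hgal.sq_mul hκ rfl fun i j => (pulled_lt_iff hn hs i j).symm]
  · intro σ
    obtain ⟨g, hg⟩ := exists_gal (q := q) (Q := Q) (h₀ := hx) hκ _ _ (hx.comp σ) rfl
    refine ⟨_, ⟨.mk g (by rw [← affineIdem_comp hx σ]; exact hg.diag.idem_mul _) hg.mul_idem, rfl⟩, ?_⟩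
    -- Every diagram from the pulled configuration to a relabelling of `spaced n s` must bring the
    -- first strand back over all red lines. Doing this at the start costs no additional crossing.
    rw [← card_sep_add_of_subset hκ hxm (hx.comp σ) hx]
    · exact hgal.trans hg
    · refine crossings_subset hxm (hx.comp σ) hx (fun i j _ _ => (pulled_lt_iff hn hs i j).symm)
        (fun i j _ _ => (pulled_lt_add_iff hn hs i j).symm) fun i t h => ?_
      rw [h]
      exact iff_of_false (spaced_not_lt hϑ _ t) (spaced_not_lt hϑ i t)

/-- An unsteady configuration can be reached through the configuration with the first strand on the
far left, without unnecessary crossings. -/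
theorem exists_gal_unsteady {y : Fin n → ℝ} (hy : Generic κ ϑ y) (hu : IsUnsteady κ ϑ y) :
    ∃ (c : AffineWF κ ϑ q Q n) (b : AffineCorner q Q (generic_spaced n hκ hs hϑ)),
      Gal q Q (generic_spaced n hκ hs hϑ) ((arr n hκ ϑ).sep (spaced n s) y).card y
        (c * (pullEl q Q hn hκ hs hϑ * b.val)) := by
  classical
  have hx := generic_spaced n hκ hs hϑ
  have hxm := generic_pulled hn hκ hs hϑ
  have h0 := (abs_nonneg κ).trans hs.le
  have hk := neg_abs_le κ
  have hk' := le_abs_self κ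
  obtain ⟨S, hS, hgap, hred⟩ := hu
  -- `m` is the strand of the left-hand group that starts furthest to the left; all strands that
  -- start to the left of it belong to the right-hand group.
  obtain ⟨m, hmS, hmin⟩ := S.toFinite.exists_minimal hS
  replace hmin : ∀ k, k < m → k ∉ S := fun k hk hkS => (hmin hkS hk.le).not_gt hk
  -- This cycle brings `m` to the first place and preserves the order of the other strands.
  set ρ := Fin.cycleRange m with hρ
  have hρm : ρ m = ⟨0, hn⟩ := Fin.ext (by simp [hρ, Fin.coe_cycleRange_of_le le_rfl])
  have hord : ∀ i j, i ≠ m → j ≠ m → (i < j ↔ ρ i < ρ j) := by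
    have hval : ∀ i, i ≠ m → (ρ i : ℕ) = if i < m then (i : ℕ) + 1 else i := fun i hi => by
      split_ifs with h
      · exact Fin.coe_cycleRange_of_lt h
      · rw [hρ, Fin.cycleRange_of_gt (lt_of_le_of_ne (not_lt.mp h) hi.symm)]
    intro i j hi hj
    rw [Fin.lt_def, Fin.lt_def, hval i hi, hval j hj]
    split_ifs <;> omega
  have hm : ∀ i, i ≠ m → ρ m < ρ i := fun i hi => by
    rw [hρm]
    refine lt_of_le_of_ne (Nat.zero_le _) fun h => hi (ρ.injective ?_)
    rw [hρm, h]
  have lt_iff : ∀ i j : Fin n, spaced n s i < spaced n s j ↔ i < j := fun i j => by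
    constructor
    · intro h
      by_contra hcon
      rcases (not_lt.mp hcon).eq_or_lt with rfl | h'
      · exact lt_irrefl _ h
      · have := spaced_add_le h0 h'
        linarith
    · intro h
      have := spaced_add_le h0 h
      linarith [(abs_nonneg κ).trans_lt hs]
  have lt_add_iff : ∀ i j : Fin n, i ≠ j → (spaced n s i < spaced n s j + κ ↔ i < j) := fun i j hij => by
    rcases hij.lt_or_gt with h | h
    · have := spaced_add_le h0 h
      exact iff_of_true (by linarith) h
    · have := spaced_add_le h0 h
      exact iff_of_false (by linarith) h.asymm
  -- Bringing `m` to the first place makes it pass only strands that start to its left. These end to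
  -- its right by more than `|κ|`, so the same crossings of strands and ghosts are needed to reach
  -- `y`.
  have hsub₁ : crossings κ ϑ (spaced n s) (spaced n s ∘ ρ) ⊆ crossings κ ϑ (spaced n s) y := by
    refine crossings_subset hx hy (hx.comp ρ) (fun i j hij h => ?_) (fun i j hij h => ?_)
      fun i t h => iff_of_false (spaced_not_lt hϑ _ t) (spaced_not_lt hϑ _ t)
    · rw [Function.comp_apply, Function.comp_apply, lt_iff, lt_iff]
      rw [lt_iff] at h
      rcases eq_or_ne i m with rfl | hi
      · refine iff_of_true (lt_of_not_ge fun hji => ?_) (hm j hij.symm)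
        have hlt := lt_of_le_of_ne hji hij.symm
        have := hgap i hmS j (hmin j hlt)
        exact hlt.asymm (h.mpr (by linarith [abs_nonneg κ]))
      rcases eq_or_ne j m with rfl | hj
      · refine iff_of_false (fun hlt => ?_) (hm i hij).asymm
        have := hgap j hmS i (hmin i hlt)
        linarith [h.mp hlt, abs_nonneg κ]
      · exact hord i j hi hj
    · rw [Function.comp_apply, Function.comp_apply, lt_add_iff _ _ hij,
        lt_add_iff _ _ (ρ.injective.ne hij)]
      rw [lt_add_iff _ _ hij] at h
      rcases eq_or_ne i m with rfl | hi
      · refine iff_of_true (lt_of_not_ge fun hji => ?_) (hm j hij.symm)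
        have hlt := lt_of_le_of_ne hji hij.symm
        have := hgap i hmS j (hmin j hlt)
        exact hlt.asymm (h.mpr (by linarith))
      rcases eq_or_ne j m with rfl | hj
      · refine iff_of_false (fun hlt => ?_) (hm i hij).asymm
        have := hgap j hmS i (hmin i hlt)
        linarith [h.mp hlt]
      · exact hord i j hi hj
  -- At `y` the strand `m` is to the left of all red lines, so its passages over them are needed
  -- too.
  have hsub₂ : crossings κ ϑ (spaced n s ∘ ρ) (pulled hn s ∘ ρ) ⊆
      crossings κ ϑ (spaced n s ∘ ρ) y := by
    refine crossings_subset (hx.comp ρ) hy (hxm.comp ρ) (fun i j _ _ => pulled_lt_iff hn hs _ _)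
      (fun i j _ _ => pulled_lt_add_iff hn hs _ _) fun i t h => ?_
    refine iff_of_false (spaced_not_lt hϑ _ t) fun h' => ?_
    have hi : i = m := ρ.injective (by rw [hρm]; exact (pulled_lt_red hn hϑ _ t).mp h')
    subst hi
    exact spaced_not_lt hϑ _ t (h.mpr (hred i hmS t))
  obtain ⟨b, hb⟩ := exists_gal (q := q) (Q := Q) (h₀ := hx) hκ _ _ (hx.comp ρ) rfl
  obtain ⟨c, hc⟩ := exists_gal (q := q) (Q := Q) (h₀ := hxm.comp ρ) hκ _ _ hy rfl
  have hpull := (pullEl_gal (q := q) (Q := Q) hn hκ hs hϑ).comp ρ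
  refine ⟨c, .mk b (by rw [← affineIdem_comp hx ρ]; exact hb.diag.idem_mul _) hb.mul_idem, ?_⟩
  -- Both intermediate configurations lie on a geodesic, so the concatenation of the three minimal
  -- galleries is minimal.
  rw [AffineCorner.val_mk, ← card_sep_add_of_subset hκ hx hy (hx.comp ρ) hsub₁,
    ← card_sep_add_of_subset hκ (hx.comp ρ) hy (hxm.comp ρ) hsub₂, card_sep_comp hκ hx hxm ρ,
    ← add_assoc]
  exact (hb.trans hpull).trans hc

theorem idem_mul_unsteady {y : Fin n → ℝ} (hy : Generic κ ϑ y) (hu : IsUnsteady κ ϑ y)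
    (a : AffineWF κ ϑ q Q n) :
    affineIdem q Q hy * (a * affineIdem q Q (generic_spaced n hκ hs hϑ)) ∈ Submodule.span R
      {z | ∃ (c : AffineWF κ ϑ q Q n) (b : AffineCorner q Q (generic_spaced n hκ hs hϑ)),
        z = c * (pullEl q Q hn hκ hs hϑ * b.val)} := by
  have hx := generic_spaced n hκ hs hϑ
  refine corner_mem_of_gal (h₀ := hx) hκ hy (fun z hz i m => ?_) (fun σ => ?_) a
  · induction hz using Submodule.span_induction with
    | mem z hz =>
      obtain ⟨c, b, rfl⟩ := hz
      refine Submodule.subset_span ⟨c, b * sqLaurent q Q hx (Laurent.var R i m), ?_⟩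
      rw [AffineCorner.val_mul, sqLaurent_var, mul_assoc, mul_assoc]
    | zero => rw [zero_mul]; exact Submodule.zero_mem _
    | add z z' _ _ h h' => rw [add_mul]; exact Submodule.add_mem _ h h'
    | smul r z _ h => rw [smul_mul_assoc]; exact Submodule.smul_mem _ r h
  · obtain ⟨c, b, h⟩ := exists_gal_unsteady (q := q) (Q := Q) hn hκ hs hϑ (hy.comp σ) (hu.comp σ)
    exact ⟨_, Submodule.subset_span ⟨c, b, rfl⟩, h⟩

/-- What factors through an unsteady configuration lies in the ideal of the cyclotomic relation. -/
theorem mul_unsteady_mul {y : Fin n → ℝ} (hy : Generic κ ϑ y) (hu : IsUnsteady κ ϑ y)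
    (a b : AffineWF κ ϑ q Q n) :
    affineIdem q Q (generic_spaced n hκ hs hϑ) * a * affineIdem q Q hy * b *
      affineIdem q Q (generic_spaced n hκ hs hϑ) ∈ Submodule.span R
      {z | ∃ c d : AffineCorner q Q (generic_spaced n hκ hs hϑ),
        z = (c * heckeToCorner hκ hs hϑ q Q (cyclotomicEl q hn Q) * d).val} := by
  have h := idem_mul_unsteady (q := q) (Q := Q) hn hκ hs hϑ hy hu b
  have he : ∀ z, affineIdem q Q (generic_pulled hn hκ hs hϑ) * (pullEl q Q hn hκ hs hϑ * z) =
      pullEl q Q hn hκ hs hϑ * z := fun z => by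
    rw [← mul_assoc, (pullEl_gal hn hκ hs hϑ).diag.idem_mul]
  rw [mul_assoc, mul_assoc]
  generalize affineIdem q Q hy * (b * affineIdem q Q (generic_spaced n hκ hs hϑ)) = w at h
  induction h using Submodule.span_induction with
  | mem z hz =>
    obtain ⟨c, d, rfl⟩ := hz
    -- The part above the pull ends in a push by `idem_mul_pulled`, and push times pull is the
    -- cyclotomic element.
    obtain ⟨c', hc'⟩ := idem_mul_pulled (q := q) (Q := Q) hn hκ hs hϑ (a * c)
    refine Submodule.subset_span ⟨c', d, ?_⟩
    rw [AffineCorner.val_mul, AffineCorner.val_mul, heckeToCorner_cyclotomicEl, ← mul_assoc c'.val,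
      ← hc']
    simp only [mul_assoc, he]
  | zero => rw [mul_zero]; exact Submodule.zero_mem _
  | add z z' _ _ h h' => rw [mul_add]; exact Submodule.add_mem _ h h'
  | smul r z _ h => rw [mul_smul_comm]; exact Submodule.smul_mem _ r h

end

/-! ### The quotients -/

section

variable {R : Type*} [CommRing R] {n ℓ : ℕ} {κ : ℝ} {ϑ : Fin ℓ → ℝ} {q : R} {Q : Fin ℓ → R}
  {x : Fin n → ℝ} (h : Generic κ ϑ x)

/-- The quotient map on corners. -/
def cornerToWF :
    AffineCorner q Q h →ₐ[R] (isIdempotentElem_wfIdem q Q h).Corner where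
  toFun a := ⟨RingQuot.mkAlgHom R (SteadyRel κ ϑ q Q n) a.val,
    (Subsemigroup.mem_corner_iff (isIdempotentElem_wfIdem q Q h)).mpr
      ⟨by rw [wfIdem, ← map_mul, a.idem_mul], by rw [wfIdem, ← map_mul, a.mul_idem]⟩⟩
  map_one' := rfl
  map_mul' a b := Subtype.ext (map_mul _ a.val b.val)
  map_zero' := Subtype.ext (map_zero _)
  map_add' a b := Subtype.ext (map_add _ a.val b.val)
  commutes' r := Subtype.ext (map_smul (RingQuot.mkAlgHom R (SteadyRel κ ϑ q Q n)) r _)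

theorem cornerToWF_apply (a : AffineCorner q Q h) :
    (cornerToWF h a).1 = RingQuot.mkAlgHom R (SteadyRel κ ϑ q Q n) a.val := rfl

theorem cornerToWF_surjective : Function.Surjective (cornerToWF (q := q) (Q := Q) h) := by
  rintro ⟨w, hw⟩
  obtain ⟨a, rfl⟩ := RingQuot.mkAlgHom_surjective R (SteadyRel κ ϑ q Q n) w
  have hw' := (Subsemigroup.mem_corner_iff (isIdempotentElem_wfIdem q Q h)).mp hw
  refine ⟨.mk (affineIdem q Q h * a * affineIdem q Q h)
    (by simp only [← mul_assoc, affineIdem_mul_self]) (by simp only [mul_assoc, affineIdem_mul_self]),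
    Subtype.ext ?_⟩
  rw [cornerToWF_apply, AffineCorner.val_mk, map_mul, map_mul]
  change wfIdem q Q h * _ * wfIdem q Q h = _
  rw [hw'.1, hw'.2]

theorem mk_eq_zero_of_unsteady {y : Fin n → ℝ} (hy : Generic κ ϑ y) (hu : IsUnsteady κ ϑ y)
    (a b : AffineWF κ ϑ q Q n) :
    RingQuot.mkAlgHom R (SteadyRel κ ϑ q Q n) (a * affineIdem q Q hy * b) = 0 := by
  rw [map_mul, map_mul, RingQuot.mkAlgHom_rel R (SteadyRel.unsteady hy hu), map_zero, mul_zero,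
    zero_mul]

theorem mul_neg_mul {A : Type*} [Ring A] (a b c : A) : a * -b * c = -(a * b * c) := by
  rw [mul_neg, neg_mul]

/-- A subset that is closed under addition and negation, and contains `a e_B b` for all `a`, `b` and
all unsteady `B`, contains all elements that vanish in the type WF Hecke algebra. -/
theorem mem_of_mk_eq_zero (S : AddSubgroup (AffineWF κ ϑ q Q n))
    (hS : ∀ {y : Fin n → ℝ} (hy : Generic κ ϑ y), IsUnsteady κ ϑ y → ∀ a b,
      a * affineIdem q Q hy * b ∈ S)
    {a : AffineWF κ ϑ q Q n} (ha : RingQuot.mkAlgHom R (SteadyRel κ ϑ q Q n) a = 0) : a ∈ S := by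
  -- `T` is the two-sided ideal of all elements whose multiples on both sides stay in `S`. The
  -- quotient by it satisfies the steadiness relations, so it receives a map from the type WF Hecke
  -- algebra.
  let T : TwoSidedIdeal (AffineWF κ ϑ q Q n) := .mk' {w | ∀ a b, a * w * b ∈ S}
    (fun a b => by rw [mul_zero, zero_mul]; exact S.zero_mem)
    (fun hv hw a b => by rw [mul_add, add_mul]; exact S.add_mem (hv a b) (hw a b))
    (fun {v} hv a b => (mul_neg_mul a v b).symm ▸ S.neg_mem (hv a b))
    (fun {v w} hw a b => by rw [← mul_assoc]; exact hw (a * v) b)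
    (fun {v w} hv a b => by rw [mul_assoc, mul_assoc, ← mul_assoc a]; exact hv a (w * b))
  have hT : ∀ w, w ∈ T ↔ ∀ a b, a * w * b ∈ S := fun w => TwoSidedIdeal.mem_mk' ..
  have hrel : ∀ v w, SteadyRel κ ϑ q Q n v w → T.ringCon.mk' v = T.ringCon.mk' w := by
    rintro _ _ ⟨hy, hu⟩
    exact (RingCon.eq _).mpr (((hT _).mpr (hS hy hu)))
  have h1 : T.ringCon.mk' a = T.ringCon.mk' 0 := by
    rw [← RingQuot.lift_mkRingHom_apply T.ringCon.mk' hrel a, map_zero]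
    have : RingQuot.mkRingHom (SteadyRel κ ϑ q Q n) a = 0 := by
      rw [← ha, RingQuot.mkAlgHom_def]
      rfl
    rw [this, map_zero]
  have h2 := (hT a).mp ((RingCon.eq _).mp h1) 1 1
  rwa [one_mul, mul_one] at h2

end

/-! ### Passage to the cyclotomic quotient -/

section

variable {R : Type*} [CommRing R] [IsDomain R] {n ℓ : ℕ} {κ s : ℝ} {ϑ : Fin ℓ → ℝ} {q : R}
  {Q : Fin ℓ → R} (hκ : κ ≠ 0) (hs : |κ| < s) (hϑ : ∀ t, |ϑ t| + |κ| < s)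

/-- The product of push and pull factors through the pulled configuration, which is unsteady. -/
theorem cornerToWF_cyclotomicEl (hn : 0 < n) :
    cornerToWF _ (heckeToCorner hκ hs hϑ q Q (cyclotomicEl q hn Q)) = 0 := by
  refine Subtype.ext ?_
  rw [cornerToWF_apply, heckeToCorner_cyclotomicEl,
    ← (pullEl_gal (q := q) (Q := Q) hn hκ hs hϑ).diag.idem_mul (generic_pulled hn hκ hs hϑ),
    ← mul_assoc]
  exact mk_eq_zero_of_unsteady _ (isUnsteady_pulled hn hs hϑ) _ _

variable (q Q) in
/-- The homomorphism from the cyclotomic affine Hecke algebra. -/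
def cyclotomicToWFO : CyclotomicHecke q Q n →ₐ[R] WFO n hκ hs hϑ q Q :=
  RingQuot.liftAlgHom R ⟨(cornerToWF _).comp (heckeToCorner hκ hs hϑ q Q), by
    rintro _ _ ⟨hn⟩
    rw [map_zero]
    exact cornerToWF_cyclotomicEl hκ hs hϑ hn⟩

theorem cyclotomicToWFO_mk (a : AffineHecke q n) :
    cyclotomicToWFO q Q hκ hs hϑ (RingQuot.mkAlgHom R (CyclotomicRel q Q n) a) =
      cornerToWF _ (heckeToCorner hκ hs hϑ q Q a) :=
  RingQuot.liftAlgHom_mkAlgHom_apply ..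

theorem cyclotomicToWFO_surjective : Function.Surjective (cyclotomicToWFO (n := n) q Q hκ hs hϑ) := by
  intro w
  obtain ⟨b, rfl⟩ := cornerToWF_surjective _ w
  obtain ⟨a, rfl⟩ := heckeToCorner_surjective hκ hs hϑ b
  exact ⟨_, cyclotomicToWFO_mk hκ hs hϑ a⟩

variable (q Q) in
/-- The image of the ideal of the cyclotomic relation in the affine type WF Hecke algebra. -/
def cyclotomicImage : Submodule R (AffineWF κ ϑ q Q n) :=
  (LinearMap.ker (RingQuot.mkAlgHom R (CyclotomicRel q Q n)).toLinearMap).map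
    (AffineCorner.val.comp (heckeToCorner hκ hs hϑ q Q).toLinearMap)

theorem mul_unsteady_mul_mem {y : Fin n → ℝ} (hy : Generic κ ϑ y) (hu : IsUnsteady κ ϑ y)
    (a b : AffineWF κ ϑ q Q n) :
    affineIdem q Q (generic_spaced n hκ hs hϑ) * a * affineIdem q Q hy * b *
      affineIdem q Q (generic_spaced n hκ hs hϑ) ∈ cyclotomicImage q Q hκ hs hϑ := by
  -- The left-hand group of an unsteady configuration is not empty, so there is a first strand to
  -- which the cyclotomic relation refers.
  have hn : 0 < n := by
    obtain ⟨S, ⟨i, _⟩, _⟩ := hu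
    exact i.pos
  refine Submodule.span_le.mpr ?_ (mul_unsteady_mul hn hκ hs hϑ hy hu a b)
  rintro _ ⟨c, d, rfl⟩
  obtain ⟨c, rfl⟩ := heckeToCorner_surjective hκ hs hϑ c
  obtain ⟨d, rfl⟩ := heckeToCorner_surjective hκ hs hϑ d
  refine ⟨c * cyclotomicEl q hn Q * d, ?_, ?_⟩
  · rw [SetLike.mem_coe, LinearMap.mem_ker, AlgHom.toLinearMap_apply, map_mul, map_mul]
    have : RingQuot.mkAlgHom R (CyclotomicRel q Q n) (cyclotomicEl q hn Q) =
      RingQuot.mkAlgHom R (CyclotomicRel q Q n) 0 := RingQuot.mkAlgHom_rel R (.cyclotomic hn)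
    rw [this, map_zero, mul_zero, zero_mul]
  · rw [← map_mul, ← map_mul]
    rfl

/-- An element of the corner that vanishes in the quotient is a sum of products through unsteady
configurations. Cut down to the corner, these lie in the image of the cyclotomic ideal, and
`heckeToCorner` is injective. -/
theorem cyclotomicToWFO_injective (hq : IsUnit q) :
    Function.Injective (cyclotomicToWFO (n := n) q Q hκ hs hϑ) := by
  refine (injective_iff_map_eq_zero _).mpr fun w hw => ?_
  obtain ⟨a, rfl⟩ := RingQuot.mkAlgHom_surjective R (CyclotomicRel q Q n) w
  rw [cyclotomicToWFO_mk] at hw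
  have hw' := congrArg Subtype.val hw
  rw [cornerToWF_apply] at hw'
  let e := affineIdem q Q (generic_spaced n hκ hs hϑ)
  let f : AffineWF κ ϑ q Q n →ₗ[R] AffineWF κ ϑ q Q n :=
    LinearMap.mulLeftRight R (e, e)
  -- The additive subgroup used consists of the elements `w` for which `e * w * e` lies in the image
  -- of the cyclotomic ideal.
  have hmem := mem_of_mk_eq_zero ((cyclotomicImage q Q hκ hs hϑ).comap f).toAddSubgroup
    (fun hy hu b c => ?_) hw'
  · obtain ⟨a', ha', he⟩ := hmem
    have h1 : f (heckeToCorner hκ hs hϑ q Q a).val = (heckeToCorner hκ hs hϑ q Q a).val := by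
      change e * (heckeToCorner hκ hs hϑ q Q a).val * e = _
      rw [AffineCorner.idem_mul, AffineCorner.mul_idem]
    rw [h1] at he
    rw [← heckeToCorner_injective hκ hs hϑ hq (AffineCorner.val_injective he)]
    exact ha'
  · have := mul_unsteady_mul_mem (q := q) (Q := Q) hκ hs hϑ hy hu b c
    have h1 : f (b * affineIdem q Q hy * c) = e * b * affineIdem q Q hy * c * e := by
      change e * (b * affineIdem q Q hy * c) * e = _
      simp only [mul_assoc]
    rw [← h1] at this
    exact this

variable (q Q) in
/-- The isomorphism of the cyclotomic affine Hecke algebra with `WF_𝒪`. -/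
def cyclotomicEquivWFO (hq : IsUnit q) : CyclotomicHecke q Q n ≃ₐ[R] WFO n hκ hs hϑ q Q :=
  AlgEquiv.ofBijective (cyclotomicToWFO q Q hκ hs hϑ)
    ⟨cyclotomicToWFO_injective hκ hs hϑ hq, cyclotomicToWFO_surjective hκ hs hϑ⟩

end

/-! ### The deformed parameter -/

/-- The constant coefficient is `q * 1`, which is invertible in the field. -/
theorem isUnit_qDeformed {k : Type*} [Field k] (ℓ : ℕ) {q : k} (hq : q ≠ 0) {d : PowerSeries k}
    (hd : PowerSeries.constantCoeff d = 1) : IsUnit (qDeformed ℓ q d) := by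
  have hsub : PowerSeries.HasSubst (MvPowerSeries.X none : Base k ℓ) := PowerSeries.HasSubst.X none
  have h1 : d = 1 + (d - 1) := by ring
  have h2 : MvPowerSeries.constantCoeff (PowerSeries.subst (MvPowerSeries.X none : Base k ℓ) (d - 1)) = 0 :=
    PowerSeries.constantCoeff_subst_eq_zero (by simp) _ (by rw [map_sub, hd, map_one, sub_self])
  rw [MvPowerSeries.isUnit_iff_constantCoeff, qDeformed, h1, PowerSeries.subst_add hsub,
    MvPowerSeries.constantCoeff_smul, map_add, h2, ← PowerSeries.coe_substAlgHom hsub, map_one,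
    map_one, add_zero, smul_eq_mul, mul_one]
  exact hq.isUnit

end

end WFHecke

/-- Both base rings, the power series ring and the field, are domains in which the Hecke parameter
is invertible, so one isomorphism covers both cases. -/
theorem mainTheorem7 {k : Type*} [Field k] (q : k) (hq0 : q ≠ 0) (hq1 : q ≠ 1) (n ℓ : ℕ)
    (Q : Fin ℓ → k) (hQ : ∀ t, Q t ≠ 0) (κ : ℝ) (hκ : κ ≠ 0) (ϑ : Fin ℓ → ℝ) (s : ℝ)
    (hs : |κ| < s) (hϑ : ∀ t, |ϑ t| + |κ| < s) :
    (∀ [CharZero k] (d : PowerSeries k), PowerSeries.constantCoeff d = 1 →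
      Nonempty (WFHecke.WFO n hκ hs hϑ (WFHecke.qDeformed ℓ q d) (WFHecke.QDeformed Q)
        ≃ₐ[WFHecke.Base k ℓ]
          WFHecke.CyclotomicHecke (WFHecke.qDeformed ℓ q d) (WFHecke.QDeformed Q) n)) ∧
    Nonempty (WFHecke.WFO n hκ hs hϑ q Q ≃ₐ[k] WFHecke.CyclotomicHecke q Q n) :=
  ⟨fun d hd =>
    haveI : IsDomain (WFHecke.Base k ℓ) := NoZeroDivisors.to_isDomain _
    ⟨(WFHecke.cyclotomicEquivWFO _ _ hκ hs hϑ
      (WFHecke.isUnit_qDeformed ℓ hq0 hd)).symm⟩,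
    ⟨(WFHecke.cyclotomicEquivWFO q Q hκ hs hϑ hq0.isUnit).symm⟩⟩
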